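/- **Model.** An asymmetric RAM has a fast memory of $M \ge 1$ words, an unbounded slow memory, and an integer write cost $\omega \ge 1$. A program is a fixed finite list of instructions (arithmetic on words, conditional jumps), whose operands are constants or memory cells, addressed directly or indirectly. It is given the two strings, their lengths, $M$ and $\omega$ in slow memory (a number that does not fit in a word is capped at the largest word) and must leave its answer in slow memory. The I/O cost $Q$ of a run is the number of reads from slow memory plus $\omega$ times the number of writes to slow memory; its work $W$ is $Q$ plus the number of reads from and writes to fast memory. Words have $w$ bits with $w \ge d \log_2(m+n)$ for a constant $d$, where $m,n$ are the lengths of the two strings; each letter of the strings is one word. **Theorem.** Let $f$ be either the edit distance (the least number of single-letter insertions, deletions and substitutions that turn one string into the other) or the length of a longest common subsequence. 1. Let $k_T = \min\big((\omega/M)^{1/3}, \sqrt{M}\big)$. There is a program such that for every $c>0$ there are constants $d$ and $C$ such that, for all $M \ge 1$, $\omega \ge 1$, all word sizes $w \ge d\log_2(m+n)$ and all strings $x,y$ of lengths $m,n \ge c\,k_T M$, the program computes $f(x,y)$ with work $$W \le C\Big(mn + \frac{mn\,\omega}{k_T M}\Big).$$ 2. Let $k_Q = \min\big(\omega^{1/3},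 \sqrt{M}\big)$. There is a program such that for every $c>0$ there are constants $d$ and $C$ such that, for all $M \ge 1$, $\omega \ge 1$, all word sizes $w \ge d\log_2(m+n)$ and all strings $x,y$ of lengths $m,n \ge c\,k_Q M$, the program computes $f(x,y)$ with I/O cost $$Q \le C\,\frac{mn\,\omega}{k_Q M}.$$ -/

import Mathlib

/-! The asymmetric random access machine: a program with finite control, a fast memory of `M` words,
an unbounded slow memory, words of `w` bits, and a cost of `ω` for every write to slow memory. -/

namespace AsymRAM

/-- The two memories. -/
inductive Mem
  | fast
  | slow

/-- Operands of instructions: a constant, the cell `a` of the memory `s`, or the cell of the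
memory `s` whose address is stored in the cell `a` of the memory `p` (indirect addressing). -/
inductive Operand
  | const (v : ℕ)
  | dir (s : Mem) (a : ℕ)
  | ind (s p : Mem) (a : ℕ)

/-- Destinations of instructions, with direct or indirect addressing. -/
inductive Dest
  | dir (s : Mem) (a : ℕ)
  | ind (s p : Mem) (a : ℕ)

/-- The arithmetic operations. -/
inductive Op
  | add
  | sub
  | mul
  | div
  | mod

/-- The instructions: `op o d a b` stores `a o b` in `d`; `jlt a b l` and `jeq a b l` jump to the
instruction with index `l` if `a < b`, respectively if `a = b`. -/
inductive Instr
  | op (o : Op) (d : Dest) (a b : Operand)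
  | jlt (a b : Operand) (l : ℕ)
  | jeq (a b : Operand) (l : ℕ)

/-- A program is a finite list of instructions. It is not stored in memory. -/
abbrev Program := List Instr

/-- Arithmetic on words of `w` bits (modulo `2 ^ w`). -/
def Op.eval (w : ℕ) : Op → ℕ → ℕ → ℕ
  | .add, a, b => (a + b) % 2 ^ w
  | .sub, a, b => (a + (2 ^ w - b)) % 2 ^ w
  | .mul, a, b => (a * b) % 2 ^ w
  | .div, a, b => a / b
  | .mod, a, b => a % b

/-- A configuration: the program counter, the contents of both memories, and the numbers of
accesses (reads and writes) to fast memory, of reads from slow memory and of writes to slow memory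
that were made so far. -/
structure Config where
  pc : ℕ
  fast : ℕ → ℕ
  slow : ℕ → ℕ
  fastAccesses : ℕ
  slowReads : ℕ
  slowWrites : ℕ

/-- The content of a cell. Fast memory has only the cells `0, …, M - 1`; a read of any other
address yields `0`. -/
def Config.load (M : ℕ) (c : Config) : Mem → ℕ → ℕ
  | .fast, a => if a < M then c.fast a else 0
  | .slow, a => c.slow a

/-- Store a value in a cell and count the write. A write to a fast address outside
`0, …, M - 1` is lost. -/
def Config.store (M : ℕ) (c : Config) (v : ℕ) : Mem → ℕ → Config
  | .fast, a =>
      { c with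
        fast := if a < M then Function.update c.fast a v else c.fast
        fastAccesses := c.fastAccesses + 1 }
  | .slow, a =>
      { c with
        slow := Function.update c.slow a v
        slowWrites := c.slowWrites + 1 }

/-- Count one read. -/
def Config.countRead (c : Config) : Mem → Config
  | .fast => { c with fastAccesses := c.fastAccesses + 1 }
  | .slow => { c with slowReads := c.slowReads + 1 }

/-- The value of an operand. -/
def Operand.val (w M : ℕ) (c : Config) : Operand → ℕ
  | .const v => v % 2 ^ w
  | .dir s a => c.load M s a
  | .ind s p a => c.load M s (c.load M p a)

/-- Count the reads that the evaluation of an operand makes. -/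
def Operand.count (c : Config) : Operand → Config
  | .const _ => c
  | .dir s _ => c.countRead s
  | .ind s p _ => (c.countRead p).countRead s

/-- Store a value in a destination, counting the write and, for an indirect destination, the read
of the address. -/
def Dest.store (M : ℕ) (c : Config) (v : ℕ) : Dest → Config
  | .dir s a => c.store M v s a
  | .ind s p a => (c.countRead p).store M v s (c.load M p a)

/-- The effect of one instruction. -/
def Instr.exec (w M : ℕ) (c : Config) : Instr → Config
  | .op o d a b =>
      { d.store M (b.count (a.count c)) (o.eval w (a.val w M c) (b.val w M c)) with
        pc := c.pc + 1 }
  | .jlt a b l =>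
      { b.count (a.count c) with pc := if a.val w M c < b.val w M c then l else c.pc + 1 }
  | .jeq a b l =>
      { b.count (a.count c) with pc := if a.val w M c = b.val w M c then l else c.pc + 1 }

/-- The program halts when the program counter leaves it. -/
def Program.Halted (P : Program) (c : Config) : Prop := P.length ≤ c.pc

/-- One step; a halted configuration does not change. -/
def Program.step (w M : ℕ) (P : Program) (c : Config) : Config :=
  match P[c.pc]? with
  | some i => i.exec w M c
  | none => c

/-- The initial configuration on the strings `x`, `y`: slow memory holds `|x|`, `|y|`, `M`, `ω`,
then the letters of `x`, then those of `y`, and zeros afterwards; fast memory is zero. A number that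
does not fit in a word is replaced by the largest word. -/
def init (w M ω : ℕ) (x y : List ℕ) : Config where
  pc := 0
  fast := fun _ => 0
  slow := fun a => min (([x.length, y.length, M, ω] ++ x ++ y).getD a 0) (2 ^ w - 1)
  fastAccesses := 0
  slowReads := 0
  slowWrites := 0

/-- The asymmetric I/O cost: reads from slow memory plus `ω` times the writes to slow memory. -/
def Config.ioCost (ω : ℕ) (c : Config) : ℕ := c.slowReads + ω * c.slowWrites

/-- The asymmetric work: the I/O cost plus the reads from and writes to fast memory. -/
def Config.work (ω : ℕ) (c : Config) : ℕ := c.ioCost ω + c.fastAccesses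

/-- Started on `x`, `y`, the program halts with `r` in cell `0` of slow memory, and the cost of the
whole computation is at most `B`. -/
def Program.ComputesWithin (P : Program) (w M ω : ℕ) (x y : List ℕ) (r : ℕ)
    (cost : Config → ℕ) (B : ℝ) : Prop :=
  ∃ t : ℕ, P.Halted ((P.step w M)^[t] (init w M ω x y)) ∧
    ((P.step w M)^[t] (init w M ω x y)).slow 0 = r ∧
    (cost ((P.step w M)^[t] (init w M ω x y)) : ℝ) ≤ B

end AsymRAM

/-- One edit of a string: an insertion, a deletion or a substitution of a single letter. -/
inductive Edit : List ℕ → List ℕ → Prop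
  | insert (u v : List ℕ) (b : ℕ) : Edit (u ++ v) (u ++ b :: v)
  | delete (u v : List ℕ) (a : ℕ) : Edit (u ++ a :: v) (u ++ v)
  | substitute (u v : List ℕ) (a b : ℕ) : Edit (u ++ a :: v) (u ++ b :: v)

/-- `EditsIn k x y`: some sequence of `k` edits turns `x` into `y`. -/
inductive EditsIn : ℕ → List ℕ → List ℕ → Prop
  | zero (x : List ℕ) : EditsIn 0 x x
  | succ {k : ℕ} {x y z : List ℕ} (h : Edit x y) (t : EditsIn k y z) : EditsIn (k + 1) x z

/-- The edit distance: the least number of edits that turn `x` into `y`. -/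
noncomputable def editDistance (x y : List ℕ) : ℕ := sInf {k | EditsIn k x y}

/-- The infimum in `editDistance` is attained. -/
theorem editDistance_isLeast (x y : List ℕ) :
    IsLeast {k | EditsIn k x y} (editDistance x y) := by
  have h1 : ∀ v z : List ℕ, ∃ k, EditsIn k v (z ++ v) := by
    intro v z
    induction z using List.reverseRecOn generalizing v with
    | nil => exact ⟨0, EditsIn.zero v⟩
    | append_singleton z b ih =>
      obtain ⟨k, hk⟩ := ih (b :: v)
      refine ⟨k + 1, EditsIn.succ (Edit.insert [] v b) ?_⟩
      simpa using hk
  have h2 : ∃ k, EditsIn k x y := by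
    induction x with
    | nil => simpa using h1 [] y
    | cons a x ih =>
      obtain ⟨k, hk⟩ := ih
      exact ⟨k + 1, EditsIn.succ (Edit.delete [] x a) hk⟩
  have hn : {k | EditsIn k x y}.Nonempty := h2
  exact ⟨Nat.sInf_mem hn, fun k hk => Nat.sInf_le hk⟩

/-- The length of a longest common subsequence. -/
noncomputable def lcsLength (x y : List ℕ) : ℕ :=
  sSup {k | ∃ z : List ℕ, z.Sublist x ∧ z.Sublist y ∧ z.length = k}

/-- The supremum in `lcsLength` is attained. -/
theorem lcsLength_isGreatest (x y : List ℕ) :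
    IsGreatest {k | ∃ z : List ℕ, z.Sublist x ∧ z.Sublist y ∧ z.length = k} (lcsLength x y) := by
  have hb : BddAbove {k | ∃ z : List ℕ, z.Sublist x ∧ z.Sublist y ∧ z.length = k} :=
    ⟨x.length, by rintro k ⟨z, hx, -, rfl⟩; exact hx.length_le⟩
  have hn : {k | ∃ z : List ℕ, z.Sublist x ∧ z.Sublist y ∧ z.length = k}.Nonempty :=
    ⟨0, [], List.nil_sublist x, List.nil_sublist y, rfl⟩
  exact ⟨Nat.sSup_mem hn hb, fun k hk => le_csSup hb hk⟩

/-- `k_T = min ((ω / M) ^ (1 / 3), √M)`. -/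
noncomputable def kT (M ω : ℕ) : ℝ := min (((ω : ℝ) / (M : ℝ)) ^ ((1 : ℝ) / 3)) (Real.sqrt (M : ℝ))

/-- `k_Q = min (ω ^ (1 / 3), √M)`. -/
noncomputable def kQ (M ω : ℕ) : ℝ := min ((ω : ℝ) ^ ((1 : ℝ) / 3)) (Real.sqrt (M : ℝ))

/-! Both functions are read off one dynamic program `dp` on the grid of prefixes. With substitution
cost 1 it is the edit distance; with cost 2 it is the sum of the lengths minus twice the length of a
longest common subsequence (`editDistance_eq_dp`, `lcsLength_eq_dp`). The grid is cut into tiles of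
side `S`, where a tile edge fits in fast memory, and into blocks of `k × k` tiles. A block takes its
left and top boundary from slow memory and writes only `O(k S)` values, those of its right and
bottom boundary. This makes `O(m n / (k S))` writes in all, fewer by a factor `k` than if every tile
were written. Edges between the tiles of a block are recomputed from the boundary of the block when
they are needed.

Recomputation is cheap because shortest paths can be chosen without crossings. The nodes of a
staircase frontier are identified by their diagonals. Within a tile, the point where the chosen path
enters is a monotone function of the point where it leaves (`tileE_mono`). Hence each tile has a
threshold: paths to frontier nodes on diagonals below it enter the tile from the left, all others
from above. These `k ^ 2` numbers fit in fast memory if `k ^ 2 ≤ S`, and they determine for every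
frontier node a chain of at most `2 k` tiles, its sketch. Rerunning the tiles of the chain, with the
large value `inf` on the edge that is not used, never gives less than the distance
(`Block.sketchVal_ge`) and gives exactly the distance at the node itself. When the frontier moves
across a tile, each threshold is pulled back through the monotone entry function, and the invariant
survives (`Sketches.next`).

The values on the top edge of a tile are the minimum over one sketch for each interval into which
the thresholds divide the edge (`exists_sketch`, `collectC_spec`). As the frontier moves along a
row, every threshold of the rows above is met on at most one edge, so a row needs at most `k + k ^
2` sketches; the potential `aheadCount` expresses this. A block then costs `O(k S)` writes, `O(k ^ 4
* S)` reads and `O(k ^ 4 * S ^ 2)` accesses to fast memory. There are `O(m n / (k S) ^ 2)` blocks,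
so the cost of the writes is `O(ω m n / (k S))`. The reads cost no more if `k ^ 3 ≤ ω`, and the
accesses to fast memory cost no more if `k ^ 3 * S ≤ ω`. The program takes the largest such `k` with
`k ^ 2 ≤ S`, and for this choice `k S` agrees with `k_Q M`, respectively `k_T M`, up to a constant
(`IsBlockNum.le_scale`, `IsBlockNum.scale_le`). In the case of the work, `S` is bounded by a
fraction of `ω` too, so that `k = 1` is always admissible; if `ω` is the smaller bound, everything
is `O(m n)`. If `M < 100`, the claimed bounds allow to run the whole dynamic program in slow memory.

The algorithm is an explicit program. It is written in a small language `Cmd` of variables and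
arrays, verified by weakest preconditions that also count memory accesses, and compiled in two
stages to machine instructions (`Cmd.code_spec`, `LCmd.Big.runs`). -/

namespace AsymRAM

/-! ### Structured control flow and its compilation to jumps. -/

/-- Structured programs over the instructions of the machine. -/
inductive LCmd
  | op (o : Op) (d : Dest) (a b : Operand)
  | skip
  | seq (c₁ c₂ : LCmd)
  | ite (a b : Operand) (c₁ c₂ : LCmd)
  | whileLt (a b : Operand) (c : LCmd)

namespace LCmd

/-- The number of instructions of the compiled program. -/
def len : LCmd → ℕ
  | op .. => 1
  | skip => 0
  | seq c₁ c₂ => c₁.len + c₂.len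
  | ite _ _ c₁ c₂ => c₁.len + c₂.len + 2
  | whileLt _ _ c => c.len + 3

/-- The instructions of a structured program, placed at the address `p`. -/
def code : LCmd → ℕ → Program
  | op o d a b, _ => [.op o d a b]
  | skip, _ => []
  | seq c₁ c₂, p => c₁.code p ++ c₂.code (p + c₁.len)
  | ite a b c₁ c₂, p =>
      [.jlt a b (p + 2 + c₂.len)] ++ (c₂.code (p + 1) ++
        ([.jeq (.const 0) (.const 0) (p + 2 + c₂.len + c₁.len)] ++ c₁.code (p + 2 + c₂.len)))
  | whileLt a b c, p =>
      [.jlt a b (p + 2)] ++ ([.jeq (.const 0) (.const 0) (p + 3 + c.len)] ++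
        (c.code (p + 2) ++ [.jeq (.const 0) (.const 0) p]))

theorem length_code (c : LCmd) (p : ℕ) : (c.code p).length = c.len := by
  induction c generalizing p <;> simp_all [code, len] <;> omega

/-- Big-step semantics; the program counter is ignored and kept. -/
inductive Big (w M : ℕ) : LCmd → Config → Config → Prop
  | op (o d a b c) :
      Big w M (op o d a b) c { (Instr.op o d a b).exec w M c with pc := c.pc }
  | skip (c) : Big w M skip c c
  | seq {c₁ c₂ s₁ s₂ s₃} (h₁ : Big w M c₁ s₁ s₂) (h₂ : Big w M c₂ s₂ s₃) :
      Big w M (seq c₁ c₂) s₁ s₃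
  | ite_true {a b c₁ c₂ s s'} (h : a.val w M s < b.val w M s)
      (h₁ : Big w M c₁ (b.count (a.count s)) s') : Big w M (ite a b c₁ c₂) s s'
  | ite_false {a b c₁ c₂ s s'} (h : ¬ a.val w M s < b.val w M s)
      (h₁ : Big w M c₂ (b.count (a.count s)) s') : Big w M (ite a b c₁ c₂) s s'
  | while_true {a b c s s' s''} (h : a.val w M s < b.val w M s)
      (h₁ : Big w M c (b.count (a.count s)) s') (h₂ : Big w M (whileLt a b c) s' s'') :
      Big w M (whileLt a b c) s s''
  | while_false {a b c s} (h : ¬ a.val w M s < b.val w M s) :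
      Big w M (whileLt a b c) s (b.count (a.count s))

end LCmd

/-- Set the program counter. -/
def Config.jump (c : Config) (p : ℕ) : Config := { c with pc := p }

@[simp] theorem Config.jump_pc (c : Config) (p : ℕ) : (c.jump p).pc = p := rfl

theorem Config.load_jump (M : ℕ) (c : Config) (p : ℕ) (s : Mem) (a : ℕ) :
    (c.jump p).load M s a = c.load M s a := by cases s <;> rfl

theorem Operand.val_jump (w M : ℕ) (c : Config) (p : ℕ) (a : Operand) :
    a.val w M (c.jump p) = a.val w M c := by
  cases a <;> simp [Operand.val, Config.load_jump]

theorem Config.countRead_jump (c : Config) (p : ℕ) (s : Mem) :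
    (c.jump p).countRead s = (c.countRead s).jump p := by cases s <;> rfl

theorem Operand.count_jump (c : Config) (p : ℕ) (a : Operand) :
    a.count (c.jump p) = (a.count c).jump p := by
  cases a <;> simp [Operand.count, Config.countRead_jump]

theorem Config.store_jump (M : ℕ) (c : Config) (p v : ℕ) (s : Mem) (a : ℕ) :
    (c.jump p).store M v s a = (c.store M v s a).jump p := by cases s <;> rfl

theorem Dest.store_jump (M : ℕ) (c : Config) (p v : ℕ) (d : Dest) :
    d.store M (c.jump p) v = (d.store M c v).jump p := by
  cases d <;> simp [Dest.store, Config.countRead_jump, Config.store_jump, Config.load_jump]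

theorem Program.step_of_append (w M : ℕ) (pre post : Program) (i : Instr) (c : Config) :
    (Program.step w M (pre ++ ([i] ++ post))) (c.jump pre.length)
      = i.exec w M (c.jump pre.length) := by
  simp [Program.step]

namespace LCmd

/-- Compiled code contains absolute jump targets, so it is placed at the address `pre.length`
between arbitrary programs `pre` and `post`. In the induction the siblings of a subprogram become
part of this context. -/
theorem Big.runs {w M : ℕ} {cmd : LCmd} {c c' : Config} (h : Big w M cmd c c') :
    ∀ (pre post : Program), ∃ t : ℕ,
      (Program.step w M (pre ++ (cmd.code pre.length ++ post)))^[t] (c.jump pre.length)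
        = c'.jump (pre.length + cmd.len) := by
  have jlt_step : ∀ (pre post : Program) (a b : Operand) (l : ℕ) (s : Config),
      Program.step w M (pre ++ ([.jlt a b l] ++ post)) (s.jump pre.length)
        = (b.count (a.count s)).jump
          (if a.val w M s < b.val w M s then l else pre.length + 1) := by
    intro pre post a b l s
    rw [Program.step_of_append]
    simp only [Instr.exec, Operand.val_jump, Operand.count_jump, Config.jump_pc]
    rfl
  have jump_step : ∀ (pre post : Program) (l : ℕ) (s : Config),
      Program.step w M (pre ++ ([.jeq (.const 0) (.const 0) l] ++ post)) (s.jump pre.length)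
        = s.jump l := by
    intro pre post l s
    rw [Program.step_of_append]
    simp [Instr.exec, Operand.count]
    rfl
  induction h with
  | op o d a b c =>
    intro pre post
    refine ⟨1, ?_⟩
    simp only [code, len, Function.iterate_one, Program.step_of_append]
    simp only [Instr.exec, Operand.val_jump, Operand.count_jump, Dest.store_jump, Config.jump_pc]
    rfl
  | skip c => exact fun pre post => ⟨0, rfl⟩
  | @seq c₁ c₂ s₁ s₂ s₃ h₁ h₂ ih₁ ih₂ =>
    intro pre post
    obtain ⟨t₁, e₁⟩ := ih₁ pre (c₂.code (pre.length + c₁.len) ++ post)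
    obtain ⟨t₂, e₂⟩ := ih₂ (pre ++ c₁.code pre.length) post
    refine ⟨t₂ + t₁, ?_⟩
    simp only [List.length_append, length_code, List.append_assoc] at e₁ e₂
    simp only [code, List.append_assoc, Function.iterate_add_apply, e₁, e₂, len, Nat.add_assoc]
  | @ite_true a b c₁ c₂ s s' h h₁ ih =>
    intro pre post
    obtain ⟨t, e⟩ := ih (pre ++ ([.jlt a b (pre.length + 2 + c₂.len)] ++ (c₂.code (pre.length + 1)
      ++ [.jeq (.const 0) (.const 0) (pre.length + 2 + c₂.len + c₁.len)]))) post
    refine ⟨t + 1, ?_⟩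
    have hl : pre.length + (1 + (c₂.len + 1)) = pre.length + 2 + c₂.len := by omega
    simp only [List.length_append, length_code, List.append_assoc, List.length_singleton, hl] at e
    simp only [code, List.append_assoc, Function.iterate_succ_apply, jlt_step, if_pos h, e, len]
    congr 1; omega
  | @ite_false a b c₁ c₂ s s' h h₁ ih =>
    intro pre post
    obtain ⟨t, e⟩ := ih (pre ++ [.jlt a b (pre.length + 2 + c₂.len)])
      ([.jeq (.const 0) (.const 0) (pre.length + 2 + c₂.len + c₁.len)] ++
        (c₁.code (pre.length + 2 + c₂.len) ++ post))
    -- One step for the failed test, `t` for the branch, and one for the jump over the other branch.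
    refine ⟨1 + (t + 1), ?_⟩
    simp only [List.length_append, List.append_assoc, List.length_singleton] at e
    simp only [code, List.append_assoc, Function.iterate_succ_apply, Function.iterate_add_apply,
      Function.iterate_zero, id, jlt_step, if_neg h, e, len]
    have e2 := jump_step (pre ++ ([.jlt a b (pre.length + 2 + c₂.len)] ++ c₂.code (pre.length + 1)))
      (c₁.code (pre.length + 2 + c₂.len) ++ post) (pre.length + 2 + c₂.len + c₁.len) s'
    simp only [List.length_append, length_code, List.append_assoc, List.length_singleton] at e2
    rw [show pre.length + 1 + c₂.len = pre.length + (1 + c₂.len) by omega, e2]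
    congr 1; omega
  | @while_true a b c s s' s'' h h₁ h₂ ih₁ ih₂ =>
    intro pre post
    obtain ⟨t₁, e₁⟩ := ih₁ (pre ++ ([.jlt a b (pre.length + 2)] ++
      [.jeq (.const 0) (.const 0) (pre.length + 3 + c.len)]))
      ([.jeq (.const 0) (.const 0) pre.length] ++ post)
    obtain ⟨t₂, e₂⟩ := ih₂ pre post
    refine ⟨t₂ + (1 + (t₁ + 1)), ?_⟩
    simp only [List.length_append, List.append_assoc, List.length_singleton,
      show pre.length + (1 + 1) = pre.length + 2 by omega] at e₁
    simp only [code, List.append_assoc] at e₂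
    simp only [code, List.append_assoc, Function.iterate_succ_apply, Function.iterate_add_apply,
      Function.iterate_zero, id, jlt_step, if_pos h, e₁]
    have e3 := jump_step (pre ++ ([.jlt a b (pre.length + 2)] ++
      ([.jeq (.const 0) (.const 0) (pre.length + 3 + c.len)] ++ c.code (pre.length + 2))))
      post pre.length s'
    simp only [List.length_append, length_code, List.append_assoc, List.length_singleton] at e3
    rw [show pre.length + 2 + c.len = pre.length + (1 + (1 + c.len)) by omega, e3, e₂]
  | @while_false a b c s h =>
    intro pre post
    refine ⟨2, ?_⟩
    simp only [code, List.append_assoc, Function.iterate_succ_apply,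
      Function.iterate_zero, id, jlt_step, if_neg h]
    have e3 := jump_step (pre ++ [.jlt a b (pre.length + 2)])
      (c.code (pre.length + 2) ++ ([.jeq (.const 0) (.const 0) pre.length] ++ post))
      (pre.length + 3 + c.len) (b.count (a.count s))
    simp only [List.length_append, List.append_assoc, List.length_singleton] at e3
    rw [e3, len]
    congr 1; omega

theorem Big.computesWithin {w M ω : ℕ} {x y : List ℕ} {cmd : LCmd} {c' : Config}
    (h : Big w M cmd (init w M ω x y) c') (cost : Config → ℕ) (B : ℝ)
    (hcost : ∀ c p, cost (Config.jump c p) = cost c) (hB : (cost c' : ℝ) ≤ B) :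
    (cmd.code 0).ComputesWithin w M ω x y (c'.slow 0) cost B := by
  obtain ⟨t, e⟩ := h.runs [] []
  simp only [List.nil_append, List.append_nil, List.length_nil, Nat.zero_add] at e
  have e0 : (init w M ω x y).jump 0 = init w M ω x y := rfl
  rw [e0] at e
  refine ⟨t, ?_, ?_, ?_⟩
  · rw [e]; simp [Program.Halted, length_code]
  · rw [e]; rfl
  · rw [e, hcost]; exact hB

end LCmd

end AsymRAM

/-! ### Abstract states, commands, and weakest preconditions with costs. -/

namespace AsymRAM

/-- The variables of structured programs. -/
inductive Var
  | m | n | om | mm | S | k | K | inf | vb | v2 | nbr | nbc | th | tw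
  | bi | bj | z | ro | co
  | i | b | q | kap | lo | dl
  | a | c | len
  | hm | wn | r | cc | p | val | en
  | t | u
  deriving DecidableEq

/-- The arrays of structured programs. -/
inductive Arr
  | U | E | L | T | X | Y | TH | DIR
  deriving DecidableEq

/-- The register of a variable. -/
def Var.idx : Var → ℕ
  | m => 0 | n => 1 | om => 2 | mm => 3 | S => 4 | k => 5 | K => 6 | inf => 7 | vb => 8 | v2 => 9
  | nbr => 10 | nbc => 11 | th => 12 | tw => 13 | bi => 14 | bj => 15 | z => 16 | ro => 17
  | co => 18 | i => 19 | b => 20 | q => 21 | kap => 22 | lo => 23 | dl => 24 | a => 25 | c => 26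
  | len => 27 | hm => 28 | wn => 29 | r => 30 | cc => 31 | p => 32 | val => 33 | en => 34
  | t => 35 | u => 36

/-- Levels of variables: a subroutine of level `l` changes only variables of level at most `l`. -/
def Var.lvl : Var → ℕ
  | t => 0 | u => 0 | p => 0 | val => 0 | en => 0
  | r => 1 | cc => 1 | hm => 2 | wn => 2
  | a => 3 | c => 3 | len => 3
  | q => 4 | dl => 4 | kap => 5 | lo => 5
  | b => 6 | i => 7 | z => 8 | ro => 8 | co => 8 | bj => 9 | bi => 10
  | _ => 11

/-- The register that holds the base address of an array. -/
def Arr.idx : Arr → ℕ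
  | U => 48 | E => 49 | L => 50 | T => 51 | X => 52 | Y => 53 | TH => 54 | DIR => 55

theorem Var.idx_lt (x : Var) : x.idx < 48 := by cases x <;> decide

theorem Var.idx_inj {x y : Var} : x.idx = y.idx ↔ x = y := by
  refine ⟨fun h => ?_, fun h => h ▸ rfl⟩
  have : Function.LeftInverse (fun j => (([.m, .n, .om, .mm, .S, .k, .K, .inf, .vb, .v2, .nbr, .nbc,
      .th, .tw, .bi, .bj, .z, .ro, .co, .i, .b, .q, .kap, .lo, .dl, .a, .c, .len, .hm, .wn, .r, .cc,
      .p, .val, .en, .t, .u] : List Var).getD j .m)) Var.idx := by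
    intro x; cases x <;> rfl
  exact this.injective h

theorem Arr.idx_bounds (y : Arr) : 48 ≤ y.idx ∧ y.idx < 56 := by cases y <;> decide

theorem Arr.idx_inj {x y : Arr} : x.idx = y.idx ↔ x = y := by
  refine ⟨fun h => ?_, fun h => h ▸ rfl⟩
  have : Function.LeftInverse (fun j => (([.U, .E, .L, .T, .X, .Y, .TH, .DIR] : List Arr).getD
      (j - 48) .U)) Arr.idx := by
    intro x; cases x <;> rfl
  exact this.injective h

/-- Abstract states: variables, base addresses of arrays, arrays, slow memory, and upper bounds for
the numbers of local memory accesses, slow reads and slow writes. -/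
structure St where
  v : Var → ℕ
  ad : Arr → ℕ
  ar : Arr → ℕ → ℕ
  g : ℕ → ℕ
  n : ℕ
  rd : ℕ
  wr : ℕ

/-- Where and how a structured program is laid out in the memory `μ`. -/
structure Lay where
  w : ℕ
  M : ℕ
  μ : Mem
  base : ℕ
  sz : Arr → ℕ

/-- The number of words. -/
abbrev Lay.W (ℓ : Lay) : ℕ := 2 ^ ℓ.w

/-- The arithmetic operations without overflow. -/
def Op.nat : Op → ℕ → ℕ → ℕ
  | .add, a, b => a + b
  | .sub, a, b => a - b
  | .mul, a, b => a * b
  | .div, a, b => a / b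
  | .mod, a, b => a % b

/-- The condition under which the machine computes the exact result. -/
def Op.ok (W : ℕ) : Op → ℕ → ℕ → Prop
  | .add, a, b => a + b < W
  | .sub, a, b => b ≤ a
  | .mul, a, b => a * b < W
  | .div, _, _ => True
  | .mod, _, _ => True

/-- Expressions over variables and arrays. -/
inductive Expr
  | C (n : ℕ)
  | V (x : Var)
  | A (y : Arr) (e : Expr)
  | bin (o : Op) (e₁ e₂ : Expr)

namespace Expr

instance : Add Expr := ⟨bin .add⟩
instance : Sub Expr := ⟨bin .sub⟩
instance : Mul Expr := ⟨bin .mul⟩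
instance : Div Expr := ⟨bin .div⟩

def val (s : St) : Expr → ℕ
  | C n => n
  | V x => s.v x
  | A y e => s.ar y (e.val s)
  | bin o e₁ e₂ => o.nat (e₁.val s) (e₂.val s)

def ok (ℓ : Lay) (s : St) : Expr → Prop
  | C _ => True
  | V _ => True
  | A y e => e.ok ℓ s ∧ e.val s < ℓ.sz y
  | bin o e₁ e₂ => e₁.ok ℓ s ∧ e₂.ok ℓ s ∧ o.ok ℓ.W (e₁.val s) (e₂.val s)

/-- A bound for the number of memory accesses in the evaluation. -/
def cost : Expr → ℕ
  | C _ => 6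
  | V _ => 6
  | A _ e => e.cost + 12
  | bin _ e₁ e₂ => e₁.cost + e₂.cost + 6

/-- Constants are small, and `d` temporaries suffice. -/
def small : Expr → ℕ → Bool
  | C n, d => decide (n < 1000) && decide (0 < d)
  | V _, d => decide (0 < d)
  | A _ e, d => e.small d
  | bin _ e₁ e₂, d => e₁.small d && e₂.small (d - 1)

variable (s : St) (ℓ : Lay) (e₁ e₂ e : Expr) (y : Arr) (x : Var) (j : ℕ)

@[simp] theorem val_C : (C j).val s = j := rfl
@[simp] theorem val_V : (V x).val s = s.v x := rfl
@[simp] theorem val_A : (A y e).val s = s.ar y (e.val s) := rfl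
@[simp] theorem val_add : (e₁ + e₂).val s = e₁.val s + e₂.val s := rfl
@[simp] theorem val_sub : (e₁ - e₂).val s = e₁.val s - e₂.val s := rfl
@[simp] theorem val_mul : (e₁ * e₂).val s = e₁.val s * e₂.val s := rfl
@[simp] theorem val_div : (e₁ / e₂).val s = e₁.val s / e₂.val s := rfl
@[simp] theorem ok_C : (C j).ok ℓ s ↔ True := Iff.rfl
@[simp] theorem ok_V : (V x).ok ℓ s ↔ True := Iff.rfl
@[simp] theorem ok_A : (A y e).ok ℓ s ↔ e.ok ℓ s ∧ e.val s < ℓ.sz y := Iff.rfl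
@[simp] theorem ok_add : (e₁ + e₂).ok ℓ s ↔ e₁.ok ℓ s ∧ e₂.ok ℓ s ∧ e₁.val s + e₂.val s < ℓ.W :=
  Iff.rfl
@[simp] theorem ok_sub : (e₁ - e₂).ok ℓ s ↔ e₁.ok ℓ s ∧ e₂.ok ℓ s ∧ e₂.val s ≤ e₁.val s := Iff.rfl
@[simp] theorem ok_mul : (e₁ * e₂).ok ℓ s ↔ e₁.ok ℓ s ∧ e₂.ok ℓ s ∧ e₁.val s * e₂.val s < ℓ.W :=
  Iff.rfl
@[simp] theorem ok_div : (e₁ / e₂).ok ℓ s ↔ e₁.ok ℓ s ∧ e₂.ok ℓ s ∧ True := Iff.rfl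
@[simp] theorem cost_C : (C j).cost = 6 := rfl
@[simp] theorem cost_V : (V x).cost = 6 := rfl
@[simp] theorem cost_A : (A y e).cost = e.cost + 12 := rfl
@[simp] theorem cost_add : (e₁ + e₂).cost = e₁.cost + e₂.cost + 6 := rfl
@[simp] theorem cost_sub : (e₁ - e₂).cost = e₁.cost + e₂.cost + 6 := rfl
@[simp] theorem cost_mul : (e₁ * e₂).cost = e₁.cost + e₂.cost + 6 := rfl
@[simp] theorem cost_div : (e₁ / e₂).cost = e₁.cost + e₂.cost + 6 := rfl

end Expr

namespace St

/-- Count local memory accesses. -/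
def tick (s : St) (j : ℕ) : St := { s with n := s.n + j }

/-- Assign to a variable. -/
def setv (s : St) (x : Var) (u j : ℕ) : St :=
  { s with v := Function.update s.v x u, n := s.n + j }

/-- Assign to an array entry. -/
def seta (s : St) (y : Arr) (i u j : ℕ) : St :=
  { s with ar := Function.update s.ar y (Function.update (s.ar y) i u), n := s.n + j }

/-- Assign to a variable after a read from slow memory. -/
def rdg (s : St) (x : Var) (u j : ℕ) : St :=
  { s with v := Function.update s.v x u, n := s.n + j, rd := s.rd + 1 }

/-- Assign to a cell of slow memory. -/
def wrg (s : St) (i u j : ℕ) : St :=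
  { s with g := Function.update s.g i u, n := s.n + j, wr := s.wr + 1 }

/-- Set the base address of an array. -/
def setb (s : St) (y : Arr) (u j : ℕ) : St :=
  { s with ad := Function.update s.ad y u, n := s.n + j }

variable (s : St) (x x' : Var) (y y' : Arr) (i u j : ℕ)

@[simp] theorem tick_v : (s.tick j).v = s.v := rfl
@[simp] theorem tick_ad : (s.tick j).ad = s.ad := rfl
@[simp] theorem tick_ar : (s.tick j).ar = s.ar := rfl
@[simp] theorem tick_g : (s.tick j).g = s.g := rfl
@[simp] theorem tick_n : (s.tick j).n = s.n + j := rfl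
@[simp] theorem tick_rd : (s.tick j).rd = s.rd := rfl
@[simp] theorem tick_wr : (s.tick j).wr = s.wr := rfl
@[simp] theorem setv_v : (s.setv x u j).v x' = if x' = x then u else s.v x' := by
  simp [setv, Function.update_apply]
@[simp] theorem setv_ad : (s.setv x u j).ad = s.ad := rfl
@[simp] theorem setv_ar : (s.setv x u j).ar = s.ar := rfl
@[simp] theorem setv_g : (s.setv x u j).g = s.g := rfl
@[simp] theorem setv_n : (s.setv x u j).n = s.n + j := rfl
@[simp] theorem setv_rd : (s.setv x u j).rd = s.rd := rfl
@[simp] theorem setv_wr : (s.setv x u j).wr = s.wr := rfl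
@[simp] theorem rdg_v : (s.rdg x u j).v x' = if x' = x then u else s.v x' := by
  simp [rdg, Function.update_apply]
@[simp] theorem rdg_ad : (s.rdg x u j).ad = s.ad := rfl
@[simp] theorem rdg_ar : (s.rdg x u j).ar = s.ar := rfl
@[simp] theorem rdg_g : (s.rdg x u j).g = s.g := rfl
@[simp] theorem rdg_n : (s.rdg x u j).n = s.n + j := rfl
@[simp] theorem rdg_rd : (s.rdg x u j).rd = s.rd + 1 := rfl
@[simp] theorem rdg_wr : (s.rdg x u j).wr = s.wr := rfl
@[simp] theorem seta_v : (s.seta y i u j).v = s.v := rfl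
@[simp] theorem seta_ad : (s.seta y i u j).ad = s.ad := rfl
@[simp] theorem seta_ar : (s.seta y i u j).ar y'
    = if y' = y then Function.update (s.ar y) i u else s.ar y' := by
  simp [seta, Function.update_apply]
@[simp] theorem seta_g : (s.seta y i u j).g = s.g := rfl
@[simp] theorem seta_n : (s.seta y i u j).n = s.n + j := rfl
@[simp] theorem seta_rd : (s.seta y i u j).rd = s.rd := rfl
@[simp] theorem seta_wr : (s.seta y i u j).wr = s.wr := rfl
@[simp] theorem wrg_v : (s.wrg i u j).v = s.v := rfl
@[simp] theorem wrg_ar : (s.wrg i u j).ar = s.ar := rfl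
@[simp] theorem wrg_g : (s.wrg i u j).g = Function.update s.g i u := rfl
@[simp] theorem wrg_n : (s.wrg i u j).n = s.n + j := rfl
@[simp] theorem wrg_rd : (s.wrg i u j).rd = s.rd := rfl
@[simp] theorem wrg_wr : (s.wrg i u j).wr = s.wr + 1 := rfl
@[simp] theorem setb_v : (s.setb y u j).v = s.v := rfl
@[simp] theorem setb_ad : (s.setb y u j).ad y' = if y' = y then u else s.ad y' := by
  simp [setb, Function.update_apply]
@[simp] theorem setb_ar : (s.setb y u j).ar = s.ar := rfl
@[simp] theorem setb_g : (s.setb y u j).g = s.g := rfl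
@[simp] theorem setb_n : (s.setb y u j).n = s.n + j := rfl
@[simp] theorem setb_rd : (s.setb y u j).rd = s.rd := rfl
@[simp] theorem setb_wr : (s.setb y u j).wr = s.wr := rfl

end St

/-- Commands on abstract states. -/
inductive Cmd
  | skip
  | set (x : Var) (e : Expr)
  | put (y : Arr) (e₁ e₂ : Expr)
  | rdG (x : Var) (e : Expr)
  | wrG (e₁ e₂ : Expr)
  | setB (y : Arr) (e : Expr)
  | seq (c₁ c₂ : Cmd)
  | ite (e₁ e₂ : Expr) (c₁ c₂ : Cmd)
  | whileLt (e₁ e₂ : Expr) (c : Cmd)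

infixr:60 " ;; " => Cmd.seq

namespace Cmd

/-- Weakest preconditions. -/
def wp (ℓ : Lay) : Cmd → (St → Prop) → St → Prop
  | skip, Q, s => Q s
  | set x e, Q, s => e.ok ℓ s ∧ Q (s.setv x (e.val s) (e.cost + 6))
  | put y e₁ e₂, Q, s => e₁.ok ℓ s ∧ e₂.ok ℓ s ∧ e₁.val s < ℓ.sz y ∧
      Q (s.seta y (e₁.val s) (e₂.val s) (e₁.cost + e₂.cost + 12))
  | rdG x e, Q, s => ℓ.μ = .fast ∧ e.ok ℓ s ∧ Q (s.rdg x (s.g (e.val s)) (e.cost + 6))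
  | wrG e₁ e₂, Q, s => ℓ.μ = .fast ∧ e₁.ok ℓ s ∧ e₂.ok ℓ s ∧
      Q (s.wrg (e₁.val s) (e₂.val s) (e₁.cost + e₂.cost + 6))
  | setB y e, Q, s => ℓ.sz = 0 ∧ e.ok ℓ s ∧ Q (s.setb y (e.val s) (e.cost + 6))
  | seq c₁ c₂, Q, s => c₁.wp ℓ (c₂.wp ℓ Q) s
  | ite e₁ e₂ c₁ c₂, Q, s => e₁.ok ℓ s ∧ e₂.ok ℓ s ∧
      (e₁.val s < e₂.val s → c₁.wp ℓ Q (s.tick (e₁.cost + e₂.cost + 6))) ∧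
      (¬ e₁.val s < e₂.val s → c₂.wp ℓ Q (s.tick (e₁.cost + e₂.cost + 6)))
  | whileLt e₁ e₂ c, Q, s => ∃ N : ℕ, Nat.rec (motive := fun _ => St → Prop) (fun _ => False)
      (fun _ R s => e₁.ok ℓ s ∧ e₂.ok ℓ s ∧
        (e₁.val s < e₂.val s → c.wp ℓ R (s.tick (e₁.cost + e₂.cost + 6))) ∧
        (¬ e₁.val s < e₂.val s → Q (s.tick (e₁.cost + e₂.cost + 6)))) N s

/-- The command fits the layout: small constants, few temporaries. -/
def small : Cmd → Bool
  | skip => true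
  | set _ e => e.small 7
  | put _ e₁ e₂ => e₁.small 7 && e₂.small 6
  | rdG _ e => e.small 7
  | wrG e₁ e₂ => e₁.small 7 && e₂.small 6
  | setB _ e => e.small 7
  | seq c₁ c₂ => c₁.small && c₂.small
  | ite e₁ e₂ c₁ c₂ => e₁.small 7 && e₂.small 6 && c₁.small && c₂.small
  | whileLt e₁ e₂ c => e₁.small 7 && e₂.small 6 && c.small

theorem wp_mono {ℓ : Lay} {c : Cmd} {Q Q' : St → Prop} (hQ : ∀ s, Q s → Q' s) {s : St}
    (h : c.wp ℓ Q s) : c.wp ℓ Q' s := by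
  induction c generalizing Q Q' s with
  | skip => exact hQ _ h
  | set => exact ⟨h.1, hQ _ h.2⟩
  | put => exact ⟨h.1, h.2.1, h.2.2.1, hQ _ h.2.2.2⟩
  | rdG => exact ⟨h.1, h.2.1, hQ _ h.2.2⟩
  | wrG => exact ⟨h.1, h.2.1, h.2.2.1, hQ _ h.2.2.2⟩
  | setB => exact ⟨h.1, h.2.1, hQ _ h.2.2⟩
  | seq c₁ c₂ ih₁ ih₂ => exact ih₁ (fun _ => ih₂ hQ) h
  | ite e₁ e₂ c₁ c₂ ih₁ ih₂ =>
    exact ⟨h.1, h.2.1, fun hc => ih₁ hQ (h.2.2.1 hc), fun hc => ih₂ hQ (h.2.2.2 hc)⟩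
  | whileLt e₁ e₂ c ih =>
    -- `N` bounds the number of tests of the loop, so this case is an induction on `N`.
    obtain ⟨N, h⟩ := h
    refine ⟨N, ?_⟩
    induction N generalizing s with
    | zero => exact h
    | succ N ihN =>
      exact ⟨h.1, h.2.1, fun hc => ih (fun _ => ihN) (h.2.2.1 hc), fun hc => hQ _ (h.2.2.2 hc)⟩

/-- The rule for loops, with a decreasing measure. -/
theorem wp_while {ℓ : Lay} {e₁ e₂ : Expr} {c : Cmd} {Q : St → Prop} (I : ℕ → St → Prop)
    (hI : ∀ j s, I j s → e₁.ok ℓ s ∧ e₂.ok ℓ s ∧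
      (e₁.val s < e₂.val s → c.wp ℓ (fun s' => ∃ j' < j, I j' s') (s.tick (e₁.cost + e₂.cost + 6))) ∧
      (¬ e₁.val s < e₂.val s → Q (s.tick (e₁.cost + e₂.cost + 6))))
    {j : ℕ} {s : St} (h : I j s) : (whileLt e₁ e₂ c).wp ℓ Q s := by
  have key : ∀ N j s, j < N → I j s → Nat.rec (motive := fun _ => St → Prop) (fun _ => False)
      (fun _ R s => e₁.ok ℓ s ∧ e₂.ok ℓ s ∧
        (e₁.val s < e₂.val s → c.wp ℓ R (s.tick (e₁.cost + e₂.cost + 6))) ∧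
        (¬ e₁.val s < e₂.val s → Q (s.tick (e₁.cost + e₂.cost + 6)))) N s := by
    intro N
    induction N with
    | zero => intro j s hj; omega
    | succ N ih =>
      intro j s hj hs
      obtain ⟨h₁, h₂, h₃, h₄⟩ := hI j s hs
      refine ⟨h₁, h₂, fun hc => wp_mono ?_ (h₃ hc), h₄⟩
      rintro s' ⟨j', hj', hs'⟩
      exact ih j' s' (by omega) hs'
  -- A measure of `j` allows `j` executions of the body, hence `j + 1` tests.
  exact ⟨j + 1, key _ j s (Nat.lt_succ_self j) h⟩

/-- The loop `for x = 0, …, N - 1`. -/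
def loop (x : Var) (e : Expr) (c : Cmd) : Cmd :=
  .set x (.C 0) ;; .whileLt (.V x) e (c ;; .set x (.V x + .C 1))

/-- The invariant describes the states just before a test. The numbers are costs: 12 for `x := 0`,
`e.cost + 12` for a test, 24 for the increment. The bound `N < ℓ.W` keeps the increment from
overflowing. -/
theorem wp_loop {ℓ : Lay} {x : Var} {e : Expr} {c : Cmd} {Q : St → Prop} {s : St} (N : ℕ)
    (I : ℕ → St → Prop) (hW : N < ℓ.W)
    (h0 : I 0 (s.setv x 0 12))
    (he : ∀ j s, j ≤ N → I j s → s.v x = j ∧ e.ok ℓ s ∧ e.val s = N)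
    (hstep : ∀ j s, j < N → I j s → c.wp ℓ
      (fun s' => s'.v x = j ∧ I (j + 1) (s'.setv x (j + 1) 24)) (s.tick (e.cost + 12)))
    (hQ : ∀ s, I N s → Q (s.tick (e.cost + 12))) :
    (loop x e c).wp ℓ Q s := by
  refine ⟨by simp, ?_⟩
  refine wp_while (fun j s => ∃ i, j = N - i ∧ i ≤ N ∧ I i s) ?_ (j := N) ⟨0, rfl, by omega, h0⟩
  rintro j s ⟨i, rfl, hi, hs⟩
  obtain ⟨h₁, h₂, h₃⟩ := he i s hi hs
  refine ⟨by simp, h₂, fun hc => ?_, fun hc => ?_⟩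
  · simp only [Expr.val_V, h₁, h₃] at hc
    have := hstep i s hc hs
    rw [show (Expr.V x).cost + e.cost + 6 = e.cost + 12 by simp; omega]
    refine wp_mono (c := c) ?_ this
    rintro s' ⟨hx, hs'⟩
    refine ⟨by simp [hx]; omega, N - (i + 1), by omega, i + 1, rfl, hc, ?_⟩
    simpa [hx] using hs'
  · simp only [Expr.val_V, h₁, h₃] at hc
    obtain rfl : i = N := by omega
    rw [show (Expr.V x).cost + e.cost + 6 = e.cost + 12 by simp; omega]
    exact hQ _ hs

end Cmd

end AsymRAM

/-! ### Representation of abstract states by configurations. -/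

namespace AsymRAM

/-- The word in a cell of the memory `μ` that is known to exist. -/
abbrev Lay.get (ℓ : Lay) (c : Config) (a : ℕ) : ℕ := c.load ℓ.M ℓ.μ a

/-- A cell address exists. -/
def Lay.inR (ℓ : Lay) (a : ℕ) : Prop := ℓ.μ = .fast → a < ℓ.M

/-- All words are smaller than `2 ^ w`. -/
def Config.AllLt (c : Config) (w : ℕ) : Prop := ∀ a, c.fast a < 2 ^ w ∧ c.slow a < 2 ^ w

theorem Config.AllLt.load {c : Config} {w : ℕ} (h : c.AllLt w) (M : ℕ) (s : Mem) (a : ℕ) :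
    c.load M s a < 2 ^ w := by
  cases s
  · simp only [Config.load]; split
    · exact (h a).1
    · positivity
  · exact (h a).2

/-- The cost of a command that makes at most `j` accesses to the memory `μ`. -/
def Lay.loc (ℓ : Lay) (j : ℕ) : ℕ := match ℓ.μ with | .fast => 0 | .slow => j

theorem Lay.loc_add (ℓ : Lay) (i j : ℕ) : ℓ.loc (i + j) = ℓ.loc i + ℓ.loc j := by
  unfold Lay.loc; split <;> simp

/-- The configuration `c` represents the abstract state `s`. -/
structure Rep (ℓ : Lay) (s : St) (c : Config) : Prop where
  lt : c.AllLt ℓ.w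
  big : 1000 < 2 ^ ℓ.w
  room : ℓ.inR (ℓ.base + 63)
  var : ∀ x : Var, ℓ.get c (ℓ.base + x.idx) = s.v x
  adr : ∀ y : Arr, ℓ.get c (ℓ.base + y.idx) = s.ad y
  arr : ∀ (y : Arr) (i : ℕ), i < ℓ.sz y → ℓ.get c (s.ad y + i) = s.ar y i
  slow : ℓ.μ = .fast → c.slow = s.g
  valid : ∀ (y : Arr) (i : ℕ), i < ℓ.sz y →
    ℓ.base + 64 ≤ s.ad y + i ∧ ℓ.inR (s.ad y + i) ∧ s.ad y + i < 2 ^ ℓ.w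
  disj : ∀ (y y' : Arr) (i i' : ℕ), i < ℓ.sz y → i' < ℓ.sz y' → s.ad y + i = s.ad y' + i' →
    y = y' ∧ i = i'
  fa : c.fastAccesses ≤ s.n
  sr : c.slowReads ≤ s.rd + ℓ.loc s.n
  sw : c.slowWrites ≤ s.wr + ℓ.loc s.n

/-- `c'` arises from `c` by storing `u` in the cell `a` of the memory `μ`. -/
structure Stored (ℓ : Lay) (c c' : Config) (a u j rd : ℕ) : Prop where
  lt : c'.AllLt ℓ.w
  get : ∀ a', ℓ.get c' a' = if a' = a then u else ℓ.get c a'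
  slow : ℓ.μ = .fast → c'.slow = c.slow
  fa : c'.fastAccesses ≤ c.fastAccesses + j
  sr : c'.slowReads ≤ c.slowReads + rd + ℓ.loc j
  sw : c'.slowWrites ≤ c.slowWrites + ℓ.loc j

theorem Op.eval_lt {w : ℕ} (o : Op) {a b : ℕ} (ha : a < 2 ^ w) : o.eval w a b < 2 ^ w := by
  cases o
  · exact Nat.mod_lt _ (by positivity)
  · exact Nat.mod_lt _ (by positivity)
  · exact Nat.mod_lt _ (by positivity)
  · exact lt_of_le_of_lt (Nat.div_le_self a b) ha
  · exact lt_of_le_of_lt (Nat.mod_le a b) ha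

theorem Op.eval_eq {w : ℕ} (o : Op) {a b : ℕ} (ha : a < 2 ^ w) (h : o.ok (2 ^ w) a b) :
    o.eval w a b = o.nat a b := by
  cases o
  · exact Nat.mod_eq_of_lt h
  · simp only [Op.ok] at h
    simp only [Op.eval, Op.nat]
    rw [show a + (2 ^ w - b) = (a - b) + 2 ^ w by omega, Nat.add_mod_right,
      Nat.mod_eq_of_lt (by omega)]
  · exact Nat.mod_eq_of_lt h
  · rfl
  · rfl

theorem Operand.val_lt {w M : ℕ} {c : Config} (h : c.AllLt w) (a : Operand) :
    a.val w M c < 2 ^ w := by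
  cases a
  · exact Nat.mod_lt _ (by positivity)
  · exact h.load _ _ _
  · exact h.load _ _ _

/-- Operands that access only the memory `s`, except for the number of reads of slow memory. -/
def Operand.Reads (s : Mem) (rd : ℕ) : Operand → Prop
  | .const _ => True
  | .dir s' _ => s' = s
  | .ind s' p _ => p = s ∧ (s' = s ∨ (s' = .slow ∧ rd = 1))

theorem Operand.count_spec (ℓ : Lay) (c : Config) (a : Operand) (rd : ℕ)
    (h : a.Reads ℓ.μ rd) :
    (a.count c).fast = c.fast ∧ (a.count c).slow = c.slow ∧
    (a.count c).fastAccesses ≤ c.fastAccesses + 2 ∧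
    (a.count c).slowReads ≤ c.slowReads + rd + ℓ.loc 2 ∧
    (a.count c).slowWrites = c.slowWrites := by
  obtain ⟨w, M, μ, base, sz⟩ := ℓ
  rcases a with v | ⟨s, a⟩ | ⟨s, p, a⟩
  · simp [Operand.count]
    omega
  · simp only [Operand.Reads] at h
    subst h
    cases s <;> simp [Operand.count, Config.countRead, Lay.loc]
    omega
  · obtain ⟨rfl, h⟩ := h
    cases p <;> cases s <;> simp_all [Operand.count, Config.countRead, Lay.loc]

theorem Config.load_congr {c c' : Config} (h : c'.fast = c.fast) (h' : c'.slow = c.slow) (M : ℕ)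
    (s : Mem) (a : ℕ) : c'.load M s a = c.load M s a := by
  cases s <;> simp [Config.load, h, h']

theorem stored_dest (ℓ : Lay) {c c' : Config} {d : Dest} {u a : ℕ}
    (hd : d = .dir ℓ.μ a ∨ ∃ p, d = .ind ℓ.μ ℓ.μ p ∧ ℓ.get c p = a)
    (ha : ℓ.inR a) (hu : u < 2 ^ ℓ.w) (hlt : c.AllLt ℓ.w) (hc' : c' = d.store ℓ.M c u) :
    Stored ℓ c c' a u 2 0 := by
  obtain ⟨w, M, μ, base, sz⟩ := ℓ
  have main : ∀ c₀ : Config, c₀.fast = c.fast → c₀.slow = c.slow →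
      c₀.fastAccesses ≤ c.fastAccesses + 1 →
      c₀.slowReads ≤ c.slowReads + Lay.loc ⟨w, M, μ, base, sz⟩ 1 → c₀.slowWrites = c.slowWrites →
      Stored ⟨w, M, μ, base, sz⟩ c (c₀.store M u μ a) a u 2 0 := by
    intro c₀ h1 h2 h3 h4 h5
    cases μ
    · have haM : a < M := ha rfl
      refine ⟨fun b => ?_, fun b => ?_, fun _ => ?_, ?_, ?_, ?_⟩
      · simp only [Config.store, if_pos haM, h1, h2]
        refine ⟨?_, (hlt b).2⟩
        rw [Function.update_apply]; split
        · exact hu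
        · exact (hlt b).1
      · simp only [Lay.get, Config.load, Config.store, if_pos haM, h1, Function.update_apply]
        split_ifs with h6 h7 h7 <;> first | rfl | omega
      · simp [Config.store, h2]
      · simp [Config.store]; omega
      · simp [Config.store, Lay.loc] at *; omega
      · simp [Config.store, Lay.loc, h5]
    · refine ⟨fun b => ?_, fun b => ?_, fun h => ?_, ?_, ?_, ?_⟩
      · simp only [Config.store, h1, h2]
        refine ⟨(hlt b).1, ?_⟩
        rw [Function.update_apply]; split
        · exact hu
        · exact (hlt b).2
      · simp only [Lay.get, Config.load, Config.store, h2, Function.update_apply]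
      · cases h
      · simp [Config.store]; omega
      · simp [Config.store, Lay.loc] at *; omega
      · simp [Config.store, Lay.loc, h5]
  rcases hd with rfl | ⟨p, rfl, rfl⟩
  · subst hc'
    exact main c rfl rfl (by omega) (by omega) rfl
  · subst hc'
    refine main (c.countRead μ) ?_ ?_ ?_ ?_ ?_ <;> cases μ <;> simp [Config.countRead, Lay.loc]

/-- All compiled arithmetic instructions pass through this lemma, except for explicit writes to slow
memory. The 6 stands for at most two accesses for each of the two operands and the destination; `rd
= 1` allows for one read of slow memory by a program that lives in fast memory. -/
theorem stored_op (ℓ : Lay) {c : Config} (o : Op) {d : Dest} {a₁ a₂ : Operand} {a rd : ℕ}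
    (hd : d = .dir ℓ.μ a ∨ ∃ p, d = .ind ℓ.μ ℓ.μ p ∧ ℓ.get c p = a)
    (ha : ℓ.inR a) (hlt : c.AllLt ℓ.w) (h₁ : a₁.Reads ℓ.μ rd) (h₂ : a₂.Reads ℓ.μ 0) :
    ∃ c', LCmd.Big ℓ.w ℓ.M (.op o d a₁ a₂) c c' ∧
      Stored ℓ c c' a (o.eval ℓ.w (a₁.val ℓ.w ℓ.M c) (a₂.val ℓ.w ℓ.M c)) 6 rd := by
  refine ⟨_, LCmd.Big.op o d a₁ a₂ c, ?_⟩
  set u := o.eval ℓ.w (a₁.val ℓ.w ℓ.M c) (a₂.val ℓ.w ℓ.M c) with hu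
  have hu' : u < 2 ^ ℓ.w := o.eval_lt (a₁.val_lt hlt)
  obtain ⟨e1, e2, e3, e4, e5⟩ := a₁.count_spec ℓ c rd h₁
  obtain ⟨f1, f2, f3, f4, f5⟩ := a₂.count_spec ℓ (a₁.count c) 0 h₂
  have hget : ∀ b, ℓ.get (a₂.count (a₁.count c)) b = ℓ.get c b := fun b =>
    Config.load_congr (f1.trans e1) (f2.trans e2) _ _ _
  have hs := stored_dest ℓ (c := a₂.count (a₁.count c)) (d := d) (u := u) (a := a)
    (by simpa only [hget] using hd) ha hu' (fun b => by rw [f1, f2, e1, e2]; exact hlt b) rfl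
  have hl2 : ℓ.loc 6 = ℓ.loc 2 + ℓ.loc 2 + ℓ.loc 2 := by rw [← ℓ.loc_add, ← ℓ.loc_add]
  have hpc : ∀ b, ℓ.get { (Instr.op o d a₁ a₂).exec ℓ.w ℓ.M c with pc := c.pc } b
      = ℓ.get (d.store ℓ.M (a₂.count (a₁.count c)) u) b := fun b =>
    Config.load_congr rfl rfl _ _ _
  refine ⟨hs.lt, fun b => ?_, fun h => ?_, ?_, ?_, ?_⟩
  · rw [hpc, hs.get, hget]
  · exact (hs.slow h).trans (f2.trans e2)
  · have := hs.fa; simp only [Instr.exec, ← hu]; omega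
  · have := hs.sr; simp only [Instr.exec, ← hu]; omega
  · have := hs.sw; simp only [Instr.exec, ← hu]; omega

namespace Rep

variable {ℓ : Lay} {s : St} {c c' : Config}

theorem inR_reg (h : Rep ℓ s c) {j : ℕ} (hj : j < 64) : ℓ.inR (ℓ.base + j) := fun e => by
  have := h.room e; omega

/-- Temporary registers are not part of the abstract state, so a store there shows only in the
counter. -/
theorem temp (h : Rep ℓ s c) {d u j : ℕ} (hd : d < 8)
    (hs : Stored ℓ c c' (ℓ.base + (56 + d)) u j 0) : Rep ℓ (s.tick j) c' where
  lt := hs.lt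
  big := h.big
  room := h.room
  var x := by
    have := x.idx_lt
    rw [hs.get, if_neg (by omega), h.var]; rfl
  adr y := by
    have := y.idx_bounds
    rw [hs.get, if_neg (by omega), h.adr]; rfl
  arr y i hi := by
    have := h.valid y i hi
    rw [hs.get, if_neg (by simp only [St.tick_ad]; omega)]
    exact h.arr y i hi
  slow e := (hs.slow e).trans (h.slow e)
  valid := h.valid
  disj := h.disj
  fa := by have := hs.fa; have := h.fa; simp; omega
  sr := by have := hs.sr; have := h.sr; simp [ℓ.loc_add]; omega
  sw := by have := hs.sw; have := h.sw; simp [ℓ.loc_add]; omega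

theorem setv (h : Rep ℓ s c) {x : Var} {u j : ℕ}
    (hs : Stored ℓ c c' (ℓ.base + x.idx) u j 0) : Rep ℓ (s.setv x u j) c' where
  lt := hs.lt
  big := h.big
  room := h.room
  var x' := by
    rw [hs.get, h.var, St.setv_v]
    have : ℓ.base + x'.idx = ℓ.base + x.idx ↔ x' = x := by
      rw [Nat.add_left_cancel_iff, Var.idx_inj]
    simp only [this]
  adr y := by
    have := y.idx_bounds
    have := x.idx_lt
    rw [hs.get, if_neg (by omega), h.adr]; rfl
  arr y i hi := by
    have := h.valid y i hi
    have := x.idx_lt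
    rw [hs.get, if_neg (by simp only [St.setv_ad]; omega)]
    exact h.arr y i hi
  slow e := (hs.slow e).trans (h.slow e)
  valid := h.valid
  disj := h.disj
  fa := by have := hs.fa; have := h.fa; simp; omega
  sr := by have := hs.sr; have := h.sr; simp [ℓ.loc_add]; omega
  sw := by have := hs.sw; have := h.sw; simp [ℓ.loc_add]; omega

theorem rdg (h : Rep ℓ s c) {x : Var} {u j : ℕ}
    (hs : Stored ℓ c c' (ℓ.base + x.idx) u j 1) : Rep ℓ (s.rdg x u j) c' where
  lt := hs.lt
  big := h.big
  room := h.room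
  var x' := by
    rw [hs.get, h.var, St.rdg_v]
    have : ℓ.base + x'.idx = ℓ.base + x.idx ↔ x' = x := by
      rw [Nat.add_left_cancel_iff, Var.idx_inj]
    simp only [this]
  adr y := by
    have := y.idx_bounds
    have := x.idx_lt
    rw [hs.get, if_neg (by omega), h.adr]; rfl
  arr y i hi := by
    have := h.valid y i hi
    have := x.idx_lt
    rw [hs.get, if_neg (by simp only [St.rdg_ad]; omega)]
    exact h.arr y i hi
  slow e := (hs.slow e).trans (h.slow e)
  valid := h.valid
  disj := h.disj
  fa := by have := hs.fa; have := h.fa; simp; omega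
  sr := by have := hs.sr; have := h.sr; simp [ℓ.loc_add]; omega
  sw := by have := hs.sw; have := h.sw; simp [ℓ.loc_add]; omega

theorem seta (h : Rep ℓ s c) {y : Arr} {i u j : ℕ} (hi : i < ℓ.sz y)
    (hs : Stored ℓ c c' (s.ad y + i) u j 0) : Rep ℓ (s.seta y i u j) c' where
  lt := hs.lt
  big := h.big
  room := h.room
  var x := by
    have := x.idx_lt
    have := h.valid y i hi
    rw [hs.get, if_neg (by omega), h.var]; rfl
  adr y' := by
    have := y'.idx_bounds
    have := h.valid y i hi
    rw [hs.get, if_neg (by omega), h.adr]; rfl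
  arr y' i' hi' := by
    rw [St.seta_ad, hs.get, St.seta_ar]
    split_ifs with h1 h2 h2
    · obtain ⟨rfl, rfl⟩ := h.disj _ _ _ _ hi' hi h1
      simp
    · exact absurd (h.disj _ _ _ _ hi' hi h1).1 h2
    · subst h2
      rw [Function.update_of_ne (by rintro rfl; exact h1 rfl)]
      exact h.arr _ _ hi'
    · exact h.arr _ _ hi'
  slow e := (hs.slow e).trans (h.slow e)
  valid := h.valid
  disj := h.disj
  fa := by have := hs.fa; have := h.fa; simp; omega
  sr := by have := hs.sr; have := h.sr; simp [ℓ.loc_add]; omega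
  sw := by have := hs.sw; have := h.sw; simp [ℓ.loc_add]; omega

theorem setb (h : Rep ℓ s c) (hsz : ℓ.sz = 0) {y : Arr} {u j : ℕ}
    (hs : Stored ℓ c c' (ℓ.base + y.idx) u j 0) : Rep ℓ (s.setb y u j) c' where
  lt := hs.lt
  big := h.big
  room := h.room
  var x := by
    have := x.idx_lt
    have := y.idx_bounds
    rw [hs.get, if_neg (by omega), h.var]; rfl
  adr y' := by
    rw [hs.get, h.adr, St.setb_ad]
    have : ℓ.base + y'.idx = ℓ.base + y.idx ↔ y' = y := by
      rw [Nat.add_left_cancel_iff, Arr.idx_inj]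
    simp only [this]
  arr y i hi := by simp [hsz] at hi
  slow e := (hs.slow e).trans (h.slow e)
  valid y i hi := by simp [hsz] at hi
  disj y _ i _ hi := by simp [hsz] at hi
  fa := by have := hs.fa; have := h.fa; simp; omega
  sr := by have := hs.sr; have := h.sr; simp [ℓ.loc_add]; omega
  sw := by have := hs.sw; have := h.sw; simp [ℓ.loc_add]; omega

end Rep

end AsymRAM

/-! ### Compilation of expressions and commands. -/

namespace AsymRAM

/-- The address of a temporary register. -/
def tmp (base d : ℕ) : ℕ := base + (56 + d)

/-- Evaluate an expression into the temporary register `d`. -/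
def Expr.code (μ : Mem) (base : ℕ) : Expr → ℕ → LCmd
  | C j, d => .op .div (.dir μ (tmp base d)) (.const j) (.const 1)
  | V x, d => .op .div (.dir μ (tmp base d)) (.dir μ (base + x.idx)) (.const 1)
  | A y e, d => .seq (e.code μ base d) (.seq
      (.op .add (.dir μ (tmp base d)) (.dir μ (tmp base d)) (.dir μ (base + y.idx)))
      (.op .div (.dir μ (tmp base d)) (.ind μ μ (tmp base d)) (.const 1)))
  | bin o e₁ e₂, d => .seq (e₁.code μ base d) (.seq (e₂.code μ base (d + 1))
      (.op o (.dir μ (tmp base d)) (.dir μ (tmp base d)) (.dir μ (tmp base (d + 1)))))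

theorem Rep.val_dir {ℓ : Lay} {s : St} {c : Config} (_ : Rep ℓ s c) (a : ℕ) :
    (Operand.dir ℓ.μ a).val ℓ.w ℓ.M c = ℓ.get c a := rfl

theorem Rep.val_const {ℓ : Lay} {s : St} {c : Config} (h : Rep ℓ s c) {j : ℕ} (hj : j < 1000) :
    (Operand.const j).val ℓ.w ℓ.M c = j := Nat.mod_eq_of_lt (hj.trans h.big)

theorem Expr.val_tick (s : St) (e : Expr) (j : ℕ) : e.val (s.tick j) = e.val s := by
  induction e <;> simp_all [val]

theorem Expr.ok_tick {ℓ : Lay} {s : St} {e : Expr} (j : ℕ) (h : e.ok ℓ s) :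
    e.ok ℓ (s.tick j) := by
  induction e with
  | C => trivial
  | V => trivial
  | A y e ih => exact ⟨ih h.1, by rw [val_tick]; exact h.2⟩
  | bin o a b iha ihb => exact ⟨iha h.1, ihb h.2.1, by rw [val_tick, val_tick]; exact h.2.2⟩

theorem Expr.small_pos {e : Expr} {b : ℕ} (h : e.small b) : 0 < b := by
  induction e generalizing b with
  | C => simp [small] at h; omega
  | V => simpa [small] using h
  | A _ e ih => exact ih h
  | bin o e₁ e₂ ih₁ _ => simp [small] at h; exact ih₁ h.1

/-- The last clause keeps the left operand of a binary operation alive while the right one is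
evaluated one register higher. There are eight temporary registers, which is the meaning of `d + b ≤
8`. -/
theorem Expr.code_spec {ℓ : Lay} {e : Expr} {s : St} {c : Config} {d b : ℕ} (h : Rep ℓ s c)
    (hok : e.ok ℓ s) (hsm : e.small b) (hd : d + b ≤ 8) :
    ∃ c', LCmd.Big ℓ.w ℓ.M (e.code ℓ.μ ℓ.base d) c c' ∧ Rep ℓ (s.tick e.cost) c' ∧
      ℓ.get c' (tmp ℓ.base d) = e.val s ∧
      ∀ d' < d, ℓ.get c' (tmp ℓ.base d') = ℓ.get c (tmp ℓ.base d') := by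
  induction e generalizing s c d b with
  | C j =>
    simp only [small, Bool.and_eq_true, decide_eq_true_eq] at hsm
    obtain ⟨c', hb, hs⟩ := stored_op ℓ (c := c) .div (d := .dir ℓ.μ (tmp ℓ.base d))
      (a₁ := .const j) (a₂ := .const 1) (rd := 0) (Or.inl rfl) (h.inR_reg (by omega)) h.lt
      trivial trivial
    refine ⟨c', hb, h.temp (by omega) hs, ?_, fun d' hd' => ?_⟩
    · rw [hs.get, if_pos rfl, h.val_const hsm.1, h.val_const (by norm_num)]
      exact Nat.div_one j
    · rw [hs.get, if_neg (by unfold tmp; omega)]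
  | V x =>
    simp only [small, decide_eq_true_eq] at hsm
    obtain ⟨c', hb, hs⟩ := stored_op ℓ (c := c) .div (d := .dir ℓ.μ (tmp ℓ.base d))
      (a₁ := .dir ℓ.μ (ℓ.base + x.idx)) (a₂ := .const 1) (rd := 0) (Or.inl rfl)
      (h.inR_reg (by omega)) h.lt rfl trivial
    refine ⟨c', hb, h.temp (by omega) hs, ?_, fun d' hd' => ?_⟩
    · rw [hs.get, if_pos rfl, h.val_const (by norm_num), h.val_dir, h.var]
      exact Nat.div_one _
    · rw [hs.get, if_neg (by unfold tmp; omega)]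
  | A y e ih =>
    have hb0 : 0 < b := small_pos (e := e) hsm
    obtain ⟨c₁, hb₁, h₁, hv₁, hf₁⟩ := ih h hok.1 hsm hd
    have hlt := hok.2
    obtain ⟨c₂, hb₂, hs₂⟩ := stored_op ℓ (c := c₁) .add (d := .dir ℓ.μ (tmp ℓ.base d))
      (a₁ := .dir ℓ.μ (tmp ℓ.base d)) (a₂ := .dir ℓ.μ (ℓ.base + y.idx)) (rd := 0)
      (Or.inl rfl) (h.inR_reg (by omega)) h₁.lt rfl rfl
    have h₂ := h₁.temp (d := d) (by omega) hs₂
    obtain ⟨c₃, hb₃, hs₃⟩ := stored_op ℓ (c := c₂) .div (d := .dir ℓ.μ (tmp ℓ.base d))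
      (a₁ := .ind ℓ.μ ℓ.μ (tmp ℓ.base d)) (a₂ := .const 1) (rd := 0)
      (Or.inl rfl) (h.inR_reg (by omega)) h₂.lt ⟨rfl, Or.inl rfl⟩ trivial
    have h₃ := h₂.temp (d := d) (by omega) hs₃
    refine ⟨c₃, .seq hb₁ (.seq hb₂ hb₃), h₃, ?_, fun d' hd' => ?_⟩
    · have hp : ℓ.get c₂ (tmp ℓ.base d) = s.ad y + e.val s := by
        rw [hs₂.get, if_pos rfl, h₁.val_dir, h₁.val_dir, hv₁, h₁.adr]
        have := (h.valid y _ hlt).2.2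
        rw [Op.eval_eq]
        · simp [Op.nat, Nat.add_comm]
        · omega
        · show _ + _ < _
          simp only [St.tick_ad]; omega
      rw [hs₃.get, if_pos rfl, h₂.val_const (by norm_num)]
      have : (Operand.ind ℓ.μ ℓ.μ (tmp ℓ.base d)).val ℓ.w ℓ.M c₂ = s.ar y (e.val s) := by
        have h4 : (Operand.ind ℓ.μ ℓ.μ (tmp ℓ.base d)).val ℓ.w ℓ.M c₂
          = ℓ.get c₂ (ℓ.get c₂ (tmp ℓ.base d)) := rfl
        rw [h4, hp]
        exact h₂.arr y _ hlt
      rw [this]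
      exact Nat.div_one _
    · rw [hs₃.get, if_neg (by unfold tmp; omega), hs₂.get, if_neg (by unfold tmp; omega),
        hf₁ d' hd']
  | bin o e₁ e₂ ih₁ ih₂ =>
    simp only [small, Bool.and_eq_true] at hsm
    have hb1 := small_pos hsm.2
    obtain ⟨c₁, hb₁, h₁, hv₁, hf₁⟩ := ih₁ h hok.1 hsm.1 hd
    obtain ⟨c₂, hb₂, h₂, hv₂, hf₂⟩ := ih₂ (d := d + 1) h₁ (ok_tick _ hok.2.1) hsm.2 (by omega)
    obtain ⟨c₃, hb₃, hs₃⟩ := stored_op ℓ (c := c₂) o (d := .dir ℓ.μ (tmp ℓ.base d))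
      (a₁ := .dir ℓ.μ (tmp ℓ.base d)) (a₂ := .dir ℓ.μ (tmp ℓ.base (d + 1))) (rd := 0)
      (Or.inl rfl) (h.inR_reg (by omega)) h₂.lt rfl rfl
    have h₃ := h₂.temp (d := d) (by omega) hs₃
    refine ⟨c₃, .seq hb₁ (.seq hb₂ hb₃), ?_, ?_, fun d' hd' => ?_⟩
    · have : ((s.tick e₁.cost).tick e₂.cost).tick 6 = s.tick (bin o e₁ e₂).cost := by
        simp [St.tick, cost]; omega
      rwa [this] at h₃
    · have h5 : ℓ.get c₂ (tmp ℓ.base d) = e₁.val s := by rw [hf₂ d (by omega), hv₁]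
      rw [hs₃.get, if_pos rfl, h₂.val_dir, h₂.val_dir, hv₂, h5, val_tick]
      exact Op.eval_eq o (by rw [← h5]; exact h₂.lt.load _ _ _) hok.2.2
    · rw [hs₃.get, if_neg (by unfold tmp; omega), hf₂ d' (by omega), hf₁ d' hd']

/-- Evaluate two expressions into the temporary registers `0` and `1`. -/
def code₂ (μ : Mem) (base : ℕ) (e₁ e₂ : Expr) : LCmd :=
  .seq (e₁.code μ base 0) (e₂.code μ base 1)

theorem code₂_spec {ℓ : Lay} {e₁ e₂ : Expr} {s : St} {c : Config} (h : Rep ℓ s c)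
    (hok₁ : e₁.ok ℓ s) (hok₂ : e₂.ok ℓ s) (h₁ : e₁.small 7) (h₂ : e₂.small 6) :
    ∃ c', LCmd.Big ℓ.w ℓ.M (code₂ ℓ.μ ℓ.base e₁ e₂) c c' ∧
      Rep ℓ (s.tick (e₁.cost + e₂.cost)) c' ∧
      ℓ.get c' (tmp ℓ.base 0) = e₁.val s ∧ ℓ.get c' (tmp ℓ.base 1) = e₂.val s := by
  obtain ⟨c₁, b₁, r₁, v₁, -⟩ := Expr.code_spec (d := 0) h hok₁ h₁ (by omega)
  obtain ⟨c₂, b₂, r₂, v₂, f₂⟩ := Expr.code_spec (d := 1) r₁ (Expr.ok_tick _ hok₂) h₂ (by omega)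
  refine ⟨c₂, .seq b₁ b₂, ?_, ?_, ?_⟩
  · have : (s.tick e₁.cost).tick e₂.cost = s.tick (e₁.cost + e₂.cost) := by
      simp [St.tick]; omega
    rwa [this] at r₂
  · rw [f₂ 0 (by omega), v₁]
  · rw [v₂, Expr.val_tick]

/-- The test operands. -/
abbrev top (μ : Mem) (base j : ℕ) : Operand := .dir μ (tmp base j)

/-- Compilation of commands for the memory `μ` with registers at `base`. -/
def Cmd.code (μ : Mem) (base : ℕ) : Cmd → LCmd
  | skip => .skip
  | set x e => .seq (e.code μ base 0) (.op .div (.dir μ (base + x.idx)) (top μ base 0) (.const 1))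
  | put y e₁ e₂ => .seq (code₂ μ base e₁ e₂) (.seq
      (.op .add (.dir μ (tmp base 0)) (top μ base 0) (.dir μ (base + y.idx)))
      (.op .div (.ind μ μ (tmp base 0)) (top μ base 1) (.const 1)))
  | rdG x e => .seq (e.code μ base 0)
      (.op .div (.dir μ (base + x.idx)) (.ind .slow μ (tmp base 0)) (.const 1))
  | wrG e₁ e₂ => .seq (code₂ μ base e₁ e₂)
      (.op .div (.ind .slow μ (tmp base 0)) (top μ base 1) (.const 1))
  | setB y e => .seq (e.code μ base 0) (.op .div (.dir μ (base + y.idx)) (top μ base 0) (.const 1))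
  | seq c₁ c₂ => .seq (c₁.code μ base) (c₂.code μ base)
  | ite e₁ e₂ c₁ c₂ => .seq (code₂ μ base e₁ e₂)
      (.ite (top μ base 0) (top μ base 1) (c₁.code μ base) (c₂.code μ base))
  | whileLt e₁ e₂ c => .seq (code₂ μ base e₁ e₂)
      (.whileLt (top μ base 0) (top μ base 1) (.seq (c.code μ base) (code₂ μ base e₁ e₂)))

theorem Rep.test {ℓ : Lay} {s : St} {c : Config} (h : Rep ℓ s c) :
    Rep ℓ (s.tick 6) ((top ℓ.μ ℓ.base 1).count ((top ℓ.μ ℓ.base 0).count c)) ∧ ∀ i,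
      ℓ.get ((top ℓ.μ ℓ.base 1).count ((top ℓ.μ ℓ.base 0).count c)) (tmp ℓ.base i) =
        ℓ.get c (tmp ℓ.base i) := by
  obtain ⟨e1, e2, e3, e4, e5⟩ := (top ℓ.μ ℓ.base 0).count_spec ℓ c 0 rfl
  obtain ⟨f1, f2, f3, f4, f5⟩ := (top ℓ.μ ℓ.base 1).count_spec ℓ _ 0 rfl
  set c' := (top ℓ.μ ℓ.base 1).count ((top ℓ.μ ℓ.base 0).count c)
  have hget : ∀ b, ℓ.get c' b = ℓ.get c b := fun b =>
    Config.load_congr (f1.trans e1) (f2.trans e2) _ _ _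
  refine ⟨⟨fun b => ?_, h.big, h.room, fun x => (hget _).trans (h.var x),
    fun y => (hget _).trans (h.adr y), fun y i hi => (hget _).trans (h.arr y i hi),
    fun e => (f2.trans e2).trans (h.slow e), h.valid, h.disj, ?_, ?_, ?_⟩, fun i => hget _⟩
  · rw [f1, f2, e1, e2]; exact h.lt b
  · have := h.fa; simp; omega
  · have := h.sr
    have hl2 : ℓ.loc 6 = ℓ.loc 2 + ℓ.loc 2 + ℓ.loc 2 := by rw [← ℓ.loc_add, ← ℓ.loc_add]
    simp [ℓ.loc_add]; omega
  · have := h.sw; simp [ℓ.loc_add]; omega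

/-- The bridge from weakest preconditions to machine runs. It is generic in the memory `ℓ.μ`, so the
same commands can be run with their variables in fast memory or, if that is too small, in slow
memory. -/
theorem Cmd.code_spec {ℓ : Lay} {cmd : Cmd} {Q : St → Prop} {s : St} {c : Config}
    (h : Rep ℓ s c) (hsm : cmd.small) (hwp : cmd.wp ℓ Q s) :
    ∃ c' s', LCmd.Big ℓ.w ℓ.M (cmd.code ℓ.μ ℓ.base) c c' ∧ Rep ℓ s' c' ∧ Q s' := by
  induction cmd generalizing Q s c with
  | skip => exact ⟨c, s, .skip c, h, hwp⟩
  | set x e =>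
    obtain ⟨c₁, b₁, r₁, v₁, -⟩ := Expr.code_spec (d := 0) h hwp.1 hsm (by omega)
    obtain ⟨c₂, b₂, s₂⟩ := stored_op ℓ (c := c₁) .div (d := .dir ℓ.μ (ℓ.base + x.idx))
      (a₁ := top ℓ.μ ℓ.base 0) (a₂ := .const 1) (rd := 0)
      (Or.inl rfl) (h.inR_reg (by have := x.idx_lt; omega)) r₁.lt rfl trivial
    rw [r₁.val_dir, v₁, r₁.val_const (by norm_num)] at s₂
    refine ⟨c₂, _, .seq b₁ b₂, r₁.setv s₂, ?_⟩
    have e : (s.tick e.cost).setv x (Op.eval ℓ.w .div (e.val s) 1) 6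
        = s.setv x (e.val s) (e.cost + 6) := by simp [St.tick, St.setv, Op.eval]; omega
    rw [e]; exact hwp.2
  | put y e₁ e₂ =>
    simp only [small, Bool.and_eq_true] at hsm
    obtain ⟨hw1, hw2, hw3, hw4⟩ := hwp
    obtain ⟨c₁, b₁, r₁, v₁, v₁'⟩ := code₂_spec h hw1 hw2 hsm.1 hsm.2
    obtain ⟨c₂, b₂, s₂⟩ := stored_op ℓ (c := c₁) .add (d := .dir ℓ.μ (tmp ℓ.base 0))
      (a₁ := top ℓ.μ ℓ.base 0) (a₂ := .dir ℓ.μ (ℓ.base + y.idx)) (rd := 0)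
      (Or.inl rfl) (h.inR_reg (by omega)) r₁.lt rfl rfl
    have hval := h.valid y _ hw3
    have r₂ := r₁.temp (d := 0) (by omega) s₂
    have hp : ℓ.get c₂ (tmp ℓ.base 0) = s.ad y + e₁.val s := by
      rw [s₂.get, if_pos rfl, r₁.val_dir, r₁.val_dir, v₁, r₁.adr, Op.eval_eq]
      · simp [Op.nat, Nat.add_comm]
      · omega
      · show _ + _ < _
        simp only [St.tick_ad]; omega
    have hp' : ℓ.get c₂ (tmp ℓ.base 1) = e₂.val s := by
      rw [s₂.get, if_neg (by simp [tmp]), v₁']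
    obtain ⟨c₃, b₃, s₃⟩ := stored_op ℓ (c := c₂) .div (d := .ind ℓ.μ ℓ.μ (tmp ℓ.base 0))
      (a₁ := top ℓ.μ ℓ.base 1) (a₂ := .const 1) (rd := 0)
      (Or.inr ⟨_, rfl, hp⟩) hval.2.1 r₂.lt rfl trivial
    rw [r₂.val_dir, hp', r₂.val_const (by norm_num)] at s₃
    refine ⟨c₃, _, .seq b₁ (.seq b₂ b₃), r₂.seta (y := y) (i := e₁.val s) hw3 s₃, ?_⟩
    have e : ((s.tick (e₁.cost + e₂.cost)).tick 6).seta y (e₁.val s)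
        (Op.eval ℓ.w .div (e₂.val s) 1) 6
        = s.seta y (e₁.val s) (e₂.val s) (e₁.cost + e₂.cost + 12) := by
      simp [St.tick, St.seta, Op.eval]; omega
    rw [e]; exact hw4
  | rdG x e =>
    obtain ⟨hw1, hw2, hw3⟩ := hwp
    obtain ⟨c₁, b₁, r₁, v₁, -⟩ := Expr.code_spec (d := 0) h hw2 hsm (by omega)
    obtain ⟨c₂, b₂, s₂⟩ := stored_op ℓ (c := c₁) .div (d := .dir ℓ.μ (ℓ.base + x.idx))
      (a₁ := .ind .slow ℓ.μ (tmp ℓ.base 0)) (a₂ := .const 1) (rd := 1)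
      (Or.inl rfl) (h.inR_reg (by have := x.idx_lt; omega)) r₁.lt ⟨rfl, Or.inr ⟨rfl, rfl⟩⟩ trivial
    have hv : (Operand.ind .slow ℓ.μ (tmp ℓ.base 0)).val ℓ.w ℓ.M c₁ = s.g (e.val s) := by
      have h4 : (Operand.ind .slow ℓ.μ (tmp ℓ.base 0)).val ℓ.w ℓ.M c₁
        = c₁.slow (ℓ.get c₁ (tmp ℓ.base 0)) := rfl
      rw [h4, v₁, r₁.slow hw1]; rfl
    rw [hv, r₁.val_const (by norm_num)] at s₂
    refine ⟨c₂, _, .seq b₁ b₂, r₁.rdg s₂, ?_⟩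
    have e : (s.tick e.cost).rdg x (Op.eval ℓ.w .div (s.g (e.val s)) 1) 6
        = s.rdg x (s.g (e.val s)) (e.cost + 6) := by simp [St.tick, St.rdg, Op.eval]; omega
    rw [e]; exact hw3
  | wrG e₁ e₂ =>
    simp only [small, Bool.and_eq_true] at hsm
    obtain ⟨hμ, hw1, hw2, hw3⟩ := hwp
    obtain ⟨c₁, b₁, r₁, v₁, v₁'⟩ := code₂_spec h hw1 hw2 hsm.1 hsm.2
    refine ⟨_, s.wrg (e₁.val s) (e₂.val s) (e₁.cost + e₂.cost + 6),
      .seq b₁ (.op _ _ _ _ c₁), ?_, hw3⟩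
    -- The destination lies outside the memory of the layout, so `stored_op` does not apply and the
    -- new configuration is inspected directly.
    obtain ⟨w, M, μ, base, sz⟩ := ℓ
    simp only at hμ
    subst hμ
    have hu : (Op.div.eval w ((top Mem.fast base 1).val w M c₁)
        ((Operand.const 1).val w M c₁)) = e₂.val s := by
      rw [r₁.val_const (by norm_num)]
      show _ / 1 = _
      rw [Nat.div_one, ← v₁']; rfl
    have ha : (if tmp base 0 < M then c₁.fast (tmp base 0) else 0) = e₁.val s := v₁
    have hmem : ∀ a, Config.load M { (Instr.op .div (.ind .slow .fast (tmp base 0))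
        (top Mem.fast base 1) (.const 1)).exec w M c₁ with pc := c₁.pc } .fast a
        = c₁.load M .fast a := fun a => rfl
    have hsl := r₁.slow rfl
    refine ⟨fun a => ⟨(r₁.lt a).1, ?_⟩, r₁.big, r₁.room, fun x => (hmem _).trans (r₁.var x),
      fun y => (hmem _).trans (r₁.adr y), fun y i hi => (hmem _).trans (r₁.arr y i hi),
      fun _ => ?_, r₁.valid, r₁.disj, ?_, ?_, ?_⟩
    · simp only [Instr.exec, hu]
      show Function.update c₁.slow _ _ a < _
      rw [Function.update_apply]; split
      · rw [← v₁']; exact r₁.lt.load _ _ _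
      · exact (r₁.lt a).2
    · simp only [Instr.exec, hu]
      show Function.update c₁.slow (if tmp base 0 < M then c₁.fast (tmp base 0) else 0) _ = _
      rw [ha, hsl]; rfl
    · have := r₁.fa
      show c₁.fastAccesses + 1 + 1 ≤ _
      simp at this ⊢; omega
    · have := r₁.sr
      show c₁.slowReads ≤ _
      simpa [Lay.loc] using this
    · have := r₁.sw
      show c₁.slowWrites + 1 ≤ _
      simp [Lay.loc] at this ⊢; omega
  | setB y e =>
    obtain ⟨hw1, hw2, hw3⟩ := hwp
    obtain ⟨c₁, b₁, r₁, v₁, -⟩ := Expr.code_spec (d := 0) h hw2 hsm (by omega)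
    obtain ⟨c₂, b₂, s₂⟩ := stored_op ℓ (c := c₁) .div (d := .dir ℓ.μ (ℓ.base + y.idx))
      (a₁ := top ℓ.μ ℓ.base 0) (a₂ := .const 1) (rd := 0)
      (Or.inl rfl) (h.inR_reg (by have := y.idx_bounds; omega)) r₁.lt rfl trivial
    rw [r₁.val_dir, v₁, r₁.val_const (by norm_num)] at s₂
    refine ⟨c₂, _, .seq b₁ b₂, r₁.setb hw1 s₂, ?_⟩
    have e : (s.tick e.cost).setb y (Op.eval ℓ.w .div (e.val s) 1) 6
        = s.setb y (e.val s) (e.cost + 6) := by simp [St.tick, St.setb, Op.eval]; omega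
    rw [e]; exact hw3
  | seq c₁ c₂ ih₁ ih₂ =>
    simp only [small, Bool.and_eq_true] at hsm
    obtain ⟨d₁, s₁, b₁, r₁, q₁⟩ := ih₁ h hsm.1 hwp
    obtain ⟨d₂, s₂, b₂, r₂, q₂⟩ := ih₂ r₁ hsm.2 q₁
    exact ⟨d₂, s₂, .seq b₁ b₂, r₂, q₂⟩
  | ite e₁ e₂ c₁ c₂ ih₁ ih₂ =>
    simp only [small, Bool.and_eq_true] at hsm
    obtain ⟨hw1, hw2, hw3, hw4⟩ := hwp
    obtain ⟨d₀, b₀, r₀, v₀, v₀'⟩ := code₂_spec h hw1 hw2 hsm.1.1.1 hsm.1.1.2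
    have r₀' := r₀.test.1
    have e : (s.tick (e₁.cost + e₂.cost)).tick 6 = s.tick (e₁.cost + e₂.cost + 6) := by
      simp [St.tick]; omega
    rw [e] at r₀'
    by_cases hc : e₁.val s < e₂.val s
    · obtain ⟨d₁, s₁, b₁, r₁, q₁⟩ := ih₁ r₀' hsm.1.2 (hw3 hc)
      refine ⟨d₁, s₁, .seq b₀ (.ite_true ?_ b₁), r₁, q₁⟩
      rw [r₀.val_dir, r₀.val_dir, v₀, v₀']; exact hc
    · obtain ⟨d₁, s₁, b₁, r₁, q₁⟩ := ih₂ r₀' hsm.2 (hw4 hc)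
      refine ⟨d₁, s₁, .seq b₀ (.ite_false ?_ b₁), r₁, q₁⟩
      rw [r₀.val_dir, r₀.val_dir, v₀, v₀']; exact hc
  | whileLt e₁ e₂ body ih =>
    simp only [small, Bool.and_eq_true] at hsm
    obtain ⟨N, hN⟩ := hwp
    have e : (s.tick (e₁.cost + e₂.cost)).tick 6 = s.tick (e₁.cost + e₂.cost + 6) := by
      simp [St.tick]; omega
    -- The operands of the test are evaluated once before the compiled loop and again at the end of
    -- its body; `d₀` is the configuration after the first evaluation, where the induction can
    -- start.
    suffices key : ∃ d₀ c' s', LCmd.Big ℓ.w ℓ.M (code₂ ℓ.μ ℓ.base e₁ e₂) c d₀ ∧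
        LCmd.Big ℓ.w ℓ.M (.whileLt (top ℓ.μ ℓ.base 0) (top ℓ.μ ℓ.base 1)
          (.seq (body.code ℓ.μ ℓ.base) (code₂ ℓ.μ ℓ.base e₁ e₂))) d₀ c' ∧ Rep ℓ s' c' ∧ Q s' by
      obtain ⟨d₀, c', s', b₀, b₁, r, q⟩ := key
      exact ⟨c', s', .seq b₀ b₁, r, q⟩
    clear e
    induction N generalizing s c with
    | zero => exact hN.elim
    | succ N ihN =>
      obtain ⟨hw1, hw2, hw3, hw4⟩ := hN
      obtain ⟨d₀, b₀, r₀, v₀, v₀'⟩ := code₂_spec h hw1 hw2 hsm.1.1 hsm.1.2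
      have r₀' := r₀.test.1
      have e : (s.tick (e₁.cost + e₂.cost)).tick 6 = s.tick (e₁.cost + e₂.cost + 6) := by
        simp [St.tick]; omega
      rw [e] at r₀'
      by_cases hc : e₁.val s < e₂.val s
      · obtain ⟨d₁, s₁, b₁, r₁, q₁⟩ := ih r₀' hsm.2 (hw3 hc)
        obtain ⟨d₂, c', s', b₂, b₃, r₂, q₂⟩ := ihN r₁ q₁
        refine ⟨d₀, c', s', b₀, .while_true ?_ (.seq b₁ b₂) b₃, r₂, q₂⟩
        rw [r₀.val_dir, r₀.val_dir, v₀, v₀']; exact hc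
      · refine ⟨d₀, _, _, b₀, .while_false ?_, r₀', hw4 hc⟩
        rw [r₀.val_dir, r₀.val_dir, v₀, v₀']; exact hc

end AsymRAM

/-! ### The dynamic program, edit distance and common subsequences. -/

/-- The dynamic program for the distance with substitution cost `sc`. -/
def dp (sc : ℕ) (x y : List ℕ) : ℕ → ℕ → ℕ
  | 0, c => c
  | r + 1, 0 => r + 1
  | r + 1, c + 1 => min (min (dp sc x y r (c + 1) + 1) (dp sc x y (r + 1) c + 1))
      (dp sc x y r c + if x.getD r 0 = y.getD c 0 then 0 else sc)

section DP

variable {sc : ℕ} {x y : List ℕ}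

@[simp] theorem dp_zero_left (c : ℕ) : dp sc x y 0 c = c := by simp [dp]

@[simp] theorem dp_zero_right (r : ℕ) : dp sc x y r 0 = r := by cases r <;> simp [dp]

theorem dp_succ_left_le (r c : ℕ) : dp sc x y (r + 1) c ≤ dp sc x y r c + 1 := by
  cases c with
  | zero => simp
  | succ c => simp only [dp]; omega

theorem dp_succ_right_le (r c : ℕ) : dp sc x y r (c + 1) ≤ dp sc x y r c + 1 := by
  cases r with
  | zero => simp
  | succ c => simp only [dp]; omega

theorem dp_le_add (r c : ℕ) : dp sc x y r c ≤ r + c := by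
  induction r with
  | zero => simp
  | succ r ih => have := dp_succ_left_le (sc := sc) (x := x) (y := y) r c; omega

/-- Alignments of two strings with `k` insertions, deletions and substitutions. -/
inductive StrAlign : ℕ → List ℕ → List ℕ → Prop
  | nil : StrAlign 0 [] []
  | del {k x y} (a : ℕ) (h : StrAlign k x y) : StrAlign (k + 1) (x ++ [a]) y
  | ins {k x y} (b : ℕ) (h : StrAlign k x y) : StrAlign (k + 1) x (y ++ [b])
  | sub {k x y} (a b : ℕ) (h : StrAlign k x y) : StrAlign (k + 1) (x ++ [a]) (y ++ [b])
  | keep {k x y} (a : ℕ) (h : StrAlign k x y) : StrAlign k (x ++ [a]) (y ++ [a])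

namespace StrAlign

theorem refl (x : List ℕ) : StrAlign 0 x x := by
  induction x using List.reverseRecOn with
  | nil => exact nil
  | append_singleton x a ih => exact ih.keep a

theorem append {k l : ℕ} {x y u v : List ℕ} (h : StrAlign k x y) (h' : StrAlign l u v) :
    StrAlign (k + l) (x ++ u) (y ++ v) := by
  induction h' with
  | nil => simpa using h
  | del a _ ih => rw [← List.append_assoc]; exact ih.del a
  | ins b _ ih => rw [← List.append_assoc]; exact ih.ins b
  | sub a b _ ih => rw [← List.append_assoc, ← List.append_assoc]; exact ih.sub a b
  | keep a _ ih => rw [← List.append_assoc, ← List.append_assoc]; exact ih.keep a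

/-- Alignments are monotone: a cut of the first string induces a cut of the second one, and the cost
is additive. -/
theorem split {k : ℕ} {x z : List ℕ} (h : StrAlign k x z) : ∀ u v, x = u ++ v →
    ∃ k₁ k₂ z₁ z₂, z = z₁ ++ z₂ ∧ k₁ + k₂ = k ∧ StrAlign k₁ u z₁ ∧ StrAlign k₂ v z₂ := by
  induction h with
  | nil =>
    intro u v h
    obtain ⟨rfl, rfl⟩ := List.append_eq_nil_iff.1 h.symm
    exact ⟨0, 0, [], [], rfl, rfl, nil, nil⟩
  | @del k x y a h ih =>
    intro u v e
    rcases List.eq_nil_or_concat v with rfl | ⟨v, b, rfl⟩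
    · rw [List.append_nil] at e
      exact ⟨k + 1, 0, y, [], by simp, rfl, e ▸ h.del a, nil⟩
    · rw [List.concat_eq_append, ← List.append_assoc] at e
      obtain ⟨e, e'⟩ := List.append_inj' e rfl
      obtain ⟨k₁, k₂, z₁, z₂, rfl, rfl, h₁, h₂⟩ := ih u v e
      exact ⟨k₁, k₂ + 1, z₁, z₂, rfl, rfl, h₁, List.concat_eq_append ▸ h₂.del b⟩
  | @ins k x y b h ih =>
    intro u v e
    obtain ⟨k₁, k₂, z₁, z₂, rfl, rfl, h₁, h₂⟩ := ih u v e
    exact ⟨k₁, k₂ + 1, z₁, z₂ ++ [b], by simp, rfl, h₁, h₂.ins b⟩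
  | @sub k x y a b h ih =>
    intro u v e
    rcases List.eq_nil_or_concat v with rfl | ⟨v, b', rfl⟩
    · rw [List.append_nil] at e
      exact ⟨k + 1, 0, y ++ [b], [], by simp, rfl, e ▸ h.sub a b, nil⟩
    · rw [List.concat_eq_append, ← List.append_assoc] at e
      obtain ⟨e, e'⟩ := List.append_inj' e rfl
      obtain ⟨k₁, k₂, z₁, z₂, rfl, rfl, h₁, h₂⟩ := ih u v e
      exact ⟨k₁, k₂ + 1, z₁, z₂ ++ [b], by simp, rfl, h₁, by rw [List.concat_eq_append]; exact h₂.sub b' b⟩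
  | @keep k x y a h ih =>
    intro u v e
    rcases List.eq_nil_or_concat v with rfl | ⟨v, b', rfl⟩
    · rw [List.append_nil] at e
      exact ⟨k, 0, y ++ [a], [], by simp, rfl, e ▸ h.keep a, nil⟩
    · rw [List.concat_eq_append, ← List.append_assoc] at e
      obtain ⟨e, e'⟩ := List.append_inj' e rfl
      obtain ⟨k₁, k₂, z₁, z₂, rfl, rfl, h₁, h₂⟩ := ih u v e
      obtain rfl : a = b' := by simpa using e'
      exact ⟨k₁, k₂, z₁, z₂ ++ [a], by simp, rfl, h₁, by rw [List.concat_eq_append]; exact h₂.keep a⟩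

theorem length_le {k : ℕ} {x y : List ℕ} (h : StrAlign k x y) : y.length ≤ x.length + k := by
  induction h <;> simp <;> omega

theorem of_nil (y : List ℕ) : StrAlign y.length [] y := by
  induction y using List.reverseRecOn with
  | nil => exact nil
  | append_singleton y b ih => simpa using ih.ins b

/-- Only the part of the alignment at the edited letter has to be changed, so one edit in front
raises the cost by at most one. -/
theorem edit {k : ℕ} {x y z : List ℕ} (e : Edit x y) (h : StrAlign k y z) :
    ∃ k' ≤ k + 1, StrAlign k' x z := by
  cases e with
  | insert u v b =>
    obtain ⟨k₁, k₂, z₁, z₂, rfl, rfl, h₁, h₂⟩ := h.split u (b :: v) rfl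
    obtain ⟨k₃, k₄, z₃, z₄, rfl, rfl, h₃, h₄⟩ := h₂.split [b] v rfl
    -- The inserted `b` was aligned with `z₃`. Without `b` all of `z₃` has to be inserted, and
    -- `z₃.length ≤ 1 + k₃`.
    refine ⟨k₁ + (z₃.length + k₄), ?_, h₁.append ?_⟩
    · have := h₃.length_le; simp at this; omega
    · simpa using (of_nil z₃).append h₄
  | delete u v a =>
    obtain ⟨k₁, k₂, z₁, z₂, rfl, rfl, h₁, h₂⟩ := h.split u v rfl
    refine ⟨k₁ + (1 + k₂), by omega, h₁.append ?_⟩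
    simpa using (nil.del a).append h₂
  | substitute u v a b =>
    obtain ⟨k₁, k₂, z₁, z₂, rfl, rfl, h₁, h₂⟩ := h.split u (b :: v) rfl
    obtain ⟨k₃, k₄, z₃, z₄, rfl, rfl, h₃, h₄⟩ := h₂.split [b] v rfl
    have hl := h₃.length_le
    -- If `b` was deleted, delete `a` instead. Otherwise replace `a` by the last letter of `z₃` and
    -- insert the others.
    rcases List.eq_nil_or_concat z₃ with rfl | ⟨z₃, d, rfl⟩
    · refine ⟨k₁ + (1 + k₄), by omega, h₁.append ?_⟩
      simpa using (nil.del a).append h₄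
    · rw [List.concat_eq_append] at *
      refine ⟨k₁ + (z₃.length + 1 + k₄), by simp at hl; omega, h₁.append ?_⟩
      have := ((of_nil z₃).sub a d).append h₄
      simpa using this

end StrAlign

theorem Edit.snoc {x y : List ℕ} (h : Edit x y) (b : ℕ) : Edit (x ++ [b]) (y ++ [b]) := by
  cases h with
  | insert u v c => simpa using Edit.insert u (v ++ [b]) c
  | delete u v c => simpa using Edit.delete u (v ++ [b]) c
  | substitute u v c d => simpa using Edit.substitute u (v ++ [b]) c d

theorem EditsIn.snoc {k : ℕ} {x y : List ℕ} (h : EditsIn k x y) (b : ℕ) :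
    EditsIn k (x ++ [b]) (y ++ [b]) := by
  induction h with
  | zero x => exact .zero _
  | succ h _ ih => exact .succ (h.snoc b) ih

theorem StrAlign.editsIn {k : ℕ} {x y : List ℕ} (h : StrAlign k x y) : EditsIn k x y := by
  induction h with
  | nil => exact .zero _
  | @del k x y a _ ih => exact .succ (by simpa using Edit.delete x [] a) ih
  | @ins k x y b _ ih => exact .succ (by simpa using Edit.insert x [] b) (ih.snoc b)
  | @sub k x y a b _ ih => exact .succ (Edit.substitute x [] a b) (ih.snoc b)
  | keep a _ ih => exact ih.snoc a

theorem EditsIn.alignment {k : ℕ} {x y : List ℕ} (h : EditsIn k x y) :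
    ∃ k' ≤ k, StrAlign k' x y := by
  induction h with
  | zero x => exact ⟨0, le_rfl, .refl x⟩
  | succ h _ ih =>
    obtain ⟨k', hk, ha⟩ := ih
    obtain ⟨k'', hk', ha'⟩ := ha.edit h
    exact ⟨k'', by omega, ha'⟩

theorem take_eq_append_singleton {x u : List ℕ} {a r : ℕ} (hr : r ≤ x.length)
    (h : u ++ [a] = x.take r) : ∃ r', r = r' + 1 ∧ u = x.take r' ∧ a = x.getD r' 0 := by
  have hl := congrArg List.length h
  simp only [List.length_append, List.length_singleton, List.length_take] at hl
  obtain ⟨r', rfl⟩ : ∃ r', r = r' + 1 := ⟨r - 1, by omega⟩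
  rw [List.take_add_one, List.getElem?_eq_getElem (by omega)] at h
  obtain ⟨h1, h2⟩ := List.append_inj' h rfl
  refine ⟨r', rfl, h1, ?_⟩
  simp only [Option.toList_some, List.cons.injEq, and_true] at h2
  rw [h2, List.getD_eq_getElem _ _ (by omega)]

theorem take_succ_eq {x : List ℕ} {r : ℕ} (hr : r + 1 ≤ x.length) :
    x.take (r + 1) = x.take r ++ [x.getD r 0] := by
  rw [List.take_add_one, List.getElem?_eq_getElem (by omega), List.getD_eq_getElem _ _ (by omega)]
  rfl

theorem StrAlign.dp_le {k : ℕ} {u v : List ℕ} (h : StrAlign k u v) : ∀ r c, r ≤ x.length →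
    c ≤ y.length → u = x.take r → v = y.take c → dp 1 x y r c ≤ k := by
  induction h with
  | nil =>
    intro r c hr hc h1 h2
    have h1 := congrArg List.length h1
    have h2 := congrArg List.length h2
    simp only [List.length_nil, List.length_take] at h1 h2
    obtain rfl : r = 0 := by omega
    obtain rfl : c = 0 := by omega
    simp
  | del a _ ih =>
    intro r c hr hc h1 h2
    obtain ⟨r, rfl, h1, -⟩ := take_eq_append_singleton hr h1
    have := ih r c (by omega) hc h1 h2
    have := dp_succ_left_le (sc := 1) (x := x) (y := y) r c
    omega
  | ins a _ ih =>
    intro r c hr hc h1 h2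
    obtain ⟨c, rfl, h2, -⟩ := take_eq_append_singleton hc h2
    have := ih r c hr (by omega) h1 h2
    have := dp_succ_right_le (sc := 1) (x := x) (y := y) r c
    omega
  | sub a b _ ih =>
    intro r c hr hc h1 h2
    obtain ⟨r, rfl, h1, -⟩ := take_eq_append_singleton hr h1
    obtain ⟨c, rfl, h2, -⟩ := take_eq_append_singleton hc h2
    have := ih r c (by omega) (by omega) h1 h2
    simp only [dp]
    split_ifs <;> omega
  | keep a _ ih =>
    intro r c hr hc h1 h2
    obtain ⟨r, rfl, h1, e1⟩ := take_eq_append_singleton hr h1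
    obtain ⟨c, rfl, h2, e2⟩ := take_eq_append_singleton hc h2
    have := ih r c (by omega) (by omega) h1 h2
    simp only [dp]
    rw [← e1, ← e2, if_pos rfl]
    omega

theorem alignment_dp (r c : ℕ) (hr : r ≤ x.length) (hc : c ≤ y.length) :
    StrAlign (dp 1 x y r c) (x.take r) (y.take c) := by
  induction r generalizing c with
  | zero => simpa [hc] using StrAlign.of_nil (y.take c)
  | succ r ihr =>
    induction c with
    | zero =>
      have := (ihr 0 (by omega) hc).del (x.getD r 0)
      rw [← take_succ_eq hr] at this
      simpa using this
    | succ c ihc =>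
      have h1 := (ihr (c + 1) (by omega) hc).del (x.getD r 0)
      have h2 := (ihc (by omega)).ins (y.getD c 0)
      have h3 : StrAlign (dp 1 x y r c + if x.getD r 0 = y.getD c 0 then 0 else 1)
          (x.take (r + 1)) (y.take (c + 1)) := by
        rw [take_succ_eq hr, take_succ_eq hc]
        split_ifs with h
        · rw [h]; exact (ihr c (by omega) (by omega)).keep _
        · exact (ihr c (by omega) (by omega)).sub _ _
      rw [← take_succ_eq hr] at h1
      rw [← take_succ_eq hc] at h2
      simp only [dp]
      rcases min_choice (min (dp 1 x y r (c + 1) + 1) (dp 1 x y (r + 1) c + 1))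
        (dp 1 x y r c + if x.getD r 0 = y.getD c 0 then 0 else 1) with h | h <;> rw [h]
      · rcases min_choice (dp 1 x y r (c + 1) + 1) (dp 1 x y (r + 1) c + 1) with h | h <;> rw [h]
        · exact h1
        · exact h2
      · exact h3

variable (x y) in
theorem editDistance_eq_dp : editDistance x y = dp 1 x y x.length y.length := by
  have h := editDistance_isLeast x y
  apply le_antisymm
  · refine h.2 (StrAlign.editsIn ?_)
    simpa using alignment_dp (x := x) (y := y) x.length y.length le_rfl le_rfl
  · obtain ⟨k', hk, ha⟩ := EditsIn.alignment h.1
    exact (ha.dp_le _ _ le_rfl le_rfl (by simp) (by simp)).trans hk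

theorem sublist_append_singleton {z l : List ℕ} {a : ℕ} (h : z.Sublist (l ++ [a])) :
    z.Sublist l ∨ ∃ z', z = z' ++ [a] ∧ z'.Sublist l := by
  obtain ⟨z₁, z₂, rfl, h₁, h₂⟩ := List.sublist_append_iff.1 h
  rcases List.sublist_singleton.1 h₂ with rfl | rfl
  · left; simpa using h₁
  · right; exact ⟨z₁, rfl, h₁⟩

/-- Substitution cost 2 makes `dp + 2 * |z| - (r + c)` invariant along the recursion: a gap costs 1
and uses up one letter, a mismatch costs 2 and uses up two, a match costs nothing, uses up two and
lengthens `z` by one. This and the next lemma are the two inequalities that follow. -/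
theorem dp_add_le_of_sublist (r c : ℕ) (hr : r ≤ x.length) (hc : c ≤ y.length) (z : List ℕ)
    (h1 : z.Sublist (x.take r)) (h2 : z.Sublist (y.take c)) :
    dp 2 x y r c + 2 * z.length ≤ r + c := by
  induction r generalizing c z with
  | zero =>
    have : z = [] := by simpa using h1
    simp [this]
  | succ r ihr =>
    induction c generalizing z with
    | zero =>
      have : z = [] := by simpa using h2
      simp [this]
    | succ c ihc =>
      have hl := dp_succ_left_le (sc := 2) (x := x) (y := y) r (c + 1)
      have hr' := dp_succ_right_le (sc := 2) (x := x) (y := y) (r + 1) c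
      have h1' := h1
      have h2' := h2
      rw [take_succ_eq hr] at h1'
      rw [take_succ_eq hc] at h2'
      rcases sublist_append_singleton h1' with h | ⟨z₁, rfl, h⟩
      · have := ihr (c + 1) (by omega) hc z h h2
        omega
      · rcases sublist_append_singleton h2' with h' | ⟨z₂, e, h'⟩
        · have := ihc (by omega) _ h1 h'
          omega
        · obtain ⟨rfl, e⟩ := List.append_inj' e rfl
          have := ihr c (by omega) (by omega) _ h h'
          have e : x.getD r 0 = y.getD c 0 := by simpa using e
          simp only [dp, if_pos e, List.length_append, List.length_singleton]
          omega

theorem exists_sublist_dp (r c : ℕ) (hr : r ≤ x.length) (hc : c ≤ y.length) :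
    ∃ z : List ℕ, z.Sublist (x.take r) ∧ z.Sublist (y.take c) ∧
      dp 2 x y r c + 2 * z.length = r + c := by
  induction r generalizing c with
  | zero => exact ⟨[], by simp, by simp, by simp⟩
  | succ r ihr =>
    induction c with
    | zero => exact ⟨[], by simp, by simp, by simp⟩
    | succ c ihc =>
      have hx : (x.take r).Sublist (x.take (r + 1)) := by
        rw [take_succ_eq hr]; exact List.sublist_append_left _ _
      have hy : (y.take c).Sublist (y.take (c + 1)) := by
        rw [take_succ_eq hc]; exact List.sublist_append_left _ _
      obtain ⟨z₁, a₁, b₁, e₁⟩ := ihr (c + 1) (by omega) hc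
      obtain ⟨z₂, a₂, b₂, e₂⟩ := ihc (by omega)
      obtain ⟨z₃, a₃, b₃, e₃⟩ := ihr c (by omega) (by omega)
      have d1 := dp_add_le_of_sublist (r + 1) (c + 1) hr hc _ (a₁.trans hx) b₁
      have d2 := dp_add_le_of_sublist (r + 1) (c + 1) hr hc _ a₂ (b₂.trans hy)
      by_cases h : x.getD r 0 = y.getD c 0
      · have a₄ : (z₃ ++ [x.getD r 0]).Sublist (x.take (r + 1)) := by
          rw [take_succ_eq hr]; exact a₃.append (List.Sublist.refl _)
        have b₄ : (z₃ ++ [x.getD r 0]).Sublist (y.take (c + 1)) := by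
          rw [take_succ_eq hc, h]; exact b₃.append (List.Sublist.refl _)
        have d3 := dp_add_le_of_sublist (r + 1) (c + 1) hr hc _ a₄ b₄
        have d : dp 2 x y (r + 1) (c + 1) = min (min (dp 2 x y r (c + 1) + 1)
          (dp 2 x y (r + 1) c + 1)) (dp 2 x y r c + 0) := by simp only [dp, if_pos h]
        simp only [List.length_append, List.length_singleton] at d3
        by_cases c1 : dp 2 x y (r + 1) (c + 1) = dp 2 x y r (c + 1) + 1
        · exact ⟨z₁, a₁.trans hx, b₁, by omega⟩
        by_cases c2 : dp 2 x y (r + 1) (c + 1) = dp 2 x y (r + 1) c + 1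
        · exact ⟨z₂, a₂, b₂.trans hy, by omega⟩
        exact ⟨_, a₄, b₄, by simp; omega⟩
      · have d3 := dp_add_le_of_sublist (r + 1) (c + 1) hr hc _ (a₃.trans hx) (b₃.trans hy)
        have d : dp 2 x y (r + 1) (c + 1) = min (min (dp 2 x y r (c + 1) + 1)
          (dp 2 x y (r + 1) c + 1)) (dp 2 x y r c + 2) := by simp only [dp, if_neg h]
        by_cases c1 : dp 2 x y (r + 1) (c + 1) = dp 2 x y r (c + 1) + 1
        · exact ⟨z₁, a₁.trans hx, b₁, by omega⟩
        by_cases c2 : dp 2 x y (r + 1) (c + 1) = dp 2 x y (r + 1) c + 1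
        · exact ⟨z₂, a₂, b₂.trans hy, by omega⟩
        exact ⟨z₃, a₃.trans hx, b₃.trans hy, by omega⟩

variable (x y) in
theorem lcsLength_eq_dp :
    lcsLength x y = (x.length + y.length - dp 2 x y x.length y.length) / 2 := by
  obtain ⟨z, a, b, e⟩ := exists_sublist_dp (x := x) (y := y) x.length y.length le_rfl le_rfl
  rw [List.take_length] at a b
  obtain ⟨⟨z', a', b', e'⟩, h⟩ := lcsLength_isGreatest x y
  have h1 := h ⟨z, a, b, rfl⟩
  have h2 := dp_add_le_of_sublist (x := x) (y := y) x.length y.length le_rfl le_rfl z'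
    (by simpa using a') (by simpa using b')
  omega

end DP

/-! ### Tiles: values and entry points on a moving frontier. -/

/-- Fold a step function over the cells of a grid, row by row. -/
def gridRow {σ : Type*} (f : ℕ → σ → σ) : ℕ → σ → σ
  | 0, s => s
  | c + 1, s => f c (gridRow f c s)

/-- Fold a step function over the cells of a grid with `Wd` columns, row by row. -/
def grid {σ : Type*} (f : ℕ → ℕ → σ → σ) (Wd : ℕ) : ℕ → σ → σ
  | 0, s => s
  | r + 1, s => gridRow (f r) Wd (grid f Wd r s)

/-- `P r c` is the relation just before the cell `(r, c)` is processed, and `wrap` passes from the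
end of a row to the start of the next. Every statement about tiles below is an instance with a
suitable `P`. -/
theorem grid_rel {σ τ : Type*} {f : ℕ → ℕ → σ → σ} {g : ℕ → ℕ → τ → τ} {H Wd : ℕ}
    (P : ℕ → ℕ → σ → τ → Prop)
    (step : ∀ r c s t, r < H → c < Wd → P r c s t → P r (c + 1) (f r c s) (g r c t))
    (wrap : ∀ r s t, r < H → P r Wd s t → P (r + 1) 0 s t) {s : σ} {t : τ} (h : P 0 0 s t) :
    P H 0 (grid f Wd H s) (grid g Wd H t) := by
  have row : ∀ r, r < H → ∀ s t, P r 0 s t → ∀ c, c ≤ Wd →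
      P r c (gridRow (f r) c s) (gridRow (g r) c t) := by
    intro r hr s t h c
    induction c with
    | zero => intro _; exact h
    | succ c ih => intro hc; exact step r c _ _ hr (by omega) (ih (by omega))
  have : ∀ r, r ≤ H → P r 0 (grid f Wd r s) (grid g Wd r t) := by
    intro r
    induction r with
    | zero => intro _; exact h
    | succ r ih =>
      intro hr
      exact wrap r _ _ (by omega) (row r (by omega) _ _ (ih (by omega)) Wd le_rfl)
  exact this H le_rfl

theorem grid_inv {σ : Type*} {f : ℕ → ℕ → σ → σ} {H Wd : ℕ} (P : ℕ → ℕ → σ → Prop)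
    (step : ∀ r c s, r < H → c < Wd → P r c s → P r (c + 1) (f r c s))
    (wrap : ∀ r s, r < H → P r Wd s → P (r + 1) 0 s) {s : σ} (h : P 0 0 s) :
    P H 0 (grid f Wd H s) :=
  grid_rel (g := fun _ _ (u : Unit) => u) (fun r c s _ => P r c s)
    (fun r c s _ => step r c s) (fun r s _ => wrap r s) (t := ()) h

/-- The value and the entry point of a cell, from the values and the entry points of its three
neighbours on the frontier. -/
def pick (hm wn wt r c : ℕ) (a b d : ℕ × ℕ) : ℕ × ℕ :=
  if r < hm then
    if c < wn then
      let v := (b.1 + wt, b.2)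
      let v := if a.1 + 1 < v.1 then (a.1 + 1, a.2) else v
      if d.1 + 1 < v.1 then (d.1 + 1, d.2) else v
    else a
  else d

/-- Process the cell in row `r` and column `c`. -/
def cellFn (hm wn : ℕ) (wt : ℕ → ℕ → ℕ) (H r c : ℕ) (s : (ℕ → ℕ) × (ℕ → ℕ)) :
    (ℕ → ℕ) × (ℕ → ℕ) :=
  let p := H + c - r
  let v := pick hm wn (wt r c) r c (s.1 (p - 1), s.2 (p - 1)) (s.1 p, s.2 p)
    (s.1 (p + 1), s.2 (p + 1))
  (Function.update s.1 p v.1, Function.update s.2 p v.2)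

/-- Process a tile with `H` rows and `Wd` columns. -/
def tileFn (hm wn : ℕ) (wt : ℕ → ℕ → ℕ) (H Wd : ℕ) (s : (ℕ → ℕ) × (ℕ → ℕ)) :
    (ℕ → ℕ) × (ℕ → ℕ) :=
  grid (cellFn hm wn wt H) Wd H s

/-- The values on the frontier after a tile. -/
def tileV (hm wn : ℕ) (wt : ℕ → ℕ → ℕ) (H Wd : ℕ) (U : ℕ → ℕ) : ℕ → ℕ :=
  (tileFn hm wn wt H Wd (U, id)).1

/-- The entry points of the nodes on the frontier after a tile. -/
def tileE (hm wn : ℕ) (wt : ℕ → ℕ → ℕ) (H Wd : ℕ) (U : ℕ → ℕ) : ℕ → ℕ :=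
  (tileFn hm wn wt H Wd (U, id)).2

/-- `N` satisfies the recurrence of the tile. -/
def IsDist (hm wn : ℕ) (wt : ℕ → ℕ → ℕ) (H Wd : ℕ) (N : ℕ → ℕ → ℕ) : Prop :=
  ∀ r c, r < H → c < Wd → N (r + 1) (c + 1) =
    if r < hm then if c < wn then min (min (N r (c + 1) + 1) (N (r + 1) c + 1)) (N r c + wt r c)
      else N (r + 1) c else N r (c + 1)

section Tile

variable {hm wn H Wd : ℕ} {wt : ℕ → ℕ → ℕ}

theorem pick_fst (hm wn wt r c : ℕ) (a b d : ℕ × ℕ) :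
    (pick hm wn wt r c a b d).1 = if r < hm then if c < wn then
      min (min (d.1 + 1) (a.1 + 1)) (b.1 + wt) else a.1 else d.1 := by
  unfold pick
  simp only
  split_ifs <;> simp only <;> omega

/-- Entry points are carried along without any influence on the values. -/
theorem tileFn_fst (U E : ℕ → ℕ) : (tileFn hm wn wt H Wd (U, E)).1 = tileV hm wn wt H Wd U := by
  refine grid_rel (f := cellFn hm wn wt H) (g := cellFn hm wn wt H) (H := H) (Wd := Wd) (fun _ _ s t => s.1 = t.1) ?_ (fun _ _ _ _ h => h) rfl
  intro r c s t _ _ h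
  simp only [cellFn, pick_fst, h]

/-- Tiles respect relations such as `=` and `≥`. -/
theorem tileV_rel (R : ℕ → ℕ → Prop) (hadd : ∀ a b c, R a b → R (a + c) (b + c))
    (hmin : ∀ a b c d, R a b → R c d → R (min a c) (min b d)) {N : ℕ → ℕ → ℕ}
    (hN : IsDist hm wn wt H Wd N) {U : ℕ → ℕ} (hl : ∀ i ≤ H, R (U (H - i)) (N i 0))
    (ht : ∀ j ≤ Wd, R (U (H + j)) (N 0 j)) :
    (∀ j ≤ Wd, R (tileV hm wn wt H Wd U j) (N H j)) ∧
    (∀ i ≤ H, R (tileV hm wn wt H Wd U (H + Wd - i)) (N i Wd)) := by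
  -- The node `(i, j)` is stored at its diagonal `H + j - i`. The four alternatives are the parts of
  -- the current frontier: the left side below the current row, the new row up to column `c`, the
  -- old row from column `c` on, and the right side above.
  have key := grid_inv (f := cellFn hm wn wt H) (H := H) (Wd := Wd) (s := (U, id))
    (fun r c s => ∀ i j, i ≤ H → j ≤ Wd →
      ((j = 0 ∧ r + 1 ≤ i) ∨ (i = r + 1 ∧ j ≤ c) ∨ (i = r ∧ c ≤ j) ∨ (j = Wd ∧ i ≤ r)) →
      R (s.1 (H + j - i)) (N i j)) ?_ ?_ ?_
  · constructor
    · intro j hj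
      have := key H j le_rfl hj (by omega)
      rwa [show H + j - H = j by omega] at this
    · intro i hi
      exact key i Wd hi le_rfl (by omega)
  · intro r c s hr hc ih i j hi hj hij
    simp only [cellFn]
    by_cases hp : i = r + 1 ∧ j = c + 1
    · obtain ⟨rfl, rfl⟩ := hp
      rw [show H + (c + 1) - (r + 1) = H + c - r by omega, Function.update_self, pick_fst,
        hN r c hr hc]
      have h1 := ih r (c + 1) (by omega) hj (by omega)
      have h2 := ih (r + 1) c hi (by omega) (by omega)
      have h3 := ih r c (by omega) (by omega) (by omega)
      rw [show H + (c + 1) - r = H + c - r + 1 by omega] at h1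
      rw [show H + c - (r + 1) = H + c - r - 1 by omega] at h2
      split_ifs
      · exact hmin _ _ _ _ (hmin _ _ _ _ (hadd _ _ _ h1) (hadd _ _ _ h2)) (hadd _ _ _ h3)
      · exact h2
      · exact h1
    · rw [Function.update_of_ne (by omega)]
      exact ih i j hi hj (by omega)
  · intro r s hr ih i j hi hj hij
    exact ih i j hi hj (by omega)
  · intro i j hi hj hij
    rcases Nat.eq_zero_or_pos i with rfl | hi0
    · exact ht j hj
    · rcases Nat.eq_zero_or_pos j with rfl | hj0
      · exact hl i hi
      · have : i = 1 ∧ j = 0 := by omega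
        omega

theorem tileV_eq {N : ℕ → ℕ → ℕ}
    (hN : IsDist hm wn wt H Wd N) {U : ℕ → ℕ} (hl : ∀ i ≤ H, U (H - i) = N i 0)
    (ht : ∀ j ≤ Wd, U (H + j) = N 0 j) :
    (∀ j ≤ Wd, tileV hm wn wt H Wd U j = N H j) ∧
    (∀ i ≤ H, tileV hm wn wt H Wd U (H + Wd - i) = N i Wd) :=
  tileV_rel (· = ·) (by intros; subst_vars; rfl) (by intros; subst_vars; rfl) hN hl ht

theorem tileV_ge {N : ℕ → ℕ → ℕ}
    (hN : IsDist hm wn wt H Wd N) {U : ℕ → ℕ} (hl : ∀ i ≤ H, N i 0 ≤ U (H - i))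
    (ht : ∀ j ≤ Wd, N 0 j ≤ U (H + j)) :
    (∀ j ≤ Wd, N H j ≤ tileV hm wn wt H Wd U j) ∧
    (∀ i ≤ H, N i Wd ≤ tileV hm wn wt H Wd U (H + Wd - i)) :=
  tileV_rel (fun a b => b ≤ a) (by intros; omega) (by intros; omega) hN hl ht

theorem tileV_congr {U U' : ℕ → ℕ} (h : ∀ t ≤ H + Wd, U t = U' t) :
    ∀ t ≤ H + Wd, tileV hm wn wt H Wd U t = tileV hm wn wt H Wd U' t := by
  refine grid_rel (f := cellFn hm wn wt H) (g := cellFn hm wn wt H) (H := H) (Wd := Wd) (fun _ _ s s' => ∀ t ≤ H + Wd, s.1 t = s'.1 t) ?_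
    (fun _ _ _ _ h => h) h
  intro r c s s' hr hc h t ht
  simp only [cellFn, Function.update_apply, pick_fst]
  rw [h t ht, h (H + c - r) (by omega), h (H + c - r - 1) (by omega), h (H + c - r + 1) (by omega)]

/-- A cell either exceeds its predecessor on the diagonal by at most 2 or copies a neighbour, so
each row raises the bound by at most 2. Such bounds exclude overflow. -/
theorem grid_bound {U E : ℕ → ℕ} {B : ℕ} (hwt : ∀ r c, wt r c ≤ 2)
    (hU : ∀ t ≤ H + Wd, U t ≤ B) :
    ∀ r' ≤ H, ∀ t ≤ H + Wd, (grid (cellFn hm wn wt H) Wd r' (U, E)).1 t ≤ B + 2 * r' := by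
  intro r' hr'
  have := grid_inv (f := cellFn hm wn wt H) (H := r') (Wd := Wd) (s := (U, E))
    (fun r c s => ∀ t ≤ H + Wd, s.1 t ≤ B + 2 * r + 2 ∧
      (c = 0 → s.1 t ≤ B + 2 * r) ∧ (H + c ≤ t + r → s.1 t ≤ B + 2 * r)) ?_ ?_ ?_
  · intro t ht
    exact (this t ht).2.1 rfl
  · intro r c s hr hc ih t ht
    have h0 := ih (H + c - r) (by omega)
    have h1 := ih (H + c - r - 1) (by omega)
    have h2 := ih (H + c - r + 1) (by omega)
    have h3 := ih t ht
    have h4 := h0.2.2 (by omega)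
    have hw := hwt r c
    simp only [cellFn, Function.update_apply, pick_fst]
    refine ⟨?_, by omega, fun h => ?_⟩
    · split_ifs <;> omega
    · rw [if_neg (by omega)]; exact h3.2.2 (by omega)
  · intro r s hr ih t ht
    have := ih t ht
    exact ⟨by omega, fun _ => by omega, fun _ => by omega⟩
  · intro t ht
    have := hU t ht
    simp; omega

theorem tileV_le {U : ℕ → ℕ} {B : ℕ} (hwt : ∀ r c, wt r c ≤ 2) (hU : ∀ t ≤ H + Wd, U t ≤ B) :
    ∀ t ≤ H + Wd, tileV hm wn wt H Wd U t ≤ B + 2 * H :=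
  grid_bound hwt hU H le_rfl

/-- Bounds on the intermediate values of a tile. -/
theorem cell_bound {U E : ℕ → ℕ} {B r c : ℕ} (hwt : ∀ r c, wt r c ≤ 2)
    (hU : ∀ t ≤ H + Wd, U t ≤ B) (hr : r < H) (hc : c ≤ Wd) :
    ∀ t ≤ H + Wd, (gridRow (cellFn hm wn wt H r) c (grid (cellFn hm wn wt H) Wd r (U, E))).1 t
      ≤ B + 2 * H := by
  have h0 := grid_bound (hm := hm) (wn := wn) (E := E) hwt hU r hr.le
  set s₀ := grid (cellFn hm wn wt H) Wd r (U, E)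
  have : ∀ c ≤ Wd, ∀ t ≤ H + Wd, (gridRow (cellFn hm wn wt H r) c s₀).1 t ≤ B + 2 * r + 2 ∧
      (H + c ≤ t + r → (gridRow (cellFn hm wn wt H r) c s₀).1 t ≤ B + 2 * r) := by
    intro c
    induction c with
    | zero => intro _ t ht; have := h0 t ht; simp only [gridRow]; omega
    | succ c ih =>
      intro hc t ht
      have ih := ih (by omega)
      simp only [gridRow]
      set s := gridRow (cellFn hm wn wt H r) c s₀
      have h0 := ih (H + c - r) (by omega)
      have h1 := ih (H + c - r - 1) (by omega)
      have h2 := ih (H + c - r + 1) (by omega)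
      have h3 := ih t ht
      have h4 := h0.2 (by omega)
      have hw := hwt r c
      simp only [cellFn, Function.update_apply, pick_fst]
      refine ⟨?_, fun h => ?_⟩
      · split_ifs <;> omega
      · rw [if_neg (by omega)]; exact h3.2 (by omega)
  intro t ht
  have := (this c hc t ht).1
  omega

theorem pick_cases (r c : ℕ) (s : (ℕ → ℕ) × (ℕ → ℕ)) : ∃ j d,
    (j = H + c - r - 1 ∨ j = H + c - r ∨ j = H + c - r + 1) ∧
    (cellFn hm wn wt H r c s).1 = Function.update s.1 (H + c - r) (s.1 j + d) ∧
    (cellFn hm wn wt H r c s).2 = Function.update s.2 (H + c - r) (s.2 j) ∧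
    ∀ s' : (ℕ → ℕ) × (ℕ → ℕ), (cellFn hm wn wt H r c s').1 (H + c - r) ≤ s'.1 j + d := by
  simp only [cellFn, Function.update_self, pick_fst]
  unfold pick
  by_cases h1 : r < hm
  · by_cases h2 : c < wn
    · simp only [h1, h2, if_true]
      split_ifs
      · exact ⟨_, 1, Or.inr (Or.inr rfl), congrArg _ (by omega), rfl, fun s' => by omega⟩
      · exact ⟨_, 1, Or.inl rfl, congrArg _ (by omega), rfl, fun s' => by omega⟩
      · exact ⟨_, 1, Or.inr (Or.inr rfl), congrArg _ (by omega), rfl, fun s' => by omega⟩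
      · exact ⟨_, wt r c, Or.inr (Or.inl rfl), congrArg _ (by omega), rfl, fun s' => by omega⟩
    · simp only [h1, h2, if_true, if_false]
      exact ⟨_, 0, Or.inl rfl, congrArg _ (by omega), rfl, fun s' => by omega⟩
  · simp only [h1, if_false]
    exact ⟨_, 0, Or.inr (Or.inr rfl), congrArg _ (by omega), rfl, fun s' => by omega⟩

/-- The processed cell takes its entry point from one of three consecutive frontier positions with
itself in the middle, so a sorted sequence remains sorted. In other words, the chosen paths do not
cross. -/
theorem tileE_mono (U : ℕ → ℕ) : Monotone (tileE hm wn wt H Wd U) := by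
  refine grid_inv (f := cellFn hm wn wt H) (H := H) (Wd := Wd) (fun _ _ s => Monotone s.2) ?_
    (fun _ _ _ h => h) monotone_id
  intro r c s hr hc h
  obtain ⟨j, d, hj, -, h2, -⟩ := pick_cases (hm := hm) (wn := wn) (wt := wt) (H := H) r c s
  rw [h2]
  refine monotone_nat_of_le_succ fun t => ?_
  simp only [Function.update_apply]
  split_ifs <;> apply h <;> omega

/-- Processed cells have positions from `1` to `H + Wd - 1`, so the ends of the frontier are never
touched. -/
theorem tileE_of_ge (U : ℕ → ℕ) {t : ℕ} (ht : t = 0 ∨ H + Wd ≤ t) :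
    tileE hm wn wt H Wd U t = t := by
  refine grid_inv (f := cellFn hm wn wt H) (H := H) (Wd := Wd) (fun _ _ s => s.2 t = t) ?_
    (fun _ _ _ h => h) rfl
  intro r c s hr hc h
  simp only [cellFn, Function.update_apply]
  rw [if_neg (by omega), h]

/-- The values at the entry points determine the values after the tile. -/
theorem tileV_le_of_entry {U G : ℕ → ℕ} {t : ℕ}
    (h : G (tileE hm wn wt H Wd U t) ≤ U (tileE hm wn wt H Wd U t)) :
    tileV hm wn wt H Wd G t ≤ tileV hm wn wt H Wd U t := by
  suffices key : ∀ t, G (tileE hm wn wt H Wd U t) ≤ U (tileE hm wn wt H Wd U t) →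
      tileV hm wn wt H Wd G t ≤ tileV hm wn wt H Wd U t from key t h
  clear h t
  -- Both inputs are processed in parallel. The entry point of a new cell is that of its neighbour
  -- `j`, so the invariant at `j` and the edge of weight `d` give the bound for the new cell.
  refine grid_rel (f := cellFn hm wn wt H) (g := cellFn hm wn wt H) (H := H) (Wd := Wd)
    (s := (U, id)) (t := (G, id)) (fun _ _ s s' => ∀ t, G (s.2 t) ≤ U (s.2 t) → s'.1 t ≤ s.1 t) ?_
    (fun _ _ _ _ h => h) (fun _ h => h)
  intro r c s s' hr hc ih t
  obtain ⟨j, d, hj, h1, h2, h3⟩ := pick_cases (hm := hm) (wn := wn) (wt := wt) (H := H) r c s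
  rw [h1, h2]
  by_cases ht : t = H + c - r
  · subst ht
    rw [Function.update_self, Function.update_self]
    intro h
    have := h3 s'
    have := ih j h
    omega
  · rw [Function.update_of_ne ht, Function.update_of_ne ht]
    intro h
    have : (cellFn hm wn wt H r c s').1 t = s'.1 t := by
      simp only [cellFn, Function.update_of_ne ht]
    rw [this]
    exact ih t h

end Tile

/-! ### Blocks, sketches and thresholds. -/

/-- The input of a tile entered from the left. -/
def shiftR (S inf : ℕ) (U : ℕ → ℕ) (t : ℕ) : ℕ := if t ≤ S then U (S + t) else inf

/-- The input of a tile entered from above. -/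
def shiftD (S inf : ℕ) (U : ℕ → ℕ) (t : ℕ) : ℕ := if t < S then inf else U (t - S)

/-- The diagonal of the bottom left corner of the tile in row `a` and column `c`. -/
def loDiag (Z S a c : ℕ) : ℕ := Z + c * S - (a + 1) * S

/-- A block of `k × k` tiles of side `S` whose top left corner has the diagonal `Z`: `N` are the
distances in the block, and `V` contains those on its left and top boundary. -/
structure Block (S k inf Z : ℕ) (V hm wn : ℕ → ℕ) (wt : ℕ → ℕ → ℕ → ℕ → ℕ)
    (N : ℕ → ℕ → ℕ) : Prop where
  hZ : k * S + S ≤ Z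
  le_inf : ∀ i j, N i j ≤ inf
  top : ∀ j ≤ k * S, V (Z + j) = N 0 j
  left : ∀ i ≤ k * S, V (Z - i) = N i 0
  dist : ∀ a c, a < k → c < k →
    IsDist (hm a) (wn c) (wt a c) S S (fun i j => N (a * S + i) (c * S + j))

/-- The values on the lower right boundary of the tile `(a, c)`, if only those paths are taken into
account that enter the tiles on the way to it from the left or from above, as `left` says. -/
def sketchVal (S inf Z : ℕ) (V hm wn : ℕ → ℕ) (wt : ℕ → ℕ → ℕ → ℕ → ℕ) (left : ℕ → ℕ → Prop)
    [∀ a c, Decidable (left a c)] : ℕ → ℕ → ℕ → ℕ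
  | 0, c => fun t => V (loDiag Z S 0 c + t)
  | a + 1, 0 => fun t => V (loDiag Z S (a + 1) 0 + t)
  | a + 1, c + 1 => tileV (hm a) (wn c) (wt a c) S S
      (if left a c then shiftR S inf (sketchVal S inf Z V hm wn wt left (a + 1) c)
        else shiftD S inf (sketchVal S inf Z V hm wn wt left a (c + 1)))
termination_by a c => a + c

/-- The sketch values for the tile directions given by thresholds. -/
abbrev thVal (S k inf Z : ℕ) (V hm wn : ℕ → ℕ) (wt : ℕ → ℕ → ℕ → ℕ → ℕ) (TH : ℕ → ℕ) (dl : ℕ) :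
    ℕ → ℕ → ℕ → ℕ :=
  sketchVal S inf Z V hm wn wt (fun a c => dl < TH (a * k + c))

section Block

variable {S k inf Z : ℕ} {V hm wn : ℕ → ℕ} {wt : ℕ → ℕ → ℕ → ℕ → ℕ} {N : ℕ → ℕ → ℕ}

/-- In `sketchVal` tiles are counted from one and the index `0` stands for the boundary of the
block, so `left a c` belongs to the indices `(a + 1, c + 1)`. A value depends only on directions
above and to the left. -/
theorem sketchVal_congr {l l' : ℕ → ℕ → Prop} [∀ a c, Decidable (l a c)]
    [∀ a c, Decidable (l' a c)] {a c : ℕ} (h : ∀ a' < a, ∀ c' < c, (l a' c' ↔ l' a' c')) :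
    sketchVal S inf Z V hm wn wt l a c = sketchVal S inf Z V hm wn wt l' a c := by
  induction a generalizing c with
  | zero => simp [sketchVal]
  | succ a iha =>
    induction c with
    | zero => simp [sketchVal]
    | succ c ihc =>
      rw [sketchVal, sketchVal, iha (fun a' h1 c' h2 => h a' (by omega) c' h2),
        ihc (fun a' h1 c' h2 => h a' h1 c' (by omega))]
      simp only [h a (by omega) c (by omega)]

/-- Each tile on the way adds at most `2 * S`, and the way has at most `a + c` tiles. This bounds
the words that occur when a sketch is evaluated. -/
theorem sketchVal_le (hwt : ∀ a c r c', wt a c r c' ≤ 2) {l : ℕ → ℕ → Prop}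
    [∀ a c, Decidable (l a c)] (hZ : k * S + S ≤ Z)
    (hV : ∀ j, Z ≤ j + k * S + S → j ≤ Z + k * S + S → V j ≤ inf)
    {a c : ℕ} (ha : a ≤ k) (hc : c ≤ k) :
    ∀ t ≤ S + S, sketchVal S inf Z V hm wn wt l a c t ≤ inf + 2 * S * (a + c) := by
  have hac := Nat.mul_le_mul_right S hc
  have haa := Nat.mul_le_mul_right S ha
  induction a generalizing c with
  | zero =>
    intro t ht
    rw [sketchVal]
    refine (hV _ ?_ ?_).trans (Nat.le_add_right _ _) <;> simp only [loDiag, Nat.add_mul] <;> omega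
  | succ a iha =>
    induction c with
    | zero =>
      intro t ht
      rw [sketchVal]
      simp only [Nat.add_mul] at haa
      refine (hV _ ?_ ?_).trans (Nat.le_add_right _ _) <;> simp only [loDiag, Nat.add_mul] <;> omega
    | succ c ihc =>
      intro t ht
      simp only [Nat.add_mul] at haa hac
      have h1 := iha (c := c + 1) (by omega) hc (by rw [Nat.add_mul]; omega) (by omega)
      have h2 := ihc (by omega) (by omega)
      have e1 : 2 * S * (a + 1 + (c + 1)) = 2 * S * (a + 1 + c) + 2 * S := by ring
      have e2 : 2 * S * (a + (c + 1)) = 2 * S * (a + 1 + c) := by ring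
      rw [sketchVal, e1]
      rw [e2] at h1
      have := tileV_le (hm := hm a) (wn := wn c) (H := S) (Wd := S)
        (B := inf + 2 * S * (a + 1 + c)) (hwt a c)
        (U := if l a c then shiftR S inf (sketchVal S inf Z V hm wn wt l (a + 1) c)
          else shiftD S inf (sketchVal S inf Z V hm wn wt l a (c + 1))) ?_ t ht
      · omega
      · intro t ht
        split_ifs
        · unfold shiftR; split_ifs
          · exact h2 _ (by omega)
          · omega
        · unfold shiftD; split_ifs
          · omega
          · exact h1 _ (by omega)

namespace Block

variable (h : Block S k inf Z V hm wn wt N)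
include h

theorem tile_ge {a c : ℕ} (ha : a < k) (hc : c < k) {U : ℕ → ℕ}
    (hl : ∀ i ≤ S, N (a * S + i) (c * S) ≤ U (S - i))
    (ht : ∀ j ≤ S, N (a * S) (c * S + j) ≤ U (S + j)) :
    (∀ j ≤ S, N ((a + 1) * S) (c * S + j) ≤ tileV (hm a) (wn c) (wt a c) S S U j) ∧
    (∀ i ≤ S, N (a * S + i) ((c + 1) * S) ≤ tileV (hm a) (wn c) (wt a c) S S U (S + S - i)) := by
  have := tileV_ge (h.dist a c ha hc) (U := U) (by simpa using hl) (by simpa using ht)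
  simpa [Nat.add_mul] using this

theorem tile_eq {a c : ℕ} (ha : a < k) (hc : c < k) {U : ℕ → ℕ}
    (hl : ∀ i ≤ S, U (S - i) = N (a * S + i) (c * S))
    (ht : ∀ j ≤ S, U (S + j) = N (a * S) (c * S + j)) :
    (∀ j ≤ S, tileV (hm a) (wn c) (wt a c) S S U j = N ((a + 1) * S) (c * S + j)) ∧
    (∀ i ≤ S, tileV (hm a) (wn c) (wt a c) S S U (S + S - i) = N (a * S + i) ((c + 1) * S)) := by
  have := tileV_eq (h.dist a c ha hc) (U := U) (by simpa using hl) (by simpa using ht)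
  simpa [Nat.add_mul] using this

/-- A sketch restricts the paths that are taken into account. The value `inf` on the closed edge is
at least every distance, so restricting can only increase values, whatever the directions are. -/
theorem sketchVal_ge {l : ℕ → ℕ → Prop} [∀ a c, Decidable (l a c)] {a c : ℕ}
    (ha : a ≤ k) (hc : c ≤ k) :
    (∀ a', a = a' + 1 → ∀ i ≤ S, N (a' * S + i) (c * S)
      ≤ sketchVal S inf Z V hm wn wt l a c (S + S - i)) ∧
    (∀ c', c = c' + 1 → ∀ j ≤ S, N (a * S) (c' * S + j)
      ≤ sketchVal S inf Z V hm wn wt l a c j) := by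
  have hZ := h.hZ
  have hac := Nat.mul_le_mul_right S hc
  have haa := Nat.mul_le_mul_right S ha
  induction a generalizing c with
  | zero =>
    refine ⟨by omega, ?_⟩
    rintro c' rfl j hj
    simp only [Nat.add_mul] at hac
    rw [sketchVal]
    have := h.top (c' * S + j) (by omega)
    simp only [loDiag]
    rw [show Z + (c' + 1) * S - (0 + 1) * S + j = Z + (c' * S + j) by
      simp only [Nat.add_mul]; omega, this]
    simp
  | succ a iha =>
    induction c with
    | zero =>
      refine ⟨?_, by omega⟩
      rintro a' e i hi
      obtain rfl : a = a' := by omega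
      simp only [Nat.add_mul] at haa
      rw [sketchVal]
      have := h.left (a * S + i) (by omega)
      simp only [loDiag]
      rw [show Z + 0 * S - (a + 1 + 1) * S + (S + S - i) = Z - (a * S + i) by
        simp only [Nat.add_mul]; omega, this]
      simp
    | succ c ihc =>
      simp only [Nat.add_mul] at haa hac
      have h1 := (iha (c := c + 1) (by omega) hc (by rw [Nat.add_mul]; omega) (by omega)).2 c rfl
      have h2 := (ihc (by omega) (by omega)).1 a rfl
      rw [sketchVal]
      have key := h.tile_ge (a := a) (c := c) (by omega) (by omega)
        (U := if l a c then shiftR S inf (sketchVal S inf Z V hm wn wt l (a + 1) c)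
          else shiftD S inf (sketchVal S inf Z V hm wn wt l a (c + 1))) ?_ ?_
      · refine ⟨fun a' e => ?_, fun c' e => ?_⟩
        · obtain rfl : a = a' := by omega
          exact key.2
        · obtain rfl : c = c' := by omega
          exact key.1
      · intro i hi
        split_ifs
        · have := h2 i hi
          simp only [shiftR]
          rw [if_pos (by omega), show S + (S - i) = S + S - i by omega]
          exact this
        · simp only [shiftD]
          split_ifs with h3
          · exact h.le_inf _ _
          · obtain rfl : i = 0 := by omega
            simpa using h1 0 (by omega)
      · intro j hj
        split_ifs
        · simp only [shiftR]
          split_ifs with h3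
          · obtain rfl : j = 0 := by omega
            simpa using h2 0 (by omega)
          · exact h.le_inf _ _
        · have := h1 j hj
          simp only [shiftD]
          rw [if_neg (by omega), show S + j - S = j by omega]
          exact this

end Block

/-- The thresholds `TH` of the tiles processed before the tile `(i, b)` describe optimal paths to
all nodes of the frontier. -/
structure Sketches (S k inf Z : ℕ) (V hm wn : ℕ → ℕ) (wt : ℕ → ℕ → ℕ → ℕ → ℕ) (N : ℕ → ℕ → ℕ)
    (TH : ℕ → ℕ) (i b : ℕ) : Prop where
  above : ∀ b', b ≤ b' → b' < k → ∀ t ≤ S,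
    thVal S k inf Z V hm wn wt TH (loDiag Z S i (b' + 1) + t) i (b' + 1) t = N (i * S) (b' * S + t)
  side : i < k → ∀ t ≤ S,
    thVal S k inf Z V hm wn wt TH (loDiag Z S (i + 1) b + (S + t)) (i + 1) b (S + t)
      = N (i * S + (S - t)) (b * S)
  done : ∀ b' < b, ∀ t ≤ S,
    thVal S k inf Z V hm wn wt TH (loDiag Z S (i + 1) (b' + 1) + t) (i + 1) (b' + 1) t
      = N ((i + 1) * S) (b' * S + t)

theorem Block.sketches_zero (h : Block S k inf Z V hm wn wt N) (TH : ℕ → ℕ) :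
    Sketches S k inf Z V hm wn wt N TH 0 0 := by
  have hZ := h.hZ
  refine ⟨fun b' _ hb t ht => ?_, fun hk t ht => ?_, fun b' hb => by omega⟩
  · have := Nat.mul_le_mul_right S hb
    simp only [Nat.succ_eq_add_one, Nat.add_mul] at this
    rw [thVal, sketchVal]
    simp only [loDiag]
    rw [show Z + (b' + 1) * S - (0 + 1) * S + t = Z + (b' * S + t) by
      simp only [Nat.add_mul]; omega, h.top _ (by omega)]
    simp
  · have := Nat.mul_le_mul_right S hk
    simp only [Nat.succ_eq_add_one, Nat.add_mul] at this
    rw [thVal, sketchVal]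
    simp only [loDiag]
    rw [show Z + 0 * S - (0 + 1 + 1) * S + (S + t) = Z - (S - t) by
      simp only [Nat.add_mul]; omega, h.left _ (by omega)]
    simp

/-- The bottom edges of the finished row are the top edges of the next one, and the left edge of its
first tile lies on the boundary of the block. -/
theorem Sketches.next_row (h : Block S k inf Z V hm wn wt N) {TH : ℕ → ℕ} {i : ℕ}
    (hs : Sketches S k inf Z V hm wn wt N TH i k) :
    Sketches S k inf Z V hm wn wt N TH (i + 1) 0 := by
  have hZ := h.hZ
  refine ⟨fun b' _ hb t ht => hs.done b' hb t ht, fun hk t ht => ?_, fun b' hb => by omega⟩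
  have := Nat.mul_le_mul_right S hk
  simp only [Nat.succ_eq_add_one, Nat.add_mul] at this
  rw [thVal, sketchVal]
  simp only [loDiag]
  rw [show Z + 0 * S - (i + 1 + 1 + 1) * S + (S + t)
      = Z - ((i + 1) * S + (S - t)) by
    simp only [Nat.add_mul]; omega, h.left _ (by simp only [Nat.add_mul]; omega)]
  simp

/-- `TH'` are the thresholds `TH` moved across a tile with the diagonals `lo, …, lo + 2 S` and the
entry points `E`. -/
def Remap (S lo n : ℕ) (E TH TH' : ℕ → ℕ) : Prop :=
  ∀ q < n, ∀ dl, dl < TH' q ↔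
    (if lo ≤ dl ∧ dl ≤ lo + (S + S) then lo + E (dl - lo) else dl) < TH q

/-- The optimal path to a node behind the tile passes through its entry point, a node of the old
frontier. So the new node must use, in all earlier tiles, the directions of that old node; `Remap`
says that its comparisons with the new thresholds have exactly this outcome. The processed tile gets
the diagonal of its top left corner as threshold before the remapping, which separates entries on
the left edge from those on the top edge. -/
theorem Sketches.next (h : Block S k inf Z V hm wn wt N) {TH TH' : ℕ → ℕ} {i b : ℕ}
    (hi : i < k) (hb : b < k) (hs : Sketches S k inf Z V hm wn wt N TH i b) {U : ℕ → ℕ}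
    (hl : ∀ t ≤ S, U t = N (i * S + (S - t)) (b * S))
    (ht : ∀ t ≤ S, U (S + t) = N (i * S) (b * S + t))
    (hr : Remap S (loDiag Z S (i + 1) (b + 1)) (i * k + b + 1)
      (tileE (hm i) (wn b) (wt i b) S S U)
      (Function.update TH (i * k + b) (loDiag Z S i (b + 1))) TH') :
    Sketches S k inf Z V hm wn wt N TH' i (b + 1) := by
  have hZ := h.hZ
  have hik := Nat.mul_le_mul_right S hi
  have hbk := Nat.mul_le_mul_right S hb
  simp only [Nat.succ_eq_add_one, Nat.add_mul, Nat.one_mul] at hik hbk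
  set E := tileE (hm i) (wn b) (wt i b) S S U with hE
  have E0 : E 0 = 0 := tileE_of_ge U (Or.inl rfl)
  have E2 : E (S + S) = S + S := tileE_of_ge U (Or.inr le_rfl)
  have hEm : Monotone E := tileE_mono U
  set lo := loDiag Z S (i + 1) (b + 1) with hlo
  have hlo' : lo + i * S + S = Z + b * S := by
    rw [hlo, loDiag]; simp only [Nat.add_mul]; omega
  have hκ : loDiag Z S i (b + 1) = lo + S := by
    rw [loDiag]; simp only [Nat.add_mul]; omega
  -- The entry function fixes both ends of the tile's window, so on and beyond the ends all
  -- comparisons are the same as before.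
  have hout : ∀ dl, dl ≤ lo ∨ lo + (S + S) ≤ dl →
      (if lo ≤ dl ∧ dl ≤ lo + (S + S) then lo + E (dl - lo) else dl) = dl := by
    intro dl hd
    split_ifs with h1
    · rcases hd with hd | hd
      · obtain rfl : dl = lo := by omega
        simp [E0]
      · obtain rfl : dl = lo + (S + S) := by omega
        simp [E2]
    · rfl
  have idx : ∀ a' c', a' < i → c' < k → a' * k + c' < i * k := by
    intro a' c' h1 h2
    have := Nat.mul_le_mul_right k h1
    simp only [Nat.succ_eq_add_one, Nat.add_mul] at this
    omega
  have hnew : ∀ dl, dl < TH' (i * k + b) ↔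
      (if lo ≤ dl ∧ dl ≤ lo + (S + S) then lo + E (dl - lo) else dl) < lo + S := by
    intro dl
    rw [hr _ (by omega) dl, Function.update_self, hκ]
  have hold : ∀ q < i * k + b, ∀ dl, dl < TH' q ↔
      (if lo ≤ dl ∧ dl ≤ lo + (S + S) then lo + E (dl - lo) else dl) < TH q := by
    intro q hq dl
    rw [hr _ (by omega) dl, Function.update_of_ne (by omega)]
  -- By `tileV_le_of_entry` it suffices that the input of the sketch is correct at the single point
  -- `E t`. The reverse inequality holds for all directions by `sketchVal_ge`.
  have exact_ : ∀ t ≤ S + S, thVal S k inf Z V hm wn wt TH' (lo + t) (i + 1) (b + 1) t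
      ≤ tileV (hm i) (wn b) (wt i b) S S U t := by
    intro t htt
    have hEt : E t ≤ S + S := E2 ▸ hEm htt
    have hif : (if lo ≤ lo + t ∧ lo + t ≤ lo + (S + S) then lo + E (lo + t - lo) else lo + t)
        = lo + E t := by rw [if_pos (by omega), Nat.add_sub_cancel_left]
    rw [thVal, sketchVal]
    apply tileV_le_of_entry
    simp only [hnew, hif, ← hE]
    -- `lo + S` is the diagonal of the corner, so `E t < S` means entry through the left edge; the
    -- corner itself counts as an entry from above.
    by_cases hc : E t < S
    · rw [if_pos (by omega), shiftR, if_pos (by omega)]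
      have h1 := hs.side hi (E t) (by omega)
      rw [hl _ (by omega), ← h1]
      have h2 : loDiag Z S (i + 1) b + (S + E t) = lo + E t := by
        rw [loDiag]; simp only [Nat.add_mul]; omega
      rw [h2]
      refine le_of_eq (congrFun (sketchVal_congr fun a' ha' c' hc' => ?_) _)
      rw [hold, hif]
      rcases Nat.lt_succ_iff_lt_or_eq.1 ha' with h3 | rfl
      · have := idx a' c' h3 (by omega); omega
      · omega
    · rw [if_neg (by omega), shiftD, if_neg (by omega)]
      have h1 := hs.above b le_rfl hb (E t - S) (by omega)
      have h3 := ht (E t - S) (by omega)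
      rw [show S + (E t - S) = E t by omega] at h3
      rw [h3, ← h1]
      have h2 : loDiag Z S i (b + 1) + (E t - S) = lo + E t := by omega
      rw [h2]
      refine le_of_eq (congrFun (sketchVal_congr fun a' ha' c' hc' => ?_) _)
      rw [hold, hif]
      have := idx a' c' ha' (by omega); omega
  have heq := h.tile_eq hi hb (U := U)
    (fun j hj => by rw [hl _ (by omega)]; congr 1; omega) ht
  refine ⟨fun b' h1 h2 t htS => ?_, fun _ t htS => ?_, fun b' hb' t htS => ?_⟩
  · rw [← hs.above b' (by omega) h2 t htS]
    refine congrFun (sketchVal_congr fun a' ha' c' hc' => ?_) _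
    have := idx a' c' ha' (by omega)
    rw [hold _ (by omega), hout]
    right
    have := Nat.mul_le_mul_right S h1
    rw [loDiag]
    simp only [Nat.add_mul] at this ⊢
    omega
  · have h2 : loDiag Z S (i + 1) (b + 1) + (S + t) = lo + (S + t) := rfl
    refine le_antisymm ?_ ?_
    · refine (exact_ _ (by omega)).trans (le_of_eq ?_)
      have := heq.2 (S - t) (by omega)
      rwa [show S + S - (S - t) = S + t by omega] at this
    · have := (h.sketchVal_ge (l := fun a c => lo + (S + t) < TH' (a * k + c))
        (a := i + 1) (c := b + 1) (by omega) (by omega)).1 i rfl (S - t) (by omega)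
      rwa [show S + S - (S - t) = S + t by omega] at this
  · rcases Nat.lt_succ_iff_lt_or_eq.1 hb' with hb' | rfl
    · rw [← hs.done b' hb' t htS]
      refine congrFun (sketchVal_congr fun a' ha' c' hc' => ?_) _
      have h4 : a' * k + c' < i * k + b := by
        rcases Nat.lt_succ_iff_lt_or_eq.1 ha' with h3 | rfl
        · have := idx a' c' h3 (by omega); omega
        · omega
      rw [hold _ h4, hout]
      left
      have := Nat.mul_le_mul_right S hb'
      rw [loDiag]
      simp only [Nat.succ_eq_add_one, Nat.add_mul] at this ⊢
      omega
    · refine le_antisymm ((exact_ _ (by omega)).trans (le_of_eq (heq.1 t htS))) ?_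
      exact (h.sketchVal_ge (by omega) (by omega)).2 b' rfl t htS

/-- The minimum over the sketches that begin at the first node of an edge or at a threshold on this
edge is attained. -/
theorem exists_sketch {TH : ℕ → ℕ} {i b t : ℕ} (hb : b < k) (ht : t ≤ S)
    (κ : ℕ) : ∃ dl, (dl = κ ∨ ∃ q < i * k, dl = TH q ∧ κ < dl ∧ dl ≤ κ + S) ∧
      thVal S k inf Z V hm wn wt TH dl i (b + 1)
        = thVal S k inf Z V hm wn wt TH (κ + t) i (b + 1) := by
  classical
  -- The largest candidate not beyond `κ + t` works: no threshold lies after it and up to `κ + t`,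
  -- so both diagonals compare alike with all thresholds involved.
  set P : ℕ → Prop := fun dl => dl = κ ∨ ∃ q < i * k, dl = TH q ∧ κ < dl ∧ dl ≤ κ + S
  have h1 : P (Nat.findGreatest P (κ + t)) :=
    Nat.findGreatest_spec (m := κ) (by omega) (Or.inl rfl)
  have h2 : Nat.findGreatest P (κ + t) ≤ κ + t := Nat.findGreatest_le _
  refine ⟨_, h1, sketchVal_congr fun a' ha' c' hc' => ⟨fun h3 => ?_, fun h3 => by omega⟩⟩
  by_contra h4
  have h5 : a' * k + c' < i * k := by
    have := Nat.mul_le_mul_right k ha'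
    simp only [Nat.succ_eq_add_one, Nat.add_mul] at this
    omega
  have h6 : κ ≤ Nat.findGreatest P (κ + t) := by
    rcases h1 with h1 | ⟨q, _, _, h1, _⟩ <;> omega
  have h7 : P (TH (a' * k + c')) := Or.inr ⟨_, h5, rfl, by omega, by omega⟩
  have := Nat.le_findGreatest (P := P) (n := κ + t) (by omega) h7
  omega

end Block

/-! ### Programs for a cell and for a tile. -/

namespace AsymRAM

open AsymRAM.Expr

/-- A command changed only variables of level at most `L` and the arrays `ys`. -/
structure Keeps (L : ℕ) (ys : List Arr) (s s' : St) : Prop where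
  v : ∀ x : Var, L < x.lvl → s'.v x = s.v x
  ar : ∀ y, y ∉ ys → s'.ar y = s.ar y
  g : s'.g = s.g
  wr : s'.wr = s.wr

theorem Keeps.refl (L : ℕ) (ys : List Arr) (s : St) : Keeps L ys s s :=
  ⟨fun _ _ => rfl, fun _ _ => rfl, rfl, rfl⟩

theorem Keeps.trans {L L' L'' : ℕ} {ys ys' ys'' : List Arr} {s s' s'' : St}
    (h : Keeps L ys s s') (h' : Keeps L' ys' s' s'') (hL : L ≤ L'' := by decide)
    (hL' : L' ≤ L'' := by decide) (hy : ys ⊆ ys'' := by simp) (hy' : ys' ⊆ ys'' := by simp) :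
    Keeps L'' ys'' s s'' :=
  ⟨fun x hx => (h'.v x (by omega)).trans (h.v x (by omega)),
    fun y hy₁ => (h'.ar y fun h => hy₁ (hy' h)).trans (h.ar y fun h => hy₁ (hy h)),
    h'.g.trans h.g, h'.wr.trans h.wr⟩

theorem Keeps.mono {L L' : ℕ} {ys ys' : List Arr} {s s' : St}
    (h : Keeps L ys s s') (hL : L ≤ L' := by decide) (hy : ys ⊆ ys' := by simp) :
    Keeps L' ys' s s' :=
  ⟨fun x hx => h.v x (by omega), fun y hy₁ => h.ar y fun h => hy₁ (hy h), h.g, h.wr⟩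

/-- A command changed only the variables `xs`, with at most `j` memory accesses. -/
structure Sets (xs : List Var) (j : ℕ) (s s' : St) : Prop where
  v : ∀ x : Var, x ∉ xs → s'.v x = s.v x
  ar : s'.ar = s.ar
  g : s'.g = s.g
  wr : s'.wr = s.wr
  rd : s'.rd = s.rd
  n : s'.n ≤ s.n + j

theorem Sets.trans {xs : List Var} {j j' : ℕ} {s s' s'' : St} (h : Sets xs j s s')
    (h' : Sets xs j' s' s'') : Sets xs (j + j') s s'' :=
  ⟨fun x hx => (h'.v x hx).trans (h.v x hx), h'.ar.trans h.ar, h'.g.trans h.g, h'.wr.trans h.wr,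
    h'.rd.trans h.rd, by have := h.n; have := h'.n; omega⟩

theorem Sets.mono {xs xs' : List Var} {j j' : ℕ} {s s' : St} (h : Sets xs j s s')
    (hj : j ≤ j') (hx : xs ⊆ xs' := by simp) : Sets xs' j' s s' :=
  ⟨fun x hx₁ => h.v x fun h => hx₁ (hx h), h.ar, h.g, h.wr, h.rd, by have := h.n; omega⟩

/-- Improve the value of a cell by a step from the neighbour `e`. -/
def relaxC (e : Expr) : Cmd :=
  .set .u (A .U e + C 1) ;;
  .ite (V .u) (V .val) (.set .val (V .u) ;; .set .en (A .E e)) .skip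

/-- Choose the value and the entry point of a cell. -/
def pickC (sc : ℕ) : Cmd :=
  .ite (V .r) (V .hm)
    (.ite (V .cc) (V .wn)
      (.set .val (A .U (V .p)) ;; .set .en (A .E (V .p)) ;;
        .ite (A .X (V .r)) (A .Y (V .cc)) (.set .val (V .val + C sc))
          (.ite (A .Y (V .cc)) (A .X (V .r)) (.set .val (V .val + C sc)) .skip) ;;
        relaxC (V .p - C 1) ;; relaxC (V .p + C 1))
      (.set .val (A .U (V .p - C 1)) ;; .set .en (A .E (V .p - C 1))))
    (.set .val (A .U (V .p + C 1)) ;; .set .en (A .E (V .p + C 1)))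

/-- Process one cell. -/
def cellC (sc : ℕ) : Cmd :=
  .set .p (V .th + V .cc - V .r) ;; pickC sc ;; .put .U (V .p) (V .val) ;; .put .E (V .p) (V .en)

theorem relaxC_spec {ℓ : Lay} {s : St} {e : Expr} {j : ℕ} (he : e.ok ℓ s) (hj : e.val s = j)
    (hev : ∀ s' : St, s'.v .p = s.v .p → s'.ar = s.ar → e.val s' = e.val s)
    (heo : ∀ s' : St, s'.v .p = s.v .p → s'.ar = s.ar → e.ok ℓ s → e.ok ℓ s')
    (hc : e.cost ≤ 18) (hU : j < ℓ.sz .U) (hE : j < ℓ.sz .E) (hW : s.ar .U j + 1 < ℓ.W) :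
    (relaxC e).wp ℓ (fun s' => Sets [.val, .en, .u] 130 s s' ∧ (s'.v .val, s'.v .en)
      = if s.ar .U j + 1 < s.v .val then (s.ar .U j + 1, s.ar .E j) else (s.v .val, s.v .en)) s := by
  refine ⟨⟨⟨he, by rwa [hj]⟩, trivial, ?_⟩, trivial, trivial, fun h => ⟨trivial, ⟨?_, ?_⟩, ?_⟩,
    fun h => ?_⟩
  · show s.ar .U (e.val s) + 1 < _; rwa [hj]
  · exact heo _ (by simp) (by simp) he
  · rw [hev _ (by simp) (by simp), hj]; exact hE
  · rw [val_A, hev _ (by simp) (by simp), hj]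
    simp only [val_add, val_A, hj, val_V, val_C, St.setv_v, St.setv_ar, St.tick_ar, St.tick_v,
      reduceCtorEq, if_true, if_false] at h ⊢
    rw [if_pos h]
    exact ⟨⟨fun x hx => by simp at hx; simp [hx], rfl, rfl, rfl, rfl, by simp; omega⟩, rfl⟩
  · simp only [val_add, val_A, hj, val_V, val_C, St.setv_v, 
      reduceCtorEq, if_true, if_false] at h
    refine ⟨⟨fun x hx => by simp at hx; simp [hx], rfl, rfl, rfl, rfl, by simp; omega⟩, ?_⟩
    simp [h, hj]

theorem pickC_spec {ℓ : Lay} {sc : ℕ} {s : St} {B r c p : ℕ}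
    (hr : s.v .r = r) (hc : s.v .cc = c) (hp : s.v .p = p) (hp0 : 1 ≤ p)
    (hU : p + 1 < ℓ.sz .U) (hE : p + 1 < ℓ.sz .E) (hX : r < ℓ.sz .X) (hY : c < ℓ.sz .Y)
    (h1 : s.ar .U (p - 1) ≤ B) (h2 : s.ar .U p ≤ B) (h3 : s.ar .U (p + 1) ≤ B)
    (hBW : B + sc + 1 < ℓ.W) (hW : p + 1 < ℓ.W) :
    (pickC sc).wp ℓ (fun s' => Sets [.val, .en, .u] 600 s s' ∧
      (s'.v .val, s'.v .en) = pick (s.v .hm) (s.v .wn)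
        (if s.ar .X r = s.ar .Y c then 0 else sc) r c (s.ar .U (p - 1), s.ar .E (p - 1))
        (s.ar .U p, s.ar .E p) (s.ar .U (p + 1), s.ar .E (p + 1))) s := by
  subst hr hc hp
  refine ⟨trivial, trivial, fun hr => ⟨trivial, trivial, fun hc => ?_, fun hc => ?_⟩, fun hr => ?_⟩
  · simp only [val_V, St.tick_v] at hr hc
    set s₁ := (((s.tick 18).tick 18).setv .val (s.ar .U (s.v .p)) 24).setv .en
      (s.ar .E (s.v .p)) 24 with hs₁
    set w := if s.ar .X (s.v .r) = s.ar .Y (s.v .cc) then 0 else sc with hw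
    -- The common end of the three outcomes of comparing two letters; equality is tested by two
    -- strict comparisons.
    have hcut : ∀ s₂, Sets [.val, .en, .u] 200 s s₂ → s₂.v .val = s.ar .U (s.v .p) + w →
        s₂.v .en = s.ar .E (s.v .p) →
        (relaxC (V .p - C 1) ;; relaxC (V .p + C 1)).wp ℓ (fun s' => Sets [.val, .en, .u] 600 s s' ∧
          (s'.v .val, s'.v .en) = pick (s.v .hm) (s.v .wn) w (s.v .r) (s.v .cc)
            (s.ar .U (s.v .p - 1), s.ar .E (s.v .p - 1)) (s.ar .U (s.v .p), s.ar .E (s.v .p))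
            (s.ar .U (s.v .p + 1), s.ar .E (s.v .p + 1))) s₂ := by
      intro s₂ h₂ hv₂ he₂
      have hp₂ : s₂.v .p = s.v .p := h₂.v _ (by decide)
      refine Cmd.wp_mono (c := relaxC _) ?_ (relaxC_spec (j := s.v .p - 1) ?_ ?_ ?_ ?_ ?_ ?_ ?_ ?_)
      · rintro s₃ ⟨h₃, e₃⟩
        have hp₃ : s₃.v .p = s.v .p := (h₃.v _ (by decide)).trans hp₂
        refine Cmd.wp_mono (c := relaxC _) ?_
          (relaxC_spec (j := s.v .p + 1) ?_ ?_ ?_ ?_ ?_ ?_ ?_ ?_)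
        · rintro s₄ ⟨h₄, e₄⟩
          refine ⟨((h₂.trans h₃).trans h₄).mono (by omega), ?_⟩
          rw [h₂.ar, hv₂, he₂] at e₃
          have e₅ := congrArg Prod.fst e₃
          simp only at e₅
          rw [e₄, h₃.ar, h₂.ar, e₃, e₅]
          unfold pick
          rw [if_pos hr, if_pos hc]
        · simp [hp₃]; omega
        · simp [hp₃]
        · intro s' h _; simp [h]
        · intro s' h _; simp [h]
        · simp
        · exact hU
        · exact hE
        · rw [h₃.ar, h₂.ar]; omega
      · simp [hp₂]; omega
      · simp [hp₂]
      · intro s' h _; simp [h]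
      · intro s' h _; simp [h]
      · simp
      · omega
      · omega
      · rw [h₂.ar]; omega
    have hval : ∀ x : Var, x ≠ .val → x ≠ .en → s₁.v x = s.v x := by
      intro x h1 h2; simp [hs₁, h1, h2]
    refine ⟨⟨trivial, by simp; omega⟩, ⟨trivial, by simp; omega⟩, ⟨trivial, ?_⟩, ⟨trivial, ?_⟩,
      fun h => ⟨⟨trivial, trivial, ?_⟩, hcut _ ?_ ?_ ?_⟩, fun h => ⟨⟨trivial, ?_⟩, ⟨trivial, ?_⟩,
        fun h' => ⟨⟨trivial, trivial, ?_⟩, hcut _ ?_ ?_ ?_⟩, fun h' => hcut _ ?_ ?_ ?_⟩⟩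
    · exact hX
    · exact hY
    · show s.ar .U (s.v .p) + sc < _
      omega
    · exact ⟨fun x hx => by simp at hx; simp [hx], rfl, rfl, rfl, rfl, by simp⟩
    · have h : s.ar .X (s.v .r) < s.ar .Y (s.v .cc) := h
      have : w = sc := by rw [hw, if_neg (by omega)]
      simp [this]
    · simp
    · exact hY
    · exact hX
    · show s.ar .U (s.v .p) + sc < _
      omega
    · exact ⟨fun x hx => by simp at hx; simp [hx], rfl, rfl, rfl, rfl, by simp⟩
    · have h' : s.ar .Y (s.v .cc) < s.ar .X (s.v .r) := h'
      have : w = sc := by rw [hw, if_neg (by omega)]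
      simp [this]
    · simp
    · exact ⟨fun x hx => by simp at hx; simp [hx], rfl, rfl, rfl, rfl, by simp⟩
    · have h : ¬ s.ar .X (s.v .r) < s.ar .Y (s.v .cc) := h
      have h' : ¬ s.ar .Y (s.v .cc) < s.ar .X (s.v .r) := h'
      have : w = 0 := by rw [hw, if_pos (by omega)]
      simp [this]
    · simp
  · simp only [val_V, St.tick_v] at hr hc
    refine ⟨?_, ?_, ⟨fun x hx => by simp at hx; simp [hx], rfl, rfl, rfl, rfl, by simp⟩, ?_⟩
    · simp; omega
    · simp; omega
    · simp [pick, hr, hc]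
  · simp only [val_V] at hr
    refine ⟨?_, ?_, ⟨fun x hx => by simp at hx; simp [hx], rfl, rfl, rfl, rfl, by simp⟩, ?_⟩
    · simp; omega
    · simp; omega
    · simp [pick, hr]

/-- The cost of matching two letters. -/
def letterW (sc : ℕ) (X Y : ℕ → ℕ) (r c : ℕ) : ℕ := if X r = Y c then 0 else sc

theorem cellC_spec {ℓ : Lay} {sc : ℕ} {s : St} {B H Wd r c : ℕ}
    (hth : s.v .th = H) (hr : s.v .r = r) (hc : s.v .cc = c) (hrH : r < H) (hcW : c < Wd)
    (hU : H + Wd < ℓ.sz .U) (hE : H + Wd < ℓ.sz .E) (hX : H ≤ ℓ.sz .X) (hY : Wd ≤ ℓ.sz .Y)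
    (hB : ∀ t ≤ H + Wd, s.ar .U t ≤ B) (hBW : B + sc + 1 < ℓ.W) (hW : H + Wd < ℓ.W) :
    (cellC sc).wp ℓ (fun s' => Keeps 0 [.U, .E] s s' ∧ s'.rd = s.rd ∧ s'.n ≤ s.n + 700 ∧
      (s'.ar .U, s'.ar .E) = cellFn (s.v .hm) (s.v .wn) (letterW sc (s.ar .X) (s.ar .Y)) H r c
        (s.ar .U, s.ar .E)) s := by
  subst hth hr hc
  refine ⟨⟨⟨trivial, trivial, ?_⟩, trivial, ?_⟩, ?_⟩
  · show s.v .th + s.v .cc < _; omega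
  · show s.v .r ≤ s.v .th + s.v .cc; omega
  set s₁ := s.setv .p ((V .th + V .cc - V .r : Expr).val s) ((V .th + V .cc - V .r : Expr).cost + 6)
    with hs₁
  set p := s.v .th + s.v .cc - s.v .r with hp
  have hp₁ : s₁.v .p = p := by simp [hs₁, hp]
  have hv₁ : ∀ x : Var, x ≠ .p → s₁.v x = s.v x := fun x hx => by simp [hs₁, hx]
  have ha₁ : s₁.ar = s.ar := rfl
  refine Cmd.wp_mono (c := pickC sc) ?_ (pickC_spec (B := B) (hv₁ .r (by decide))
    (hv₁ .cc (by decide)) hp₁ (by omega) (by omega) (by omega) (by omega) (by omega) ?_ ?_ ?_ hBW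
    (by omega))
  · rintro s₂ ⟨h₂, e₂⟩
    have hp₂ : s₂.v .p = p := (h₂.v _ (by decide)).trans hp₁
    rw [hv₁ _ (by decide), hv₁ _ (by decide)] at e₂
    have hn := h₂.n
    have hn₁ : s₁.n = s.n + 36 := rfl
    refine ⟨trivial, trivial, ?_, trivial, trivial, ?_, ⟨fun x hx => ?_, fun y hy => ?_, ?_, ?_⟩,
      ?_, ?_, ?_⟩
    · show s₂.v .p < _; omega
    · show s₂.v .p < _; omega
    · show s₂.v x = _
      rw [h₂.v x (by intro h; simp at h; rcases h with rfl | rfl | rfl <;> exact absurd hx (by decide)),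
        hv₁ x (by rintro rfl; exact absurd hx (by decide))]
    · simp only [List.mem_cons, List.not_mem_nil, not_or] at hy
      simp [hy, h₂.ar, ha₁]
    · exact h₂.g
    · exact h₂.wr
    · exact h₂.rd
    · simp; omega
    · simp only [cellFn, ← hp, letterW]
      rw [ha₁] at e₂
      rw [← e₂]
      simp [hp₂, h₂.ar, ha₁]
  · exact hB _ (by omega)
  · exact hB _ (by omega)
  · exact hB _ (by omega)

/-- Process a tile. -/
def tileC (sc : ℕ) : Cmd := .loop .r (V .th) (.loop .cc (V .tw) (cellC sc))

theorem tileC_spec {ℓ : Lay} {sc : ℕ} {s : St} {B H Wd : ℕ} (hsc : sc ≤ 2)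
    (hth : s.v .th = H) (htw : s.v .tw = Wd)
    (hU : H + Wd < ℓ.sz .U) (hE : H + Wd < ℓ.sz .E) (hX : H ≤ ℓ.sz .X) (hY : Wd ≤ ℓ.sz .Y)
    (hB : ∀ t ≤ H + Wd, s.ar .U t ≤ B) (hBW : B + 2 * H + sc + 1 < ℓ.W) (hW : H + Wd < ℓ.W) :
    (tileC sc).wp ℓ (fun s' => Keeps 1 [.U, .E] s s' ∧ s'.rd = s.rd ∧
      s'.n ≤ s.n + (H * (742 * Wd + 72) + 30) ∧
      (s'.ar .U, s'.ar .E) = tileFn (s.v .hm) (s.v .wn) (letterW sc (s.ar .X) (s.ar .Y)) H Wd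
        (s.ar .U, s.ar .E)) s := by
  set wt := letterW sc (s.ar .X) (s.ar .Y) with hwt
  have hwt2 : ∀ r c, wt r c ≤ 2 := fun r c => by simp only [hwt, letterW]; split_ifs <;> omega
  -- Per cell `742 = 700 + 18 + 24`, for the cell, the test and the increment. Per row `72 = 12 + 18
  -- + 18 + 24`, for the start and the last test of the inner loop and the test and the increment of
  -- the outer one.
  refine Cmd.wp_loop H (fun r s' => Keeps 1 [.U, .E] s s' ∧ s'.rd = s.rd ∧ s'.v .r = r ∧
    s'.n ≤ s.n + (r * (742 * Wd + 72) + 12) ∧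
    (s'.ar .U, s'.ar .E) = grid (cellFn (s.v .hm) (s.v .wn) wt H) Wd r (s.ar .U, s.ar .E))
    (by omega) ?_ ?_ ?_ ?_
  · refine ⟨⟨fun x hx => ?_, fun y _ => rfl, rfl, rfl⟩, rfl, by simp, by simp, rfl⟩
    rw [St.setv_v, if_neg (by rintro rfl; exact absurd hx (by decide))]
  · rintro r s' hr ⟨h, -, hr', -⟩
    exact ⟨hr', trivial, (h.v .th (by decide)).trans hth⟩
  · rintro r s₁ hr ⟨h₁, hd₁, hr₁, hn₁, e₁⟩
    refine Cmd.wp_loop Wd (fun c s' => Keeps 1 [.U, .E] s s' ∧ s'.rd = s.rd ∧ s'.v .r = r ∧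
      s'.v .cc = c ∧ s'.n ≤ s.n + (r * (742 * Wd + 72) + 12 + 742 * c + 30) ∧
      (s'.ar .U, s'.ar .E) = gridRow (cellFn (s.v .hm) (s.v .wn) wt H r) c
        (grid (cellFn (s.v .hm) (s.v .wn) wt H) Wd r (s.ar .U, s.ar .E)))
      (by omega) ?_ ?_ ?_ ?_
    · refine ⟨⟨fun x hx => ?_, fun y hy => h₁.ar y hy, h₁.g, h₁.wr⟩, hd₁, by simp [hr₁], by simp,
        by simp; omega, e₁⟩
      rw [St.setv_v, if_neg (by rintro rfl; exact absurd hx (by decide))]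
      exact h₁.v x hx
    · rintro c s' hc ⟨h, -, -, hc', -⟩
      exact ⟨hc', trivial, (h.v .tw (by decide)).trans htw⟩
    · rintro c s₂ hc ⟨h₂, hd₂, hr₂, hc₂, hn₂, e₂⟩
      have hb := cell_bound (hm := s.v .hm) (wn := s.v .wn) (E := s.ar .E) hwt2 hB hr (c := c) hc.le
      rw [← e₂] at hb
      refine Cmd.wp_mono (c := cellC sc) ?_ (cellC_spec (s := s₂.tick _) (r := r) (c := c)
        ((h₂.v .th (by decide)).trans hth) hr₂ hc₂ hr hc hU hE hX hY hb (by omega) hW)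
      rintro s₃ ⟨h₃, hd₃, hn₃, e₃⟩
      have k₃ : Keeps 1 [.U, .E] (s₂.tick ((V .tw).cost + 12)) s₃ := h₃.mono
      have hcc : s₃.v .cc = c := (h₃.v .cc (by decide)).trans hc₂
      refine ⟨hcc, ⟨fun x hx => ?_, fun y hy => ?_, ?_, ?_⟩, ?_, ?_, ?_, ?_, ?_⟩
      · rw [St.setv_v, if_neg (by rintro rfl; exact absurd hx (by decide))]
        exact (h₃.v x (by omega)).trans (h₂.v x hx)
      · exact (h₃.ar y hy).trans (h₂.ar y hy)
      · exact h₃.g.trans h₂.g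
      · exact h₃.wr.trans h₂.wr
      · exact hd₃.trans hd₂
      · simp only [St.setv_v, reduceCtorEq, if_false]
        exact (h₃.v .r (by decide)).trans hr₂
      · simp
      · simp only [St.tick_n, St.setv_n, cost_V] at hn₃ ⊢; omega
      · show (s₃.ar .U, s₃.ar .E) = _
        rw [e₃, gridRow, ← e₂]
        simp only [St.tick_v, St.tick_ar, h₂.v .hm (by decide), h₂.v .wn (by decide),
          h₂.ar .X (by decide), h₂.ar .Y (by decide), ← hwt]
    · rintro s₂ ⟨h₂, hd₂, hr₂, hc₂, hn₂, e₂⟩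
      refine ⟨hr₂, ⟨fun x hx => ?_, h₂.ar, h₂.g, h₂.wr⟩, hd₂, by simp, ?_, e₂⟩
      · rw [St.setv_v, if_neg (by rintro rfl; exact absurd hx (by decide))]
        exact h₂.v x hx
      · simp only [St.tick_n, St.setv_n, cost_V]
        rw [Nat.add_mul r 1]; omega
  · rintro s₁ ⟨h₁, hd₁, -, hn₁, e₁⟩
    exact ⟨⟨h₁.v, h₁.ar, h₁.g, h₁.wr⟩, hd₁, by simp only [St.tick_n, cost_V]; omega, e₁⟩

end AsymRAM

/-! ### Frame rules for loops, and loading from slow memory. -/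

namespace AsymRAM

open AsymRAM.Expr

/-- The expression depends only on variables of level above `L` and on arrays other than `ys`. -/
def Expr.indep (L : ℕ) (ys : List Arr) : Expr → Bool
  | C _ => true
  | V x => decide (L < x.lvl)
  | A y e => decide (y ∉ ys) && e.indep L ys
  | bin _ e₁ e₂ => e₁.indep L ys && e₂.indep L ys

theorem Expr.val_indep {L : ℕ} {ys : List Arr} {e : Expr} (he : e.indep L ys) {s s' : St}
    (h : Keeps L ys s s') : e.val s' = e.val s := by
  induction e with
  | C => rfl
  | V x => exact h.v x (by simpa [indep] using he)
  | A y e ih =>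
    simp only [indep, Bool.and_eq_true, decide_eq_true_eq] at he
    simp only [val_A, ih he.2, h.ar y he.1]
  | bin o e₁ e₂ ih₁ ih₂ =>
    simp only [indep, Bool.and_eq_true] at he
    simp only [val, ih₁ he.1, ih₂ he.2]

theorem Expr.ok_indep {L : ℕ} {ys : List Arr} {e : Expr} (he : e.indep L ys) {ℓ : Lay} {s s' : St}
    (h : Keeps L ys s s') (hok : e.ok ℓ s) : e.ok ℓ s' := by
  induction e with
  | C => trivial
  | V x => trivial
  | A y e ih =>
    simp only [indep, Bool.and_eq_true, decide_eq_true_eq] at he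
    exact ⟨ih he.2 hok.1, by rw [val_indep he.2 h]; exact hok.2⟩
  | bin o e₁ e₂ ih₁ ih₂ =>
    simp only [indep, Bool.and_eq_true] at he
    exact ⟨ih₁ he.1 hok.1, ih₂ he.2 hok.2.1, by
      rw [val_indep he.1 h, val_indep he.2 h]; exact hok.2.2⟩

theorem Keeps.tick {L : ℕ} {ys : List Arr} {s s' : St} (h : Keeps L ys s s') (j : ℕ) :
    Keeps L ys s (s'.tick j) := ⟨h.v, h.ar, h.g, h.wr⟩

theorem Keeps.setv {L : ℕ} {ys : List Arr} {s s' : St} (h : Keeps L ys s s') {x : Var} {u j : ℕ}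
    (hx : x.lvl ≤ L := by decide) : Keeps L ys s (s'.setv x u j) :=
  ⟨fun y hy => by
    rw [St.setv_v, if_neg (by rintro rfl; omega)]; exact h.v y hy, h.ar, h.g, h.wr⟩

theorem Keeps.rdg {L : ℕ} {ys : List Arr} {s s' : St} (h : Keeps L ys s s') {x : Var} {u j : ℕ}
    (hx : x.lvl ≤ L := by decide) : Keeps L ys s (s'.rdg x u j) :=
  ⟨fun y hy => by
    rw [St.rdg_v, if_neg (by rintro rfl; omega)]; exact h.v y hy, h.ar, h.g, h.wr⟩

theorem Keeps.seta {L : ℕ} {ys : List Arr} {s s' : St} (h : Keeps L ys s s') {y : Arr} {i u j : ℕ}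
    (hy : y ∈ ys := by simp) : Keeps L ys s (s'.seta y i u j) :=
  ⟨h.v, fun y' hy' => by
    rw [St.seta_ar, if_neg (by rintro rfl; exact hy' hy)]; exact h.ar y' hy', h.g, h.wr⟩

/-- The rule for loops whose body keeps most of the state. -/
theorem loop_spec {ℓ : Lay} {s : St} {x : Var} {e : Expr} {c : Cmd} {L N : ℕ} {ys : List Arr}
    {k j : ℕ} (P : ℕ → (Arr → ℕ → ℕ) → Prop) (hx : x.lvl ≤ L := by decide)
    (hei : e.indep L ys := by decide)
    (he : e.ok ℓ s) (hN : e.val s = N) (hW : N < ℓ.W) (h0 : P 0 s.ar)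
    (hc : ∀ i < N, ∀ s', Keeps L ys s s' → s'.v x = i → P i s'.ar → c.wp ℓ (fun s'' =>
      Keeps L ys s' s'' ∧ s''.v x = i ∧ s''.rd ≤ s'.rd + k ∧ s''.n ≤ s'.n + j ∧ P (i + 1) s''.ar)
      s') :
    (Cmd.loop x e c).wp ℓ (fun s' => Keeps L ys s s' ∧ s'.rd ≤ s.rd + N * k ∧
      s'.n ≤ s.n + (N * (j + e.cost + 36) + e.cost + 24) ∧ P N s'.ar) s := by
  refine Cmd.wp_loop N (fun i s' => Keeps L ys s s' ∧ s'.v x = i ∧ s'.rd ≤ s.rd + i * k ∧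
    s'.n ≤ s.n + (i * (j + e.cost + 36) + 12) ∧ P i s'.ar) hW ?_ ?_ ?_ ?_
  · exact ⟨(Keeps.refl L ys s).setv hx, by simp, by simp, by simp, h0⟩
  · rintro i s' hi ⟨h, hv, -⟩
    exact ⟨hv, ok_indep hei h he, (val_indep hei h).trans hN⟩
  · rintro i s' hi ⟨h, hv, hr, hn, hP⟩
    refine Cmd.wp_mono (c := c) ?_ (hc i hi _ (h.tick _) hv hP)
    rintro s'' ⟨h', hv', hr', hn', hP'⟩
    refine ⟨hv', ?_, by simp, ?_, ?_, hP'⟩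
    · exact Keeps.setv (Keeps.trans (h.tick _) h' le_rfl le_rfl (by simp) (by simp)) hx
    · simp only [St.tick_rd, St.setv_rd] at hr' ⊢; rw [Nat.add_mul]; omega
    · simp only [St.tick_n, St.setv_n] at hn' ⊢; rw [Nat.add_mul i 1]; omega
  · rintro s' ⟨h, -, hr, hn, hP⟩
    exact ⟨h.tick _, hr, by simp only [St.tick_n]; omega, hP⟩

/-- A loop that assigns to entries of the array `y`. -/
theorem fill_spec {ℓ : Lay} {s : St} {y : Arr} {e e₁ e₂ : Expr} {N : ℕ} (F : ℕ → ℕ → ℕ)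
    (he : e.ok ℓ s) (hN : e.val s = N) (hW : N < ℓ.W) (h0 : s.ar y = F 0)
    (hc : ∀ j < N, ∀ s', Keeps 0 [y] s s' → s'.v .t = j → s'.ar y = F j →
      e₁.ok ℓ s' ∧ e₂.ok ℓ s' ∧ e₁.val s' < ℓ.sz y ∧
      Function.update (F j) (e₁.val s') (e₂.val s') = F (j + 1))
    (hei : e.indep 0 [y] := by decide) :
    (Cmd.loop .t e (.put y e₁ e₂)).wp ℓ (fun s' => Keeps 0 [y] s s' ∧ s'.rd ≤ s.rd ∧
      s'.n ≤ s.n + (N * (e₁.cost + e₂.cost + 12 + e.cost + 36) + e.cost + 24) ∧ s'.ar y = F N) s := by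
  refine Cmd.wp_mono (c := Cmd.loop _ _ _) ?_ (loop_spec (k := 0) (j := e₁.cost + e₂.cost + 12)
    (fun j ar => ar y = F j) (by decide) hei he hN hW h0 ?_)
  · rintro s' ⟨h, hr, hn, e⟩
    exact ⟨h, by simpa using hr, hn, e⟩
  · intro j hj s' h hv hF
    obtain ⟨h₁, h₂, h₃, h₄⟩ := hc j hj s' h hv hF
    refine ⟨h₁, h₂, h₃, (Keeps.refl _ _ _).seta, hv, le_rfl, le_rfl, ?_⟩
    simp [hF, h₄]

/-- Copy a segment of slow memory to the array `y`. -/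
def loadC (y : Arr) (e base : Expr) : Cmd :=
  .loop .t e (.rdG .u (base + V .t) ;; .put y (V .t) (V .u))

theorem loadC_spec {ℓ : Lay} {s : St} {y : Arr} {e base : Expr} {N b : ℕ} (hμ : ℓ.μ = .fast)
    (he : e.ok ℓ s) (hN : e.val s = N) (hb : base.ok ℓ s) (hbv : base.val s = b)
    (hW : N + b < ℓ.W) (hs : N ≤ ℓ.sz y)
    (hei : e.indep 0 [y] := by decide) (hbi : base.indep 0 [y] := by decide) :
    (loadC y e base).wp ℓ (fun s' => Keeps 0 [y] s s' ∧ s'.rd ≤ s.rd + N ∧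
      s'.n ≤ s.n + (N * (base.cost + e.cost + 100) + e.cost + 24) ∧
      s'.ar y = fun t => if t < N then s.g (b + t) else s.ar y t) s := by
  refine Cmd.wp_mono (c := Cmd.loop _ _ _) ?_ (loop_spec (k := 1) (j := base.cost + 42)
    (fun j ar => ar y = fun t => if t < j then s.g (b + t) else s.ar y t) (by decide) hei he hN
    (by omega) (by simp) ?_)
  · rintro s' ⟨h, hr, hn, hF⟩
    refine ⟨h, by simpa using hr, hn.trans ?_, hF⟩
    have := Nat.mul_le_mul_left N
      (show base.cost + 42 + e.cost + 36 ≤ base.cost + e.cost + 100 by omega)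
    omega
  · intro j hj s' h hv hF
    have e1 := val_indep hbi h
    refine ⟨hμ, ⟨ok_indep hbi h hb, trivial, ?_⟩, trivial, trivial, ?_,
      (Keeps.rdg (Keeps.refl _ _ _)).seta, ?_, ?_, ?_, ?_⟩
    · simp only [val_V, hv, e1, hbv]; show b + j < ℓ.W; omega
    · simp [hv]; omega
    · simp [hv]
    · simp
    · simp
      omega
    · funext t
      simp only [val_V, St.seta_ar, if_true, St.rdg_v, reduceCtorEq, if_false, hv, St.rdg_ar, hF,
        val_add, e1, hbv, h.g, Function.update_apply]
      split_ifs <;> first | rfl | omega | (subst_vars; rfl)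

end AsymRAM

/-! ### The parameters of a block, and a tile with its letters. -/

namespace AsymRAM

open AsymRAM.Expr

/-- The parameters of a block: its side is `k * S`, its top left corner is in row `ro` and column
`co` and has the diagonal `Z`. -/
structure Blk where
  S : ℕ
  k : ℕ
  inf : ℕ
  m : ℕ
  n : ℕ
  sc : ℕ
  Z : ℕ
  ro : ℕ
  co : ℕ
  v2 : ℕ
  xs : ℕ → ℕ
  ys : ℕ → ℕ

namespace Blk

variable (B : Blk)

/-- The number of letters of the first string below the top of the tiles in row `a`. -/
def hm (a : ℕ) : ℕ := B.m - (B.ro + a * B.S)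

/-- The number of letters of the second string to the right of the left side of column `c`. -/
def wn (c : ℕ) : ℕ := B.n - (B.co + c * B.S)

/-- The costs of matches in the tile `(a, c)`. -/
def wt (a c : ℕ) : ℕ → ℕ → ℕ :=
  letterW B.sc (fun t => B.xs (B.ro + a * B.S + t)) (fun t => B.ys (B.co + c * B.S + t))

/-- The layout has room for the arrays, and words are long enough. -/
structure Fits (ℓ : Lay) : Prop where
  μ : ℓ.μ = .fast
  S_pos : 1 ≤ B.S
  k_pos : 1 ≤ B.k
  sc_le : B.sc ≤ 2
  U : 2 * B.S + 1 ≤ ℓ.sz .U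
  E : 2 * B.S + 1 ≤ ℓ.sz .E
  L : B.S + 1 ≤ ℓ.sz .L
  T : B.S + 1 ≤ ℓ.sz .T
  X : B.S ≤ ℓ.sz .X
  Y : B.S ≤ ℓ.sz .Y
  TH : B.k * B.k ≤ ℓ.sz .TH
  DIR : 2 * B.k ≤ ℓ.sz .DIR
  low : 4 + B.m + B.n + B.k * B.S + B.S ≤ B.Z
  high : B.Z + B.k * B.S + B.S < B.v2
  word : 100 + B.inf + B.m + B.n + B.Z + B.ro + B.co + B.v2 + 2 * (B.k * B.k) + 8 * (B.k * B.S)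
    < ℓ.W

/-- The state contains the parameters and the strings. -/
structure At (s : St) : Prop where
  S : s.v .S = B.S
  k : s.v .k = B.k
  K : s.v .K = B.k * B.S
  inf : s.v .inf = B.inf
  m : s.v .m = B.m
  n : s.v .n = B.n
  v2 : s.v .v2 = B.v2
  th : s.v .th = B.S
  tw : s.v .tw = B.S
  z : s.v .z = B.Z
  ro : s.v .ro = B.ro
  co : s.v .co = B.co
  xs : ∀ j < B.m, s.g (4 + j) = B.xs j
  ys : ∀ j < B.n, s.g (4 + B.m + j) = B.ys j

variable {B}

theorem At.keeps {L : ℕ} {ys : List Arr} {s s' : St} (h : B.At s) (hk : Keeps L ys s s')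
    (hL : L ≤ 7 := by decide) : B.At s' where
  S := (hk.v .S (by simp only [Var.lvl]; omega)).trans h.S
  k := (hk.v .k (by simp only [Var.lvl]; omega)).trans h.k
  K := (hk.v .K (by simp only [Var.lvl]; omega)).trans h.K
  inf := (hk.v .inf (by simp only [Var.lvl]; omega)).trans h.inf
  m := (hk.v .m (by simp only [Var.lvl]; omega)).trans h.m
  n := (hk.v .n (by simp only [Var.lvl]; omega)).trans h.n
  v2 := (hk.v .v2 (by simp only [Var.lvl]; omega)).trans h.v2
  th := (hk.v .th (by simp only [Var.lvl]; omega)).trans h.th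
  tw := (hk.v .tw (by simp only [Var.lvl]; omega)).trans h.tw
  z := (hk.v .z (by simp only [Var.lvl]; omega)).trans h.z
  ro := (hk.v .ro (by simp only [Var.lvl]; omega)).trans h.ro
  co := (hk.v .co (by simp only [Var.lvl]; omega)).trans h.co
  xs := by rw [hk.g]; exact h.xs
  ys := by rw [hk.g]; exact h.ys

end Blk

/-- Cells beyond the ends of the strings ignore their weights. So it does no harm that letters are
loaded for a full tile even where a string has ended. -/
theorem tileFn_congr {hm wn H Wd : ℕ} {wt wt' : ℕ → ℕ → ℕ}
    (h : ∀ r c, r < H → c < Wd → r < hm → c < wn → wt r c = wt' r c) (s : (ℕ → ℕ) × (ℕ → ℕ)) :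
    tileFn hm wn wt H Wd s = tileFn hm wn wt' H Wd s := by
  refine grid_rel (fun _ _ s t => s = t) ?_ (fun _ _ _ _ h => h) rfl
  rintro r c s _ hr hc rfl
  have : ∀ a b d, pick hm wn (wt r c) r c a b d = pick hm wn (wt' r c) r c a b d := by
    intro a b d
    unfold pick
    split_ifs with h1 h2
    · rw [h r c hr hc h1 h2]
    · rfl
    · rfl
  simp only [cellFn, this]

/-- Load the letters of the tile in row `a` and column `c`, which are counted from `1`. -/
def lettersC : Cmd :=
  .set .hm (V .ro + (V .a - C 1) * V .S) ;; loadC .X (V .S) (C 4 + V .hm) ;;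
  .ite (V .hm) (V .m) (.set .hm (V .m - V .hm)) (.set .hm (C 0)) ;;
  .set .wn (V .co + (V .c - C 1) * V .S) ;; loadC .Y (V .S) (C 4 + V .m + V .wn) ;;
  .ite (V .wn) (V .n) (.set .wn (V .n - V .wn)) (.set .wn (C 0))

/-- Truncated subtraction. -/
theorem monus_spec {ℓ : Lay} {s : St} {x y : Var} {Q : St → Prop}
    (h : ∀ s' : St, s'.v = Function.update s.v x (s.v y - s.v x) → s'.ar = s.ar → s'.g = s.g →
      s'.wr = s.wr → s'.rd = s.rd → s'.n ≤ s.n + 42 → Q s') :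
    (Cmd.ite (V x) (V y) (.set x (V y - V x)) (.set x (C 0))).wp ℓ Q s := by
  refine ⟨trivial, trivial, fun hlt => ⟨⟨trivial, trivial, ?_⟩, ?_⟩, fun hlt => ⟨trivial, ?_⟩⟩
  · exact le_of_lt hlt
  · exact h _ rfl rfl rfl rfl rfl (by simp)
  · refine h _ ?_ rfl rfl rfl rfl (by simp)
    simp only [val_V] at hlt
    simp only [St.setv, St.tick, val_C]
    congr 1; omega

theorem lettersC_spec {ℓ : Lay} {B : Blk} (hF : B.Fits ℓ) {s : St} (hA : B.At s) {a c : ℕ}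
    (ha : a < B.k) (hc : c < B.k) (hva : s.v .a = a + 1) (hvc : s.v .c = c + 1) :
    lettersC.wp ℓ (fun s' => Keeps 2 [.X, .Y] s s' ∧ s'.rd ≤ s.rd + 2 * B.S ∧
      s'.n ≤ s.n + 700 * B.S ∧ s'.v .hm = B.hm a ∧ s'.v .wn = B.wn c ∧
      (∀ t < B.S, t < B.hm a → s'.ar .X t = B.xs (B.ro + a * B.S + t)) ∧
      (∀ t < B.S, t < B.wn c → s'.ar .Y t = B.ys (B.co + c * B.S + t))) s := by
  have hS := hF.S_pos
  have hW := hF.word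
  have haS := Nat.mul_le_mul_right B.S ha
  have hcS := Nat.mul_le_mul_right B.S hc
  simp only [Nat.succ_eq_add_one, Nat.add_mul] at haS hcS
  refine ⟨⟨trivial, ⟨⟨trivial, trivial, ?_⟩, trivial, ?_⟩, ?_⟩, ?_⟩
  · show 1 ≤ s.v .a; omega
  · show (s.v .a - 1) * s.v .S < ℓ.W
    rw [hva, hA.S, Nat.add_sub_cancel]; omega
  · show s.v .ro + (s.v .a - 1) * s.v .S < ℓ.W
    rw [hva, hA.S, Nat.add_sub_cancel, hA.ro]; omega
  set s₁ := s.setv .hm ((V .ro + (V .a - C 1) * V .S : Expr).val s)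
    ((V .ro + (V .a - C 1) * V .S : Expr).cost + 6) with hs₁
  have k₁ : Keeps 2 [] s s₁ := (Keeps.refl 2 [] s).setv
  have hn₁ : s₁.n = s.n + 48 := rfl
  have hhm₁ : s₁.v .hm = B.ro + a * B.S := by simp [hs₁, hva, hA.S, hA.ro]
  have A₁ := hA.keeps k₁
  clear_value s₁
  -- Here `hm` still is the row of the tile in the whole grid, used as an address. After loading,
  -- truncated subtraction turns it into the number of letters that are left.
  refine Cmd.wp_mono (c := loadC _ _ _) ?_ (loadC_spec (N := B.S) (b := 4 + (B.ro + a * B.S)) hF.μ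
    trivial A₁.S ⟨trivial, trivial, ?_⟩ (by simp [hhm₁]) (by omega) hF.X)
  swap
  · simp [hhm₁]; show _ < ℓ.W; omega
  rintro s₂ ⟨k₂, r₂, n₂, x₂⟩
  have A₂ := A₁.keeps k₂
  have hhm₂ : s₂.v .hm = B.ro + a * B.S := (k₂.v .hm (by decide)).trans hhm₁
  refine monus_spec fun s₃ v₃ ar₃ g₃ w₃ r₃ n₃ => ?_
  have k₃ : Keeps 2 [] s₂ s₃ := ⟨fun x hx => by
    rw [v₃, Function.update_of_ne (by rintro rfl; exact absurd hx (by decide))],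
    fun y _ => by rw [ar₃], g₃, w₃⟩
  have A₃ := A₂.keeps k₃
  have hhm₃ : s₃.v .hm = B.hm a := by
    rw [v₃, Function.update_self, A₂.m, hhm₂]; rfl
  have hvc₃ : s₃.v .c = c + 1 := by
    rw [k₃.v _ (by decide), k₂.v _ (by decide), k₁.v _ (by decide), hvc]
  refine ⟨⟨trivial, ⟨⟨trivial, trivial, ?_⟩, trivial, ?_⟩, ?_⟩, ?_⟩
  · show 1 ≤ s₃.v .c; omega
  · show (s₃.v .c - 1) * s₃.v .S < ℓ.W
    rw [hvc₃, A₃.S, Nat.add_sub_cancel]; omega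
  · show s₃.v .co + (s₃.v .c - 1) * s₃.v .S < ℓ.W
    rw [hvc₃, A₃.S, Nat.add_sub_cancel, A₃.co]; omega
  set s₄ := s₃.setv .wn ((V .co + (V .c - C 1) * V .S : Expr).val s₃)
    ((V .co + (V .c - C 1) * V .S : Expr).cost + 6) with hs₄
  have k₄ : Keeps 2 [] s₃ s₄ := (Keeps.refl 2 [] s₃).setv
  have hn₄ : s₄.n = s₃.n + 48 := rfl
  have hr₄ : s₄.rd = s₃.rd := rfl
  have hwn₄ : s₄.v .wn = B.co + c * B.S := by simp [hs₄, hvc₃, A₃.S, A₃.co]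
  have hhm₄ : s₄.v .hm = B.hm a := by simp [hs₄, hhm₃]
  have A₄ := A₃.keeps k₄
  have ar₄ : s₄.ar = s₃.ar := rfl
  clear_value s₄
  refine Cmd.wp_mono (c := loadC _ _ _) ?_ (loadC_spec (N := B.S) (b := 4 + B.m + (B.co + c * B.S))
    hF.μ trivial A₄.S ⟨⟨trivial, trivial, ?_⟩, trivial, ?_⟩ (by simp [hwn₄, A₄.m]) (by omega) hF.Y)
  rotate_left
  · simp [A₄.m]; show _ < ℓ.W; omega
  · simp [hwn₄, A₄.m]; show _ < ℓ.W; omega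
  rintro s₅ ⟨k₅, r₅, n₅, x₅⟩
  have A₅ := A₄.keeps k₅
  have hwn₅ : s₅.v .wn = B.co + c * B.S := (k₅.v .wn (by decide)).trans hwn₄
  refine monus_spec fun s₆ v₆ ar₆ g₆ w₆ r₆ n₆ => ?_
  have k₆ : Keeps 2 [] s₅ s₆ := ⟨fun x hx => by
    rw [v₆, Function.update_of_ne (by rintro rfl; exact absurd hx (by decide))],
    fun y _ => by rw [ar₆], g₆, w₆⟩
  have K : Keeps 2 [.X, .Y] s s₆ :=
    ((((k₁.trans (L'' := 2) (ys'' := [.X, .Y]) k₂).trans (L'' := 2) (ys'' := [.X, .Y]) k₃).trans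
      (L'' := 2) (ys'' := [.X, .Y]) k₄).trans (L'' := 2) (ys'' := [.X, .Y]) k₅).trans k₆
  have hg₁ := k₁.g
  have hg₄ := ((k₁.trans (L'' := 2) (ys'' := [.X, .Y]) k₂).trans (L'' := 2) (ys'' := [.X, .Y])
    k₃).trans (L'' := 2) (ys'' := [.X, .Y]) k₄ |>.g
  have hr₁ : s₁.rd = s.rd := by subst hs₁; rfl
  refine ⟨K, by omega, ?_, ?_, ?_, fun t ht ht' => ?_, fun t ht ht' => ?_⟩
  · simp only [cost_V, cost_C, cost_add] at n₂ n₅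
    omega
  · rw [v₆, Function.update_of_ne (by decide), k₅.v _ (by decide), hhm₄]
  · rw [v₆, Function.update_self, A₅.n, hwn₅]; rfl
  · rw [ar₆, k₅.ar _ (by decide), ar₄, ar₃, x₂]
    simp only [if_pos ht]
    rw [hg₁, Nat.add_assoc, hA.xs]
    rw [Blk.hm] at ht'; omega
  · rw [ar₆, x₅]
    simp only [if_pos ht]
    rw [hg₄, Nat.add_assoc, hA.ys]
    rw [Blk.wn] at ht'; omega

/-- Process the tile in row `a` and column `c`, which are counted from `1`. -/
def stepC (sc : ℕ) : Cmd := lettersC ;; tileC sc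

theorem stepC_spec {ℓ : Lay} {B : Blk} (hF : B.Fits ℓ) {s : St} (hA : B.At s) {a c b : ℕ}
    (ha : a < B.k) (hc : c < B.k) (hva : s.v .a = a + 1) (hvc : s.v .c = c + 1)
    (hb : ∀ t ≤ B.S + B.S, s.ar .U t ≤ b) (hbW : b + 2 * B.S + 3 < ℓ.W) :
    (stepC B.sc).wp ℓ (fun s' => Keeps 2 [.U, .E, .X, .Y] s s' ∧ s'.rd ≤ s.rd + 2 * B.S ∧
      s'.n ≤ s.n + 1600 * (B.S * B.S) ∧ (s'.ar .U, s'.ar .E) =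
        tileFn (B.hm a) (B.wn c) (B.wt a c) B.S B.S (s.ar .U, s.ar .E)) s := by
  have hS := hF.S_pos
  have hSS := Nat.mul_le_mul_right B.S hS
  have hW := hF.word
  have hkS := Nat.mul_le_mul_right B.S hF.k_pos
  refine Cmd.wp_mono (c := lettersC) ?_ (lettersC_spec hF hA ha hc hva hvc)
  rintro s₁ ⟨k₁, r₁, n₁, hm₁, wn₁, x₁, y₁⟩
  have A₁ := hA.keeps k₁
  have hU₁ := k₁.ar .U (by decide)
  have hE₁ := k₁.ar .E (by decide)
  have hU := hF.U
  have hE := hF.E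
  have hsc := hF.sc_le
  refine Cmd.wp_mono (c := tileC _) ?_ (tileC_spec (B := b) hsc A₁.th A₁.tw (by omega)
    (by omega) hF.X hF.Y (by rwa [hU₁]) (by omega) (by omega))
  rintro s₂ ⟨k₂, r₂, n₂, e₂⟩
  refine ⟨k₁.trans k₂, by omega, ?_, ?_⟩
  · have : B.S * (742 * B.S + 72) = 742 * (B.S * B.S) + 72 * B.S := by ring
    omega
  · rw [e₂, hm₁, wn₁, hU₁, hE₁]
    refine tileFn_congr (fun r c' hr hc' h1 h2 => ?_) _
    simp only [letterW, Blk.wt, x₁ r hr h1, y₁ c' hc' h2]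

end AsymRAM

/-! ### Moving edges between tiles, and tracing a sketch back. -/

namespace AsymRAM

open AsymRAM.Expr

/-- Move the right edge of a tile to the left edge of the next tile. -/
def shiftRC : Cmd :=
  .loop .t (V .S + C 1) (.put .U (V .t) (A .U (V .S + V .t))) ;;
  .loop .t (V .S) (.put .U (V .S + C 1 + V .t) (V .inf))

/-- Move the bottom edge of a tile to the top edge of the next tile. -/
def shiftDC : Cmd :=
  .loop .t (V .S + C 1) (.put .U (V .S + V .S - V .t) (A .U (V .S - V .t))) ;;
  .loop .t (V .S) (.put .U (V .t) (V .inf))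

variable {ℓ : Lay} {B : Blk} {s : St}

theorem shiftRC_spec (hF : B.Fits ℓ) (hA : B.At s) :
    shiftRC.wp ℓ (fun s' => Keeps 0 [.U] s s' ∧ s'.rd ≤ s.rd ∧ s'.n ≤ s.n + 500 * B.S ∧
      ∀ t ≤ B.S + B.S, s'.ar .U t = shiftR B.S B.inf (s.ar .U) t) s := by
  have hS := hF.S_pos
  have hW := hF.word
  have hU := hF.U
  have hkS := Nat.mul_le_mul_right B.S hF.k_pos
  refine Cmd.wp_mono (c := Cmd.loop _ _ _) ?_ (fill_spec (N := B.S + 1)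
    (fun j t => if t < j then s.ar .U (B.S + t) else s.ar .U t) ⟨trivial, trivial, ?_⟩
    (by simp [hA.S]) (by omega) (by simp) ?_)
  · rintro s₁ ⟨k₁, r₁, n₁, e₁⟩
    have A₁ := hA.keeps k₁
    refine Cmd.wp_mono (c := Cmd.loop _ _ _) ?_ (fill_spec (N := B.S)
      (fun j t => if B.S < t ∧ t ≤ B.S + j then B.inf else s₁.ar .U t) trivial A₁.S (by omega)
      (by funext t; rw [if_neg (by omega)]) ?_)
    · rintro s₂ ⟨k₂, r₂, n₂, e₂⟩
      simp only [cost_V, cost_C, cost_add, cost_A] at n₁ n₂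
      refine ⟨k₁.trans k₂, by omega, by omega, fun t ht => ?_⟩
      rw [e₂, e₁, shiftR]
      simp only
      split_ifs <;> first | rfl | omega
    · intro j hj s' k' hv he
      have A' := A₁.keeps k'
      refine ⟨⟨⟨trivial, trivial, ?_⟩, trivial, ?_⟩, trivial, ?_, ?_⟩
      · show s'.v .S + 1 < ℓ.W; rw [A'.S]; omega
      · show s'.v .S + 1 + s'.v .t < ℓ.W; rw [A'.S, hv]; omega
      · simp only [val_add, val_V, val_C]; rw [A'.S, hv]; omega
      · simp only [val_add, val_V, val_C]; rw [A'.S, hv, A'.inf]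
        funext t
        simp only [Function.update_apply]
        split_ifs <;> first | rfl | omega
  · show s.v .S + 1 < ℓ.W; rw [hA.S]; omega
  · intro j hj s' k' hv he
    have A' := hA.keeps k'
    refine ⟨trivial, ⟨⟨trivial, trivial, ?_⟩, ?_⟩, ?_, ?_⟩
    · show s'.v .S + s'.v .t < ℓ.W; rw [A'.S, hv]; omega
    · simp only [val_add, val_V]; rw [A'.S, hv]; omega
    · simp only [val_V]; rw [hv]; omega
    · simp only [val_add, val_V, val_A]; rw [A'.S, hv, he]
      funext t
      simp only [Function.update_apply]
      split_ifs <;> first | rfl | omega | (subst_vars; rfl)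

theorem shiftDC_spec (hF : B.Fits ℓ) (hA : B.At s) :
    shiftDC.wp ℓ (fun s' => Keeps 0 [.U] s s' ∧ s'.rd ≤ s.rd ∧ s'.n ≤ s.n + 500 * B.S ∧
      ∀ t ≤ B.S + B.S, s'.ar .U t = shiftD B.S B.inf (s.ar .U) t) s := by
  have hS := hF.S_pos
  have hW := hF.word
  have hU := hF.U
  have hkS := Nat.mul_le_mul_right B.S hF.k_pos
  -- Source and target overlap at the corner and the target lies higher, so the copy runs from the
  -- end: the source `S` is read first and overwritten last.
  refine Cmd.wp_mono (c := Cmd.loop _ _ _) ?_ (fill_spec (N := B.S + 1)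
    (fun j t => if B.S + B.S < t + j ∧ t ≤ B.S + B.S then s.ar .U (t - B.S) else s.ar .U t)
    ⟨trivial, trivial, ?_⟩ (by simp [hA.S]) (by omega) (by funext t; rw [if_neg (by omega)]) ?_)
  · rintro s₁ ⟨k₁, r₁, n₁, e₁⟩
    have A₁ := hA.keeps k₁
    refine Cmd.wp_mono (c := Cmd.loop _ _ _) ?_ (fill_spec (N := B.S)
      (fun j t => if t < j then B.inf else s₁.ar .U t) trivial A₁.S (by omega)
      (by funext t; rw [if_neg (by omega)]) ?_)
    · rintro s₂ ⟨k₂, r₂, n₂, e₂⟩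
      simp only [cost_V, cost_C, cost_add, cost_A, cost_sub] at n₁ n₂
      refine ⟨k₁.trans k₂, by omega, by omega, fun t ht => ?_⟩
      rw [e₂, e₁, shiftD]
      simp only
      split_ifs <;> first | rfl | omega
    · intro j hj s' k' hv he
      have A' := A₁.keeps k'
      refine ⟨trivial, trivial, ?_, ?_⟩
      · simp only [val_V]; rw [hv]; omega
      · simp only [val_V]; rw [hv, A'.inf]
        funext t
        simp only [Function.update_apply]
        split_ifs <;> first | rfl | omega
  · show s.v .S + 1 < ℓ.W; rw [hA.S]; omega
  · intro j hj s' k' hv he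
    have A' := hA.keeps k'
    refine ⟨⟨⟨trivial, trivial, ?_⟩, trivial, ?_⟩, ⟨⟨trivial, trivial, ?_⟩, ?_⟩, ?_, ?_⟩
    · show s'.v .S + s'.v .S < ℓ.W; rw [A'.S]; omega
    · show s'.v .t ≤ s'.v .S + s'.v .S; rw [A'.S, hv]; omega
    · show s'.v .t ≤ s'.v .S; rw [A'.S, hv]; omega
    · simp only [val_sub, val_V]; rw [A'.S, hv]; omega
    · simp only [val_add, val_sub, val_V]; rw [A'.S, hv]; omega
    · simp only [val_add, val_sub, val_V, val_A]; rw [A'.S, hv, he]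
      funext t
      simp only [Function.update_apply]
      split_ifs
      all_goals first
        | rfl
        | omega
        | (congr 1; omega)

/-- `D` contains the directions of the path from the tile `(a, c)` to the tile `(i, b)`, the last
one first. -/
inductive Trace (l : ℕ → ℕ → Prop) (D : ℕ → ℕ) (i b : ℕ) : ℕ → ℕ → ℕ → Prop
  | nil : Trace l D i b 0 i b
  | left {j a c : ℕ} (h : Trace l D i b j (a + 1) (c + 1)) (hl : l a c) (hD : D j = 0) :
      Trace l D i b (j + 1) (a + 1) c
  | up {j a c : ℕ} (h : Trace l D i b j (a + 1) (c + 1)) (hl : ¬ l a c) (hD : D j = 1) :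
      Trace l D i b (j + 1) a (c + 1)

theorem Trace.congr {l : ℕ → ℕ → Prop} {D D' : ℕ → ℕ} {i b j a c : ℕ} (h : Trace l D i b j a c)
    (hD : ∀ t < j, D' t = D t) : Trace l D' i b j a c := by
  induction h with
  | nil => exact .nil
  | left _ hl hd ih => exact .left (ih fun t ht => hD t (by omega)) hl ((hD _ (by omega)).trans hd)
  | up _ hl hd ih => exact .up (ih fun t ht => hD t (by omega)) hl ((hD _ (by omega)).trans hd)

/-- Each direction lowers the sum of the indices by one. This bounds the length of the trace by `2 *
k`, the room in `DIR`. -/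
theorem Trace.sum {l : ℕ → ℕ → Prop} {D : ℕ → ℕ} {i b j a c : ℕ} (h : Trace l D i b j a c) :
    j + a + c = i + b ∧ a ≤ i ∧ c ≤ b := by
  induction h with
  | nil => omega
  | left _ _ _ ih => omega
  | up _ _ _ ih => omega

/-- Find the path to the tile in row `i` and column `b + 1`. -/
def traceC : Cmd :=
  .set .a (V .i) ;; .set .c (V .b + C 1) ;; .set .len (C 0) ;;
  .whileLt (C 0) (V .a * V .c)
    (.ite (V .dl) (A .TH ((V .a - C 1) * V .k + (V .c - C 1)))
      (.put .DIR (V .len) (C 0) ;; .set .c (V .c - C 1))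
      (.put .DIR (V .len) (C 1) ;; .set .a (V .a - C 1)) ;;
    .set .len (V .len + C 1))

/-- Thresholds tell where a path comes from, so the chain is found backwards, while its tiles have
to be run forwards. `DIR` serves as a stack in between. The loop ends on the boundary of the block,
where one index is zero. -/
theorem traceC_spec (hF : B.Fits ℓ) (hA : B.At s) {i b dl : ℕ} (hi : i < B.k) (hb : b < B.k)
    (hvi : s.v .i = i) (hvb : s.v .b = b) (hdl : s.v .dl = dl) :
    traceC.wp ℓ (fun s' => Keeps 3 [.DIR] s s' ∧ s'.rd ≤ s.rd ∧ s'.n ≤ s.n + 1000 * B.k ∧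
      s'.v .a * s'.v .c = 0 ∧ Trace (fun a c => dl < s.ar .TH (a * B.k + c)) (s'.ar .DIR) i (b + 1)
        (s'.v .len) (s'.v .a) (s'.v .c)) s := by
  have hk := hF.k_pos
  have hW := hF.word
  have hDIR := hF.DIR
  have hTH := hF.TH
  have hkk := Nat.mul_le_mul_right B.k hk
  refine ⟨trivial, ⟨trivial, trivial, ?_⟩, trivial, ?_⟩
  · show s.v .b + 1 < ℓ.W; omega
  refine Cmd.wp_while (j := i + (b + 1)) (fun j s' => j = s'.v .a + s'.v .c ∧ Keeps 3 [.DIR] s s' ∧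
    s'.rd ≤ s.rd ∧ s'.n ≤ s.n + 60 + 200 * s'.v .len ∧
    Trace (fun a c => dl < s.ar .TH (a * B.k + c)) (s'.ar .DIR) i (b + 1)
        (s'.v .len) (s'.v .a) (s'.v .c)) ?_ ?_
  · rintro j s₁ ⟨hj, k₁, r₁, n₁, T₁⟩
    have A₁ := hA.keeps k₁
    have hsum := T₁.sum
    have hac : s₁.v .a * s₁.v .c ≤ B.k * B.k := Nat.mul_le_mul (by omega) (by omega)
    refine ⟨trivial, ⟨trivial, trivial, ?_⟩, fun hlt => ?_, fun hlt => ?_⟩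
    · show s₁.v .a * s₁.v .c < ℓ.W; omega
    · simp only [val_C, val_mul, val_V] at hlt
      obtain ⟨a, ha⟩ : ∃ a, s₁.v .a = a + 1 :=
        Nat.exists_eq_succ_of_ne_zero fun h => by simp [h] at hlt
      obtain ⟨c, hc⟩ : ∃ c, s₁.v .c = c + 1 :=
        Nat.exists_eq_succ_of_ne_zero fun h => by simp [h] at hlt
      rw [ha, hc] at T₁ hsum
      have hidx : a * B.k + c < B.k * B.k := by
        have := Nat.mul_le_mul_right B.k (show a + 1 ≤ B.k by omega)
        rw [Nat.add_mul] at this; omega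
      have hTHe : s₁.ar .TH = s.ar .TH := k₁.ar .TH (by decide)
      have hdl₁ : s₁.v .dl = dl := (k₁.v .dl (by decide)).trans hdl
      refine ⟨trivial, ⟨⟨⟨⟨trivial, trivial, ?_⟩, trivial, ?_⟩, ⟨trivial, trivial, ?_⟩, ?_⟩, ?_⟩,
        fun hd => ⟨trivial, trivial, ?_, ⟨trivial, trivial, ?_⟩, ⟨trivial, trivial, ?_⟩, ?_⟩,
        fun hd => ⟨trivial, trivial, ?_, ⟨trivial, trivial, ?_⟩, ⟨trivial, trivial, ?_⟩, ?_⟩⟩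
      · show 1 ≤ s₁.v .a; omega
      · show (s₁.v .a - 1) * s₁.v .k < ℓ.W; rw [ha, A₁.k, Nat.add_sub_cancel]; omega
      · show 1 ≤ s₁.v .c; omega
      · show (s₁.v .a - 1) * s₁.v .k + (s₁.v .c - 1) < ℓ.W
        rw [ha, A₁.k, hc, Nat.add_sub_cancel, Nat.add_sub_cancel]; omega
      · simp only [val_add, val_mul, val_sub, val_V, val_C, St.tick_v]
        rw [ha, A₁.k, hc, Nat.add_sub_cancel, Nat.add_sub_cancel]; omega
      · show s₁.v .len < _; omega
      · show 1 ≤ s₁.v .c; omega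
      · simp [Op.ok]; omega
      · simp only [val_add, val_mul, val_sub, val_V, val_C, St.tick_v, val_A, St.tick_ar,
          ha, A₁.k, hc, Nat.add_sub_cancel, hTHe, hdl₁] at hd
        refine ⟨_, ?_, rfl, ?_, r₁, ?_, ?_⟩
        · simp; omega
        · exact (((k₁.tick _).tick _).seta.setv).setv
        · simp; omega
        · simp [ha, hc]
          refine Trace.left (T₁.congr fun t ht => ?_) hd (by simp)
          rw [Function.update_of_ne (by omega)]
      · show s₁.v .len < _; omega
      · show 1 ≤ s₁.v .a; omega
      · simp [Op.ok]; omega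
      · simp only [val_add, val_mul, val_sub, val_V, val_C, St.tick_v, val_A, St.tick_ar,
          ha, A₁.k, hc, Nat.add_sub_cancel, hTHe, hdl₁] at hd
        refine ⟨_, ?_, rfl, ?_, r₁, ?_, ?_⟩
        · simp; omega
        · exact (((k₁.tick _).tick _).seta.setv).setv
        · simp; omega
        · simp [ha, hc]
          refine Trace.up (T₁.congr fun t ht => ?_) hd (by simp)
          rw [Function.update_of_ne (by omega)]
    · refine ⟨k₁.tick _, r₁, ?_, ?_, T₁⟩
      · simp; omega
      · simp only [val_C, val_mul, val_V] at hlt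
        show s₁.v .a * s₁.v .c = 0
        omega
  · refine ⟨by simp [hvi, hvb], (((Keeps.refl 3 [.DIR] s).setv).setv).setv, le_rfl, by simp, ?_⟩
    simp only [val_V, St.setv_v, reduceCtorEq, if_true, if_false, val_C, val_add, hvi, hvb]
    exact .nil

end AsymRAM

/-! ### Evaluation of a sketch. -/

namespace AsymRAM

open AsymRAM.Expr

/-- Follow the stored path. -/
def popC (sc : ℕ) : Cmd :=
  .whileLt (C 0) (V .len)
    (.set .len (V .len - C 1) ;;
      .ite (A .DIR (V .len)) (C 1) (shiftRC ;; .set .c (V .c + C 1))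
        (shiftDC ;; .set .a (V .a + C 1)) ;;
      stepC sc)

/-- Take the minima of the values on the bottom edge. -/
def minC : Cmd :=
  .loop .t (V .S + C 1) (.ite (A .U (V .t)) (A .T (V .t)) (.put .T (V .t) (A .U (V .t))) .skip)

/-- Evaluate the sketch of the diagonal `dl` at the tile in row `i` and column `b + 1`. -/
def evalC (sc : ℕ) : Cmd :=
  traceC ;; loadC .U (V .S + V .S + C 1) (V .z + V .c * V .S - (V .a + C 1) * V .S) ;;
  popC sc ;; minC

variable {ℓ : Lay} {B : Blk} {s : St}

namespace Blk

/-- The sketch values in a state. -/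
abbrev sketch (B : Blk) (s : St) (dl a c : ℕ) : ℕ → ℕ :=
  thVal B.S B.k B.inf B.Z s.g B.hm B.wn B.wt (s.ar .TH) dl a c

/-- The values on the boundary of a block are small. -/
def Small (B : Blk) (s : St) : Prop :=
  ∀ j, B.Z ≤ j + B.k * B.S + B.S → j ≤ B.Z + B.k * B.S + B.S → s.g j ≤ B.inf

theorem wt_le (hF : B.Fits ℓ) (a c r c' : ℕ) : B.wt a c r c' ≤ 2 := by
  have := hF.sc_le
  simp only [wt, letterW]
  split_ifs <;> omega

end Blk

/-- Popping the directions runs the tiles of the chain from the boundary to the target, with the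
invariant that `U` is the sketch value of the current tile. At most `2 * k` tiles, each with `2 * S`
reads of letters, give `4 * (k * S)` reads. -/
theorem popC_spec (hF : B.Fits ℓ) (hA : B.At s) (hZ : B.k * B.S + B.S ≤ B.Z) (hV : B.Small s)
    {i b dl : ℕ} (hi : i < B.k) (hb : b < B.k)
    (hT : Trace (fun a c => dl < s.ar .TH (a * B.k + c)) (s.ar .DIR) i (b + 1)
        (s.v .len) (s.v .a) (s.v .c))
    (hU : ∀ t ≤ B.S + B.S, s.ar .U t = B.sketch s dl (s.v .a) (s.v .c) t) :
    (popC B.sc).wp ℓ (fun s' => Keeps 3 [.U, .E, .X, .Y] s s' ∧ s'.rd ≤ s.rd + 4 * (B.k * B.S) ∧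
      s'.n ≤ s.n + 5000 * (B.k * (B.S * B.S)) ∧
      ∀ t ≤ B.S + B.S, s'.ar .U t = B.sketch s dl i (b + 1) t) s := by
  have hS := hF.S_pos
  have hk := hF.k_pos
  have hW := hF.word
  have hDIR := hF.DIR
  have hkS := Nat.mul_le_mul_right B.S hk
  have hSS := Nat.mul_le_mul_right B.S hS
  have hSk := Nat.mul_le_mul_left B.k hS
  have hkSS := Nat.mul_le_mul_right (B.S * B.S) hk
  set len := s.v .len with hlen
  refine Cmd.wp_while (j := len) (fun j s' => j = s'.v .len ∧ j ≤ len ∧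
    Keeps 3 [.U, .E, .X, .Y] s s' ∧ s'.rd ≤ s.rd + (len - j) * (2 * B.S) ∧
    s'.n ≤ s.n + (len - j) * (2200 * (B.S * B.S)) ∧
    Trace (fun a c => dl < s.ar .TH (a * B.k + c)) (s.ar .DIR) i (b + 1) j (s'.v .a) (s'.v .c) ∧
    ∀ t ≤ B.S + B.S, s'.ar .U t = B.sketch s dl (s'.v .a) (s'.v .c) t) ?_ ?_
  · rintro j s₁ ⟨hj, hjl, k₁, r₁, n₁, T₁, U₁⟩
    have A₁ := hA.keeps k₁
    have hsum := T₁.sum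
    refine ⟨trivial, trivial, fun hlt => ?_, fun hlt => ?_⟩
    · simp only [val_C, val_V] at hlt
      obtain ⟨j, rfl⟩ : ∃ j', j = j' + 1 := Nat.exists_eq_succ_of_ne_zero (by omega)
      -- the common end of both branches
      have hstep : ∀ s₂ : St, ∀ a c, a < B.k → c < B.k → s₂.v .a = a + 1 → s₂.v .c = c + 1 →
          s₂.v .len = j → Keeps 3 [.U] s₁ s₂ → s₂.rd ≤ s₁.rd →
          s₂.n ≤ s₁.n + 500 * B.S + 100 →
          Trace (fun a c => dl < s.ar .TH (a * B.k + c)) (s.ar .DIR) i (b + 1) j (a + 1) (c + 1) →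
          (∀ t ≤ B.S + B.S, s₂.ar .U t = (if dl < s.ar .TH (a * B.k + c) then
            shiftR B.S B.inf (B.sketch s dl (a + 1) c) else
            shiftD B.S B.inf (B.sketch s dl a (c + 1))) t) →
          (stepC B.sc).wp ℓ (fun s' => ∃ j' < j + 1, j' = s'.v .len ∧ j' ≤ len ∧
            Keeps 3 [.U, .E, .X, .Y] s s' ∧ s'.rd ≤ s.rd + (len - j') * (2 * B.S) ∧
            s'.n ≤ s.n + (len - j') * (2200 * (B.S * B.S)) ∧
            Trace (fun a c => dl < s.ar .TH (a * B.k + c)) (s.ar .DIR) i (b + 1) j'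
              (s'.v .a) (s'.v .c) ∧
            ∀ t ≤ B.S + B.S, s'.ar .U t = B.sketch s dl (s'.v .a) (s'.v .c) t) s₂ := by
        intro s₂ a c ha hc hva hvc hl k₂ r₂ n₂ T₂ U₂
        -- A chain has at most `2 * k` tiles, each of which raises values by at most `2 * S`; so
        -- words do not overflow.
        have hb₂ : ∀ t ≤ B.S + B.S, s₂.ar .U t ≤ B.inf + 4 * (B.k * B.S) := by
          intro t ht
          have ha' := Nat.mul_le_mul_right B.S ha
          have hc' := Nat.mul_le_mul_right B.S hc
          simp only [Nat.succ_eq_add_one, Nat.add_mul] at ha' hc'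
          have h1 := sketchVal_le (inf := B.inf) (V := s.g) (hm := B.hm) (wn := B.wn)
            (wt := B.wt) (Blk.wt_le hF) (l := fun a c => dl < s.ar .TH (a * B.k + c)) hZ hV
            (a := a + 1) (c := c) (by omega) (by omega)
          have h2 := sketchVal_le (inf := B.inf) (V := s.g) (hm := B.hm) (wn := B.wn)
            (wt := B.wt) (Blk.wt_le hF) (l := fun a c => dl < s.ar .TH (a * B.k + c)) hZ hV
            (a := a) (c := c + 1) (by omega) (by omega)
          have e1 : 2 * B.S * (a + 1 + c) = 2 * (a * B.S) + 2 * (c * B.S) + 2 * B.S := by ring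
          have e2 : 2 * B.S * (a + (c + 1)) = 2 * (a * B.S) + 2 * (c * B.S) + 2 * B.S := by ring
          rw [e1] at h1
          rw [e2] at h2
          rw [U₂ t ht]
          split_ifs
          · unfold shiftR; split_ifs
            · exact (h1 _ (by omega)).trans (by omega)
            · omega
          · unfold shiftD; split_ifs
            · omega
            · exact (h2 _ (by omega)).trans (by omega)
        refine Cmd.wp_mono (c := stepC _) ?_ (stepC_spec hF (A₁.keeps k₂) ha hc hva hvc hb₂
          (by omega))
        rintro s₃ ⟨k₃, r₃, n₃, e₃⟩
        have hl₃ : s₃.v .len = j := (k₃.v .len (by decide)).trans hl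
        have ha₃ : s₃.v .a = a + 1 := (k₃.v .a (by decide)).trans hva
        have hc₃ : s₃.v .c = c + 1 := (k₃.v .c (by decide)).trans hvc
        have e4 : len - j = len - (j + 1) + 1 := by omega
        refine ⟨j, by omega, hl₃.symm, by omega, ?_, ?_, ?_, ?_, fun t ht => ?_⟩
        · exact (k₁.trans (L'' := 3) (ys'' := [.U, .E, .X, .Y]) k₂).trans k₃
        · rw [e4, Nat.add_mul]; omega
        · rw [e4, Nat.add_mul]; omega
        · rw [ha₃, hc₃]; exact T₂
        · have := congrArg Prod.fst e₃
          simp only [tileFn_fst] at this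
          rw [this, ha₃, hc₃, Blk.sketch, thVal, sketchVal]
          exact tileV_congr U₂ t ht
      have hc1 : (C 0 : Expr).cost + (V .len).cost + 6 = 18 := rfl
      refine ⟨⟨trivial, trivial, ?_⟩, ⟨trivial, ?_⟩, trivial, fun hd => ?_, fun hd => ?_⟩
      · show 1 ≤ s₁.v .len; omega
      · simp; omega
      · set s₂ := ((s₁.tick ((C 0).cost + (V Var.len).cost + 6)).setv .len
          ((V .len - C 1 : Expr).val (s₁.tick ((C 0).cost + (V Var.len).cost + 6)))
          ((V .len - C 1 : Expr).cost + 6)).tick ((A .DIR (V .len)).cost + (C 1).cost + 6) with hs₂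
        have k₂ : Keeps 3 [] s₁ s₂ := (((Keeps.refl 3 [] s₁).tick _).setv).tick _
        have n₂ : s₂.n = s₁.n + 72 := rfl
        have r₂ : s₂.rd = s₁.rd := rfl
        have hl₂ : s₂.v .len = j := by simp [hs₂]; omega
        have ha₂ : s₂.v .a = s₁.v .a := by simp [hs₂]
        have hc₂ : s₂.v .c = s₁.v .c := by simp [hs₂]
        have hd₂ : s.ar .DIR j = 0 := by
          rw [← k₁.ar .DIR (by decide)]
          simpa [← hj] using hd
        have A₂ := A₁.keeps k₂
        have U₂ : s₂.ar .U = s₁.ar .U := rfl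
        clear_value s₂
        generalize ha' : s₁.v .a = a' at *
        generalize hc' : s₁.v .c = c' at *
        -- The popped entry is `0`, so of the two ways to extend a trace only `left` is possible.
        rcases T₁ with _ | ⟨T, hlr, hD⟩ | ⟨T, hlr, hD⟩
        · rename_i a
          refine Cmd.wp_mono (c := shiftRC) ?_ (shiftRC_spec hF A₂)
          rintro s₃ ⟨k₃, r₃, n₃, U₃⟩
          have hc₃ : s₃.v .c = c' := (k₃.v .c (by decide)).trans hc₂
          refine ⟨⟨trivial, trivial, ?_⟩, hstep _ a c' (by omega) (by have := T.sum; omega) ?_ ?_ ?_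
            ?_ ?_ ?_ T fun t ht => ?_⟩
          · show s₃.v .c + 1 < ℓ.W; have := T.sum; omega
          · simp only [St.setv_v, reduceCtorEq, if_false]
            exact (k₃.v .a (by decide)).trans ha₂
          · simp [hc₃]
          · simp only [St.setv_v, reduceCtorEq, if_false]
            exact (k₃.v .len (by decide)).trans hl₂
          · exact (k₂.trans (L'' := 3) (ys'' := [.U]) k₃).setv
          · simp; omega
          · simp; omega
          · rw [if_pos hlr]
            show s₃.ar .U t = _
            rw [U₃ t ht, U₂]
            unfold shiftR
            split_ifs
            · exact U₁ _ (by omega)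
            · rfl
        · omega
      · set s₂ := ((s₁.tick ((C 0).cost + (V Var.len).cost + 6)).setv .len
          ((V .len - C 1 : Expr).val (s₁.tick ((C 0).cost + (V Var.len).cost + 6)))
          ((V .len - C 1 : Expr).cost + 6)).tick ((A .DIR (V .len)).cost + (C 1).cost + 6) with hs₂
        have k₂ : Keeps 3 [] s₁ s₂ := (((Keeps.refl 3 [] s₁).tick _).setv).tick _
        have n₂ : s₂.n = s₁.n + 72 := rfl
        have r₂ : s₂.rd = s₁.rd := rfl
        have hl₂ : s₂.v .len = j := by simp [hs₂]; omega
        have ha₂ : s₂.v .a = s₁.v .a := by simp [hs₂]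
        have hc₂ : s₂.v .c = s₁.v .c := by simp [hs₂]
        have hd₂ : s.ar .DIR j ≠ 0 := by
          rw [← k₁.ar .DIR (by decide)]
          simpa [← hj] using hd
        have A₂ := A₁.keeps k₂
        have U₂ : s₂.ar .U = s₁.ar .U := rfl
        clear_value s₂
        generalize ha' : s₁.v .a = a' at *
        generalize hc' : s₁.v .c = c' at *
        rcases T₁ with _ | ⟨T, hlr, hD⟩ | ⟨T, hlr, hD⟩
        · omega
        · rename_i c
          refine Cmd.wp_mono (c := shiftDC) ?_ (shiftDC_spec hF A₂)
          rintro s₃ ⟨k₃, r₃, n₃, U₃⟩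
          have ha₃ : s₃.v .a = a' := (k₃.v .a (by decide)).trans ha₂
          refine ⟨⟨trivial, trivial, ?_⟩, hstep _ a' c (by have := T.sum; omega) (by omega) ?_ ?_ ?_
            ?_ ?_ ?_ T fun t ht => ?_⟩
          · show s₃.v .a + 1 < ℓ.W; have := T.sum; omega
          · simp [ha₃]
          · simp only [St.setv_v, reduceCtorEq, if_false]
            exact (k₃.v .c (by decide)).trans hc₂
          · simp only [St.setv_v, reduceCtorEq, if_false]
            exact (k₃.v .len (by decide)).trans hl₂
          · exact (k₂.trans (L'' := 3) (ys'' := [.U]) k₃).setv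
          · simp; omega
          · simp; omega
          · rw [if_neg hlr]
            show s₃.ar .U t = _
            rw [U₃ t ht, U₂]
            unfold shiftD
            split_ifs
            · rfl
            · exact U₁ _ (by omega)
    · simp only [val_C, val_V] at hlt
      obtain rfl : j = 0 := by omega
      have hle : len ≤ 2 * B.k := by have := hT.sum; omega
      have hr := Nat.mul_le_mul_right (2 * B.S) hle
      have hn := Nat.mul_le_mul_right (2200 * (B.S * B.S)) hle
      have e1 : 2 * B.k * (2 * B.S) = 4 * (B.k * B.S) := by ring
      have e2 : 2 * B.k * (2200 * (B.S * B.S)) = 4400 * (B.k * (B.S * B.S)) := by ring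
      refine ⟨k₁.tick _, ?_, ?_, fun t ht => ?_⟩
      · show s₁.rd ≤ _; simp only [Nat.sub_zero] at r₁; omega
      · simp only [St.tick_n, cost_C, cost_V, Nat.sub_zero] at n₁ ⊢; omega
      · generalize s₁.v .a = a' at *
        generalize s₁.v .c = c' at *
        cases T₁
        exact U₁ t ht
  · exact ⟨rfl, le_rfl, Keeps.refl _ _ _, by simp, by simp, hT, hU⟩

theorem minC_spec (hF : B.Fits ℓ) (hA : B.At s) :
    minC.wp ℓ (fun s' => Keeps 0 [.T] s s' ∧ s'.rd ≤ s.rd ∧ s'.n ≤ s.n + 500 * B.S ∧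
      s'.ar .T = fun t => if t < B.S + 1 then min (s.ar .T t) (s.ar .U t) else s.ar .T t) s := by
  have hS := hF.S_pos
  have hW := hF.word
  have hU := hF.U
  have hT := hF.T
  have hkS := Nat.mul_le_mul_right B.S hF.k_pos
  refine Cmd.wp_mono (c := Cmd.loop _ _ _) ?_ (loop_spec (N := B.S + 1) (L := 0) (ys := [.T])
    (k := 0) (j := 90) (fun j ar => ar .T = fun t => if t < j then min (s.ar .T t) (s.ar .U t)
      else s.ar .T t) (by decide) (by decide) ⟨trivial, trivial, ?_⟩ (by simp [hA.S]) (by omega)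
    (by simp) ?_)
  · rintro s' ⟨h, hr, hn, hF⟩
    simp only [cost_V, cost_C, cost_add] at hn
    exact ⟨h, by simpa using hr, by omega, hF⟩
  · show s.v .S + 1 < ℓ.W; rw [hA.S]; omega
  · intro j hj s' h hv hF
    have hU' : s'.ar .U = s.ar .U := h.ar .U (by decide)
    refine ⟨⟨trivial, ?_⟩, ⟨trivial, ?_⟩, fun hlt => ⟨trivial, ⟨trivial, ?_⟩, ?_,
      ((Keeps.refl _ _ _).tick _).seta, hv, le_rfl, by simp, ?_⟩,
      fun hlt => ⟨(Keeps.refl _ _ _).tick _, hv, le_rfl, by simp, ?_⟩⟩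
    · simp [hv]; omega
    · simp [hv]; omega
    · simp [hv]; omega
    · simp [hv]; omega
    · simp only [val_A, val_V, hv, hF, hU', if_neg (lt_irrefl j)] at hlt
      funext t
      simp only [val_A, val_V, St.seta_ar, if_true, St.tick_v, hv, St.tick_ar, hF, hU',
        Function.update_apply]
      split_ifs <;> first | rfl | omega | (subst_vars; omega)
    · simp only [val_A, val_V, hv, hF, hU', if_neg (lt_irrefl j)] at hlt
      simp only [St.tick_ar, hF]
      funext t
      rcases eq_or_ne t j with rfl | ht
      · simp; omega
      · split_ifs <;> first | rfl | omega

/-- The reads are at most `3 * S` for the starting edge and `4 * (k * S)` for the letters. The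
result enters `T` through a minimum, since several sketches contribute to the same edge. -/
theorem evalC_spec (hF : B.Fits ℓ) (hA : B.At s) (hZ : B.k * B.S + B.S ≤ B.Z) (hV : B.Small s)
    {i b dl : ℕ} (hi : i < B.k) (hb : b < B.k)
    (hvi : s.v .i = i) (hvb : s.v .b = b) (hdl : s.v .dl = dl) :
    (evalC B.sc).wp ℓ (fun s' => Keeps 3 [.U, .E, .X, .Y, .T, .DIR] s s' ∧
      s'.rd ≤ s.rd + 7 * (B.k * B.S) ∧ s'.n ≤ s.n + 8000 * (B.k * (B.S * B.S)) ∧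
      s'.ar .T = fun t => if t < B.S + 1 then min (s.ar .T t) (B.sketch s dl i (b + 1) t)
        else s.ar .T t) s := by
  have hS := hF.S_pos
  have hk := hF.k_pos
  have hW := hF.word
  have hkS := Nat.mul_le_mul_right B.S hk
  have hSS := Nat.mul_le_mul_right B.S hS
  have hSk := Nat.mul_le_mul_left B.k hS
  have hkSS := Nat.mul_le_mul_right (B.S * B.S) hk
  have hkSS' := Nat.mul_le_mul_left B.k hSS
  refine Cmd.wp_mono (c := traceC) ?_ (traceC_spec hF hA hi hb hvi hvb hdl)
  rintro s₁ ⟨k₁, r₁, n₁, hac, T₁⟩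
  have A₁ := hA.keeps k₁
  have hsum := T₁.sum
  have ha' := Nat.mul_le_mul_right B.S (show s₁.v .a + 1 ≤ B.k by omega)
  have hc' := Nat.mul_le_mul_right B.S (show s₁.v .c ≤ B.k by omega)
  simp only [Nat.add_mul] at ha'
  refine Cmd.wp_mono (c := loadC _ _ _) ?_ (loadC_spec (N := B.S + B.S + 1)
    (b := loDiag B.Z B.S (s₁.v .a) (s₁.v .c)) hF.μ ⟨⟨trivial, trivial, ?_⟩, trivial, ?_⟩
    (by simp [A₁.S]) ⟨⟨trivial, ⟨trivial, trivial, ?_⟩, ?_⟩, ⟨⟨trivial, trivial, ?_⟩, trivial, ?_⟩,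
    ?_⟩ (by simp [loDiag, A₁.z, A₁.S]) ?_ (by have := hF.U; omega))
  rotate_left
  · show s₁.v .S + s₁.v .S < ℓ.W; rw [A₁.S]; omega
  · show s₁.v .S + s₁.v .S + 1 < ℓ.W; rw [A₁.S]; omega
  · show s₁.v .c * s₁.v .S < ℓ.W; rw [A₁.S]; omega
  · show s₁.v .z + s₁.v .c * s₁.v .S < ℓ.W; rw [A₁.S, A₁.z]; omega
  · show s₁.v .a + 1 < ℓ.W; omega
  · show (s₁.v .a + 1) * s₁.v .S < ℓ.W; rw [A₁.S, Nat.add_mul]; omega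
  · show (s₁.v .a + 1) * s₁.v .S ≤ s₁.v .z + s₁.v .c * s₁.v .S
    rw [A₁.S, Nat.add_mul, A₁.z]; omega
  · rw [loDiag]; omega
  rintro s₂ ⟨k₂, r₂, n₂, U₂⟩
  have A₂ := A₁.keeps k₂
  have hg : s₂.g = s.g := k₂.g.trans k₁.g
  have hTH : s₂.ar .TH = s.ar .TH := (k₂.ar _ (by decide)).trans (k₁.ar _ (by decide))
  have hsk : B.sketch s₂ = B.sketch s := by funext _ _ _; simp only [Blk.sketch, hg, hTH]
  have hva : s₂.v .a = s₁.v .a := k₂.v _ (by decide)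
  have hvc : s₂.v .c = s₁.v .c := k₂.v _ (by decide)
  refine Cmd.wp_mono (c := popC _) ?_ (popC_spec (dl := dl) hF A₂ hZ (by rw [Blk.Small, hg]; exact hV) hi hb ?_
    ?_)
  · rintro s₃ ⟨k₃, r₃, n₃, U₃⟩
    refine Cmd.wp_mono (c := minC) ?_ (minC_spec hF (A₂.keeps k₃))
    rintro s₄ ⟨k₄, r₄, n₄, T₄⟩
    refine ⟨?_, by omega, ?_, ?_⟩
    · exact ((k₁.trans (L'' := 3) (ys'' := [.U, .E, .X, .Y, .T, .DIR]) k₂).trans (L'' := 3)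
        (ys'' := [.U, .E, .X, .Y, .T, .DIR]) k₃).trans k₄
    · simp only [cost_V, cost_C, cost_add, cost_sub, cost_mul] at n₂
      rw [Nat.one_mul] at hSS hkSS'
      omega
    · rw [T₄, k₃.ar .T (by decide), k₂.ar .T (by decide), k₁.ar .T (by decide)]
      funext t
      split_ifs with ht
      · rw [U₃ t (by omega), hsk]
      · rfl
  · rw [hTH, k₂.ar .DIR (by decide), k₂.v .len (by decide), hva, hvc]
    exact T₁
  · intro t ht
    rw [U₂, hsk, hva, hvc]
    simp only [if_pos (show t < B.S + B.S + 1 by omega), k₁.g]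
    -- The trace has stopped at index `0`, where a sketch value is by definition a segment of the
    -- boundary of the block.
    rcases Nat.mul_eq_zero.1 hac with h | h
    · rw [h, Blk.sketch, thVal, sketchVal]
    · rw [h]
      rcases s₁.v .a with _ | a
      · rw [Blk.sketch, thVal, sketchVal]
      · rw [Blk.sketch, thVal, sketchVal]

end AsymRAM

/-! ### Moving thresholds across a tile. -/

theorem tileFn_congr_le {hm wn H Wd : ℕ} {wt : ℕ → ℕ → ℕ} {s s' : (ℕ → ℕ) × (ℕ → ℕ)}
    (h : ∀ t ≤ H + Wd, s.1 t = s'.1 t ∧ s.2 t = s'.2 t) : ∀ t ≤ H + Wd,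
      (tileFn hm wn wt H Wd s).1 t = (tileFn hm wn wt H Wd s').1 t ∧
      (tileFn hm wn wt H Wd s).2 t = (tileFn hm wn wt H Wd s').2 t := by
  refine grid_rel (f := cellFn hm wn wt H) (g := cellFn hm wn wt H) (H := H) (Wd := Wd)
    (fun _ _ s s' => ∀ t ≤ H + Wd, s.1 t = s'.1 t ∧ s.2 t = s'.2 t) ?_ (fun _ _ _ _ h => h) h
  intro r c s s' hr hc h t ht
  have h1 := h (H + c - r) (by omega)
  have h2 := h (H + c - r - 1) (by omega)
  have h3 := h (H + c - r + 1) (by omega)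
  simp only [cellFn, Function.update_apply, h1, h2, h3]
  split_ifs
  · exact ⟨rfl, rfl⟩
  · exact h t ht

/-- Since `E` is monotone, the `t` with `lo + E t < TH q` form an initial segment of the window, so
a single new threshold `lo + t₀` at its end describes them. Thresholds outside `(lo, lo + 2 S]`
compare in the same way with all of the window and need no change. -/
theorem remap_of {S lo n : ℕ} {E TH TH' : ℕ → ℕ} (hE : Monotone E) (hE2 : E (S + S) = S + S)
    (h1 : ∀ q < n, lo < TH q → TH q ≤ lo + (S + S) → ∃ t₀ ≤ S + S, TH' q = lo + t₀ ∧
      TH q ≤ lo + E t₀ ∧ ∀ t < t₀, lo + E t < TH q)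
    (h2 : ∀ q < n, ¬ (lo < TH q ∧ TH q ≤ lo + (S + S)) → TH' q = TH q) :
    Remap S lo n E TH TH' := by
  intro q hq dl
  by_cases h : lo < TH q ∧ TH q ≤ lo + (S + S)
  · obtain ⟨t₀, ht, e, h3, h4⟩ := h1 q hq h.1 h.2
    rw [e]
    split_ifs with h5
    · constructor
      · intro h6
        exact h4 _ (by omega)
      · intro h6
        by_contra h7
        have := hE (show t₀ ≤ dl - lo by omega)
        omega
    · omega
  · rw [h2 q hq h]
    split_ifs with h5
    · have := hE (show dl - lo ≤ S + S by omega)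
      omega
    · rfl

namespace AsymRAM

open AsymRAM.Expr

variable {ℓ : Lay} {B : Blk} {s : St}

/-- Move the thresholds across the tile in row `i` and column `b`. -/
def remapC : Cmd :=
  .loop .q (V .i * V .k + V .b + C 1)
    (.ite (V .lo) (A .TH (V .q))
      (.ite (A .TH (V .q)) (V .lo + V .S + V .S + C 1)
        (.set .u (A .TH (V .q) - V .lo) ;; .set .t (C 0) ;;
          .whileLt (A .E (V .t)) (V .u) (.set .t (V .t + C 1)) ;;
          .put .TH (V .q) (V .lo + V .t)) .skip) .skip)

theorem remapC_spec (hF : B.Fits ℓ) (hA : B.At s) {i b lo : ℕ} (hi : i < B.k) (hb : b < B.k)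
    (hvi : s.v .i = i) (hvb : s.v .b = b) (hlo : s.v .lo = lo) (hloZ : lo ≤ B.Z + B.k * B.S)
    (hE : s.ar .E (B.S + B.S) = B.S + B.S) :
    remapC.wp ℓ (fun s' => Keeps 4 [.TH] s s' ∧ s'.rd ≤ s.rd ∧
      s'.n ≤ s.n + 1000 * (B.k * B.k * B.S) ∧
      (∀ q < i * B.k + b + 1, lo < s.ar .TH q → s.ar .TH q ≤ lo + (B.S + B.S) →
        ∃ t₀ ≤ B.S + B.S, s'.ar .TH q = lo + t₀ ∧ s.ar .TH q ≤ lo + s.ar .E t₀ ∧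
          ∀ t < t₀, lo + s.ar .E t < s.ar .TH q) ∧
      (∀ q < i * B.k + b + 1, ¬ (lo < s.ar .TH q ∧ s.ar .TH q ≤ lo + (B.S + B.S)) →
        s'.ar .TH q = s.ar .TH q)) s := by
  have hS := hF.S_pos
  have hk := hF.k_pos
  have hW := hF.word
  have hEs := hF.E
  have hTH := hF.TH
  have hkS := Nat.mul_le_mul_right B.S hk
  have hkk : 1 ≤ B.k * B.k := Nat.mul_pos hk hk
  have hikb : i * B.k + b + 1 ≤ B.k * B.k := by
    have := Nat.mul_le_mul_right B.k hi
    simp only [Nat.succ_eq_add_one, Nat.add_mul] at this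
    omega
  refine Cmd.wp_mono (c := Cmd.loop _ _ _) ?_ (loop_spec (N := i * B.k + b + 1) (L := 4)
    (ys := [.TH]) (k := 0) (j := 320 + 120 * B.S)
    (fun j ar => (∀ q < j, lo < s.ar .TH q → s.ar .TH q ≤ lo + (B.S + B.S) →
        ∃ t₀ ≤ B.S + B.S, ar .TH q = lo + t₀ ∧ s.ar .TH q ≤ lo + s.ar .E t₀ ∧
          ∀ t < t₀, lo + s.ar .E t < s.ar .TH q) ∧
      (∀ q < j, ¬ (lo < s.ar .TH q ∧ s.ar .TH q ≤ lo + (B.S + B.S)) →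
        ar .TH q = s.ar .TH q) ∧ ∀ q, j ≤ q → ar .TH q = s.ar .TH q)
    (by decide) (by decide) ⟨⟨⟨trivial, trivial, ?_⟩, trivial, ?_⟩, trivial, ?_⟩
    (by simp [hvi, hvb, hA.k]) (by omega) ⟨fun q hq => by omega, fun q hq => by omega,
      fun _ _ => rfl⟩ ?_)
  · rintro s' ⟨h, hr, hn, h1, h2, -⟩
    refine ⟨h, by simpa using hr, hn.trans ?_, h1, h2⟩
    simp only [cost_V, cost_C, cost_add, cost_mul]
    have h3 := Nat.mul_le_mul_right (320 + 120 * B.S + (6 + 6 + 6 + 6 + 6 + 6 + 6) + 36) hikb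
    have h4 := Nat.mul_le_mul_left (B.k * B.k) hS
    have e1 : B.k * B.k * (320 + 120 * B.S + (6 + 6 + 6 + 6 + 6 + 6 + 6) + 36)
      = 398 * (B.k * B.k * 1) + 120 * (B.k * B.k * B.S) := by ring
    omega
  · show s.v .i * s.v .k < ℓ.W; rw [hvi, hA.k]; omega
  · show s.v .i * s.v .k + s.v .b < ℓ.W; rw [hvi, hA.k, hvb]; omega
  · show s.v .i * s.v .k + s.v .b + 1 < ℓ.W; rw [hvi, hA.k, hvb]; omega
  · rintro j hj s₁ k₁ hq₁ ⟨P1, P2, P3⟩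
    have A₁ := hA.keeps k₁
    have hlo₁ : s₁.v .lo = lo := (k₁.v .lo (by decide)).trans hlo
    have hE₁ : s₁.ar .E = s.ar .E := k₁.ar .E (by decide)
    have hTj : s₁.ar .TH j = s.ar .TH j := P3 j le_rfl
    have hskip : ¬ (lo < s.ar .TH j ∧ s.ar .TH j ≤ lo + (B.S + B.S)) →
        (∀ q < j + 1, lo < s.ar .TH q → s.ar .TH q ≤ lo + (B.S + B.S) →
        ∃ t₀ ≤ B.S + B.S, s₁.ar .TH q = lo + t₀ ∧ s.ar .TH q ≤ lo + s.ar .E t₀ ∧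
          ∀ t < t₀, lo + s.ar .E t < s.ar .TH q) ∧
      (∀ q < j + 1, ¬ (lo < s.ar .TH q ∧ s.ar .TH q ≤ lo + (B.S + B.S)) →
        s₁.ar .TH q = s.ar .TH q) ∧ ∀ q, j + 1 ≤ q → s₁.ar .TH q = s.ar .TH q := by
      intro hn
      refine ⟨fun q hq h1 h2 => ?_, fun q hq h => ?_, fun q hq => P3 q (by omega)⟩
      · rcases Nat.lt_succ_iff_lt_or_eq.1 hq with hq | rfl
        · exact P1 q hq h1 h2
        · exact absurd ⟨h1, h2⟩ hn
      · rcases Nat.lt_succ_iff_lt_or_eq.1 hq with hq | rfl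
        · exact P2 q hq h
        · exact hTj
    refine ⟨trivial, ⟨trivial, ?_⟩, fun hlt => ⟨⟨trivial, ?_⟩, ⟨⟨⟨trivial, trivial, ?_⟩, trivial,
      ?_⟩, trivial, ?_⟩, fun hlt' => ⟨⟨⟨trivial, ?_⟩, trivial, ?_⟩, trivial, ?_⟩, fun hlt' => ?_⟩,
      fun hlt => ?_⟩
    · simp only [val_V]; omega
    · simp only [val_V, St.tick_v]; omega
    · show s₁.v .lo + s₁.v .S < ℓ.W; rw [hlo₁, A₁.S]; omega
    · show s₁.v .lo + s₁.v .S + s₁.v .S < ℓ.W; rw [hlo₁, A₁.S]; omega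
    · show s₁.v .lo + s₁.v .S + s₁.v .S + 1 < ℓ.W; rw [hlo₁, A₁.S]; omega
    · simp only [val_V, St.tick_v]; omega
    · exact le_of_lt hlt
    · simp only [val_V, val_A, val_add, val_C, St.tick_v, St.tick_ar, hlo₁, A₁.S, hq₁, hTj]
        at hlt hlt'
      have hu : s.ar .TH j - lo ≤ B.S + B.S := by omega
      -- A linear search for `t₀`; it ends at `2 * S` at the latest, because `E` fixes that
      -- position.
      refine Cmd.wp_while (j := B.S + B.S) (fun r s' => ∃ t, r = B.S + B.S - t ∧ t ≤ B.S + B.S ∧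
        Keeps 0 [] s₁ s' ∧ s'.rd = s₁.rd ∧ s'.n ≤ s₁.n + 150 + t * 60 ∧ s'.v .t = t ∧
        s'.v .u = s.ar .TH j - lo ∧ ∀ t' < t, lo + s.ar .E t' < s.ar .TH j) ?_ ?_
      · rintro r s₂ ⟨t, rfl, ht, k₂, r₂, n₂, ht₂, hu₂, hmin⟩
        have hE₂ : s₂.ar .E = s.ar .E := (k₂.ar .E (by decide)).trans hE₁
        refine ⟨⟨trivial, ?_⟩, trivial, fun hc => ⟨⟨trivial, trivial, ?_⟩, _, ?_, t + 1, rfl, ?_,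
          (k₂.tick _).setv, r₂, ?_, ?_, ?_, ?_⟩, fun hc => ⟨trivial, ⟨trivial, trivial, ?_⟩, ?_, ?_,
          ?_, ?_, ?_, ?_⟩⟩
        · simp only [val_V]; omega
        · show s₂.v .t + 1 < ℓ.W; omega
        · have hne : t ≠ B.S + B.S := by
            rintro rfl
            simp only [val_A, val_V, ht₂, hu₂, hE₂] at hc
            omega
          omega
        · have hne : t ≠ B.S + B.S := by
            rintro rfl
            simp only [val_A, val_V, ht₂, hu₂, hE₂] at hc
            omega
          omega
        · simp; omega
        · simp [ht₂]
        · simp [hu₂]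
        · simp only [val_A, val_V, ht₂, hu₂, hE₂] at hc
          intro t' ht'
          rcases Nat.lt_succ_iff_lt_or_eq.1 ht' with ht' | rfl
          · exact hmin t' ht'
          · omega
        · show s₂.v .lo + s₂.v .t < ℓ.W; rw [k₂.v .lo (by decide), hlo₁]; omega
        · show s₂.v .q < _; rw [k₂.v .q (by decide)]; omega
        · refine Keeps.seta (Keeps.tick (k₂.mono) _)
        · exact (k₂.v .q (by decide)).trans hq₁
        · show s₂.rd ≤ _; omega
        · simp; omega
        · simp only [val_A, val_V, ht₂, hu₂, hE₂] at hc
          have hq₂ : s₂.v .q = j := (k₂.v .q (by decide)).trans hq₁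
          have hlo₂ : s₂.v .lo = lo := (k₂.v .lo (by decide)).trans hlo₁
          have hTH₂ : s₂.ar .TH = s₁.ar .TH := k₂.ar .TH (by decide)
          simp only [St.seta_ar, if_true, val_V, val_add, St.tick_v, St.tick_ar, hq₂, hlo₂, ht₂,
            hTH₂, Function.update_apply]
          refine ⟨fun q hq h1 h2 => ?_, fun q hq h => ?_, fun q hq => ?_⟩
          · rcases Nat.lt_succ_iff_lt_or_eq.1 hq with hq | rfl
            · rw [if_neg (by omega)]
              exact P1 q hq h1 h2
            · rw [if_pos rfl]
              exact ⟨t, ht, rfl, by omega, hmin⟩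
          · rcases Nat.lt_succ_iff_lt_or_eq.1 hq with hq | rfl
            · rw [if_neg (by omega)]
              exact P2 q hq h
            · omega
          · rw [if_neg (by omega)]
            exact P3 q (by omega)
      · refine ⟨0, rfl, by omega, ?_, rfl, by simp, by simp, ?_, fun t ht => by omega⟩
        · exact ((((Keeps.refl 0 [] s₁).tick _).tick _).setv).setv
        · simp [hq₁, hlo₁, hTj]
    · refine ⟨((Keeps.refl _ _ _).tick _).tick _, hq₁, le_rfl, by simp; omega, hskip ?_⟩
      simp only [val_V, val_A, val_add, val_C, St.tick_v, St.tick_ar, hlo₁, A₁.S, hq₁, hTj]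
        at hlt hlt'
      omega
    · refine ⟨(Keeps.refl _ _ _).tick _, hq₁, le_rfl, by simp; omega, hskip ?_⟩
      simp only [val_V, val_A, hlo₁, hq₁, hTj] at hlt
      omega

end AsymRAM

/-! ### The values on the top edge of a tile. -/

namespace AsymRAM

open AsymRAM.Expr

variable {ℓ : Lay} {B : Blk} {s : St} {N : ℕ → ℕ → ℕ}

/-- Compute the values on the top edge of the tile in row `i` and column `b`. -/
def collectC (sc : ℕ) : Cmd :=
  .set .lo (V .z + V .b * V .S - (V .i + C 1) * V .S) ;; .set .kap (V .lo + V .S) ;;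
  .loop .t (V .S + C 1) (.put .T (V .t) (V .inf)) ;;
  .set .dl (V .kap) ;; evalC sc ;;
  .loop .q (V .i * V .k)
    (.ite (V .kap) (A .TH (V .q))
      (.ite (A .TH (V .q)) (V .kap + V .S + C 1) (.set .dl (A .TH (V .q)) ;; evalC sc) .skip)
      .skip)

/-- The number of thresholds among the first `j` that lie on the edge after the diagonal `κ`. -/
def edgeCount (S κ : ℕ) (TH : ℕ → ℕ) (j : ℕ) : ℕ :=
  ((Finset.range j).filter fun q => κ < TH q ∧ TH q ≤ κ + S).card

theorem edgeCount_succ (S κ : ℕ) (TH : ℕ → ℕ) (j : ℕ) : edgeCount S κ TH (j + 1)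
    = edgeCount S κ TH j + if κ < TH j ∧ TH j ≤ κ + S then 1 else 0 := by
  simp only [edgeCount, Finset.range_add_one, Finset.filter_insert]
  split_ifs
  · rw [Finset.card_insert_of_notMem (by simp)]
  · rfl

/-- The parameters and the values on the boundary that a block depends on. -/
abbrev Blk.Ok (B : Blk) (s : St) (N : ℕ → ℕ → ℕ) : Prop :=
  Block B.S B.k B.inf B.Z s.g B.hm B.wn B.wt N

/-- No sketch gives less than the distance, and by `exists_sketch` one of those evaluated attains it
at each node, so the minimum is exact. The number of evaluations is one plus the number of
thresholds on the edge. -/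
theorem collectC_spec (hF : B.Fits ℓ) (hA : B.At s) (hB : B.Ok s N) (hV : B.Small s)
    {i b : ℕ} (hi : i < B.k) (hb : b < B.k) (hvi : s.v .i = i) (hvb : s.v .b = b)
    (hs : Sketches B.S B.k B.inf B.Z s.g B.hm B.wn B.wt N (s.ar .TH) i b) :
    (collectC B.sc).wp ℓ (fun s' => Keeps 5 [.U, .E, .X, .Y, .T, .DIR] s s' ∧
      s'.v .lo = loDiag B.Z B.S (i + 1) (b + 1) ∧ s'.v .kap = loDiag B.Z B.S i (b + 1) ∧
      (∀ t ≤ B.S, s'.ar .T t = N (i * B.S) (b * B.S + t)) ∧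
      s'.rd ≤ s.rd + 7 * (B.k * B.S) +
        7 * (B.k * B.S) * edgeCount B.S (loDiag B.Z B.S i (b + 1)) (s.ar .TH) (i * B.k) ∧
      s'.n ≤ s.n + 9000 * (B.k * (B.S * B.S)) + 200 * (B.k * B.k) + 8000 * (B.k * (B.S * B.S)) *
        edgeCount B.S (loDiag B.Z B.S i (b + 1)) (s.ar .TH) (i * B.k)) s := by
  have hS := hF.S_pos
  have hk := hF.k_pos
  have hW := hF.word
  have hTs := hF.T
  have hTH := hF.TH
  have hZ := hB.hZ
  have hkS := Nat.mul_le_mul_right B.S hk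
  have hSk := Nat.mul_le_mul_left B.k hS
  have hSS := Nat.mul_le_mul_right B.S hS
  have hkSS := Nat.mul_le_mul_right (B.S * B.S) hk
  have hik : i * B.k ≤ B.k * B.k := Nat.mul_le_mul_right _ hi.le
  have hiS := Nat.mul_le_mul_right B.S hi
  have hbS := Nat.mul_le_mul_right B.S hb
  simp only [Nat.succ_eq_add_one, Nat.add_mul] at hiS hbS
  set lo := loDiag B.Z B.S (i + 1) (b + 1) with hlo
  have hlo' : lo = B.Z + b * B.S - (i * B.S + B.S) := by
    rw [hlo, loDiag]; simp only [Nat.add_mul]; omega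
  have hκ : loDiag B.Z B.S i (b + 1) = lo + B.S := by
    rw [hlo', loDiag]; simp only [Nat.add_mul]; omega
  rw [hκ]
  have hmin : ∀ dl, ∀ t ≤ B.S, N (i * B.S) (b * B.S + t) ≤ B.sketch s dl i (b + 1) t :=
    fun dl t ht => (hB.sketchVal_ge hi.le hb).2 b rfl t ht
  refine ⟨⟨⟨trivial, ⟨trivial, trivial, ?_⟩, ?_⟩, ⟨⟨trivial, trivial, ?_⟩, trivial, ?_⟩, ?_⟩,
    ⟨trivial, trivial, ?_⟩, ?_⟩
  · show s.v .b * s.v .S < ℓ.W; rw [hvb, hA.S]; omega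
  · show s.v .z + s.v .b * s.v .S < ℓ.W; rw [hvb, hA.S, hA.z]; omega
  · show s.v .i + 1 < ℓ.W; rw [hvi]; omega
  · show (s.v .i + 1) * s.v .S < ℓ.W; rw [hvi, hA.S, Nat.add_mul]; omega
  · show (s.v .i + 1) * s.v .S ≤ s.v .z + s.v .b * s.v .S
    rw [hvi, hA.S, hvb, hA.z, Nat.add_mul]; omega
  · show s.v .z + s.v .b * s.v .S - (s.v .i + 1) * s.v .S + s.v .S < ℓ.W
    rw [hvi, hA.S, hvb, hA.z, Nat.add_mul]; omega
  set s₁ := (s.setv .lo ((V .z + V .b * V .S - (V .i + C 1) * V .S : Expr).val s)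
      ((V .z + V .b * V .S - (V .i + C 1) * V .S : Expr).cost + 6)).setv .kap
    ((V .lo + V .S : Expr).val (s.setv .lo ((V .z + V .b * V .S - (V .i + C 1) * V .S : Expr).val s)
      ((V .z + V .b * V .S - (V .i + C 1) * V .S : Expr).cost + 6)))
    ((V .lo + V .S : Expr).cost + 6) with hs₁
  have k₁ : Keeps 5 [] s s₁ := ((Keeps.refl 5 [] s).setv).setv
  have A₁ := hA.keeps k₁
  have lo₁ : s₁.v .lo = lo := by
    simp [hs₁, hvb, hA.S, hvi, hA.z, Nat.add_mul, hlo']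
  have kap₁ : s₁.v .kap = lo + B.S := by
    simp [hs₁, hvb, hA.S, hvi, hA.z, Nat.add_mul, hlo']
  have n₁ : s₁.n = s.n + 96 := rfl
  have r₁ : s₁.rd = s.rd := rfl
  clear_value s₁
  refine Cmd.wp_mono (c := Cmd.loop _ _ _) ?_ (fill_spec (N := B.S + 1)
    (fun j t => if t < j then B.inf else s₁.ar .T t) ⟨trivial, trivial, ?_⟩
    (by simp [A₁.S]) (by omega) (by simp) ?_)
  rotate_left
  · show s₁.v .S + 1 < ℓ.W; rw [A₁.S]; omega
  · intro j hj s' k' hv he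
    refine ⟨trivial, trivial, ?_, ?_⟩
    · simp only [val_V]; rw [hv]; omega
    · simp only [val_V]; rw [hv, (A₁.keeps k').inf]
      funext t
      simp only [Function.update_apply]
      split_ifs <;> first | rfl | omega
  rintro s₂ ⟨k₂, r₂, n₂, T₂⟩
  simp only [cost_V, cost_C, cost_add] at n₂
  have A₂ := A₁.keeps k₂
  refine ⟨trivial, ?_⟩
  set s₃ := s₂.setv .dl ((V .kap : Expr).val s₂) ((V .kap : Expr).cost + 6) with hs₃
  have k₃ : Keeps 5 [.T] s s₃ := (k₁.trans (L'' := 5) (ys'' := [.T]) k₂).setv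
  have A₃ := hA.keeps k₃
  have n₃ : s₃.n = s₂.n + 12 := rfl
  have r₃ : s₃.rd = s₂.rd := rfl
  have T₃ : s₃.ar .T = s₂.ar .T := rfl
  have lo₃ : s₃.v .lo = lo := by simp [hs₃, k₂.v .lo (by decide), lo₁]
  have kap₃ : s₃.v .kap = lo + B.S := by simp [hs₃, k₂.v .kap (by decide), kap₁]
  have dl₃ : s₃.v .dl = lo + B.S := by simp [hs₃, k₂.v .kap (by decide), kap₁]
  clear_value s₃
  have V₃ : B.Small s₃ := by rw [Blk.Small, k₃.g]; exact hV
  have hsk₃ : B.sketch s₃ = B.sketch s := by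
    funext _ _ _; simp only [Blk.sketch, k₃.g, k₃.ar .TH (by decide)]
  refine Cmd.wp_mono (c := evalC _) ?_ (evalC_spec hF A₃ hZ V₃ hi hb
    ((k₃.v .i (by decide)).trans hvi) ((k₃.v .b (by decide)).trans hvb) dl₃)
  rintro s₄ ⟨k₄, r₄, n₄, T₄⟩
  have K₄ : Keeps 5 [.U, .E, .X, .Y, .T, .DIR] s s₄ := k₃.trans k₄
  have lo₄ : s₄.v .lo = lo := (k₄.v .lo (by decide)).trans lo₃
  have kap₄ : s₄.v .kap = lo + B.S := (k₄.v .kap (by decide)).trans kap₃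
  have vi₄ : s₄.v .i = i := (K₄.v .i (by decide)).trans hvi
  have A₄ := hA.keeps K₄
  rw [hsk₃, T₃, T₂] at T₄
  -- Sketches to a top edge in row `i` pass only through tiles of the rows above, which own the
  -- first `i * k` thresholds. The term `170 * j` pays for inspecting thresholds, the terms with
  -- `edgeCount` for evaluating sketches.
  refine Cmd.wp_loop (i * B.k) (fun j s' => Keeps 4 [.U, .E, .X, .Y, .T, .DIR] s₄ s' ∧ s'.v .q = j ∧
    s'.rd ≤ s₄.rd + 7 * (B.k * B.S) * edgeCount B.S (lo + B.S) (s.ar .TH) j ∧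
    s'.n ≤ s₄.n + 12 + 170 * j +
      8000 * (B.k * (B.S * B.S)) * edgeCount B.S (lo + B.S) (s.ar .TH) j ∧
    ∀ t ≤ B.S, N (i * B.S) (b * B.S + t) ≤ s'.ar .T t ∧
      s'.ar .T t ≤ B.sketch s (lo + B.S) i (b + 1) t ∧
      ∀ q < j, lo + B.S < s.ar .TH q → s.ar .TH q ≤ lo + B.S + B.S →
        s'.ar .T t ≤ B.sketch s (s.ar .TH q) i (b + 1) t) (by omega) ?_ ?_ ?_ ?_
  · refine ⟨(Keeps.refl _ _ _).setv, by simp, ?_, ?_, fun t ht => ?_⟩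
    · simp
    · simp
    · simp only [St.setv_ar, T₄]
      rw [if_pos (by omega), if_pos (by omega)]
      have h1 := hmin (lo + B.S) t ht
      have h2 := hB.le_inf (i * B.S) (b * B.S + t)
      exact ⟨by omega, by omega, fun q hq => by omega⟩
  · rintro j s' hj ⟨k', hq, -⟩
    have A' := A₄.keeps k'
    have vi' : s'.v .i = i := (k'.v .i (by decide)).trans vi₄
    refine ⟨hq, ⟨trivial, trivial, ?_⟩, ?_⟩
    · show s'.v .i * s'.v .k < ℓ.W; rw [vi', A'.k]; omega
    · simp [vi', A'.k]
  · rintro j s₅ hj ⟨k₅, q₅, r₅, n₅, T₅⟩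
    have K₅ : Keeps 5 [.U, .E, .X, .Y, .T, .DIR] s s₅ := K₄.trans k₅
    have A₅ := hA.keeps K₅
    have TH₅ : s₅.ar .TH = s.ar .TH := K₅.ar .TH (by decide)
    have kap₅ : s₅.v .kap = lo + B.S := (k₅.v .kap (by decide)).trans kap₄
    have hsk₅ : ∀ s' : St, s'.g = s₅.g → s'.ar = s₅.ar → B.sketch s' = B.sketch s := by
      intro s' h1 h2
      funext _ _ _; simp only [Blk.sketch, h1, h2, TH₅, K₅.g]
    have hec : (V .i * V .k : Expr).cost + 12 = 30 := rfl
    rw [edgeCount_succ]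
    have hskip : ∀ s' : St, s'.v = s₅.v → s'.ar = s₅.ar → s'.g = s₅.g → s'.wr = s₅.wr →
        s'.rd = s₅.rd → s'.n ≤ s₅.n + 140 → ¬ (lo + B.S < s.ar .TH j ∧ s.ar .TH j ≤ lo + B.S + B.S) →
        s'.v .q = j ∧ Keeps 4 [.U, .E, .X, .Y, .T, .DIR] s₄ (s'.setv .q (j + 1) 24) ∧
        (s'.setv .q (j + 1) 24).v .q = j + 1 ∧
        (s'.setv .q (j + 1) 24).rd ≤ s₄.rd + 7 * (B.k * B.S) *
          (edgeCount B.S (lo + B.S) (s.ar .TH) j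
            + if lo + B.S < s.ar .TH j ∧ s.ar .TH j ≤ lo + B.S + B.S then 1 else 0) ∧
        (s'.setv .q (j + 1) 24).n ≤ s₄.n + 12 + 170 * (j + 1) + 8000 * (B.k * (B.S * B.S)) *
          (edgeCount B.S (lo + B.S) (s.ar .TH) j
            + if lo + B.S < s.ar .TH j ∧ s.ar .TH j ≤ lo + B.S + B.S then 1 else 0) ∧
        ∀ t ≤ B.S, N (i * B.S) (b * B.S + t) ≤ (s'.setv .q (j + 1) 24).ar .T t ∧
          (s'.setv .q (j + 1) 24).ar .T t ≤ B.sketch s (lo + B.S) i (b + 1) t ∧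
          ∀ q < j + 1, lo + B.S < s.ar .TH q → s.ar .TH q ≤ lo + B.S + B.S →
            (s'.setv .q (j + 1) 24).ar .T t ≤ B.sketch s (s.ar .TH q) i (b + 1) t := by
      intro s' hv har hg hw hr hn hP
      have k' : Keeps 4 [.U, .E, .X, .Y, .T, .DIR] s₄ s' :=
        ⟨fun x hx => by rw [hv]; exact k₅.v x hx, fun y hy => by rw [har]; exact k₅.ar y hy,
          hg.trans k₅.g, hw.trans k₅.wr⟩
      rw [if_neg hP]
      refine ⟨by rw [hv]; exact q₅, k'.setv, by simp, ?_, ?_, fun t ht => ?_⟩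
      · show s'.rd ≤ _; rw [Nat.add_zero]; omega
      · simp only [St.setv_n, Nat.add_zero]
        omega
      · simp only [St.setv_ar, har]
        refine ⟨(T₅ t ht).1, (T₅ t ht).2.1, fun q hq h1 h2 => ?_⟩
        rcases Nat.lt_succ_iff_lt_or_eq.1 hq with hq | rfl
        · exact (T₅ t ht).2.2 q hq h1 h2
        · exact absurd ⟨h1, h2⟩ hP
    refine ⟨trivial, ⟨trivial, ?_⟩, fun hlt => ⟨⟨trivial, ?_⟩, ⟨⟨trivial, trivial, ?_⟩, trivial,
      ?_⟩, fun hlt' => ⟨⟨trivial, ?_⟩, ?_⟩, fun hlt' => ?_⟩, fun hlt => ?_⟩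
    · simp only [val_V, St.tick_v]; omega
    · simp only [val_V, St.tick_v]; omega
    · show s₅.v .kap + s₅.v .S < ℓ.W; rw [kap₅, A₅.S]; omega
    · show s₅.v .kap + s₅.v .S + 1 < ℓ.W; rw [kap₅, A₅.S]; omega
    · simp only [val_V, St.tick_v]; omega
    · simp only [val_V, val_A, val_add, val_C, St.tick_v, St.tick_ar, kap₅, A₅.S, q₅, TH₅]
        at hlt hlt'
      have hP : lo + B.S < s.ar .TH j ∧ s.ar .TH j ≤ lo + B.S + B.S := by omega
      refine Cmd.wp_mono (c := evalC _) ?_ (evalC_spec (dl := s.ar .TH j) hF (A₅.keeps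
        (((((Keeps.refl 4 [] s₅).tick _).tick _).tick _).setv)) hZ ?_ hi hb ?_ ?_ ?_)
      · rintro s₆ ⟨k₆, r₆, n₆, T₆⟩
        have K₆ : Keeps 4 [.U, .E, .X, .Y, .T, .DIR] s₅ s₆ :=
          (((((Keeps.refl 4 [.U, .E, .X, .Y, .T, .DIR] s₅).tick _).tick _).tick _).setv).trans k₆
        rw [hsk₅ (((((s₅.tick _).tick _).tick _).setv _ _ _)) rfl rfl] at T₆
        rw [if_pos hP]
        refine ⟨?_, (k₅.trans K₆).setv, by simp, ?_, ?_, fun t ht => ?_⟩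
        · refine (k₆.v .q (by decide)).trans ?_
          simp [q₅]
        · simp only [St.setv_rd, St.tick_rd] at r₆ ⊢
          rw [Nat.mul_add, Nat.mul_one]; omega
        · simp only [St.setv_n, St.tick_n, cost_V, cost_A, cost_C, cost_add, cost_mul] at n₆ ⊢
          rw [Nat.mul_add (8000 * _), Nat.mul_one]
          omega
        · simp only [St.setv_ar, St.tick_ar] at T₆ ⊢
          simp only [T₆, if_pos (show t < B.S + 1 by omega)]
          have h1 := hmin (s.ar .TH j) t ht
          obtain ⟨h2, h3, h4⟩ := T₅ t ht
          refine ⟨by omega, by omega, fun q hq h5 h6 => ?_⟩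
          rcases Nat.lt_succ_iff_lt_or_eq.1 hq with hq | rfl
          · exact (min_le_left _ _).trans (h4 q hq h5 h6)
          · exact min_le_right _ _
      · show ∀ j, _; simp only [St.setv_g, St.tick_g, K₅.g]; exact hV
      · simp only [St.setv_v, St.tick_v, reduceCtorEq, if_false]
        exact (K₅.v .i (by decide)).trans hvi
      · simp only [St.setv_v, St.tick_v, reduceCtorEq, if_false]
        exact (K₅.v .b (by decide)).trans hvb
      · simp [q₅, TH₅]
    · simp only [val_V, val_A, val_add, val_C, St.tick_v, St.tick_ar, kap₅, A₅.S, q₅, TH₅]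
        at hlt hlt'
      exact hskip _ rfl rfl rfl rfl rfl (by simp) (by omega)
    · simp only [val_V, val_A, St.tick_v, St.tick_ar, kap₅, q₅, TH₅] at hlt
      exact hskip _ rfl rfl rfl rfl rfl (by simp) (by omega)
  · rintro s₅ ⟨k₅, q₅, r₅, n₅, T₅⟩
    refine ⟨(K₄.trans k₅).tick _, ?_, ?_, fun t ht => ?_, ?_, ?_⟩
    · exact (k₅.v .lo (by decide)).trans lo₄
    · exact (k₅.v .kap (by decide)).trans kap₄
    · show s₅.ar .T t = _
      obtain ⟨h1, h2, h3⟩ := T₅ t ht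
      refine le_antisymm ?_ h1
      rw [← hs.above b le_rfl hb t ht, hκ]
      obtain ⟨dl, hdl, e⟩ := exists_sketch (S := B.S) (k := B.k) (inf := B.inf) (Z := B.Z) (V := s.g)
        (hm := B.hm) (wn := B.wn) (wt := B.wt) (TH := s.ar .TH) (i := i) hb ht (lo + B.S)
      rw [← e]
      rcases hdl with rfl | ⟨q, hq, rfl, h4, h5⟩
      · exact h2
      · exact h3 q hq h4 h5
    · show s₅.rd ≤ _; omega
    · simp only [St.tick_n, cost_mul, cost_V]; omega

end AsymRAM

/-! ### Moving the frontier across a tile. -/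

namespace AsymRAM

open AsymRAM.Expr

variable {ℓ : Lay} {B : Blk} {s : St} {N : ℕ → ℕ → ℕ}

/-- Process the tile in row `i` and column `b` when the values on its left and top edges are
known. -/
def advanceC (sc : ℕ) : Cmd :=
  .loop .t (V .S + C 1) (.put .U (V .t) (A .L (V .t))) ;;
  .loop .t (V .S + C 1) (.put .U (V .S + V .t) (A .T (V .t))) ;;
  .loop .t (V .S + V .S + C 1) (.put .E (V .t) (V .t)) ;;
  .set .a (V .i + C 1) ;; .set .c (V .b + C 1) ;; stepC sc ;;
  .put .TH (V .i * V .k + V .b) (V .kap) ;; remapC ;;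
  .loop .t (V .S + C 1) (.put .L (V .t) (A .U (V .S + V .t)))

/-- With both input edges at hand the tile is processed once more, now with entry points, and the
thresholds are moved. The right edge goes to `L` as the left edge of the next tile. The clause about
`lo + (S + S)` serves the amortisation: a threshold is never moved to the right out of the window.
-/
theorem advanceC_spec (hF : B.Fits ℓ) (hA : B.At s) (hB : B.Ok s N)
    {i b lo : ℕ} (hi : i < B.k) (hb : b < B.k) (hvi : s.v .i = i) (hvb : s.v .b = b)
    (hlo : lo = loDiag B.Z B.S (i + 1) (b + 1))
    (hvlo : s.v .lo = lo) (hvk : s.v .kap = loDiag B.Z B.S i (b + 1))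
    (hs : Sketches B.S B.k B.inf B.Z s.g B.hm B.wn B.wt N (s.ar .TH) i b)
    (hL : ∀ t ≤ B.S, s.ar .L t = N (i * B.S + (B.S - t)) (b * B.S))
    (hT : ∀ t ≤ B.S, s.ar .T t = N (i * B.S) (b * B.S + t)) :
    (advanceC B.sc).wp ℓ (fun s' => Keeps 4 [.U, .E, .X, .Y, .TH, .L] s s' ∧
      Sketches B.S B.k B.inf B.Z s.g B.hm B.wn B.wt N (s'.ar .TH) i (b + 1) ∧
      (∀ t ≤ B.S, s'.ar .L t = N (i * B.S + (B.S - t)) ((b + 1) * B.S)) ∧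
      (∀ j ≤ B.S, s'.ar .U j = N ((i + 1) * B.S) (b * B.S + j)) ∧
      (∀ j ≤ B.S, s'.ar .U (B.S + B.S - j) = N (i * B.S + j) ((b + 1) * B.S)) ∧
      (∀ q < i * B.k, lo + (B.S + B.S) < s'.ar .TH q → lo + (B.S + B.S) < s.ar .TH q) ∧
      s'.rd ≤ s.rd + 2 * B.S ∧
      s'.n ≤ s.n + 4000 * (B.S * B.S) + 1000 * (B.k * B.k * B.S)) s := by
  have hS := hF.S_pos
  have hk := hF.k_pos
  have hW := hF.word
  have hTs := hF.T
  have hLs := hF.L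
  have hUs := hF.U
  have hEs := hF.E
  have hTH := hF.TH
  have hZ := hB.hZ
  have hkS := Nat.mul_le_mul_right B.S hk
  have hSk := Nat.mul_le_mul_left B.k hS
  have hSS := Nat.mul_le_mul_right B.S hS
  have hiS := Nat.mul_le_mul_right B.S hi
  have hbS := Nat.mul_le_mul_right B.S hb
  have hik := Nat.mul_le_mul_right B.k hi
  simp only [Nat.succ_eq_add_one, Nat.add_mul] at hiS hbS hik
  have hlo' : lo = B.Z + b * B.S - (i * B.S + B.S) := by
    rw [hlo, loDiag]; simp only [Nat.add_mul]; omega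
  have hκ : loDiag B.Z B.S i (b + 1) = lo + B.S := by
    rw [hlo', loDiag]; simp only [Nat.add_mul]; omega
  have hS1 : ∀ s' : St, B.At s' → (V .S + C 1 : Expr).ok ℓ s' := fun s' h =>
    ⟨trivial, trivial, by show s'.v .S + 1 < ℓ.W; rw [h.S]; omega⟩
  refine Cmd.wp_mono (c := Cmd.loop _ _ _) ?_ (fill_spec (N := B.S + 1)
    (fun j t => if t < j then s.ar .L t else s.ar .U t) (hS1 s hA) (by simp [hA.S]) (by omega)
    (by simp) ?_)
  rotate_left
  · intro j hj s' k' hv he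
    refine ⟨trivial, ⟨trivial, ?_⟩, ?_, ?_⟩
    · simp only [val_V]; rw [hv]; omega
    · simp only [val_V]; rw [hv]; omega
    · simp only [val_V, val_A]; rw [hv, k'.ar .L (by decide)]
      funext t
      simp only [Function.update_apply]
      split_ifs <;> first | rfl | omega | (subst_vars; rfl)
  rintro s₁ ⟨k₁, r₁, n₁, U₁⟩
  have A₁ := hA.keeps k₁
  refine Cmd.wp_mono (c := Cmd.loop _ _ _) ?_ (fill_spec (N := B.S + 1)
    (fun j t => if B.S ≤ t ∧ t < B.S + j then s₁.ar .T (t - B.S) else s₁.ar .U t)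
    (hS1 s₁ A₁) (by simp [A₁.S]) (by omega) (by funext t; rw [if_neg (by omega)]) ?_)
  rotate_left
  · intro j hj s' k' hv he
    have A' := A₁.keeps k'
    refine ⟨⟨trivial, trivial, ?_⟩, ⟨trivial, ?_⟩, ?_, ?_⟩
    · show s'.v .S + s'.v .t < ℓ.W; rw [hv, A'.S]; omega
    · simp only [val_V]; rw [hv]; omega
    · simp only [val_V, val_add]; rw [hv, A'.S]; omega
    · simp only [val_V, val_A, val_add]; rw [hv, A'.S, k'.ar .T (by decide)]
      funext t
      simp only [Function.update_apply]
      split_ifs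
      all_goals first
        | rfl
        | omega
        | (congr 1; omega)
  rintro s₂ ⟨k₂, r₂, n₂, U₂⟩
  have A₂ := A₁.keeps k₂
  refine Cmd.wp_mono (c := Cmd.loop _ _ _) ?_ (fill_spec (N := B.S + B.S + 1)
    (fun j t => if t < j then t else s₂.ar .E t)
    ⟨⟨trivial, trivial, ?_⟩, trivial, ?_⟩ (by simp [A₂.S]) (by omega) (by simp) ?_)
  rotate_left
  · show s₂.v .S + s₂.v .S < ℓ.W; rw [A₂.S]; omega
  · show s₂.v .S + s₂.v .S + 1 < ℓ.W; rw [A₂.S]; omega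
  · intro j hj s' k' hv he
    refine ⟨trivial, trivial, ?_, ?_⟩
    · simp only [val_V]; rw [hv]; omega
    · simp only [val_V]; rw [hv]
      funext t
      simp only [Function.update_apply]
      split_ifs <;> first | rfl | omega
  rintro s₃ ⟨k₃, r₃, n₃, E₃⟩
  simp only [cost_V, cost_A, cost_C, cost_add] at n₁ n₂ n₃
  have K₃ : Keeps 0 [.U, .E] s s₃ := (k₁.trans (L'' := 0) (ys'' := [.U, .E]) k₂).trans k₃
  have U₃ : ∀ t, s₃.ar .U t = if B.S ≤ t ∧ t < B.S + (B.S + 1) then s.ar .T (t - B.S) else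
      if t < B.S + 1 then s.ar .L t else s.ar .U t := by
    intro t
    rw [k₃.ar .U (by decide), U₂, U₁, k₁.ar .T (by decide)]
  have Ul : ∀ t ≤ B.S, s₃.ar .U t = N (i * B.S + (B.S - t)) (b * B.S) := by
    intro t ht
    rw [U₃]
    split_ifs with h1
    · obtain rfl : t = B.S := by omega
      rw [hT _ (by omega)]; simp
    · exact hL t ht
    · omega
  have Ut : ∀ t ≤ B.S, s₃.ar .U (B.S + t) = N (i * B.S) (b * B.S + t) := by
    intro t ht
    rw [U₃, if_pos (by omega), hT _ (by omega), Nat.add_sub_cancel_left]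
  clear U₃
  have E₃ : ∀ t ≤ B.S + B.S, s₃.ar .E t = t := by
    intro t ht; rw [E₃]; exact if_pos (by omega)
  refine ⟨⟨trivial, trivial, ?_⟩, ⟨trivial, trivial, ?_⟩, ?_⟩
  · show s₃.v .i + 1 < ℓ.W; rw [K₃.v .i (by decide), hvi]; omega
  · show s₃.v .b + 1 < ℓ.W; rw [K₃.v .b (by decide), hvb]; omega
  set s₄ := (s₃.setv .a ((V .i + C 1 : Expr).val s₃) ((V .i + C 1 : Expr).cost + 6)).setv .c
    ((V .b + C 1 : Expr).val (s₃.setv .a ((V .i + C 1 : Expr).val s₃)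
      ((V .i + C 1 : Expr).cost + 6))) ((V .b + C 1 : Expr).cost + 6) with hs₄
  have K₄ : Keeps 3 [.U, .E] s s₄ := ((K₃.mono (L' := 3) (ys' := [.U, .E])).setv).setv
  have n₄ : s₄.n = s₃.n + 48 := rfl
  have r₄ : s₄.rd = s₃.rd := rfl
  have U₄ : s₄.ar .U = s₃.ar .U := rfl
  have E₄ : s₄.ar .E = s₃.ar .E := rfl
  have a₄ : s₄.v .a = i + 1 := by simp [hs₄, K₃.v .i (by decide), hvi]
  have c₄ : s₄.v .c = b + 1 := by simp [hs₄, K₃.v .b (by decide), hvb]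
  have A₄ := hA.keeps K₄
  clear_value s₄
  have hUb : ∀ t ≤ B.S + B.S, s₄.ar .U t ≤ B.inf := by
    intro t ht
    rw [U₄]
    rcases le_total t B.S with h | h
    · rw [Ul t h]; exact hB.le_inf _ _
    · obtain ⟨t', rfl⟩ := Nat.exists_eq_add_of_le h
      rw [Ut t' (by omega)]; exact hB.le_inf _ _
  refine Cmd.wp_mono (c := stepC _) ?_ (stepC_spec hF A₄ hi hb a₄ c₄ hUb (by omega))
  rintro s₅ ⟨k₅, r₅, n₅, e₅⟩
  have K₅ : Keeps 3 [.U, .E, .X, .Y] s s₅ := K₄.trans k₅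
  have A₅ := hA.keeps K₅
  set UU := s₃.ar .U with hUU
  have eU : s₅.ar .U = tileV (B.hm i) (B.wn b) (B.wt i b) B.S B.S UU := by
    have := congrArg Prod.fst e₅
    simpa only [tileFn_fst, U₄] using this
  have eE : ∀ t ≤ B.S + B.S, s₅.ar .E t = tileE (B.hm i) (B.wn b) (B.wt i b) B.S B.S UU t := by
    intro t ht
    have := congrArg Prod.snd e₅
    simp only at this
    rw [this, U₄]
    -- The array `E` is the identity only on the window, which is all that the tile sees.
    exact (tileFn_congr_le (s := (UU, s₄.ar .E)) (s' := (UU, id))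
      (fun t ht => ⟨rfl, by simp only [E₄]; exact E₃ t ht⟩) t ht).2
  have hE2 : s₅.ar .E (B.S + B.S) = B.S + B.S := by
    rw [eE _ le_rfl]; exact tileE_of_ge _ (Or.inr le_rfl)
  have i₅ : s₅.v .i = i := (K₅.v .i (by decide)).trans hvi
  have b₅ : s₅.v .b = b := (K₅.v .b (by decide)).trans hvb
  have lo₅ : s₅.v .lo = lo := (K₅.v .lo (by decide)).trans hvlo
  have kap₅ : s₅.v .kap = lo + B.S := by rw [K₅.v .kap (by decide), hvk, hκ]
  have TH₅ : s₅.ar .TH = s.ar .TH := K₅.ar .TH (by decide)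
  refine ⟨⟨⟨trivial, trivial, ?_⟩, trivial, ?_⟩, trivial, ?_, ?_⟩
  · show s₅.v .i * s₅.v .k < ℓ.W; rw [i₅, A₅.k]; omega
  · show s₅.v .i * s₅.v .k + s₅.v .b < ℓ.W; rw [i₅, A₅.k, b₅]; omega
  · simp only [val_add, val_mul, val_V]; rw [i₅, A₅.k, b₅]; omega
  set s₆ := s₅.seta .TH ((V .i * V .k + V .b : Expr).val s₅) ((V .kap : Expr).val s₅)
    ((V .i * V .k + V .b : Expr).cost + (V .kap : Expr).cost + 12) with hs₆
  have k₆ : Keeps 3 [.TH] s₅ s₆ := (Keeps.refl _ _ _).seta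
  have n₆ : s₆.n = s₅.n + 48 := rfl
  have r₆ : s₆.rd = s₅.rd := rfl
  have TH₆ : s₆.ar .TH = Function.update (s.ar .TH) (i * B.k + b) (lo + B.S) := by
    simp [hs₆, i₅, b₅, A₅.k, kap₅, TH₅]
  have E₆ : s₆.ar .E = s₅.ar .E := k₆.ar .E (by decide)
  have A₆ := A₅.keeps k₆
  clear_value s₆
  refine Cmd.wp_mono (c := remapC) ?_ (remapC_spec (lo := lo) hF A₆ hi hb ((k₆.v .i (by decide)).trans i₅)
    ((k₆.v .b (by decide)).trans b₅) ((k₆.v .lo (by decide)).trans lo₅) (by omega)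
    (by rw [E₆]; exact hE2))
  rintro s₇ ⟨k₇, r₇, n₇, P1, P2⟩
  have A₇ := A₆.keeps k₇
  refine Cmd.wp_mono (c := Cmd.loop _ _ _) ?_ (fill_spec (N := B.S + 1)
    (fun j t => if t < j then s₇.ar .U (B.S + t) else s₇.ar .L t) (hS1 s₇ A₇)
    (by simp [A₇.S]) (by omega) (by simp) ?_)
  rotate_left
  · intro j hj s' k' hv he
    have A' := A₇.keeps k'
    refine ⟨trivial, ⟨⟨trivial, trivial, ?_⟩, ?_⟩, ?_, ?_⟩
    · show s'.v .S + s'.v .t < ℓ.W; rw [hv, A'.S]; omega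
    · simp only [val_V, val_add]; rw [hv, A'.S]; omega
    · simp only [val_V]; rw [hv]; omega
    · simp only [val_V, val_A, val_add]; rw [hv, A'.S, k'.ar .U (by decide)]
      funext t
      simp only [Function.update_apply]
      split_ifs <;> first | rfl | omega | (subst_vars; rfl)
  rintro s₈ ⟨k₈, r₈, n₈, L₈⟩
  simp only [cost_V, cost_A, cost_C, cost_add] at n₈
  have eU₇ : s₇.ar .U = tileV (B.hm i) (B.wn b) (B.wt i b) B.S B.S UU := by
    rw [k₇.ar .U (by decide), k₆.ar .U (by decide), eU]
  have heq := hB.tile_eq hi hb (U := UU)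
    (fun j hj => by rw [Ul _ (by omega)]; congr 1; omega) Ut
  have TH₈ : s₈.ar .TH = s₇.ar .TH := k₈.ar .TH (by decide)
  refine ⟨?_, ?_, fun t ht => ?_, fun j hj => ?_, fun j hj => ?_, fun q hq hlt => ?_, by omega, ?_⟩
  · exact ((K₅.trans (L'' := 4) (ys'' := [.U, .E, .X, .Y, .TH, .L]) k₆).trans (L'' := 4)
      (ys'' := [.U, .E, .X, .Y, .TH, .L]) k₇).trans k₈
  · refine Sketches.next (N := N) hB hi hb hs Ul Ut ?_
    rw [hκ, ← hlo, TH₈, ← TH₆]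
    refine remap_of (tileE_mono _) (tileE_of_ge _ (Or.inr le_rfl)) (fun q hq h1 h2 => ?_) P2
    obtain ⟨t₀, h3, h4, h5, h6⟩ := P1 q hq h1 h2
    rw [E₆] at h5 h6
    refine ⟨t₀, h3, h4, by rwa [eE t₀ h3] at h5, fun t ht => ?_⟩
    have := h6 t ht
    rwa [eE t (by omega)] at this
  · rw [L₈]
    simp only [if_pos (show t < B.S + 1 by omega), eU₇]
    have := heq.2 (B.S - t) (by omega)
    rwa [show B.S + B.S - (B.S - t) = B.S + t by omega] at this
  · rw [k₈.ar .U (by decide), eU₇]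
    exact heq.1 j hj
  · rw [k₈.ar .U (by decide), eU₇]
    exact heq.2 j hj
  -- A threshold from the window stays in the window and the others do not move, so none can get
  -- ahead of it.
  · have hq' : s₆.ar .TH q = s.ar .TH q := by rw [TH₆, Function.update_of_ne (by omega)]
    rw [TH₈] at hlt
    rw [← hq']
    by_contra hcon
    by_cases h : lo < s₆.ar .TH q
    · obtain ⟨t₀, h3, h4, -⟩ := P1 q (by omega) h (by omega)
      omega
    · rw [P2 q (by omega) (by omega)] at hlt
      omega
  · omega

end AsymRAM

/-! ### Sketches under writes to slow memory, and counting of thresholds. -/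

section Congr

variable {S k inf Z : ℕ} {V V' hm wn : ℕ → ℕ} {wt : ℕ → ℕ → ℕ → ℕ → ℕ} {N : ℕ → ℕ → ℕ}

/-- Sketches read slow memory only up to `Z + k * S + S`. The results of a block are kept behind
that, from `v2` on, so writing them does not affect the sketches that are still to be evaluated. -/
theorem sketchVal_congr_left (hVV : ∀ j ≤ Z + k * S + S, V j = V' j) (hZ : k * S + S ≤ Z)
    {l : ℕ → ℕ → Prop} [∀ a c, Decidable (l a c)] {a c : ℕ} (ha : a ≤ k) (hc : c ≤ k) :
    ∀ t ≤ S + S, sketchVal S inf Z V hm wn wt l a c t = sketchVal S inf Z V' hm wn wt l a c t := by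
  have hac := Nat.mul_le_mul_right S hc
  have haa := Nat.mul_le_mul_right S ha
  induction a generalizing c with
  | zero =>
    intro t ht
    rw [sketchVal, sketchVal]
    refine hVV _ ?_
    simp only [loDiag, Nat.add_mul]; omega
  | succ a iha =>
    induction c with
    | zero =>
      intro t ht
      rw [sketchVal, sketchVal]
      simp only [Nat.add_mul] at haa
      refine hVV _ ?_
      simp only [loDiag, Nat.add_mul]; omega
    | succ c ihc =>
      intro t ht
      simp only [Nat.add_mul] at haa hac
      have h1 := iha (c := c + 1) (by omega) hc (by rw [Nat.add_mul]; omega) (by omega)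
      have h2 := ihc (by omega) (by omega)
      rw [sketchVal, sketchVal]
      refine tileV_congr (fun t ht => ?_) t ht
      split_ifs
      · unfold shiftR; split_ifs
        · exact h2 _ (by omega)
        · rfl
      · unfold shiftD; split_ifs
        · rfl
        · exact h1 _ (by omega)

theorem Block.congr (hVV : ∀ j ≤ Z + k * S + S, V j = V' j) (h : Block S k inf Z V hm wn wt N) :
    Block S k inf Z V' hm wn wt N :=
  ⟨h.hZ, h.le_inf, fun j hj => by rw [← hVV _ (by omega)]; exact h.top j hj,
    fun i hi => by rw [← hVV _ (by omega)]; exact h.left i hi, h.dist⟩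

theorem Sketches.congr (hVV : ∀ j ≤ Z + k * S + S, V j = V' j) (hZ : k * S + S ≤ Z) {TH : ℕ → ℕ}
    {i b : ℕ} (hi : i ≤ k) (hb : b ≤ k) (hik : i < k ∨ b = 0)
    (h : Sketches S k inf Z V hm wn wt N TH i b) :
    Sketches S k inf Z V' hm wn wt N TH i b := by
  refine ⟨fun b' h1 h2 t ht => ?_, fun h1 t ht => ?_, fun b' h1 t ht => ?_⟩
  · rw [← h.above b' h1 h2 t ht]
    exact (sketchVal_congr_left hVV hZ hi h2 t (by omega)).symm
  · rw [← h.side h1 t ht]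
    exact (sketchVal_congr_left hVV hZ h1 hb _ (by omega)).symm
  · rw [← h.done b' h1 t ht]
    exact (sketchVal_congr_left hVV hZ (by omega) (by omega) t (by omega)).symm

end Congr

/-- The number of thresholds among the first `j` that lie after the diagonal `κ`. -/
def aheadCount (κ : ℕ) (TH : ℕ → ℕ) (j : ℕ) : ℕ := ((Finset.range j).filter fun q => κ < TH q).card

theorem aheadCount_le (κ : ℕ) (TH : ℕ → ℕ) (j : ℕ) : aheadCount κ TH j ≤ j :=
  (Finset.card_filter_le _ _).trans (by simp)

namespace AsymRAM

open AsymRAM.Expr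

/-- The thresholds on the current edge are behind the frontier after the tile, and by hypothesis
none comes in from behind. So `aheadCount` drops at least by the number of thresholds that were
evaluated on this edge. -/
theorem aheadCount_add_edgeCount {S κ : ℕ} {TH TH' : ℕ → ℕ} {j : ℕ}
    (h : ∀ q < j, κ + S < TH' q → κ + S < TH q) :
    aheadCount (κ + S) TH' j + edgeCount S κ TH j ≤ aheadCount κ TH j := by
  unfold aheadCount edgeCount
  rw [← Finset.card_union_of_disjoint]
  · refine Finset.card_le_card fun q hq => ?_
    simp only [Finset.mem_union, Finset.mem_filter, Finset.mem_range] at hq ⊢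
    rcases hq with ⟨hq, h1⟩ | ⟨hq, h1, h2⟩
    · have := h q hq h1
      exact ⟨hq, by omega⟩
    · exact ⟨hq, h1⟩
  · rw [Finset.disjoint_left]
    intro q hq hq'
    simp only [Finset.mem_filter, Finset.mem_range] at hq hq'
    have := h q hq.1 hq.2
    omega

/-- A command changed only slow memory and variables of level at most `L`. -/
structure Writes (L : ℕ) (s s' : St) : Prop where
  v : ∀ x : Var, L < x.lvl → s'.v x = s.v x
  ar : s'.ar = s.ar

variable {ℓ : Lay} {s : St}

/-- The rule for loops that write to slow memory. -/
theorem wloop_spec {x : Var} {L : ℕ} {e : Expr} {c : Cmd} {N k j : ℕ} (F : ℕ → ℕ → ℕ)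
    (he : ∀ s', Writes L s s' → e.ok ℓ s' ∧ e.val s' = N) (hW : N < ℓ.W) (h0 : s.g = F 0)
    (hc : ∀ i < N, ∀ s', Writes L s s' → s'.v x = i → s'.g = F i → c.wp ℓ (fun s'' =>
      Writes L s' s'' ∧ s''.v x = i ∧ s''.rd ≤ s'.rd + k ∧ s''.wr ≤ s'.wr + 1 ∧ s''.n ≤ s'.n + j ∧
      s''.g = F (i + 1)) s') (hx : x.lvl ≤ L := by decide) :
    (Cmd.loop x e c).wp ℓ (fun s' => Writes L s s' ∧ s'.rd ≤ s.rd + N * k ∧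
      s'.wr ≤ s.wr + N ∧ s'.n ≤ s.n + (N * (j + e.cost + 36) + e.cost + 24) ∧ s'.g = F N) s := by
  refine Cmd.wp_loop N (fun i s' => Writes L s s' ∧ s'.v x = i ∧ s'.rd ≤ s.rd + i * k ∧
    s'.wr ≤ s.wr + i ∧ s'.n ≤ s.n + (i * (j + e.cost + 36) + 12) ∧ s'.g = F i) hW ?_ ?_ ?_ ?_
  · exact ⟨⟨fun y hy => by rw [St.setv_v, if_neg (by rintro rfl; omega)], rfl⟩, by simp, by simp,
      by simp, by simp, h0⟩
  · rintro i s' hi ⟨h, hv, -⟩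
    exact ⟨hv, he s' h⟩
  · rintro i s' hi ⟨h, hv, hr, hw, hn, hg⟩
    refine Cmd.wp_mono (c := c) ?_ (hc i hi (s'.tick _) ⟨h.v, h.ar⟩ hv hg)
    rintro s'' ⟨h', hv', hr', hw', hn', hg'⟩
    refine ⟨hv', ⟨fun y hy => ?_, ?_⟩, by simp, ?_, ?_, ?_, hg'⟩
    · rw [St.setv_v, if_neg (by rintro rfl; omega)]
      exact (h'.v y hy).trans (h.v y hy)
    · exact h'.ar.trans h.ar
    · simp only [St.tick_rd, St.setv_rd] at hr' ⊢; rw [Nat.add_mul]; omega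
    · simp only [St.tick_wr, St.setv_wr] at hw' ⊢; omega
    · simp only [St.tick_n, St.setv_n] at hn' ⊢; rw [Nat.add_mul i 1]; omega
  · rintro s' ⟨h, -, hr, hw, hn, hg⟩
    exact ⟨⟨h.v, h.ar⟩, hr, hw, by simp only [St.tick_n]; omega, hg⟩

/-- Write to consecutive cells of slow memory. -/
def storeC (e base src : Expr) : Cmd := .loop .t e (.wrG (base + V .t) src)

theorem storeC_spec {e base src : Expr} {N b : ℕ} (f : ℕ → ℕ) (hμ : ℓ.μ = .fast)
    (he : ∀ s', Writes 0 s s' → e.ok ℓ s' ∧ e.val s' = N)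
    (hb : ∀ s', Writes 0 s s' → base.ok ℓ s' ∧ base.val s' = b) (hW : N + b < ℓ.W)
    (hs : ∀ j < N, ∀ s', Writes 0 s s' → s'.v .t = j → src.ok ℓ s' ∧ src.val s' = f j) :
    (storeC e base src).wp ℓ (fun s' => Writes 0 s s' ∧ s'.rd ≤ s.rd ∧
      s'.wr ≤ s.wr + N ∧ s'.n ≤ s.n + (N * (base.cost + src.cost + e.cost + 60) + e.cost + 24) ∧
      s'.g = fun a => if b ≤ a ∧ a < b + N then f (a - b) else s.g a) s := by
  refine Cmd.wp_mono (c := Cmd.loop _ _ _) ?_ (wloop_spec (k := 0) (j := base.cost + src.cost + 18)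
    (fun j a => if b ≤ a ∧ a < b + j then f (a - b) else s.g a) he (by omega)
    (by funext a; rw [if_neg (by omega)]) ?_)
  · rintro s' ⟨h, hr, hw, hn, hg⟩
    refine ⟨h, by omega, hw, hn.trans ?_, hg⟩
    have := Nat.mul_le_mul_left N (show base.cost + src.cost + 18 + e.cost + 36
      ≤ base.cost + src.cost + e.cost + 60 by omega)
    omega
  · intro j hj s' h hv hg
    obtain ⟨b1, b2⟩ := hb s' h
    obtain ⟨s1, s2⟩ := hs j hj s' h hv
    refine ⟨hμ, ⟨b1, trivial, ?_⟩, s1, ⟨fun _ _ => rfl, rfl⟩, hv, le_rfl, le_rfl, ?_, ?_⟩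
    · show base.val s' + s'.v .t < ℓ.W; omega
    · simp only [St.wrg_n, cost_add, cost_V]; omega
    · simp only [St.wrg_g, val_add, val_V, hv, b2, s2, hg]
      funext a
      simp only [Function.update_apply]
      split_ifs
      all_goals first
        | rfl
        | omega
        | (congr 1; omega)

end AsymRAM

/-! ### One tile of a block, with amortised cost. -/

namespace AsymRAM

open AsymRAM.Expr

variable {ℓ : Lay} {B : Blk} {s : St} {N : ℕ → ℕ → ℕ}

theorem Blk.At.of {s' : St} (h : B.At s) (hv : ∀ x : Var, 7 < x.lvl → s'.v x = s.v x)
    (hg : ∀ j < 4 + B.m + B.n, s'.g j = s.g j) : B.At s' where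
  S := (hv .S (by decide)).trans h.S
  k := (hv .k (by decide)).trans h.k
  K := (hv .K (by decide)).trans h.K
  inf := (hv .inf (by decide)).trans h.inf
  m := (hv .m (by decide)).trans h.m
  n := (hv .n (by decide)).trans h.n
  v2 := (hv .v2 (by decide)).trans h.v2
  th := (hv .th (by decide)).trans h.th
  tw := (hv .tw (by decide)).trans h.tw
  z := (hv .z (by decide)).trans h.z
  ro := (hv .ro (by decide)).trans h.ro
  co := (hv .co (by decide)).trans h.co
  xs := fun j hj => (hg _ (by omega)).trans (h.xs j hj)
  ys := fun j hj => (hg _ (by omega)).trans (h.ys j hj)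

/-- Process the tile in row `i` and column `b`, and write the values on the bottom of the block. -/
def tileStepC (sc : ℕ) : Cmd :=
  collectC sc ;; advanceC sc ;;
    .ite (V .k) (V .i + C 2) (storeC (V .S) (V .v2 + V .b * V .S) (A .U (V .t))) .skip

/-- The costs are stated with a potential: every threshold of the rows above that is still ahead has
one evaluation of a sketch paid in advance. Up to the potential, each tile then has the cost of a
single evaluation and of moving the thresholds. -/
theorem tileStepC_spec (hF : B.Fits ℓ) (hA : B.At s) (hB : B.Ok s N) (hV : B.Small s)
    {i b : ℕ} (hi : i < B.k) (hb : b < B.k) (hvi : s.v .i = i) (hvb : s.v .b = b)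
    (hs : Sketches B.S B.k B.inf B.Z s.g B.hm B.wn B.wt N (s.ar .TH) i b)
    (hL : ∀ t ≤ B.S, s.ar .L t = N (i * B.S + (B.S - t)) (b * B.S)) :
    (tileStepC B.sc).wp ℓ (fun s' => (∀ x : Var, 5 < x.lvl → s'.v x = s.v x) ∧
      (∀ a, ¬ (B.v2 + b * B.S ≤ a ∧ a < B.v2 + b * B.S + B.S) → s'.g a = s.g a) ∧
      (i + 1 = B.k → ∀ j < B.S, s'.g (B.v2 + b * B.S + j) = N (B.k * B.S) (b * B.S + j)) ∧
      Sketches B.S B.k B.inf B.Z s'.g B.hm B.wn B.wt N (s'.ar .TH) i (b + 1) ∧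
      (∀ t ≤ B.S, s'.ar .L t = N (i * B.S + (B.S - t)) ((b + 1) * B.S)) ∧
      s'.wr ≤ s.wr + (if i + 1 = B.k then B.S else 0) ∧
      s'.rd + 7 * (B.k * B.S) * aheadCount (loDiag B.Z B.S i (b + 1 + 1)) (s'.ar .TH) (i * B.k)
        ≤ s.rd + 7 * (B.k * B.S) * aheadCount (loDiag B.Z B.S i (b + 1)) (s.ar .TH) (i * B.k)
          + 9 * (B.k * B.S) ∧
      s'.n + 8000 * (B.k * (B.S * B.S)) *
          aheadCount (loDiag B.Z B.S i (b + 1 + 1)) (s'.ar .TH) (i * B.k)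
        ≤ s.n + 8000 * (B.k * (B.S * B.S)) *
          aheadCount (loDiag B.Z B.S i (b + 1)) (s.ar .TH) (i * B.k)
          + 15000 * (B.k * B.k * (B.S * B.S))) s := by
  have hS := hF.S_pos
  have hk := hF.k_pos
  have hW := hF.word
  have hUs := hF.U
  have hhi := hF.high
  have hlow := hF.low
  have hZ := hB.hZ
  have hkS := Nat.mul_le_mul_right B.S hk
  have hSk := Nat.mul_le_mul_left B.k hS
  have hiS := Nat.mul_le_mul_right B.S hi
  have hbS := Nat.mul_le_mul_right B.S hb
  simp only [Nat.succ_eq_add_one, Nat.add_mul] at hiS hbS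
  have hκ : loDiag B.Z B.S i (b + 1 + 1) = loDiag B.Z B.S i (b + 1) + B.S := by
    simp only [loDiag, Nat.add_mul]; omega
  have hκ' : loDiag B.Z B.S (i + 1) (b + 1) + B.S = loDiag B.Z B.S i (b + 1) := by
    simp only [loDiag, Nat.add_mul]; omega
  have hkk1 : 1 ≤ B.k * B.k := Nat.mul_pos hk hk
  have hSS1 : 1 ≤ B.S * B.S := Nat.mul_pos hS hS
  have hSS : B.S ≤ B.S * B.S := Nat.le_mul_of_pos_left _ hS
  have q1 : B.k * (B.S * B.S) ≤ B.k * B.k * (B.S * B.S) :=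
    Nat.mul_le_mul_right _ (Nat.le_mul_of_pos_left _ hk)
  have q2 : B.k * B.k ≤ B.k * B.k * (B.S * B.S) := Nat.le_mul_of_pos_right _ hSS1
  have q3 : B.S * B.S ≤ B.k * B.k * (B.S * B.S) := Nat.le_mul_of_pos_left _ hkk1
  have q4 : B.k * B.k * B.S ≤ B.k * B.k * (B.S * B.S) := Nat.mul_le_mul_left _ hSS
  refine Cmd.wp_mono (c := collectC _) ?_ (collectC_spec hF hA hB hV hi hb hvi hvb hs)
  rintro s₁ ⟨k₁, lo₁, kap₁, T₁, r₁, n₁⟩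
  have A₁ := hA.keeps k₁
  have TH₁ : s₁.ar .TH = s.ar .TH := k₁.ar .TH (by decide)
  refine Cmd.wp_mono (c := advanceC _) ?_ (advanceC_spec (N := N) hF A₁ (by rw [Blk.Ok, k₁.g]; exact hB)
    hi hb ((k₁.v .i (by decide)).trans hvi) ((k₁.v .b (by decide)).trans hvb) rfl lo₁ kap₁
    (by rw [k₁.g, TH₁]; exact hs) (by rw [k₁.ar .L (by decide)]; exact hL) T₁)
  rintro s₂ ⟨k₂, S₂, L₂, U₂, -, P₂, r₂, n₂⟩
  have K₂ : Keeps 5 [.U, .E, .X, .Y, .T, .DIR, .TH, .L] s s₂ := k₁.trans k₂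
  have A₂ := hA.keeps K₂
  rw [k₁.g] at S₂
  have hcount := aheadCount_add_edgeCount (S := B.S) (κ := loDiag B.Z B.S i (b + 1))
    (TH := s.ar .TH) (TH' := s₂.ar .TH) (j := i * B.k) (fun q hq h => by
      rw [← TH₁]
      have := P₂ q hq (by omega)
      omega)
  rw [← hκ] at hcount
  set c' := aheadCount (loDiag B.Z B.S i (b + 1 + 1)) (s₂.ar .TH) (i * B.k) with hc'
  set c := aheadCount (loDiag B.Z B.S i (b + 1)) (s.ar .TH) (i * B.k)
  set e := edgeCount B.S (loDiag B.Z B.S i (b + 1)) (s.ar .TH) (i * B.k)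
  -- All evaluations but one are covered by the drop of the potential. There remain `7 * (k * S)`
  -- reads for that one and `2 * S` for the letters of the tile.
  have hr : s₂.rd + 7 * (B.k * B.S) * c' ≤ s.rd + 7 * (B.k * B.S) * c + 9 * (B.k * B.S) := by
    have := Nat.mul_le_mul_left (7 * (B.k * B.S)) hcount
    rw [Nat.mul_add] at this
    omega
  have hn : s₂.n + 8000 * (B.k * (B.S * B.S)) * c' ≤ s.n + 8000 * (B.k * (B.S * B.S)) * c
      + 14200 * (B.k * B.k * (B.S * B.S)) := by
    have := Nat.mul_le_mul_left (8000 * (B.k * (B.S * B.S))) hcount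
    rw [Nat.mul_add] at this
    omega
  have i₂ : s₂.v .i = i := (K₂.v .i (by decide)).trans hvi
  have b₂ : s₂.v .b = b := (K₂.v .b (by decide)).trans hvb
  refine ⟨trivial, ⟨trivial, trivial, ?_⟩, fun hlt => ?_, fun hlt => ⟨K₂.v, ?_, ?_, ?_, L₂, ?_, hr,
    ?_⟩⟩
  · show s₂.v .i + 2 < ℓ.W; omega
  -- `k < i + 2` and `i < k` say that this is the last row, the only one whose bottom edge leaves
  -- the block.
  · simp only [val_V, val_add, val_C, i₂, A₂.k] at hlt
    refine Cmd.wp_mono (c := storeC _ _ _) ?_ (storeC_spec (N := B.S) (b := B.v2 + b * B.S)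
      (s₂.ar .U) hF.μ (fun s' h => ⟨trivial, (h.v .S (by decide)).trans A₂.S⟩) (fun s' h => ?_)
      (by omega) fun j hj s' h hv => ⟨⟨trivial, ?_⟩, ?_⟩)
    rotate_left
    · have e1 : s'.v .v2 = B.v2 := (h.v .v2 (by decide)).trans A₂.v2
      have e2 : s'.v .S = B.S := (h.v .S (by decide)).trans A₂.S
      have e3 : s'.v .b = b := (h.v .b (by decide)).trans b₂
      refine ⟨⟨trivial, ⟨trivial, trivial, ?_⟩, ?_⟩, ?_⟩
      · show s'.v .b * s'.v .S < ℓ.W; rw [e2, e3]; omega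
      · show s'.v .v2 + s'.v .b * s'.v .S < ℓ.W; rw [e1, e2, e3]; omega
      · simp [e1, e2, e3]
    · simp only [val_V]; omega
    · simp only [val_A, val_V, hv, h.ar]; rfl
    rintro s₃ ⟨h₃, r₃, w₃, n₃, g₃⟩
    simp only [St.tick_g, St.tick_rd, St.tick_n, St.tick_wr, cost_V, cost_C, cost_add, cost_A, cost_mul]
      at g₃ n₃ r₃ w₃
    have ar₃ : s₃.ar = s₂.ar := h₃.ar
    have hlow' : ∀ a, ¬ (B.v2 + b * B.S ≤ a ∧ a < B.v2 + b * B.S + B.S) → s₃.g a = s.g a := by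
      intro a ha
      rw [g₃]
      simp only [if_neg ha, K₂.g]
    refine ⟨fun x hx => (h₃.v x (by omega)).trans (K₂.v x hx), hlow', fun hik j hj => ?_, ?_,
      fun t ht => ?_, ?_, ?_, ?_⟩
    · rw [g₃]
      simp only
      rw [if_pos (by omega), Nat.add_sub_cancel_left, U₂ j hj.le, hik]
    · rw [ar₃]
      exact S₂.congr (fun j hj => (hlow' j (by omega)).symm) hZ hi.le hb (Or.inl hi)
    · rw [ar₃]; exact L₂ t ht
    · rw [if_pos (by omega), ← K₂.wr]; exact w₃
    · rw [ar₃, ← hc']; omega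
    · rw [ar₃, ← hc']; omega
  · exact fun a _ => congrFun K₂.g a
  · simp only [val_V, val_add, val_C, i₂, A₂.k] at hlt
    omega
  · rw [St.tick_g, K₂.g]; exact S₂
  · show s₂.wr ≤ _; rw [K₂.wr]; omega
  · simp only [St.tick_n, St.tick_ar, cost_V, cost_C, cost_add, ← hc']; omega

end AsymRAM

/-! ### Rows of tiles, and whole blocks. -/

namespace AsymRAM

open AsymRAM.Expr

variable {ℓ : Lay} {B : Blk} {s : St} {N : ℕ → ℕ → ℕ}

/-- Process the tiles in row `i`. -/
def rowC (sc : ℕ) : Cmd :=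
  loadC .L (V .S + C 1) (V .z - (V .i + C 1) * V .S) ;; .loop .b (V .k) (tileStepC sc) ;;
  storeC (V .S + C 1) (V .v2 + V .K + V .K - (V .i + C 1) * V .S) (A .L (V .t))

/-- Right edges of consecutive rows share a corner, hence `S + 1` values are written. The clause for
addresses at or behind the corner says that it is rewritten with its distance and that what earlier
rows stored beyond it stays. -/
theorem rowC_spec (hF : B.Fits ℓ) (hA : B.At s) (hB : B.Ok s N) (hV : B.Small s)
    {i : ℕ} (hi : i < B.k) (hvi : s.v .i = i)
    (hs : Sketches B.S B.k B.inf B.Z s.g B.hm B.wn B.wt N (s.ar .TH) i 0) :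
    (rowC B.sc).wp ℓ (fun s' => (∀ x : Var, 6 < x.lvl → s'.v x = s.v x) ∧
      (∀ a < B.v2, s'.g a = s.g a) ∧
      (∀ j, B.v2 + 2 * (B.k * B.S) ≤ j + i * B.S → s'.g j = 
        if j + i * B.S ≤ B.v2 + 2 * (B.k * B.S) then N (i * B.S) (B.k * B.S) else s.g j) ∧
      (∀ t ≤ B.S, s'.g (B.v2 + (2 * (B.k * B.S) - (i + 1) * B.S + t))
        = N (i * B.S + (B.S - t)) (B.k * B.S)) ∧
      (i + 1 = B.k → ∀ j < B.k * B.S, s'.g (B.v2 + j) = N (B.k * B.S) j) ∧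
      Sketches B.S B.k B.inf B.Z s'.g B.hm B.wn B.wt N (s'.ar .TH) (i + 1) 0 ∧
      s'.wr ≤ s.wr + (B.S + 1) + (if i + 1 = B.k then B.k * B.S else 0) ∧
      s'.rd ≤ s.rd + 20 * (B.k * B.k * B.k * B.S) ∧
      s'.n ≤ s.n + 30000 * (B.k * B.k * B.k * (B.S * B.S))) s := by
  have hS := hF.S_pos
  have hk := hF.k_pos
  have hW := hF.word
  have hUs := hF.U
  have hLs := hF.L
  have hhi := hF.high
  have hlow := hF.low
  have hZ := hB.hZ
  have hkS := Nat.mul_le_mul_right B.S hk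
  have hSk := Nat.mul_le_mul_left B.k hS
  have hiS := Nat.mul_le_mul_right B.S hi
  simp only [Nat.succ_eq_add_one, Nat.add_mul] at hiS
  have hik : i * B.k ≤ B.k * B.k := Nat.mul_le_mul_right _ hi.le
  have hkk1 : 1 ≤ B.k * B.k := Nat.mul_pos hk hk
  have hkkk1 : 1 ≤ B.k * B.k * B.k := Nat.mul_pos hkk1 hk
  have hSS1 : 1 ≤ B.S * B.S := Nat.mul_pos hS hS
  have hSS : B.S ≤ B.S * B.S := Nat.le_mul_of_pos_left _ hS
  have q1 : B.S ≤ B.k * B.k * B.k * B.S := Nat.le_mul_of_pos_left _ hkkk1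
  have q2 : B.k * (B.k * B.S) ≤ B.k * B.k * B.k * B.S := by
    rw [← Nat.mul_assoc]
    exact Nat.mul_le_mul_right _ (Nat.le_mul_of_pos_right _ hk)
  have q3 : B.S * B.S ≤ B.k * B.k * B.k * (B.S * B.S) := Nat.le_mul_of_pos_left _ hkkk1
  have q4 : B.k ≤ B.k * B.k * B.k * (B.S * B.S) :=
    (Nat.le_mul_of_pos_left _ hkk1).trans (Nat.le_mul_of_pos_right _ hSS1)
  refine Cmd.wp_mono (c := loadC _ _ _) ?_ (loadC_spec (N := B.S + 1)
    (b := B.Z - (i + 1) * B.S) hF.μ ⟨trivial, trivial, ?_⟩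
    (by simp [hA.S]) ⟨trivial, ⟨⟨trivial, trivial, ?_⟩, trivial, ?_⟩, ?_⟩
    (by simp [hA.z, hA.S, hvi]) (by rw [Nat.add_mul]; omega) (by omega))
  rotate_left
  · show s.v .S + 1 < ℓ.W; rw [hA.S]; omega
  · show s.v .i + 1 < ℓ.W; omega
  · show (s.v .i + 1) * s.v .S < ℓ.W; rw [hvi, hA.S, Nat.add_mul]; omega
  · show (s.v .i + 1) * s.v .S ≤ s.v .z; rw [hvi, hA.S, hA.z, Nat.add_mul]; omega
  rintro s₁ ⟨k₁, r₁, n₁, L₁⟩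
  simp only [cost_V, cost_C, cost_add, cost_mul, cost_sub] at n₁
  have A₁ := hA.keeps k₁
  have i₁ : s₁.v .i = i := (k₁.v .i (by decide)).trans hvi
  refine Cmd.wp_loop B.k (fun b s' => (∀ x : Var, 6 < x.lvl → s'.v x = s.v x) ∧ s'.v .b = b ∧
      (∀ a, ¬ (B.v2 ≤ a ∧ a < B.v2 + b * B.S) → s'.g a = s.g a) ∧
      (i + 1 = B.k → ∀ j < b * B.S, s'.g (B.v2 + j) = N (B.k * B.S) j) ∧
      Sketches B.S B.k B.inf B.Z s'.g B.hm B.wn B.wt N (s'.ar .TH) i b ∧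
      (∀ t ≤ B.S, s'.ar .L t = N (i * B.S + (B.S - t)) (b * B.S)) ∧
      s'.wr ≤ s.wr + (if i + 1 = B.k then b * B.S else 0) ∧
      s'.rd + 7 * (B.k * B.S) * aheadCount (loDiag B.Z B.S i (b + 1)) (s'.ar .TH) (i * B.k)
        ≤ s₁.rd + 7 * (B.k * B.S) * (B.k * B.k) + b * (9 * (B.k * B.S)) ∧
      s'.n + 8000 * (B.k * (B.S * B.S)) *
          aheadCount (loDiag B.Z B.S i (b + 1)) (s'.ar .TH) (i * B.k)
        ≤ s₁.n + 12 + 8000 * (B.k * (B.S * B.S)) * (B.k * B.k)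
          + b * (15000 * (B.k * B.k * (B.S * B.S)) + 60)) (by omega) ?_ ?_ ?_ ?_
  -- The initial potential of a row: at most `k * k` thresholds. From here the factor `k ^ 3 * S`
  -- for the reads of a row arises, as each of them may cost one evaluation with `O(k * S)` reads.
  · have hc : aheadCount (loDiag B.Z B.S i (0 + 1)) (s₁.ar .TH) (i * B.k) ≤ B.k * B.k :=
      (aheadCount_le _ _ _).trans hik
    have h1 := Nat.mul_le_mul_left (7 * (B.k * B.S)) hc
    have h2 := Nat.mul_le_mul_left (8000 * (B.k * (B.S * B.S))) hc
    refine ⟨fun x hx => ?_, by simp, fun a _ => ?_, fun _ j hj => by simp at hj, ?_, fun t ht => ?_,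
      ?_, ?_, ?_⟩
    · rw [St.setv_v, if_neg (by rintro rfl; exact absurd hx (by decide))]
      exact k₁.v x (by omega)
    · exact congrFun k₁.g a
    · show Sketches _ _ _ _ s₁.g _ _ _ _ (s₁.ar .TH) _ _
      rw [k₁.g, k₁.ar .TH (by decide)]; exact hs
    · show s₁.ar .L t = _
      rw [L₁]
      simp only [if_pos (show t < B.S + 1 by omega), Nat.zero_mul]
      rw [← hB.left _ (by omega)]
      congr 1
      rw [Nat.add_mul]; omega
    · rw [St.setv_wr, k₁.wr]; omega
    · simp only [St.setv_rd, St.setv_ar, Nat.zero_mul]; omega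
    · simp only [St.setv_n, St.setv_ar, Nat.zero_mul]; omega
  · rintro b s' hb ⟨hv, hvb, -⟩
    exact ⟨hvb, trivial, (hv .k (by decide)).trans hA.k⟩
  · rintro b s₂ hb ⟨v₂, b₂, g₂, o₂, S₂, L₂, w₂, r₂, n₂⟩
    have hbS := Nat.mul_le_mul_right B.S hb
    simp only [Nat.succ_eq_add_one, Nat.add_mul] at hbS
    have glow : ∀ a < B.v2, s₂.g a = s.g a := fun a ha => g₂ a (by omega)
    have A₂ : B.At (s₂.tick ((V .k).cost + 12)) :=
      hA.of (fun x hx => v₂ x (by omega)) (fun j hj => glow j (by omega))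
    refine Cmd.wp_mono (c := tileStepC _) ?_ (tileStepC_spec (N := N) hF A₂
      (hB.congr fun j hj => (glow j (by omega)).symm)
      (fun j h1 h2 => by rw [St.tick_g, glow j (by omega)]; exact hV j h1 h2) hi hb
      ((v₂ .i (by decide)).trans hvi) b₂ S₂ L₂)
    rintro s₃ ⟨v₃, g₃, o₃, S₃, L₃, w₃, r₃, n₃⟩
    simp only [St.tick_v, St.tick_g, St.tick_ar, St.tick_rd, St.tick_n, St.tick_wr, cost_V]
      at v₃ g₃ w₃ r₃ n₃
    refine ⟨(v₃ .b (by decide)).trans b₂, fun x hx => ?_, by simp, fun a ha => ?_,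
      fun hik j hj => ?_, S₃, L₃, ?_, ?_, ?_⟩
    · rw [St.setv_v, if_neg (by rintro rfl; exact absurd hx (by decide))]
      exact (v₃ x (by omega)).trans (v₂ x hx)
    · rw [Nat.add_mul] at ha
      rw [St.setv_g, g₃ a (by omega), g₂ a (by omega)]
    · rw [Nat.add_mul] at hj
      rw [St.setv_g]
      by_cases h : j < b * B.S
      · rw [g₃ _ (by omega)]
        exact o₂ hik j h
      · obtain ⟨j', rfl⟩ := Nat.exists_eq_add_of_le (not_lt.1 h)
        rw [← Nat.add_assoc]
        exact o₃ hik j' (by omega)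
    · rw [St.setv_wr, Nat.add_mul]
      split_ifs at w₂ w₃ ⊢ <;> omega
    · simp only [St.setv_rd, St.setv_ar]
      rw [Nat.add_mul]; omega
    · simp only [St.setv_n, St.setv_ar]
      rw [Nat.add_mul b 1]; omega
  · rintro s₂ ⟨v₂, b₂, g₂, o₂, S₂, L₂, w₂, r₂, n₂⟩
    have glow : ∀ a < B.v2, s₂.g a = s.g a := fun a ha => g₂ a (by omega)
    have A₂ : B.At (s₂.tick ((V .k).cost + 12)) :=
      hA.of (fun x hx => v₂ x (by omega)) (fun j hj => glow j (by omega))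
    refine Cmd.wp_mono (c := storeC _ _ _) ?_ (storeC_spec (N := B.S + 1)
      (b := B.v2 + (2 * (B.k * B.S) - (i + 1) * B.S)) (s₂.ar .L) hF.μ (fun s' h => ?_)
      (fun s' h => ?_) (by omega) fun j hj s' h hv => ⟨⟨trivial, ?_⟩, ?_⟩)
    rotate_left
    · have e2 : s'.v .S = B.S := (h.v .S (by decide)).trans A₂.S
      refine ⟨⟨trivial, trivial, ?_⟩, ?_⟩
      · show s'.v .S + 1 < ℓ.W; rw [e2]; omega
      · simp [e2]
    · have e1 : s'.v .v2 = B.v2 := (h.v .v2 (by decide)).trans A₂.v2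
      have e2 : s'.v .S = B.S := (h.v .S (by decide)).trans A₂.S
      have e3 : s'.v .i = i := (h.v .i (by decide)).trans ((v₂ .i (by decide)).trans hvi)
      have e4 : s'.v .K = B.k * B.S := (h.v .K (by decide)).trans A₂.K
      refine ⟨⟨⟨⟨trivial, trivial, ?_⟩, trivial, ?_⟩, ⟨⟨trivial, trivial, ?_⟩, trivial, ?_⟩, ?_⟩, ?_⟩
      · show s'.v .v2 + s'.v .K < ℓ.W; rw [e1, e4]; omega
      · show s'.v .v2 + s'.v .K + s'.v .K < ℓ.W; rw [e1, e4]; omega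
      · show s'.v .i + 1 < ℓ.W; rw [e3]; omega
      · show (s'.v .i + 1) * s'.v .S < ℓ.W; rw [e2, e3, Nat.add_mul]; omega
      · show (s'.v .i + 1) * s'.v .S ≤ s'.v .v2 + s'.v .K + s'.v .K
        rw [e1, e2, e3, e4, Nat.add_mul]; omega
      · simp only [val_sub, val_add, val_mul, val_V, val_C, e1, e2, e3, e4, Nat.add_mul]; omega
    · simp only [val_V]; omega
    · simp only [val_A, val_V, hv, h.ar]; rfl
    rintro s₃ ⟨h₃, r₃, w₃, n₃, g₃⟩
    simp only [St.tick_g, St.tick_rd, St.tick_n, St.tick_wr, cost_V, cost_C, cost_add, cost_A,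
      cost_mul, cost_sub] at g₃ n₃ r₃ w₃
    have ar₃ : s₃.ar = s₂.ar := h₃.ar
    simp only [Nat.add_mul i 1] at g₃ ⊢
    have glow₃ : ∀ a < B.v2, s₃.g a = s.g a := by
      intro a ha
      rw [g₃]
      simp only [if_neg (show ¬ (B.v2 + (2 * (B.k * B.S) - (i * B.S + 1 * B.S)) ≤ a ∧
        a < B.v2 + (2 * (B.k * B.S) - (i * B.S + 1 * B.S)) + (B.S + 1)) by omega)]
      exact glow a ha
    refine ⟨fun x hx => (h₃.v x (by omega)).trans (v₂ x hx), glow₃, fun j hj => ?_, fun t ht => ?_,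
      fun hik j hj => ?_, ?_, ?_, ?_, ?_⟩
    · rw [g₃]
      simp only
      split_ifs with h1 h2 h2
      · rw [show j - (B.v2 + (2 * (B.k * B.S) - (i * B.S + 1 * B.S))) = B.S by omega, L₂ _ le_rfl]
        simp
      · omega
      · omega
      · exact g₂ j (by omega)
    · rw [g₃]
      simp only
      rw [if_pos (by omega), show B.v2 + (2 * (B.k * B.S) - (i * B.S + 1 * B.S) + t)
        - (B.v2 + (2 * (B.k * B.S) - (i * B.S + 1 * B.S))) = t by omega, L₂ t ht]
    · rw [g₃]
      have : i * B.S + 1 * B.S = B.k * B.S := by rw [← hik, Nat.add_mul]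
      simp only
      rw [if_neg (by omega)]
      exact o₂ hik j hj
    · rw [ar₃]
      exact Sketches.congr (V := s.g) (fun j hj => (glow₃ j (by omega)).symm) hZ hi (Nat.zero_le _) (Or.inr rfl)
        (Sketches.next_row hB (S₂.congr (fun j hj => glow j (by omega)) hZ hi.le le_rfl (Or.inl hi)))
    · split_ifs at w₂ ⊢ <;> omega
    · have e1 : 7 * (B.k * B.S) * (B.k * B.k) = 7 * (B.k * B.k * B.k * B.S) := by ring
      have e2 : B.k * (9 * (B.k * B.S)) = 9 * (B.k * (B.k * B.S)) := by ring
      omega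
    · have e1 : 8000 * (B.k * (B.S * B.S)) * (B.k * B.k)
        = 8000 * (B.k * B.k * B.k * (B.S * B.S)) := by ring
      have e2 : B.k * (15000 * (B.k * B.k * (B.S * B.S)) + 60)
        = 15000 * (B.k * B.k * B.k * (B.S * B.S)) + 60 * B.k := by ring
      omega

/-- Process a block. -/
def blockC (sc : ℕ) : Cmd :=
  .loop .i (V .k) (rowC sc) ;;
  .loop .t (V .K + V .K + C 1) (.rdG .u (V .v2 + V .t) ;; .wrG (V .z - V .K + V .t) (V .u))

/-- Every sketch starts on the old boundary, which therefore must survive until the last tile. The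
new boundary is collected from `v2` on, in the order of diagonals, and copied over the old one at
the end; this costs only a constant factor in writes. -/
theorem blockC_spec (hF : B.Fits ℓ) (hA : B.At s) (hB : B.Ok s N) (hV : B.Small s) :
    (blockC B.sc).wp ℓ (fun s' => (∀ x : Var, 7 < x.lvl → s'.v x = s.v x) ∧
      (∀ a < B.v2, s'.g a = if B.Z ≤ a + B.k * B.S ∧ a ≤ B.Z + B.k * B.S then
        (if a ≤ B.Z then N (B.k * B.S) (a + B.k * B.S - B.Z)
          else N (B.Z + B.k * B.S - a) (B.k * B.S)) else s.g a) ∧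
      s'.wr ≤ s.wr + 6 * (B.k * B.S) ∧
      s'.rd ≤ s.rd + 25 * (B.k * B.k * B.k * B.k * B.S) ∧
      s'.n ≤ s.n + 40000 * (B.k * B.k * B.k * B.k * (B.S * B.S))) s := by
  have hS := hF.S_pos
  have hk := hF.k_pos
  have hW := hF.word
  have hhi := hF.high
  have hlow := hF.low
  have hZ := hB.hZ
  have hkS := Nat.mul_le_mul_right B.S hk
  have hSk := Nat.mul_le_mul_left B.k hS
  have hkkk1 : 1 ≤ B.k * B.k * B.k := Nat.mul_pos (Nat.mul_pos hk hk) hk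
  have hSS1 : 1 ≤ B.S * B.S := Nat.mul_pos hS hS
  have hSS : B.S ≤ B.S * B.S := Nat.le_mul_of_pos_left _ hS
  have q1 : B.k * B.S ≤ B.k * B.k * B.k * B.k * B.S :=
    Nat.mul_le_mul_right _ (Nat.le_mul_of_pos_left _ hkkk1)
  have q2 : B.k * B.k * B.k * B.k * B.S ≤ B.k * B.k * B.k * B.k * (B.S * B.S) :=
    Nat.mul_le_mul_left _ hSS
  refine Cmd.wp_loop B.k (fun i s' => (∀ x : Var, 7 < x.lvl → s'.v x = s.v x) ∧ s'.v .i = i ∧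
      (∀ a < B.v2, s'.g a = s.g a) ∧
      (0 < i → ∀ j ≤ 2 * (B.k * B.S), 2 * (B.k * B.S) ≤ j + i * B.S →
        s'.g (B.v2 + j) = N (2 * (B.k * B.S) - j) (B.k * B.S)) ∧
      (i = B.k → ∀ j < B.k * B.S, s'.g (B.v2 + j) = N (B.k * B.S) j) ∧
      Sketches B.S B.k B.inf B.Z s'.g B.hm B.wn B.wt N (s'.ar .TH) i 0 ∧
      s'.wr ≤ s.wr + i * (B.S + 1) + (if i = B.k then B.k * B.S else 0) ∧
      s'.rd ≤ s.rd + i * (20 * (B.k * B.k * B.k * B.S)) ∧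
      s'.n ≤ s.n + 12 + i * (30000 * (B.k * B.k * B.k * (B.S * B.S)) + 60)) (by omega) ?_ ?_ ?_ ?_
  · refine ⟨fun x hx => ?_, by simp, fun a _ => rfl, fun h => by omega, fun h => by omega,
      Block.sketches_zero hB _, ?_, ?_, ?_⟩
    · rw [St.setv_v, if_neg (by rintro rfl; exact absurd hx (by decide))]
    · simp only [St.setv_wr]; omega
    · simp
    · simp
  · rintro i s' hb ⟨hv, hvi, -⟩
    exact ⟨hvi, trivial, (hv .k (by decide)).trans hA.k⟩
  · rintro i s₁ hi ⟨v₁, i₁, g₁, o₁, -, S₁, w₁, r₁, n₁⟩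
    have hiS := Nat.mul_le_mul_right B.S hi
    simp only [Nat.succ_eq_add_one, Nat.add_mul] at hiS
    have A₁ : B.At (s₁.tick ((V .k).cost + 12)) :=
      hA.of (fun x hx => v₁ x (by omega)) (fun j hj => g₁ j (by omega))
    refine Cmd.wp_mono (c := rowC _) ?_ (rowC_spec (N := N) hF A₁
      (hB.congr fun j hj => (g₁ j (by omega)).symm)
      (fun j h1 h2 => by rw [St.tick_g, g₁ j (by omega)]; exact hV j h1 h2) hi i₁ S₁)
    rintro s₂ ⟨v₂, g₂, h₂, t₂, o₂, S₂, w₂, r₂, n₂⟩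
    simp only [St.tick_v, St.tick_g, St.tick_rd, St.tick_n, St.tick_wr, cost_V]
      at v₂ g₂ h₂ w₂ r₂ n₂
    refine ⟨(v₂ .i (by decide)).trans i₁, fun x hx => ?_, by simp, fun a ha => ?_,
      fun _ j hj hj' => ?_, ?_, S₂, ?_, ?_, ?_⟩
    · rw [St.setv_v, if_neg (by rintro rfl; exact absurd hx (by decide))]
      exact (v₂ x (by omega)).trans (v₁ x hx)
    · exact (g₂ a ha).trans (g₁ a ha)
    · rw [St.setv_g]
      rw [Nat.add_mul] at hj'
      by_cases h : 2 * (B.k * B.S) ≤ j + i * B.S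
      · rw [h₂ _ (by omega)]
        split_ifs with h3
        · congr 1; omega
        · exact o₁ (by rcases i with _ | i; · simp at h3; omega
                       · omega) j hj h
      · have := t₂ (j + i * B.S + B.S - 2 * (B.k * B.S)) (by omega)
        rw [Nat.add_mul] at this
        rw [show B.v2 + j = B.v2 + (2 * (B.k * B.S) - (i * B.S + 1 * B.S)
          + (j + i * B.S + B.S - 2 * (B.k * B.S))) by omega, this]
        congr 1; omega
    · exact fun h j hj => o₂ h j hj
    · rw [St.setv_wr, Nat.add_mul i 1]
      split_ifs at w₁ w₂ ⊢ <;> omega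
    · simp only [St.setv_rd]
      rw [Nat.add_mul i 1]; omega
    · simp only [St.setv_n]
      rw [Nat.add_mul i 1]; omega
  · rintro s₁ ⟨v₁, i₁, g₁, o₁, p₁, -, w₁, r₁, n₁⟩
    have o₁ := o₁ hk
    have p₁ := p₁ rfl
    rw [if_pos rfl] at w₁
    have A₁ : B.At (s₁.tick ((V .k).cost + 12)) :=
      hA.of (fun x hx => v₁ x (by omega)) (fun j hj => g₁ j (by omega))
    -- The target ends before `v2`, where the source begins, so the copy never reads what it has
    -- written.
    refine Cmd.wp_mono (c := Cmd.loop _ _ _) ?_ (wloop_spec (N := B.k * B.S + B.k * B.S + 1) (L := 0)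
      (k := 1) (j := 66) (fun j a => if B.Z - B.k * B.S ≤ a ∧ a < B.Z - B.k * B.S + j then
        s₁.g (B.v2 + (a - (B.Z - B.k * B.S))) else s₁.g a) (fun s' h => ?_) (by omega) ?_
      (fun j hj s' h hv hg => ?_))
    rotate_left
    · have e4 : s'.v .K = B.k * B.S := (h.v .K (by decide)).trans A₁.K
      refine ⟨⟨⟨trivial, trivial, ?_⟩, trivial, ?_⟩, ?_⟩
      · show s'.v .K + s'.v .K < ℓ.W; omega
      · show s'.v .K + s'.v .K + 1 < ℓ.W; omega
      · simp [e4]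
    · funext a
      rw [if_neg (by omega)]; rfl
    · have e1 : s'.v .v2 = B.v2 := (h.v .v2 (by decide)).trans A₁.v2
      have e2 : s'.v .z = B.Z := (h.v .z (by decide)).trans A₁.z
      have e4 : s'.v .K = B.k * B.S := (h.v .K (by decide)).trans A₁.K
      refine ⟨hF.μ, ⟨trivial, trivial, ?_⟩, hF.μ, ⟨⟨trivial, trivial, ?_⟩, trivial, ?_⟩, trivial,
        ⟨fun x hx => ?_, rfl⟩, ?_, le_rfl, le_rfl, ?_, ?_⟩
      · show s'.v .v2 + s'.v .t < ℓ.W; omega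
      · simp [Op.ok, e2, e4]; omega
      · simp [e2, e4, hv, Op.ok]; show _ < ℓ.W; omega
      · rw [St.wrg_v, St.rdg_v, if_neg (by rintro rfl; exact absurd hx (by decide))]
      · simp [hv]
      · simp
      · simp only [St.wrg_g, St.rdg_g, val_add, val_sub, val_V, St.rdg_v, if_true, reduceCtorEq, if_false, e1, e2, e4,
          hv, hg]
        funext a
        simp only [Function.update_apply]
        split_ifs
        all_goals first
          | rfl
          | omega
          | (congr 1; omega)
    rintro s₂ ⟨h₂, r₂, w₂, n₂, g₂⟩
    simp only [St.tick_rd, St.tick_n, St.tick_wr, cost_V, cost_C, cost_add] at n₂ r₂ w₂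
    refine ⟨fun x hx => (h₂.v x (by omega)).trans (v₁ x hx), fun a ha => ?_, ?_, ?_, ?_⟩
    · rw [g₂]
      simp only
      by_cases h : B.Z ≤ a + B.k * B.S ∧ a ≤ B.Z + B.k * B.S
      · rw [if_pos (by omega), if_pos h]
        split_ifs with h1
        · rcases Nat.lt_or_ge a B.Z with h3 | h3
          · rw [p₁ _ (by omega)]; congr 1; omega
          · rw [o₁ _ (by omega) (by omega)]
            congr 1 <;> omega
        · rw [o₁ _ (by omega) (by omega)]; congr 1; omega
      · rw [if_neg (by omega), if_neg h]
        exact g₁ a ha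
    · have e1 : B.k * (B.S + 1) = B.k * B.S + B.k := by ring
      omega
    · have e1 : B.k * (20 * (B.k * B.k * B.k * B.S)) = 20 * (B.k * B.k * B.k * B.k * B.S) := by ring
      omega
    · have e1 : B.k * (30000 * (B.k * B.k * B.k * (B.S * B.S)) + 60)
        = 30000 * (B.k * B.k * B.k * B.k * (B.S * B.S)) + 60 * B.k := by ring
      omega

end AsymRAM

/-! ### The sweep over all blocks of the padded grid. -/

/-- A problem with the parameters of the algorithm: `k × k` tiles of side `S` form a block. -/
structure Prob where
  x : List ℕ
  y : List ℕ
  sc : ℕ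
  S : ℕ
  k : ℕ

namespace Prob

variable (P : Prob)

abbrev m : ℕ := P.x.length
abbrev n : ℕ := P.y.length

/-- The side of a block. -/
def K : ℕ := P.k * P.S

/-- The number of rows of blocks. -/
def nbr : ℕ := P.m / P.K + 1

/-- The number of columns of blocks. -/
def nbc : ℕ := P.n / P.K + 1

/-- The address that belongs to the diagonal of the top left corner. -/
def Z : ℕ := 4 + P.m + P.n + P.nbr * P.K + P.S

/-- The end of the frontier in slow memory. -/
def v2 : ℕ := P.Z + P.nbc * P.K + P.S + 1

/-- The distances of prefixes, with lengths beyond the ends of the strings. -/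
def D (r c : ℕ) : ℕ := dp P.sc P.x P.y (min r P.m) (min c P.n)

/-- The block in row `i` and column `j`. -/
def blk (i j : ℕ) : AsymRAM.Blk where
  S := P.S
  k := P.k
  inf := P.m + P.n
  m := P.m
  n := P.n
  sc := P.sc
  Z := P.Z + j * P.K - i * P.K
  ro := i * P.K
  co := j * P.K
  v2 := P.v2
  xs := fun a => P.x.getD a 0
  ys := fun a => P.y.getD a 0

theorem D_le (r c : ℕ) : P.D r c ≤ P.m + P.n :=
  (dp_le_add _ _).trans (Nat.add_le_add (min_le_right _ _) (min_le_right _ _))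

/-- Beyond the end of a string, distances are copied from the left or from above. So the grid can be
padded to whole blocks without special cases, and this is the recurrence that `pick` implements. -/
theorem D_succ (r c : ℕ) : P.D (r + 1) (c + 1) =
    if r < P.m then if c < P.n then min (min (P.D r (c + 1) + 1) (P.D (r + 1) c + 1))
      (P.D r c + if P.x.getD r 0 = P.y.getD c 0 then 0 else P.sc)
      else P.D (r + 1) c else P.D r (c + 1) := by
  unfold D
  split_ifs with h1 h2 h3
  · rw [min_eq_left h1, min_eq_left h2, min_eq_left h1.le, min_eq_left h2.le, dp, if_pos h3]
  · rw [min_eq_left h1, min_eq_left h2, min_eq_left h1.le, min_eq_left h2.le, dp, if_neg h3]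
  · rw [min_eq_right (show P.n ≤ c + 1 by omega), min_eq_right (show P.n ≤ c by omega)]
  · rw [min_eq_right (show P.m ≤ r + 1 by omega), min_eq_right (show P.m ≤ r by omega)]

/-- The values on the frontier before the block in row `i` and column `j` is processed. -/
structure Front (i j : ℕ) (g : ℕ → ℕ) : Prop where
  below : ∀ c ≤ j * P.K, g (P.Z + c - (i + 1) * P.K) = P.D ((i + 1) * P.K) c
  left : ∀ r, i * P.K ≤ r → r ≤ (i + 1) * P.K → g (P.Z + j * P.K - r) = P.D r (j * P.K)
  above : ∀ c, j * P.K ≤ c → c ≤ P.nbc * P.K → g (P.Z + c - i * P.K) = P.D (i * P.K) c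
  rest : ∀ r, (i + 1) * P.K ≤ r → r ≤ P.nbr * P.K → g (P.Z - r) = P.D r 0
  le : ∀ a, 4 + P.m + P.n ≤ a → a < P.v2 → g a ≤ P.m + P.n

variable {P}

theorem Front.next_row {i : ℕ} {g : ℕ → ℕ} (h : P.Front i P.nbc g) (hi : i + 1 < P.nbr) :
    P.Front (i + 1) 0 g := by
  have h1 := Nat.mul_le_mul_right P.K hi
  have e : (i + 1 + 1) * P.K = (i + 1) * P.K + P.K := by ring
  refine ⟨fun c hc => ?_, fun r h1 h2 => ?_, fun c _ hc => h.below c hc, fun r h1 h2 =>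
    h.rest r (by omega) h2, h.le⟩
  · obtain rfl : c = 0 := by simpa using hc
    exact h.rest _ (by omega) h1
  · simpa using h.rest r h1 (h2.trans ‹_›)

/-- The frontier is stored by global diagonals; moving the origin to the corner of the block turns
the parts `left` and `above` of the frontier into its boundary. -/
theorem blk_ok {i j : ℕ} {g : ℕ → ℕ} (hi : i < P.nbr) (hj : j < P.nbc) (h : P.Front i j g) :
    Block P.S P.k (P.m + P.n) (P.blk i j).Z g (P.blk i j).hm (P.blk i j).wn (P.blk i j).wt
      (fun r c => P.D (i * P.K + r) (j * P.K + c)) := by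
  have h1 := Nat.mul_le_mul_right P.K hi
  have h2 := Nat.mul_le_mul_right P.K hj
  simp only [Nat.succ_eq_add_one, Nat.add_mul] at h1 h2
  have hK : P.k * P.S = P.K := rfl
  have hZ : P.Z = 4 + P.m + P.n + P.nbr * P.K + P.S := rfl
  have hZ' : (P.blk i j).Z = P.Z + j * P.K - i * P.K := rfl
  refine ⟨by omega, fun _ _ => P.D_le _ _, fun c hc => ?_, fun r hr => ?_, fun a c ha hc => ?_⟩
  · have := h.above (j * P.K + c) (by omega) (by omega)
    rw [hZ', show P.Z + j * P.K - i * P.K + c = P.Z + (j * P.K + c) - i * P.K by omega, this]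
    simp
  · have := h.left (i * P.K + r) (by omega) (by rw [Nat.add_mul]; omega)
    rw [hZ', show P.Z + j * P.K - i * P.K - r = P.Z + j * P.K - (i * P.K + r) by omega, this]
    simp
  · intro r c' hr hc'
    have := P.D_succ (i * P.K + (a * P.S + r)) (j * P.K + (c * P.S + c'))
    simp only [Nat.add_assoc] at this ⊢
    rw [this]
    have e1 : (r < (P.blk i j).hm a) ↔ i * P.K + (a * P.S + r) < P.m := by
      show r < P.m - (i * P.K + a * P.S) ↔ _; omega
    have e2 : (c' < (P.blk i j).wn c) ↔ j * P.K + (c * P.S + c') < P.n := by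
      show c' < P.n - (j * P.K + c * P.S) ↔ _; omega
    have e3 : (P.blk i j).wt a c r c' = if P.x.getD (i * P.K + (a * P.S + r)) 0
        = P.y.getD (j * P.K + (c * P.S + c')) 0 then 0 else P.sc := by
      simp only [AsymRAM.Blk.wt, AsymRAM.letterW, blk, Nat.add_assoc]
    simp only [e1, e2, e3]

/-- The old left and top boundary of a block and the new bottom and right boundary occupy the same
diagonals, so the frontier is updated in place. -/
theorem Front.next {i j : ℕ} {g g' : ℕ → ℕ} (hi : i < P.nbr) (hj : j < P.nbc)
    (h : P.Front i j g)
    (hg : ∀ a < P.v2, g' a = if (P.blk i j).Z ≤ a + P.K ∧ a ≤ (P.blk i j).Z + P.K then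
        (if a ≤ (P.blk i j).Z then P.D (i * P.K + P.K) (j * P.K + (a + P.K - (P.blk i j).Z))
          else P.D (i * P.K + ((P.blk i j).Z + P.K - a)) (j * P.K + P.K)) else g a) :
    P.Front i (j + 1) g' := by
  have h1 := Nat.mul_le_mul_right P.K hi
  have h2 := Nat.mul_le_mul_right P.K hj
  simp only [Nat.succ_eq_add_one, Nat.add_mul, Nat.one_mul] at h1 h2
  have hZ : P.Z = 4 + P.m + P.n + P.nbr * P.K + P.S := rfl
  have hv : P.v2 = P.Z + P.nbc * P.K + P.S + 1 := rfl
  have hZ' : (P.blk i j).Z = P.Z + j * P.K - i * P.K := rfl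
  rw [hZ'] at hg
  constructor
  · intro c hc
    have hb := h.below c
    simp only [Nat.add_mul, Nat.one_mul] at hc hb ⊢
    rw [hg _ (by omega)]
    by_cases h3 : j * P.K ≤ c
    · rw [if_pos (by omega), if_pos (by omega)]
      congr 1; omega
    · rw [if_neg (by omega)]
      exact hb (by omega)
  · intro r hr hr'
    simp only [Nat.add_mul, Nat.one_mul] at hr' ⊢
    rw [hg _ (by omega), if_pos (by omega)]
    split_ifs with h3 <;> (congr 1 <;> omega)
  · intro c hc hc'
    simp only [Nat.add_mul, Nat.one_mul] at hc ⊢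
    have ha := h.above c
    rw [hg _ (by omega)]
    split_ifs with h3 h4
    · congr 1 <;> omega
    · congr 1 <;> omega
    · exact ha (by omega) hc'
  · intro r hr hr'
    have hb := h.rest r hr hr'
    simp only [Nat.add_mul, Nat.one_mul] at hr
    rw [hg _ (by omega)]
    split_ifs with h3 h4
    · congr 1 <;> omega
    · congr 1 <;> omega
    · exact hb
  · intro a h3 h4
    rw [hg a h4]
    split_ifs
    · exact P.D_le _ _
    · exact P.D_le _ _
    · exact h.le a h3 h4

end Prob

namespace AsymRAM

open AsymRAM.Expr

/-- Process all blocks. -/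
def sweepC (sc : ℕ) : Cmd :=
  .loop .bi (V .nbr) (.set .ro (V .bi * V .K) ;;
    .loop .bj (V .nbc) (.set .co (V .bj * V .K) ;; .set .z (V .vb + V .co - V .ro) ;; blockC sc))

variable {ℓ : Lay} {P : Prob} {s : St}

/-- The layout has room for the arrays, and words are long enough. -/
structure _root_.Prob.Fits (P : Prob) (ℓ : Lay) : Prop where
  μ : ℓ.μ = .fast
  S_pos : 1 ≤ P.S
  k_pos : 1 ≤ P.k
  sc_le : P.sc ≤ 2
  U : 2 * P.S + 1 ≤ ℓ.sz .U
  E : 2 * P.S + 1 ≤ ℓ.sz .E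
  L : P.S + 1 ≤ ℓ.sz .L
  T : P.S + 1 ≤ ℓ.sz .T
  X : P.S ≤ ℓ.sz .X
  Y : P.S ≤ ℓ.sz .Y
  TH : P.k * P.k ≤ ℓ.sz .TH
  DIR : 2 * P.k ≤ ℓ.sz .DIR
  word : 100 + 6 * P.v2 + 2 * (P.k * P.k) + 8 * P.K < ℓ.W

/-- The state contains the parameters and the strings. -/
structure _root_.Prob.At (P : Prob) (s : St) : Prop where
  S : s.v .S = P.S
  k : s.v .k = P.k
  K : s.v .K = P.K
  inf : s.v .inf = P.m + P.n
  m : s.v .m = P.m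
  n : s.v .n = P.n
  v2 : s.v .v2 = P.v2
  th : s.v .th = P.S
  tw : s.v .tw = P.S
  vb : s.v .vb = P.Z
  nbr : s.v .nbr = P.nbr
  nbc : s.v .nbc = P.nbc
  xs : ∀ j < P.m, s.g (4 + j) = P.x.getD j 0
  ys : ∀ j < P.n, s.g (4 + P.m + j) = P.y.getD j 0

theorem _root_.Prob.At.of {s' : St} (h : P.At s) (hv : ∀ x : Var, 10 < x.lvl → s'.v x = s.v x)
    (hg : ∀ j < 4 + P.m + P.n, s'.g j = s.g j) : P.At s' where
  S := (hv .S (by decide)).trans h.S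
  k := (hv .k (by decide)).trans h.k
  K := (hv .K (by decide)).trans h.K
  inf := (hv .inf (by decide)).trans h.inf
  m := (hv .m (by decide)).trans h.m
  n := (hv .n (by decide)).trans h.n
  v2 := (hv .v2 (by decide)).trans h.v2
  th := (hv .th (by decide)).trans h.th
  tw := (hv .tw (by decide)).trans h.tw
  vb := (hv .vb (by decide)).trans h.vb
  nbr := (hv .nbr (by decide)).trans h.nbr
  nbc := (hv .nbc (by decide)).trans h.nbc
  xs := fun j hj => (hg _ (by omega)).trans (h.xs j hj)
  ys := fun j hj => (hg _ (by omega)).trans (h.ys j hj)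

theorem _root_.Prob.Fits.blk (hF : P.Fits ℓ) {i j : ℕ} (hi : i < P.nbr) (hj : j < P.nbc) :
    (P.blk i j).Fits ℓ where
  μ := hF.μ
  S_pos := hF.S_pos
  k_pos := hF.k_pos
  sc_le := hF.sc_le
  U := hF.U
  E := hF.E
  L := hF.L
  T := hF.T
  X := hF.X
  Y := hF.Y
  TH := hF.TH
  DIR := hF.DIR
  low := by
    have h1 := Nat.mul_le_mul_right P.K hi
    simp only [Nat.succ_eq_add_one, Nat.add_mul, Nat.one_mul] at h1
    show 4 + P.m + P.n + P.K + P.S ≤ P.Z + j * P.K - i * P.K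
    have hZ : P.Z = 4 + P.m + P.n + P.nbr * P.K + P.S := rfl
    omega
  high := by
    have h2 := Nat.mul_le_mul_right P.K hj
    simp only [Nat.succ_eq_add_one, Nat.add_mul, Nat.one_mul] at h2
    show P.Z + j * P.K - i * P.K + P.K + P.S < P.v2
    have hv : P.v2 = P.Z + P.nbc * P.K + P.S + 1 := rfl
    omega
  word := by
    have hW := hF.word
    have h1 := Nat.mul_le_mul_right P.K hi
    have h2 := Nat.mul_le_mul_right P.K hj
    simp only [Nat.succ_eq_add_one, Nat.add_mul, Nat.one_mul] at h1 h2
    have hZ : P.Z = 4 + P.m + P.n + P.nbr * P.K + P.S := rfl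
    have hv : P.v2 = P.Z + P.nbc * P.K + P.S + 1 := rfl
    show 100 + (P.m + P.n) + P.m + P.n + (P.Z + j * P.K - i * P.K) + i * P.K + j * P.K + P.v2
      + 2 * (P.k * P.k) + 8 * P.K < ℓ.W
    omega

/-- The answer stands on the diagonal of the lower right corner of the padded grid. -/
theorem sweepC_spec (hF : P.Fits ℓ) (hA : P.At s) (h0 : P.Front 0 0 s.g) :
    (sweepC P.sc).wp ℓ (fun s' => (∀ x : Var, 10 < x.lvl → s'.v x = s.v x) ∧
      s'.g (P.Z + P.nbc * P.K - P.nbr * P.K) = dp P.sc P.x P.y P.m P.n ∧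
      s'.wr ≤ s.wr + P.nbr * P.nbc * (6 * (P.k * P.S)) ∧
      s'.rd ≤ s.rd + P.nbr * P.nbc * (25 * (P.k * P.k * P.k * P.k * P.S)) ∧
      s'.n ≤ s.n + P.nbr * P.nbc * (50000 * (P.k * P.k * P.k * P.k * (P.S * P.S)))) s := by
  have hW := hF.word
  have hZ : P.Z = 4 + P.m + P.n + P.nbr * P.K + P.S := rfl
  have hv : P.v2 = P.Z + P.nbc * P.K + P.S + 1 := rfl
  have hS := hF.S_pos
  have hk := hF.k_pos
  have hK : 1 ≤ P.K := Nat.mul_pos hk hS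
  have hbr : P.nbr ≤ P.nbr * P.K := Nat.le_mul_of_pos_right _ hK
  have hbc : P.nbc ≤ P.nbc * P.K := Nat.le_mul_of_pos_right _ hK
  set w₀ := 6 * (P.k * P.S) with hw₀
  set r₀ := 25 * (P.k * P.k * P.k * P.k * P.S) with hr₀
  set u₀ := P.k * P.k * P.k * P.k * (P.S * P.S) with hu₀
  have hu : 1 ≤ u₀ := Nat.mul_pos (Nat.mul_pos (Nat.mul_pos (Nat.mul_pos hk hk) hk) hk)
    (Nat.mul_pos hS hS)
  have hnbr : 1 ≤ P.nbr := Nat.succ_pos _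
  have hnbc : 1 ≤ P.nbc := Nat.succ_pos _
  refine Cmd.wp_loop P.nbr (fun i s' => (∀ x : Var, 10 < x.lvl → s'.v x = s.v x) ∧ s'.v .bi = i ∧
      (∀ j < 4 + P.m + P.n, s'.g j = s.g j) ∧ (i < P.nbr → P.Front i 0 s'.g) ∧
      (i = P.nbr → P.Front (i - 1) P.nbc s'.g) ∧
      s'.wr ≤ s.wr + i * (P.nbc * w₀) ∧ s'.rd ≤ s.rd + i * (P.nbc * r₀) ∧
      s'.n ≤ s.n + 12 + i * (P.nbc * (40000 * u₀ + 300) + 200)) (by omega) ?_ ?_ ?_ ?_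
  · refine ⟨fun x hx => ?_, by simp, fun j _ => rfl, fun _ => h0, fun h => by omega, by simp,
      by simp, by simp⟩
    rw [St.setv_v, if_neg (by rintro rfl; exact absurd hx (by decide))]
  · rintro i s' hi ⟨hv, hvi, -⟩
    exact ⟨hvi, trivial, (hv .nbr (by decide)).trans hA.nbr⟩
  · rintro i s₁ hi ⟨v₁, i₁, g₁, f₁, -, w₁, r₁, n₁⟩
    have hi1 := Nat.mul_le_mul_right P.K hi
    simp only [Nat.succ_eq_add_one, Nat.add_mul, Nat.one_mul] at hi1
    have K₁ : s₁.v .K = P.K := (v₁ .K (by decide)).trans hA.K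
    refine ⟨⟨trivial, trivial, ?_⟩, ?_⟩
    · show s₁.v .bi * s₁.v .K < ℓ.W; rw [i₁, K₁]; omega
    set s₂ := (s₁.tick ((V .nbr).cost + 12)).setv .ro
      ((V .bi * V .K : Expr).val (s₁.tick ((V .nbr).cost + 12))) ((V .bi * V .K : Expr).cost + 6)
      with hs₂
    have v₂ : ∀ x : Var, 9 < x.lvl → s₂.v x = s₁.v x := fun x hx => by
      rw [hs₂, St.setv_v, if_neg (by rintro rfl; exact absurd hx (by decide))]; rfl
    have g₂ : s₂.g = s₁.g := rfl
    have ro₂ : s₂.v .ro = i * P.K := by simp [hs₂, i₁, K₁]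
    have n₂ : s₂.n = s₁.n + 42 := rfl
    have w₂ : s₂.wr = s₁.wr := rfl
    have r₂ : s₂.rd = s₁.rd := rfl
    clear_value s₂
    refine Cmd.wp_loop P.nbc (fun j s' => (∀ x : Var, 9 < x.lvl → s'.v x = s₂.v x) ∧ s'.v .bj = j ∧
      s'.v .ro = i * P.K ∧
      (∀ j < 4 + P.m + P.n, s'.g j = s.g j) ∧ P.Front i j s'.g ∧
      s'.wr ≤ s.wr + i * (P.nbc * w₀) + j * w₀ ∧ s'.rd ≤ s.rd + i * (P.nbc * r₀) + j * r₀ ∧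
      s'.n ≤ s.n + 12 + i * (P.nbc * (40000 * u₀ + 300) + 200) + 100 + j * (40000 * u₀ + 300))
      (by omega) ?_ ?_ ?_ ?_
    · refine ⟨fun x hx => ?_, by simp, by simp [ro₂], fun j hj => ?_, ?_, ?_, ?_, ?_⟩
      · rw [St.setv_v, if_neg (by rintro rfl; exact absurd hx (by decide))]
      · rw [St.setv_g, g₂]; exact g₁ j hj
      · rw [St.setv_g, g₂]; exact f₁ hi
      · simp only [St.setv_wr]; omega
      · simp only [St.setv_rd]; omega
      · simp only [St.setv_n]; omega
    · rintro j s' hj ⟨hv, hvj, -⟩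
      refine ⟨hvj, trivial, ?_⟩
      simp only [val_V]
      rw [hv .nbc (by decide), v₂ .nbc (by decide), v₁ .nbc (by decide), hA.nbc]
    · rintro j s₃ hj ⟨v₃, j₃, ro₃, g₃, f₃, w₃, r₃, n₃⟩
      have hj1 := Nat.mul_le_mul_right P.K hj
      simp only [Nat.succ_eq_add_one, Nat.add_mul, Nat.one_mul] at hj1
      have V₃ : ∀ x : Var, 10 < x.lvl → s₃.v x = s.v x := fun x hx => by
        rw [v₃ x (by omega), v₂ x (by omega), v₁ x hx]
      have A₃ : P.At s₃ := hA.of V₃ g₃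
      refine ⟨⟨trivial, trivial, ?_⟩, ⟨⟨trivial, trivial, ?_⟩, trivial, ?_⟩, ?_⟩
      · show s₃.v .bj * s₃.v .K < ℓ.W; rw [j₃, A₃.K]; omega
      · show s₃.v .vb + s₃.v .bj * s₃.v .K < ℓ.W; rw [j₃, A₃.K, A₃.vb]; omega
      · show s₃.v .ro ≤ s₃.v .vb + s₃.v .bj * s₃.v .K; rw [j₃, A₃.K, A₃.vb, ro₃]; omega
      set s₄ := ((s₃.tick ((V .nbc).cost + 12)).setv .co
        ((V .bj * V .K : Expr).val (s₃.tick ((V .nbc).cost + 12)))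
        ((V .bj * V .K : Expr).cost + 6)) with hs₄
      set s₅ := s₄.setv .z ((V .vb + V .co - V .ro : Expr).val s₄)
        ((V .vb + V .co - V .ro : Expr).cost + 6) with hs₅
      have v₅ : ∀ x : Var, 8 < x.lvl → s₅.v x = s₃.v x := fun x hx => by
        rw [hs₅, St.setv_v, if_neg (by rintro rfl; exact absurd hx (by decide)), hs₄, St.setv_v,
          if_neg (by rintro rfl; exact absurd hx (by decide))]; rfl
      have ro₅ : s₅.v .ro = i * P.K := by simp [hs₅, hs₄, ro₃]
      have co₅ : s₅.v .co = j * P.K := by simp [hs₅, hs₄, j₃, A₃.K]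
      have z₅ : s₅.v .z = P.Z + j * P.K - i * P.K := by
        simp [hs₅, hs₄, j₃, A₃.K, A₃.vb, ro₃]
      have g₅ : s₅.g = s₃.g := rfl
      have n₅ : s₅.n = s₃.n + 78 := rfl
      have w₅ : s₅.wr = s₃.wr := rfl
      have r₅ : s₅.rd = s₃.rd := rfl
      clear_value s₅
      have B₅ : (P.blk i j).At s₅ := ⟨(v₅ _ (by decide)).trans A₃.S, (v₅ _ (by decide)).trans A₃.k,
        (v₅ _ (by decide)).trans A₃.K, (v₅ _ (by decide)).trans A₃.inf,
        (v₅ _ (by decide)).trans A₃.m, (v₅ _ (by decide)).trans A₃.n,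
        (v₅ _ (by decide)).trans A₃.v2, (v₅ _ (by decide)).trans A₃.th,
        (v₅ _ (by decide)).trans A₃.tw, z₅, ro₅, co₅, by rw [g₅]; exact A₃.xs,
        by rw [g₅]; exact A₃.ys⟩
      have hfit := hF.blk hi hj
      have h7 := hfit.low
      have h8 := hfit.high
      refine Cmd.wp_mono (c := blockC _) ?_ (blockC_spec (B := P.blk i j) hfit B₅
        (by rw [Blk.Ok, g₅]; exact P.blk_ok hi hj f₃) (fun a h1 h2 => ?_))
      · rintro s₆ ⟨v₆, g₆, w₆, r₆, n₆⟩
        rw [g₅] at g₆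
        have e1 : 6 * ((P.blk i j).k * (P.blk i j).S) = w₀ := rfl
        have e2 : 25 * ((P.blk i j).k * (P.blk i j).k * (P.blk i j).k * (P.blk i j).k
          * (P.blk i j).S) = r₀ := rfl
        have e3 : (P.blk i j).k * (P.blk i j).k * (P.blk i j).k * (P.blk i j).k
          * ((P.blk i j).S * (P.blk i j).S) = u₀ := rfl
        rw [e1] at w₆
        rw [e2] at r₆
        rw [e3] at n₆
        refine ⟨?_, fun x hx => ?_, by simp, ?_, fun a ha => ?_, ?_, ?_, ?_, ?_⟩
        · rw [v₆ _ (by decide), v₅ _ (by decide), j₃]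
        · rw [St.setv_v, if_neg (by rintro rfl; exact absurd hx (by decide)), v₆ x (by omega),
            v₅ x (by omega), v₃ x hx]
        · simp only [St.setv_v, reduceCtorEq, if_false]
          rw [v₆ _ (by decide), ro₅]
        · have e4 : (P.blk i j).k * (P.blk i j).S = P.K := rfl
          have e5 : (P.blk i j).v2 = P.v2 := rfl
          have e6 : (P.blk i j).m = P.m := rfl
          have e7 : (P.blk i j).n = P.n := rfl
          rw [e4, e6, e7] at h7
          rw [St.setv_g, g₆ a (by omega), if_neg (by rw [e4]; omega)]
          exact g₃ a ha
        · exact f₃.next hi hj g₆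
        · simp only [St.setv_wr]; rw [Nat.add_mul j 1]; omega
        · simp only [St.setv_rd]; rw [Nat.add_mul j 1]; omega
        · simp only [St.setv_n]; rw [Nat.add_mul j 1]; omega
      · have e4 : (P.blk i j).k * (P.blk i j).S = P.K := rfl
        have e5 : (P.blk i j).v2 = P.v2 := rfl
        have e6 : (P.blk i j).m = P.m := rfl
        have e7 : (P.blk i j).n = P.n := rfl
        have e8 : (P.blk i j).S = P.S := rfl
        rw [e4, e8] at h1 h2
        rw [e4, e6, e7, e8] at h7
        rw [e4, e5, e8] at h8
        rw [g₅]
        exact f₃.le a (by omega) (by omega)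
    · rintro s₃ ⟨v₃, j₃, ro₃, g₃, f₃, w₃, r₃, n₃⟩
      refine ⟨?_, fun x hx => ?_, by simp, g₃, fun h => f₃.next_row h, fun h => ?_, ?_, ?_, ?_⟩
      · show s₃.v .bi = i
        rw [v₃ _ (by decide), v₂ _ (by decide), i₁]
      · rw [St.setv_v, if_neg (by rintro rfl; exact absurd hx (by decide))]
        show s₃.v x = _
        rw [v₃ x (by omega), v₂ x (by omega), v₁ x hx]
      · exact f₃
      · simp only [St.setv_wr, St.tick_wr]; rw [Nat.add_mul i 1]; omega
      · simp only [St.setv_rd, St.tick_rd]; rw [Nat.add_mul i 1]; omega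
      · simp only [St.setv_n, St.tick_n, cost_V]; rw [Nat.add_mul i 1]; omega
  · rintro s₁ ⟨v₁, i₁, g₁, -, f₁, w₁, r₁, n₁⟩
    refine ⟨v₁, ?_, ?_, ?_, ?_⟩
    -- The padded grid covers both strings, so the distance at its corner is that of the complete
    -- strings.
    · have h := (f₁ rfl).below (P.nbc * P.K) le_rfl
      rw [Nat.sub_add_cancel hnbr] at h
      rw [St.tick_g, h, Prob.D, min_eq_right, min_eq_right]
      · have := Nat.lt_div_mul_add (a := P.n) hK
        rw [Prob.nbc, Nat.add_mul]; omega
      · have := Nat.lt_div_mul_add (a := P.m) hK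
        rw [Prob.nbr, Nat.add_mul]; omega
    · rw [Nat.mul_assoc]; exact w₁
    · rw [Nat.mul_assoc]; exact r₁
    · have h1 : P.nbr ≤ P.nbr * P.nbc := Nat.le_mul_of_pos_right _ hnbc
      have h2 : P.nbr * P.nbc ≤ P.nbr * P.nbc * u₀ := Nat.le_mul_of_pos_right _ hu
      have e1 : P.nbr * (P.nbc * (40000 * u₀ + 300) + 200)
        = 40000 * (P.nbr * P.nbc * u₀) + 300 * (P.nbr * P.nbc) + 200 * P.nbr := by ring
      have e2 : P.nbr * P.nbc * (50000 * u₀) = 50000 * (P.nbr * P.nbc * u₀) := by ring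
      simp only [St.tick_n, cost_V]
      rw [e2]
      have h3 : 1 ≤ P.nbr * P.nbc * u₀ := Nat.mul_pos (Nat.mul_pos hnbr hnbc) hu
      omega

end AsymRAM

/-! ### Choice of the parameters and of the memory layout. -/

namespace AsymRAM

open AsymRAM.Expr

/-- The side of a tile, for fast memory of `M` words and write cost `ω`. If `b` is set, the write
cost bounds the side as well. -/
def tileSide (b : Bool) (M ω : ℕ) : ℕ := max 1 ((if b then min M ω else M) / 100)

/-- Read the parameters and choose the side of a tile. -/
def scalarC (b : Bool) : Cmd :=
  .rdG .m (C 0) ;; .rdG .n (C 1) ;; .rdG .mm (C 2) ;; .rdG .om (C 3) ;;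
  (if b then .ite (V .om) (V .mm) (.set .mm (V .om)) .skip else .skip) ;;
  .set .S (V .mm / C 100) ;; .ite (V .S) (C 1) (.set .S (C 1)) .skip ;;
  .set .q (if b then V .S else C 1)

/-- Choose the number of tiles in a row of a block. -/
def searchC : Cmd :=
  .set .k (C 1) ;; .loop .t (V .S) (.ite (V .S) ((V .k + C 1) * (V .k + C 1)) .skip
    (.ite (V .om) ((V .k + C 1) * (V .k + C 1) * (V .k + C 1) * V .q) .skip
      (.set .k (V .k + C 1))))

/-- Compute the parameters of the problem. -/
def paramC : Cmd :=
  .set .K (V .k * V .S) ;; .set .inf (V .m + V .n) ;; .set .nbr (V .m / V .K + C 1) ;;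
  .set .nbc (V .n / V .K + C 1) ;; .set .vb (C 4 + V .inf + V .nbr * V .K + V .S) ;;
  .set .v2 (V .vb + V .nbc * V .K + V .S + C 1) ;; .set .th (V .S) ;; .set .tw (V .S)

/-- Set the base addresses of the arrays. -/
def basesC : Cmd :=
  .setB .U (C 64) ;; .setB .E (C 65 + C 2 * V .S) ;; .setB .L (C 66 + C 4 * V .S) ;;
  .setB .T (C 67 + C 5 * V .S) ;; .setB .X (C 68 + C 6 * V .S) ;; .setB .Y (C 68 + C 7 * V .S) ;;
  .setB .TH (C 68 + C 8 * V .S) ;; .setB .DIR (C 68 + C 9 * V .S)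

/-- The base addresses of the arrays in fast memory. -/
def arrBase (S : ℕ) : Arr → ℕ
  | .U => 64 | .E => 65 + 2 * S | .L => 66 + 4 * S | .T => 67 + 5 * S | .X => 68 + 6 * S
  | .Y => 68 + 7 * S | .TH => 68 + 8 * S | .DIR => 68 + 9 * S

/-- The sizes of the arrays in fast memory. -/
def arrSize (S k : ℕ) : Arr → ℕ
  | .U => 2 * S + 1 | .E => 2 * S + 1 | .L => S + 1 | .T => S + 1 | .X => S | .Y => S
  | .TH => k * k | .DIR => 2 * k

/-- `k` is the largest number with `k ^ 2 ≤ S` and `k ^ 3 * q ≤ o`, or one. -/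
structure IsBlockNum (S q o k : ℕ) : Prop where
  pos : 1 ≤ k
  sq : k * k ≤ S
  cube : k * k * k * q ≤ o
  max : S < (k + 1) * (k + 1) ∨ o < (k + 1) * (k + 1) * (k + 1) * q

variable {ℓ : Lay} {s : St}

theorem scalarC_spec (b : Bool) (hμ : ℓ.μ = .fast) :
    (scalarC b).wp ℓ (fun s' => s'.v .m = s.g 0 ∧ s'.v .n = s.g 1 ∧ s'.v .om = s.g 3 ∧
      s'.v .S = tileSide b (s.g 2) (s.g 3) ∧ s'.v .q = (if b then s'.v .S else 1) ∧ s'.g = s.g ∧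
      s'.wr = s.wr ∧ s'.rd = s.rd + 4 ∧ s'.n ≤ s.n + 200) s := by
  have hmax : ∀ a : ℕ, max 1 a = if a < 1 then 1 else a := fun a => by split_ifs <;> omega
  refine ⟨hμ, trivial, hμ, trivial, hμ, trivial, hμ, trivial, ?_⟩
  set s₁ := (((s.rdg .m _ _).rdg .n _ _).rdg .mm _ _).rdg .om _ _ with hs₁
  have m₁ : s₁.v .m = s.g 0 := by simp [hs₁]
  have n₁ : s₁.v .n = s.g 1 := by simp [hs₁]
  have mm₁ : s₁.v .mm = s.g 2 := by simp [hs₁]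
  have om₁ : s₁.v .om = s.g 3 := by simp [hs₁]
  have g₁ : s₁.g = s.g := rfl
  have w₁ : s₁.wr = s.wr := rfl
  have r₁ : s₁.rd = s.rd + 4 := rfl
  have k₁ : s₁.n = s.n + 48 := rfl
  clear_value s₁
  refine Cmd.wp_mono (c := if b then _ else _) (Q := fun s' => s'.v .m = s.g 0 ∧ s'.v .n = s.g 1 ∧
    s'.v .om = s.g 3 ∧ s'.v .mm = (if b then min (s.g 2) (s.g 3) else s.g 2) ∧ s'.g = s.g ∧
    s'.wr = s.wr ∧ s'.rd = s.rd + 4 ∧ s'.n ≤ s.n + 78) ?_ ?_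
  · rintro s₂ ⟨m₂, n₂, om₂, mm₂, g₂, w₂, r₂, k₂⟩
    rw [tileSide, ← mm₂, hmax]
    refine ⟨⟨trivial, trivial, trivial⟩, trivial, trivial, fun h => ?_, fun h => ?_⟩
    all_goals simp only [val_V, St.setv_v, if_true, val_div, val_C] at h
    · refine ⟨trivial, ?_⟩
      rw [if_pos h]
      cases b <;> refine ⟨trivial, ?_⟩ <;> simp [m₂, n₂, om₂, g₂, w₂, r₂] <;> omega
    · rw [if_neg h]
      cases b <;> refine ⟨trivial, ?_⟩ <;> simp [m₂, n₂, om₂, g₂, w₂, r₂] <;> omega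
  · cases b
    · refine ⟨m₁, n₁, om₁, mm₁, g₁, w₁, r₁, by omega⟩
    · refine ⟨trivial, trivial, fun h => ⟨trivial, ?_⟩, fun h => ?_⟩
      all_goals simp only [val_V, mm₁, om₁] at h
      · simp [m₁, n₁, om₁, g₁, w₁, r₁]; omega
      · refine ⟨m₁, n₁, om₁, ?_, g₁, w₁, r₁, by simp; omega⟩
        simp [mm₁]; omega

/-- `k` grows by one per round until a constraint would fail, and then stays. The hypotheses on `q`
make `k = 1` admissible and exclude overflow. -/
theorem searchC_spec {S q o : ℕ} (hS : s.v .S = S) (hq : s.v .q = q) (ho : s.v .om = o)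
    (hS1 : 1 ≤ S) (hqS : q ≤ S) (hqo : q ≤ o) (hW : 4 * (S * S * S) < ℓ.W) :
    searchC.wp ℓ (fun s' => IsBlockNum S q o (s'.v .k) ∧
      (∀ x : Var, 10 < x.lvl → x ≠ .k → s'.v x = s.v x) ∧ s'.g = s.g ∧
      s'.wr = s.wr ∧ s'.rd = s.rd ∧ s'.n ≤ s.n + 300 * S + 100) s := by
  have hSS : S ≤ S * S := Nat.le_mul_of_pos_right _ hS1
  have hS3 : S * S ≤ S * S * S := Nat.le_mul_of_pos_right _ hS1
  refine ⟨trivial, ?_⟩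
  refine Cmd.wp_loop S (fun j s' => s'.v .t = j ∧ s'.v .q = q ∧ 1 ≤ s'.v .k ∧
    s'.v .k * s'.v .k ≤ S ∧
    s'.v .k * s'.v .k * s'.v .k * q ≤ o ∧ (s'.v .k = j + 1 ∨
      (S < (s'.v .k + 1) * (s'.v .k + 1) ∨
        o < (s'.v .k + 1) * (s'.v .k + 1) * (s'.v .k + 1) * q)) ∧
    (∀ x : Var, 10 < x.lvl → x ≠ .k → s'.v x = s.v x) ∧ s'.g = s.g ∧
    s'.wr = s.wr ∧ s'.rd = s.rd ∧ s'.n ≤ s.n + 300 * j + 24) (by omega) ?_ ?_ ?_ ?_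
  · refine ⟨by simp, by simpa using hq, by simp, by simpa using hS1, by simpa using hqo, by simp,
      fun x hx hk => ?_, rfl, rfl, rfl, by simp⟩
    rw [St.setv_v, if_neg (by rintro rfl; exact absurd hx (by decide)), St.setv_v, if_neg hk]
  · rintro j s' hj ⟨ht, -, -, -, -, -, hv, -⟩
    exact ⟨ht, trivial, (hv .S (by decide) (by decide)).trans hS⟩
  · rintro j s₁ hj ⟨t₁, q₁, k₁, sq₁, cu₁, mx₁, v₁, g₁, w₁, r₁, n₁⟩
    have S₁ : s₁.v .S = S := (v₁ .S (by decide) (by decide)).trans hS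
    have o₁ : s₁.v .om = o := (v₁ .om (by decide) (by decide)).trans ho
    set κ := s₁.v .k with hκ
    have hκS : κ ≤ S := (Nat.le_mul_of_pos_right _ k₁).trans sq₁
    have h4 : (κ + 1) * (κ + 1) ≤ 4 * S := by
      have : (κ + 1) * (κ + 1) = κ * κ + 2 * κ + 1 := by ring
      have := Nat.mul_le_mul_left κ k₁
      omega
    have key : ∀ s' : St, s'.v .t = j → s'.v .q = q → 1 ≤ s'.v .k → s'.v .k * s'.v .k ≤ S →
        s'.v .k * s'.v .k * s'.v .k * q ≤ o → (s'.v .k = j + 2 ∨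
          (S < (s'.v .k + 1) * (s'.v .k + 1) ∨
            o < (s'.v .k + 1) * (s'.v .k + 1) * (s'.v .k + 1) * q)) →
        (∀ x : Var, 10 < x.lvl → x ≠ .k → s'.v x = s.v x) → s'.g = s.g →
        s'.wr = s.wr → s'.rd = s.rd → s'.n ≤ s₁.n + 276 →
        (fun s' : St => s'.v .t = j ∧ (fun j (s' : St) => s'.v .t = j ∧ s'.v .q = q ∧ 1 ≤ s'.v .k ∧
          s'.v .k * s'.v .k ≤ S ∧
          s'.v .k * s'.v .k * s'.v .k * q ≤ o ∧ (s'.v .k = j + 1 ∨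
            (S < (s'.v .k + 1) * (s'.v .k + 1) ∨
              o < (s'.v .k + 1) * (s'.v .k + 1) * (s'.v .k + 1) * q)) ∧
          (∀ x : Var, 10 < x.lvl → x ≠ .k → s'.v x = s.v x) ∧ s'.g = s.g ∧
          s'.wr = s.wr ∧ s'.rd = s.rd ∧ s'.n ≤ s.n + 300 * j + 24) (j + 1)
          (s'.setv .t (j + 1) 24)) s' := by
      intro s' a1 a2 a3 a4 a5 a6 a7 a8 a9 a10 a11
      refine ⟨a1, by simp, by simpa using a2, by simpa using a3, by simpa using a4,
        by simpa using a5, by simpa using a6, fun x hx hk => ?_, a8, a9, a10, ?_⟩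
      · rw [St.setv_v, if_neg (by rintro rfl; exact absurd hx (by decide)), a7 x hx hk]
      · simp only [St.setv_n]; omega
    have hov : s₁.v .k + 1 < ℓ.W := by rw [← hκ]; omega
    have hov2 : (s₁.v .k + 1) * (s₁.v .k + 1) < ℓ.W := by rw [← hκ]; omega
    refine ⟨trivial, ⟨⟨trivial, trivial, hov⟩, ⟨trivial, trivial, hov⟩, hov2⟩, fun h => ?_,
      fun h => ?_⟩
    all_goals simp only [val_V, val_mul, val_add, val_C, St.tick_v, S₁, ← hκ] at h
    · exact key _ t₁ q₁ k₁ sq₁ cu₁ (Or.inr (Or.inl h)) v₁ g₁ w₁ r₁ (by simp)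
    -- The cube is formed only after `(k + 1) ^ 2 ≤ S` has been checked, so the product with `q ≤ S`
    -- is at most `S ^ 3`.
    · have h5 : (κ + 1) ≤ S := (Nat.le_mul_of_pos_right _ (Nat.succ_pos _)).trans (not_lt.1 h)
      have h6 : (κ + 1) * (κ + 1) * (κ + 1) ≤ S * S := Nat.mul_le_mul (not_lt.1 h) h5
      have h7 : (κ + 1) * (κ + 1) * (κ + 1) * q ≤ S * S * S := Nat.mul_le_mul h6 hqS
      have hov3 : (s₁.v .k + 1) * (s₁.v .k + 1) * (s₁.v .k + 1) < ℓ.W := by rw [← hκ]; omega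
      have hov4 : (s₁.v .k + 1) * (s₁.v .k + 1) * (s₁.v .k + 1) * s₁.v .q < ℓ.W := by
        rw [← hκ, q₁]; omega
      refine ⟨trivial, ⟨⟨⟨⟨trivial, trivial, hov⟩, ⟨trivial, trivial, hov⟩, hov2⟩,
        ⟨trivial, trivial, hov⟩, hov3⟩, trivial, hov4⟩, fun h' => ?_, fun h' => ⟨⟨trivial, trivial,
        hov⟩, ?_⟩⟩
      all_goals simp only [val_V, val_mul, val_add, val_C, St.tick_v, o₁, q₁, ← hκ] at h'
      · exact key _ t₁ q₁ k₁ sq₁ cu₁ (Or.inr (Or.inr h')) v₁ g₁ w₁ r₁ (by simp)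
      · refine key _ t₁ q₁ (by simp) ?_ ?_ ?_ (fun x hx hk => ?_) g₁ w₁ r₁ (by simp)
        · simpa [← hκ] using h
        · simpa [← hκ] using h'
        · rcases mx₁ with h8 | h8
          · left; simpa [← hκ] using h8
          · omega
        · rw [St.setv_v, if_neg hk]; exact v₁ x hx hk
  · rintro s₁ ⟨t₁, q₁, k₁, sq₁, cu₁, mx₁, v₁, g₁, w₁, r₁, n₁⟩
    -- Growth in all `S` rounds would give `k = S + 1`, against `k ≤ k ^ 2 ≤ S`.
    refine ⟨⟨k₁, sq₁, cu₁, mx₁.resolve_left fun h => ?_⟩, v₁, g₁, w₁, r₁, by simp; omega⟩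
    have := Nat.le_mul_of_pos_right (s₁.v .k) k₁
    omega

theorem paramC_spec {P : Prob} (hS : s.v .S = P.S) (hk : s.v .k = P.k) (hm : s.v .m = P.m)
    (hn : s.v .n = P.n) (hx : ∀ j < P.m, s.g (4 + j) = P.x.getD j 0)
    (hy : ∀ j < P.n, s.g (4 + P.m + j) = P.y.getD j 0) (hW : P.v2 < ℓ.W) :
    paramC.wp ℓ (fun s' => P.At s' ∧ s'.g = s.g ∧ s'.wr = s.wr ∧ s'.rd = s.rd ∧
      s'.n ≤ s.n + 400) s := by
  have hZ : P.Z = 4 + P.m + P.n + P.nbr * P.K + P.S := rfl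
  have hv : P.v2 = P.Z + P.nbc * P.K + P.S + 1 := rfl
  have hK : P.k * P.S = P.K := rfl
  have h1 : P.m / P.K + 1 = P.nbr := rfl
  have h2 : P.n / P.K + 1 = P.nbc := rfl
  have hKW : P.K < ℓ.W := by
    have := Nat.le_mul_of_pos_left P.K (Nat.succ_pos (P.m / P.K))
    change P.K ≤ P.nbr * P.K at this
    omega
  have e1 := Nat.div_le_self P.m P.K
  have e2 := Nat.div_le_self P.n P.K
  simp only [paramC, Cmd.wp, ok_add, ok_mul, ok_div, ok_V, ok_C, val_add, val_mul, val_div, val_V,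
    val_C, St.setv_v, reduceCtorEq, if_true, if_false, hS, hk, hm, hn, hK, h1, h2, true_and,
    and_true]
  refine ⟨hKW, by omega, by omega, by omega, by omega, by omega, ⟨?_, ?_, ?_, ?_, ?_, ?_, ?_, ?_,
    ?_, ?_, ?_, ?_, hx, hy⟩, rfl, rfl, rfl, by simp⟩
  all_goals simp [hS, hk, hm, hn, hZ, hv]
  all_goals omega

theorem basesC_spec {S : ℕ} (hS : s.v .S = S) (hsz : ℓ.sz = 0) (hW : 1000 + 9 * S < ℓ.W) :
    basesC.wp ℓ (fun s' => s'.ad = arrBase S ∧ s'.v = s.v ∧ s'.g = s.g ∧ s'.wr = s.wr ∧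
      s'.rd = s.rd ∧ s'.n ≤ s.n + 300) s := by
  simp only [basesC, Cmd.wp, ok_add, ok_mul, ok_V, ok_C, val_add, val_mul, val_V,
    val_C, St.setb_v, hS, hsz, true_and]
  refine ⟨⟨by omega, by omega⟩, ⟨by omega, by omega⟩, ⟨by omega, by omega⟩, ⟨by omega, by omega⟩,
    ⟨by omega, by omega⟩, ⟨by omega, by omega⟩, ⟨by omega, by omega⟩, ?_, rfl, rfl, rfl, by simp⟩
  funext y
  cases y <;> simp [arrBase]

end AsymRAM

/-! ### The first frontier and the output. -/

namespace AsymRAM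

open AsymRAM.Expr

/-- Initialize the frontier. -/
def initC : Cmd :=
  storeC (V .nbr * V .K + V .S - V .m) (C 4 + V .inf) (V .m) ;;
  storeC (V .m) (V .vb - V .m) (V .m - V .t) ;;
  storeC (V .n) (V .vb) (V .t) ;;
  storeC (V .v2 - V .vb - V .n) (V .vb + V .n) (V .n)

/-- Write the result: the distance, or if `l` is set, the length of a common subsequence. -/
def outC (l : Bool) : Cmd :=
  .rdG .val (V .vb + V .nbc * V .K - V .nbr * V .K) ;;
  (if l then .set .val ((V .m + V .n - V .val) / C 2) else .skip) ;; .wrG (C 0) (V .val)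

/-- The result, from the distance `d`. -/
def outVal (l : Bool) (m n d : ℕ) : ℕ := if l then (m + n - d) / 2 else d

/-- The program, after the choice of the parameters. -/
def mainC (sc : ℕ) (l : Bool) : Cmd := initC ;; sweepC sc ;; outC l

variable {ℓ : Lay} {P : Prob} {s : St}

theorem _root_.Prob.At.of_writes {s' : St} (h : P.At s) (hv : Writes 0 s s')
    (hg : ∀ j < 4 + P.m + P.n, s'.g j = s.g j) : P.At s' :=
  h.of (fun x hx => hv.v x (by omega)) hg

theorem _root_.Prob.front_zero {g : ℕ → ℕ} (hK : 1 ≤ P.K)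
    (h1 : ∀ a, 4 + P.m + P.n ≤ a → a ≤ P.Z → g a = min (P.Z - a) P.m)
    (h2 : ∀ a, P.Z ≤ a → a < P.v2 → g a = min (a - P.Z) P.n) : P.Front 0 0 g := by
  have hZ : P.Z = 4 + P.m + P.n + P.nbr * P.K + P.S := rfl
  have hv : P.v2 = P.Z + P.nbc * P.K + P.S + 1 := rfl
  have hbr : P.K ≤ P.nbr * P.K := Nat.le_mul_of_pos_left _ (Nat.succ_pos _)
  have D1 : ∀ r, P.D r 0 = min r P.m := fun r => by simp [Prob.D]
  have D2 : ∀ c, P.D 0 c = min c P.n := fun r => by simp [Prob.D]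
  refine ⟨fun c hc => ?_, fun r _ hr => ?_, fun c _ hc => ?_, fun r hr hr' => ?_, fun a h3 h4 => ?_⟩
  · obtain rfl : c = 0 := by simpa using hc
    simp only [Nat.zero_add, Nat.one_mul, Nat.add_zero, D1]
    rw [h1 _ (by omega) (by omega)]; omega
  · simp only [Nat.zero_add, Nat.one_mul, Nat.zero_mul, Nat.add_zero, D1] at hr ⊢
    rw [h1 _ (by omega) (by omega)]; omega
  · simp only [Nat.zero_mul, Nat.sub_zero, D2]
    rw [h2 _ (by omega) (by omega)]; omega
  · rw [D1, h1 _ (by omega) (by omega)]; omega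
  · rcases le_total a P.Z with h5 | h5
    · rw [h1 a h3 h5]; omega
    · rw [h2 a h5 h4]; omega

theorem initC_spec (hF : P.Fits ℓ) (hA : P.At s) :
    initC.wp ℓ (fun s' => P.At s' ∧ P.Front 0 0 s'.g ∧ s'.rd ≤ s.rd ∧
      s'.wr ≤ s.wr + (P.nbr * P.K + P.nbc * P.K + 2 * P.S + 1) ∧
      s'.n ≤ s.n + (126 * (P.nbr * P.K + P.nbc * P.K + 2 * P.S + 1) + 300)) s := by
  have hW := hF.word
  have hS := hF.S_pos
  have hZ : P.Z = 4 + P.m + P.n + P.nbr * P.K + P.S := rfl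
  have hv : P.v2 = P.Z + P.nbc * P.K + P.S + 1 := rfl
  have hK : 1 ≤ P.K := Nat.mul_pos hF.k_pos hS
  have hm : P.m ≤ P.nbr * P.K := by
    have := Nat.lt_div_mul_add (a := P.m) hK
    rw [Prob.nbr, Nat.add_mul]; omega
  have hn : P.n ≤ P.nbc * P.K := by
    have := Nat.lt_div_mul_add (a := P.n) hK
    rw [Prob.nbc, Nat.add_mul]; omega
  refine Cmd.wp_mono (c := storeC _ _ _) ?_ (storeC_spec (N := P.nbr * P.K + P.S - P.m)
    (b := 4 + P.m + P.n) (fun _ => P.m) hF.μ (fun s' h => ?_) (fun s' h => ?_) (by omega)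
    (fun j _ s' h _ => ⟨trivial, (h.v .m (by decide)).trans hA.m⟩))
  rotate_left
  · simp only [ok_sub, ok_add, ok_mul, ok_V, val_sub, val_add, val_mul, val_V, true_and]
    rw [h.v .nbr (by decide), h.v .K (by decide), h.v .S (by decide), h.v .m (by decide),
      hA.nbr, hA.K, hA.S, hA.m]
    exact ⟨⟨⟨by omega, by omega⟩, by omega⟩, rfl⟩
  · simp only [ok_add, ok_C, ok_V, val_add, val_C, val_V, true_and]
    rw [h.v .inf (by decide), hA.inf]
    exact ⟨by omega, by omega⟩
  rintro s₁ ⟨W₁, r₁, w₁, n₁, g₁⟩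
  have A₁ : P.At s₁ := hA.of_writes W₁ fun j hj => by rw [g₁]; exact if_neg (by omega)
  refine Cmd.wp_mono (c := storeC _ _ _) ?_ (storeC_spec (N := P.m)
    (b := P.Z - P.m) (fun j => P.m - j) hF.μ (fun s' h => ?_) (fun s' h => ?_) (by omega)
    (fun j hj s' h ht => ?_))
  rotate_left
  · exact ⟨trivial, (h.v .m (by decide)).trans A₁.m⟩
  · simp only [ok_sub, ok_V, val_sub, val_V, true_and]
    rw [h.v .vb (by decide), h.v .m (by decide), A₁.vb, A₁.m]
    exact ⟨by omega, rfl⟩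
  · simp only [ok_sub, ok_V, val_sub, val_V, true_and]
    rw [h.v .m (by decide), A₁.m, ht]
    exact ⟨by omega, rfl⟩
  rintro s₂ ⟨W₂, r₂, w₂, n₂, g₂⟩
  have A₂ : P.At s₂ := A₁.of_writes W₂ fun j hj => by rw [g₂]; exact if_neg (by omega)
  refine Cmd.wp_mono (c := storeC _ _ _) ?_ (storeC_spec (N := P.n)
    (b := P.Z) (fun j => j) hF.μ (fun s' h => ⟨trivial, (h.v .n (by decide)).trans A₂.n⟩)
    (fun s' h => ⟨trivial, (h.v .vb (by decide)).trans A₂.vb⟩) (by omega)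
    (fun j hj s' h ht => ⟨trivial, ht⟩))
  rintro s₃ ⟨W₃, r₃, w₃, n₃, g₃⟩
  have A₃ : P.At s₃ := A₂.of_writes W₃ fun j hj => by rw [g₃]; exact if_neg (by omega)
  refine Cmd.wp_mono (c := storeC _ _ _) ?_ (storeC_spec (N := P.v2 - P.Z - P.n)
    (b := P.Z + P.n) (fun _ => P.n) hF.μ (fun s' h => ?_) (fun s' h => ?_) (by omega)
    (fun j hj s' h ht => ⟨trivial, (h.v .n (by decide)).trans A₃.n⟩))
  rotate_left
  · simp only [ok_sub, ok_V, val_sub, val_V, true_and]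
    rw [h.v .v2 (by decide), h.v .vb (by decide), h.v .n (by decide), A₃.v2, A₃.vb, A₃.n]
    exact ⟨⟨by omega, by omega⟩, rfl⟩
  · simp only [ok_add, ok_V, val_add, val_V, true_and]
    rw [h.v .vb (by decide), h.v .n (by decide), A₃.vb, A₃.n]
    exact ⟨by omega, rfl⟩
  rintro s₄ ⟨W₄, r₄, w₄, n₄, g₄⟩
  simp only [cost_V, cost_C, cost_add, cost_sub, cost_mul] at n₁ n₂ n₃ n₄
  refine ⟨A₃.of_writes W₄ fun j hj => by rw [g₄]; exact if_neg (by omega),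
    Prob.front_zero hK (fun a h1 h2 => ?_) (fun a h1 h2 => ?_), by omega, by omega, by omega⟩
  · rw [g₄, g₃, g₂, g₁]
    dsimp only
    split_ifs <;> omega
  · rw [g₄, g₃, g₂, g₁]
    dsimp only
    split_ifs <;> omega

theorem outC_spec (l : Bool) {m n d a b c K : ℕ} (hμ : ℓ.μ = .fast) (hm : s.v .m = m)
    (hn : s.v .n = n) (ha : s.v .vb = a) (hb : s.v .nbc = b) (hc : s.v .nbr = c) (hK : s.v .K = K)
    (hd : s.g (a + b * K - c * K) = d) (hle : d ≤ m + n) (h1 : a + b * K < ℓ.W) (h2 : c * K ≤ a)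
    (h3 : m + n < ℓ.W) :
    (outC l).wp ℓ (fun s' => s'.g 0 = outVal l m n d ∧ s'.wr = s.wr + 1 ∧ s'.rd = s.rd + 1 ∧
      s'.n ≤ s.n + 200) s := by
  cases l <;> simp only [outC, outVal, Cmd.wp, ok_add, ok_mul, ok_sub, ok_div, ok_V, ok_C,
    val_add, val_mul, val_sub, val_div, val_V, val_C, St.rdg_v, St.setv_v, St.wrg_g, St.rdg_g,
    St.setv_g, reduceCtorEq, if_true, if_false, ha, hb, hc, hK, hm, hn, hd, true_and, and_true, hμ,
    Bool.false_eq_true, Function.update_self]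
  · refine ⟨⟨⟨by omega, by omega⟩, by omega, by omega⟩, ?_⟩
    simp
  · refine ⟨⟨⟨by omega, by omega⟩, by omega, by omega⟩, ⟨by omega, by omega⟩, ?_⟩
    simp

theorem mainC_spec (l : Bool) (hF : P.Fits ℓ) (hA : P.At s) :
    (mainC P.sc l).wp ℓ (fun s' => s'.g 0 = outVal l P.m P.n (dp P.sc P.x P.y P.m P.n) ∧
      s'.wr ≤ s.wr + 12 * (P.nbr * P.nbc * (P.k * P.S)) ∧
      s'.rd ≤ s.rd + 26 * (P.nbr * P.nbc * (P.k * P.k * P.k * P.k * P.S)) ∧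
      s'.n ≤ s.n + 52000 * (P.nbr * P.nbc * (P.k * P.k * P.k * P.k * (P.S * P.S)))) s := by
  have hW := hF.word
  have hS := hF.S_pos
  have hk := hF.k_pos
  have hZ : P.Z = 4 + P.m + P.n + P.nbr * P.K + P.S := rfl
  have hv : P.v2 = P.Z + P.nbc * P.K + P.S + 1 := rfl
  have hK : 1 ≤ P.K := Nat.mul_pos hk hS
  have hB : 1 ≤ P.nbr * P.nbc := Nat.mul_pos (Nat.succ_pos _) (Nat.succ_pos _)
  have hr : P.nbr * P.K ≤ P.nbr * P.nbc * P.K :=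
    Nat.mul_le_mul_right _ (Nat.le_mul_of_pos_right _ (Nat.succ_pos _))
  have hc : P.nbc * P.K ≤ P.nbr * P.nbc * P.K :=
    Nat.mul_le_mul_right _ (Nat.le_mul_of_pos_left _ (Nat.succ_pos _))
  have hKB : P.K ≤ P.nbr * P.nbc * P.K := Nat.le_mul_of_pos_left _ hB
  have hSK : P.S ≤ P.K := Nat.le_mul_of_pos_left _ hk
  have hk3 : 1 ≤ P.k * P.k * P.k := Nat.mul_pos (Nat.mul_pos hk hk) hk
  have hKR : P.K ≤ P.k * P.k * P.k * P.k * P.S := by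
    have := Nat.le_mul_of_pos_left P.K hk3
    rw [Prob.K] at this ⊢
    linarith
  have hRN : P.k * P.k * P.k * P.k * P.S ≤ P.k * P.k * P.k * P.k * (P.S * P.S) :=
    Nat.mul_le_mul_left _ (Nat.le_mul_of_pos_left _ hS)
  have e0 : P.k * P.S = P.K := rfl
  have h4 := Nat.mul_le_mul_left (P.nbr * P.nbc) (hKR.trans hRN)
  have h5 := Nat.mul_le_mul_left (P.nbr * P.nbc) hKR
  have e1 : ∀ a b, P.nbr * P.nbc * (a * b) = a * (P.nbr * P.nbc * b) := fun a b => by ring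
  refine Cmd.wp_mono (c := initC) ?_ (initC_spec hF hA)
  rintro s₁ ⟨A₁, f₁, r₁, w₁, n₁⟩
  refine Cmd.wp_mono (c := sweepC _) ?_ (sweepC_spec hF A₁ f₁)
  rintro s₂ ⟨v₂, g₂, w₂, r₂, n₂⟩
  refine Cmd.wp_mono (c := outC l) ?_ (outC_spec l hF.μ ((v₂ .m (by decide)).trans A₁.m)
    ((v₂ .n (by decide)).trans A₁.n) ((v₂ .vb (by decide)).trans A₁.vb)
    ((v₂ .nbc (by decide)).trans A₁.nbc) ((v₂ .nbr (by decide)).trans A₁.nbr)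
    ((v₂ .K (by decide)).trans A₁.K) g₂ (dp_le_add _ _) (by omega) (by omega) (by omega))
  rintro s₃ ⟨g₃, w₃, r₃, n₃⟩
  rw [e1] at w₂ r₂ n₂
  rw [e0] at w₂ ⊢
  refine ⟨g₃, by omega, by omega, by omega⟩

end AsymRAM

/-! ### The program for a fast memory of at least 100 words. -/

namespace AsymRAM

open AsymRAM.Expr

theorem _root_.Prob.v2_le (P : Prob) :
    P.v2 ≤ 5 + 2 * P.m + 2 * P.n + 2 * (P.k * P.S) + 2 * P.S := by
  have e1 := Nat.div_mul_le_self P.m P.K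
  have e2 := Nat.div_mul_le_self P.n P.K
  have e3 : P.k * P.S = P.K := rfl
  simp only [Prob.v2, Prob.Z, Prob.nbr, Prob.nbc, Nat.add_mul]
  omega

theorem tileSide_pos (b : Bool) (M ω : ℕ) : 1 ≤ tileSide b M ω := le_max_left _ _

theorem tileSide_le (b : Bool) {M ω : ℕ} (hM : 1 ≤ M) : tileSide b M ω ≤ M := by
  cases b <;> simp [tileSide] <;> omega

theorem tileSide_true_le {M ω : ℕ} (hω : 1 ≤ ω) : tileSide true M ω ≤ ω := by
  simp [tileSide]; omega

/-- The weight of the tile side in the choice of the number of tiles. -/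
def sideWeight (b : Bool) (S : ℕ) : ℕ := if b then S else 1

/-- Choose all parameters. -/
def setupC (b : Bool) : Cmd := scalarC b ;; searchC ;; paramC ;; basesC

theorem setupC_spec (b : Bool) (sc : ℕ) {ℓ : Lay} {s : St} {x y : List ℕ} (hμ : ℓ.μ = .fast)
    (hsz : ℓ.sz = 0) (hm : s.g 0 = x.length) (hn : s.g 1 = y.length)
    (ho : 1 ≤ s.g 3) (hx : ∀ j < x.length, s.g (4 + j) = x.getD j 0)
    (hy : ∀ j < y.length, s.g (4 + x.length + j) = y.getD j 0) {S : ℕ}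
    (hS : S = tileSide b (s.g 2) (s.g 3))
    (hW : 1000 + 100 * (x.length + y.length + S * S * S) < ℓ.W) :
    (setupC b).wp ℓ (fun s' => ∃ k, IsBlockNum S (sideWeight b S) (s.g 3) k ∧
      Prob.At ⟨x, y, sc, S, k⟩ s' ∧ s'.ad = arrBase S ∧ s'.g = s.g ∧
      s'.wr = s.wr ∧ s'.rd = s.rd + 4 ∧ s'.n ≤ s.n + (300 * S + 1000)) s := by
  have hS1 : 1 ≤ S := hS ▸ tileSide_pos _ _ _
  have hSS : S ≤ S * S := Nat.le_mul_of_pos_right _ hS1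
  have hS3 : S * S ≤ S * S * S := Nat.le_mul_of_pos_right _ hS1
  refine Cmd.wp_mono (c := scalarC b) ?_ (scalarC_spec b hμ)
  rintro s₁ ⟨m₁, n₁, om₁, S₁, q₁, g₁, w₁, r₁, k₁⟩
  rw [← hS] at S₁
  rw [S₁] at q₁
  refine Cmd.wp_mono (c := searchC) ?_ (searchC_spec S₁ (q := sideWeight b S) q₁ om₁ hS1 ?_ ?_
    (by omega))
  · rintro s₂ ⟨k₂, v₂, g₂, w₂, r₂, n₂⟩
    have hkS : s₂.v .k ≤ S := (Nat.le_mul_of_pos_right _ k₂.pos).trans k₂.sq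
    have hK : s₂.v .k * S ≤ S * S := Nat.mul_le_mul_right _ hkS
    refine Cmd.wp_mono (c := paramC) ?_ (paramC_spec (P := ⟨x, y, sc, S, s₂.v .k⟩)
      ((v₂ .S (by decide) (by decide)).trans S₁) rfl
      ((v₂ .m (by decide) (by decide)).trans (m₁.trans hm))
      ((v₂ .n (by decide) (by decide)).trans (n₁.trans hn)) (fun j hj => by rw [g₂, g₁]; exact hx j hj)
      (fun j hj => by rw [g₂, g₁]; exact hy j hj) ?_)
    · rintro s₃ ⟨A₃, g₃, w₃, r₃, n₃⟩
      refine Cmd.wp_mono (c := basesC) ?_ (basesC_spec (S := S) A₃.S hsz (by omega))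
      rintro s₄ ⟨a₄, v₄, g₄, w₄, r₄, n₄⟩
      have hk : s₄.n ≤ s.n + (300 * S + 1000) := by linarith
      exact ⟨_, k₂, A₃.of (fun x _ => congrFun v₄ x) (fun j _ => congrFun g₄ j), a₄,
        g₄.trans (g₃.trans (g₂.trans g₁)), by omega, by omega, hk⟩
    · have := Prob.v2_le ⟨x, y, sc, S, s₂.v .k⟩
      simp only [Prob.m, Prob.n] at this
      omega
  · cases b <;> simp [sideWeight, hS1]
  · cases b <;> simp only [sideWeight, if_true, Bool.false_eq_true, if_false]
    · exact ho
    · rw [hS]; exact tileSide_true_le ho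

/-- Base addresses may change only while there are no arrays. Once they are set, the layout gets its
arrays, which contain whatever the memory holds. By `k * k ≤ S` and `k ≤ S` the segments are
disjoint and end before `68 + 11 * S`. -/
theorem Rep.relayout {w M S k : ℕ} {s : St} {c : Config} (h : Rep ⟨w, M, .fast, 0, 0⟩ s c)
    (had : s.ad = arrBase S) (hk : k * k ≤ S) (hk' : k ≤ S) (hM : 68 + 11 * S ≤ M)
    (hW : 68 + 11 * S ≤ 2 ^ w) :
    Rep ⟨w, M, .fast, 0, arrSize S k⟩ { s with ar := fun y i => c.load M .fast (s.ad y + i) } c where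
  lt := h.lt
  big := h.big
  room := h.room
  var := h.var
  adr := h.adr
  arr := fun _ _ _ => rfl
  slow := h.slow
  valid := fun y i hi => by
    have : 64 ≤ s.ad y + i ∧ s.ad y + i < 68 + 11 * S := by
      rw [had]; cases y <;> simp only [arrBase, arrSize] at hi ⊢ <;> omega
    exact ⟨by simp only; omega, fun _ => by simp only; omega, by simp only; omega⟩
  disj := fun y y' i i' hi hi' e => by
    rw [had] at e
    cases y <;> cases y' <;> simp only [arrBase, arrSize] at hi hi' e <;>
      first | exact ⟨rfl, by omega⟩ | omega
  fa := h.fa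
  sr := h.sr
  sw := h.sw

/-- The program for a fast memory that is not very small. -/
def fastL (sc : ℕ) (l b : Bool) : LCmd :=
  .seq ((setupC b).code .fast 0) ((mainC sc l).code .fast 0)

theorem small_fastL (sc : ℕ) (hsc : sc ≤ 2) (l b : Bool) :
    (setupC b).small ∧ (mainC sc l).small := by
  interval_cases sc <;> cases l <;> cases b <;> decide

theorem fastL_spec {sc : ℕ} (hsc : sc ≤ 2) (l b : Bool) {w M : ℕ} {c : Config} {x y : List ℕ}
    (hc : c.AllLt w) (hM : 100 ≤ M) (hm : c.slow 0 = x.length) (hn : c.slow 1 = y.length)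
    (h2 : c.slow 2 = M) (ho : 1 ≤ c.slow 3) (hx : ∀ j < x.length, c.slow (4 + j) = x.getD j 0)
    (hy : ∀ j < y.length, c.slow (4 + x.length + j) = y.getD j 0) {S : ℕ}
    (hS : S = tileSide b M (c.slow 3))
    (hW : 1000 + 100 * (x.length + y.length + S * S * S) < 2 ^ w) :
    ∃ c' k, LCmd.Big w M (fastL sc l b) c c' ∧ IsBlockNum S (sideWeight b S) (c.slow 3) k ∧
      c'.slow 0 = outVal l x.length y.length (dp sc x y x.length y.length) ∧
      c'.slowWrites ≤ c.slowWrites +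
        12 * ((x.length / (k * S) + 1) * (y.length / (k * S) + 1) * (k * S)) ∧
      c'.slowReads ≤ c.slowReads +
        30 * ((x.length / (k * S) + 1) * (y.length / (k * S) + 1) * (k * k * k * k * S)) ∧
      c'.fastAccesses ≤ c.fastAccesses +
        60000 * ((x.length / (k * S) + 1) * (y.length / (k * S) + 1) *
          (k * k * k * k * (S * S))) := by
  have hS1 : 1 ≤ S := hS ▸ tileSide_pos _ _ _
  have hSS : S ≤ S * S := Nat.le_mul_of_pos_right _ hS1
  have hS3 : S * S ≤ S * S * S := Nat.le_mul_of_pos_right _ hS1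
  -- The divisor 100 in `tileSide` and the assumption `100 ≤ M` are chosen for this inequality.
  have hSM : 68 + 11 * S ≤ M := by
    rw [hS]; cases b <;> simp only [tileSide, if_true, Bool.false_eq_true, if_false] <;> omega
  set s : St := ⟨fun x => c.load M .fast (0 + x.idx), fun y => c.load M .fast (0 + y.idx), 0, c.slow,
    c.fastAccesses, c.slowReads, c.slowWrites⟩ with hs
  have R : Rep ⟨w, M, .fast, 0, 0⟩ s c := ⟨hc, by simp only; omega, fun _ => by simp only; omega,
    fun _ => rfl, fun _ => rfl, fun _ _ h => absurd h (by simp), fun _ => rfl,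
    fun _ _ h => absurd h (by simp), fun _ _ _ _ h => absurd h (by simp), le_rfl, le_rfl, le_rfl⟩
  obtain ⟨hsm1, hsm2⟩ := small_fastL sc hsc l b
  obtain ⟨c₁, s₁, b₁, R₁, k, K₁, A₁, a₁, g₁, w₁, r₁, n₁⟩ := Cmd.code_spec R hsm1
    (setupC_spec b sc (x := x) (y := y) rfl rfl hm hn ho hx hy
      (S := S) (by rw [hS, ← h2]) hW)
  have hkS : k ≤ S := (Nat.le_mul_of_pos_right _ K₁.pos).trans K₁.sq
  have hK : k * S ≤ S * S := Nat.mul_le_mul_right _ hkS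
  have R₂ := R₁.relayout a₁ K₁.sq hkS hSM (by omega)
  obtain ⟨c₂, s₂, b₂, R₂, g₂, w₂, r₂, n₂⟩ := Cmd.code_spec R₂ hsm2
    (mainC_spec (P := ⟨x, y, sc, S, k⟩) l ⟨rfl, hS1, K₁.pos, hsc, le_rfl, le_rfl, le_rfl, le_rfl,
      le_rfl, le_rfl, le_rfl, le_rfl, by
        have hv := Prob.v2_le ⟨x, y, sc, S, k⟩
        have := K₁.sq
        simp only [Prob.m, Prob.n] at hv
        simp only [Prob.K, Lay.W]
        omega⟩ (A₁.of (fun _ _ => rfl) fun _ _ => rfl))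
  have hB : 1 ≤ (x.length / (k * S) + 1) * (y.length / (k * S) + 1) :=
    Nat.mul_pos (Nat.succ_pos _) (Nat.succ_pos _)
  have hk4 : 1 ≤ k * k * k * k := Nat.mul_pos (Nat.mul_pos (Nat.mul_pos K₁.pos K₁.pos) K₁.pos) K₁.pos
  have t1 : 1 ≤ (x.length / (k * S) + 1) * (y.length / (k * S) + 1) * (k * k * k * k * S) :=
    Nat.mul_pos hB (Nat.mul_pos hk4 hS1)
  have t2 : S * S ≤ (x.length / (k * S) + 1) * (y.length / (k * S) + 1) *
      (k * k * k * k * (S * S)) :=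
    (Nat.le_mul_of_pos_left _ hk4).trans (Nat.le_mul_of_pos_left _ hB)
  have q1 := R₂.fa
  have q2 := R₂.sr
  have q3 := R₂.sw
  simp only [Prob.nbr, Prob.nbc, Prob.K, Prob.m, Prob.n, Lay.loc, Nat.add_zero] at q1 q2 q3 w₂ r₂ n₂
  refine ⟨c₂, k, .seq b₁ b₂, K₁, by rw [R₂.slow rfl, g₂], ?_, ?_, ?_⟩
  · refine q3.trans (w₂.trans ?_); rw [w₁]
  · refine q2.trans (r₂.trans ?_); rw [r₁, hs]; simp only; omega
  · refine q1.trans (n₂.trans ?_); rw [hs] at n₁; simp only at n₁; omega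

end AsymRAM

/-! ### Very small fast memory: making room in slow memory. -/

namespace AsymRAM

open AsymRAM.Expr

/-- `c'` arises from `c` by at most `j` accesses of each kind, and its slow memory is `f`. -/
structure Moved (w : ℕ) (c c' : Config) (f : ℕ → ℕ) (j : ℕ) : Prop where
  lt : c'.AllLt w
  slow : c'.slow = f
  fa : c'.fastAccesses ≤ c.fastAccesses + j
  sr : c'.slowReads ≤ c.slowReads + j
  sw : c'.slowWrites ≤ c.slowWrites + j

theorem const_val {w M j : ℕ} {c : Config} (h : j < 2 ^ w) : (Operand.const j).val w M c = j :=
  Nat.mod_eq_of_lt h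

theorem moved_op {w M u v r : ℕ} {c : Config} (o : Op) {d : Dest} {a₁ a₂ : Operand} {a : ℕ}
    (hd : d = .dir .slow a ∨ ∃ p, d = .ind .slow .slow p ∧ c.slow p = a) (hlt : c.AllLt w)
    (hu : a₁.val w M c = u) (hv : a₂.val w M c = v) (hr : o.nat u v = r) (ho : o.ok (2 ^ w) u v)
    (h₁ : a₁.Reads .slow 0 := by trivial) (h₂ : a₂.Reads .slow 0 := by trivial) :
    ∃ c', LCmd.Big w M (.op o d a₁ a₂) c c' ∧ Moved w c c' (Function.update c.slow a r) 6 := by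
  obtain ⟨c', h, hs⟩ := stored_op ⟨w, M, .slow, 4, 0⟩ (c := c) o hd (fun h => nomatch h) hlt h₁ h₂
  refine ⟨c', h, hs.lt, ?_, hs.fa, hs.sr, hs.sw⟩
  have hul : u < 2 ^ w := hu ▸ a₁.val_lt hlt
  funext b
  rw [Function.update_apply, ← hr, ← Op.eval_eq o hul ho, ← hu, ← hv]
  exact hs.get b

/-- Move one word from the cell before the one that cell 2 points to. -/
def shiftStep : LCmd :=
  .seq (.op .sub (.dir .slow 2) (.dir .slow 2) (.const 1))
    (.seq (.op .sub (.dir .slow 3) (.dir .slow 3) (.const 1))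
      (.op .div (.ind .slow .slow 3) (.ind .slow .slow 2) (.const 1)))

/-- The strings move up by 64 cells, last letter first, so that no letter is overwritten before it
has moved. Cells 2 and 3 point behind the next source and target and are decremented before use. -/
theorem shift_loop {w M : ℕ} (hw : 1000 < 2 ^ w) (j : ℕ) {c : Config} (hc : c.AllLt w)
    (h2 : c.slow 2 = 4 + j) (h3 : c.slow 3 = 68 + j) :
    ∃ c' f, LCmd.Big w M (.whileLt (.const 4) (.dir .slow 2) shiftStep) c c' ∧
      Moved w c c' f (20 * j + 10) ∧ f 0 = c.slow 0 ∧ f 1 = c.slow 1 ∧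
      (∀ i < j, f (68 + i) = c.slow (4 + i)) ∧ ∀ a, 68 + j ≤ a → f a = c.slow a := by
  have h4 : (Operand.const 4).val w M c = 4 := const_val (by omega)
  induction j generalizing c with
  | zero =>
    refine ⟨_, c.slow, .while_false ?_, ⟨hc, rfl, ?_, ?_, ?_⟩, rfl, rfl,
      fun i hi => by omega, fun _ _ => rfl⟩
    · rw [h4]; simp [Operand.val, Config.load, h2]
    · simp [Operand.count, Config.countRead]
    · simp [Operand.count, Config.countRead]
    · simp [Operand.count, Config.countRead]
  | succ j ih =>
    set c₀ := Operand.count (Operand.count c (.const 4)) (.dir .slow 2) with hc₀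
    have hc₀lt : c₀.AllLt w := hc
    have s₀ : c₀.slow = c.slow := rfl
    have hlt := (hc 3).2
    obtain ⟨c₁, b₁, m₁⟩ := moved_op (M := M) (c := c₀) .sub (d := .dir .slow 2)
      (a₁ := .dir .slow 2) (a₂ := .const 1) (r := 4 + j) (Or.inl rfl) hc₀lt h2
      (const_val (by omega)) (by simp only [Op.nat]; omega) (by simp only [Op.ok]; omega)
    have e₁ := m₁.slow
    have k₁ : c₁.slow 3 = 68 + (j + 1) := by
      rw [e₁, Function.update_of_ne (by omega), s₀, h3]
    obtain ⟨c₂, b₂, m₂⟩ := moved_op (M := M) (c := c₁) .sub (d := .dir .slow 3)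
      (a₁ := .dir .slow 3) (a₂ := .const 1) (r := 68 + j) (Or.inl rfl) m₁.lt k₁
      (const_val (by omega)) (by simp only [Op.nat]; omega) (by simp only [Op.ok]; omega)
    have e₂ := m₂.slow
    have k₂ : c₂.slow 3 = 68 + j := by rw [e₂, Function.update_self]
    have k₂' : c₂.slow 2 = 4 + j := by
      rw [e₂, Function.update_of_ne (by omega), e₁, Function.update_self]
    obtain ⟨c₃, b₃, m₃⟩ := moved_op (M := M) (c := c₂) .div (d := .ind .slow .slow 3)
      (a₁ := .ind .slow .slow 2) (a₂ := .const 1) (u := c₂.slow (4 + j)) (Or.inr ⟨3, rfl, k₂⟩) m₂.lt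
      (by simp only [Operand.val, Config.load, k₂']) (const_val (by omega)) (Nat.div_one _) trivial
      ⟨rfl, Or.inl rfl⟩
    have e₃ := m₃.slow
    have g : ∀ a, a ≠ 2 → a ≠ 3 → c₂.slow a = c.slow a := fun a ha ha' => by
      rw [e₂, Function.update_of_ne ha', e₁, Function.update_of_ne ha, s₀]
    have g' : ∀ a, a ≠ 2 → a ≠ 3 → a ≠ 68 + j → c₃.slow a = c.slow a := fun a ha ha' h => by
      rw [e₃, Function.update_of_ne h, g a ha ha']
    obtain ⟨c₄, f, b₄, m₄, f0, f1, f2, f3⟩ := ih (c := c₃) m₃.lt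
      (by rw [e₃, Function.update_of_ne (by omega), k₂'])
      (by rw [e₃, Function.update_of_ne (by omega), k₂]) (const_val (by omega))
    have q : c₀.fastAccesses ≤ c.fastAccesses + 2 ∧ c₀.slowReads ≤ c.slowReads + 2 ∧
        c₀.slowWrites ≤ c.slowWrites + 2 := by
      simp [hc₀, Operand.count, Config.countRead]
    refine ⟨c₄, f, .while_true ?_ (.seq b₁ (.seq b₂ b₃)) b₄, ⟨m₄.lt, m₄.slow, ?_, ?_, ?_⟩,
      by rw [f0, g' 0 (by omega) (by omega) (by omega)],
      by rw [f1, g' 1 (by omega) (by omega) (by omega)], fun i hi => ?_, fun a ha => ?_⟩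
    · rw [h4]; simp only [Operand.val, Config.load, h2]; omega
    · have := m₁.fa; have := m₂.fa; have := m₃.fa; have := m₄.fa; omega
    · have := m₁.sr; have := m₂.sr; have := m₃.sr; have := m₄.sr; omega
    · have := m₁.sw; have := m₂.sw; have := m₃.sw; have := m₄.sw; omega
    · rcases Nat.lt_succ_iff_lt_or_eq.1 hi with h | rfl
      · rw [f2 i h, g' _ (by omega) (by omega) (by omega)]
      · rw [f3 _ le_rfl, e₃, Function.update_self, g _ (by omega) (by omega)]
    · rw [f3 a (by omega), g' a (by omega) (by omega) (by omega)]

/-- Move the strings, to make room for registers. -/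
def shiftL : LCmd :=
  .seq (.op .add (.dir .slow 2) (.dir .slow 0) (.dir .slow 1))
    (.seq (.op .add (.dir .slow 3) (.dir .slow 2) (.const 68))
      (.seq (.op .add (.dir .slow 2) (.dir .slow 2) (.const 4))
        (.seq (.whileLt (.const 4) (.dir .slow 2) shiftStep)
          (.seq (.op .div (.dir .slow 4) (.dir .slow 0) (.const 1))
            (.op .div (.dir .slow 5) (.dir .slow 1) (.const 1))))))

theorem shiftL_spec {w M m n : ℕ} {c : Config} (hc : c.AllLt w)
    (hm : c.slow 0 = m) (hn : c.slow 1 = n) (hw : 1000 + m + n < 2 ^ w) :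
    ∃ c' f, LCmd.Big w M shiftL c c' ∧ Moved w c c' f (20 * (m + n) + 40) ∧ f 4 = m ∧ f 5 = n ∧
      ∀ i < m + n, f (68 + i) = c.slow (4 + i) := by
  obtain ⟨c₁, b₁, m₁⟩ := moved_op (M := M) (c := c) .add (d := .dir .slow 2)
    (a₁ := .dir .slow 0) (a₂ := .dir .slow 1) (Or.inl rfl) hc hm hn rfl
    (by simp only [Op.ok]; omega)
  have e₁ := m₁.slow
  have k₁ : c₁.slow 2 = m + n := by rw [e₁]; exact Function.update_self ..
  obtain ⟨c₂, b₂, m₂⟩ := moved_op (M := M) (c := c₁) .add (d := .dir .slow 3)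
    (a₁ := .dir .slow 2) (a₂ := .const 68) (Or.inl rfl) m₁.lt k₁ (const_val (by omega)) rfl
    (by simp only [Op.ok]; omega)
  have e₂ := m₂.slow
  obtain ⟨c₃, b₃, m₃⟩ := moved_op (M := M) (c := c₂) .add (d := .dir .slow 2)
    (a₁ := .dir .slow 2) (a₂ := .const 4) (u := m + n) (Or.inl rfl) m₂.lt
    (by simp only [Operand.val, Config.load]; rw [e₂, Function.update_of_ne (by omega), k₁])
    (const_val (by omega)) rfl (by simp only [Op.ok]; omega)
  have e₃ := m₃.slow
  have g : ∀ a, a ≠ 2 → a ≠ 3 → c₃.slow a = c.slow a := fun a ha ha' => by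
    rw [e₃, Function.update_of_ne ha, e₂, Function.update_of_ne ha', e₁, Function.update_of_ne ha]
  obtain ⟨c₄, f, b₄, m₄, f0, f1, f2, -⟩ := shift_loop (M := M) (by omega) (m + n) (c := c₃) m₃.lt
    (by rw [e₃, Function.update_self]; exact Nat.add_comm _ _)
    (by rw [e₃, Function.update_of_ne (by omega), e₂, Function.update_self]
        exact Nat.add_comm _ _)
  -- With registers from cell 4 on, cells 4 and 5 belong to the variables `m` and `n`. They held
  -- letters until now, so they are filled last.
  obtain ⟨c₅, b₅, m₅⟩ := moved_op (M := M) (c := c₄) .div (d := .dir .slow 4)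
    (a₁ := .dir .slow 0) (a₂ := .const 1) (u := m) (Or.inl rfl) m₄.lt
    (by simp only [Operand.val, Config.load]; rw [m₄.slow, f0, g 0 (by omega) (by omega), hm])
    (const_val (by omega)) (Nat.div_one _) trivial
  have e₅ := m₅.slow
  obtain ⟨c₆, b₆, m₆⟩ := moved_op (M := M) (c := c₅) .div (d := .dir .slow 5)
    (a₁ := .dir .slow 1) (a₂ := .const 1) (u := n) (Or.inl rfl) m₅.lt
    (by simp only [Operand.val, Config.load]
        rw [e₅, Function.update_of_ne (by omega), m₄.slow, f1, g 1 (by omega) (by omega), hn])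
    (const_val (by omega)) (Nat.div_one _) trivial
  refine ⟨c₆, _, .seq b₁ (.seq b₂ (.seq b₃ (.seq b₄ (.seq b₅ b₆)))), ⟨m₆.lt, m₆.slow, ?_, ?_, ?_⟩,
    ?_, Function.update_self .., fun i hi => ?_⟩
  · have := m₁.fa; have := m₂.fa; have := m₃.fa; have := m₄.fa; have := m₅.fa; have := m₆.fa; omega
  · have := m₁.sr; have := m₂.sr; have := m₃.sr; have := m₄.sr; have := m₅.sr; have := m₆.sr; omega
  · have := m₁.sw; have := m₂.sw; have := m₃.sw; have := m₄.sw; have := m₅.sw; have := m₆.sw; omega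
  · rw [Function.update_of_ne (by omega), e₅, Function.update_self]
  · rw [Function.update_of_ne (by omega), e₅, Function.update_of_ne (by omega), m₄.slow, f2 i hi,
      g _ (by omega) (by omega)]

end AsymRAM

/-! ### The whole grid as a single tile in slow memory. -/

namespace AsymRAM

open AsymRAM.Expr

/-- The base addresses of the arrays in slow memory. -/
def slowBase (m n : ℕ) : Arr → ℕ
  | .X => 68 | .Y => 68 + m | .U => 68 + m + n | .E => 68 + m + n + (68 + m + n) | _ => 0

/-- The sizes of the arrays in slow memory. -/
def slowSize (m n : ℕ) : Arr → ℕ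
  | .X => m | .Y => n | .U => m + n + 1 | .E => m + n + 1 | _ => 0

/-- Set the base addresses of the arrays. -/
def slowBasesL : LCmd :=
  .seq (.op .div (.dir .slow 56) (.const 68) (.const 1))
    (.seq (.op .add (.dir .slow 57) (.dir .slow 56) (.dir .slow 4))
      (.seq (.op .add (.dir .slow 52) (.dir .slow 57) (.dir .slow 5))
        (.op .add (.dir .slow 53) (.dir .slow 52) (.dir .slow 52))))

/-- The computation for strings that form a single tile. -/
def singleC (sc : ℕ) (l : Bool) : Cmd :=
  .loop .t (V .th + C 1) (.put .U (V .t) (V .th - V .t)) ;;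
  .loop .t (V .tw) (.put .U (V .th + C 1 + V .t) (V .t + C 1)) ;;
  tileC sc ;; .set .val (.A .U (V .tw)) ;;
  (if l then .set .val ((V .th + V .tw - V .val) / C 2) else .skip)

/-- The computation in slow memory. -/
def slowMainC (sc : ℕ) (l : Bool) : Cmd :=
  .set .th (V .m) ;; .set .tw (V .n) ;; .set .hm (V .m) ;; .set .wn (V .n) ;; singleC sc l

variable {ℓ : Lay} {s : St}

/-- Cells 52, 53, 56 and 57 are the base registers of `U`, `E`, `X` and `Y` for registers that begin
at cell 4. The other arrays are not used and have size zero. -/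
theorem slowBasesL_spec {w M m n : ℕ} {c : Config} (hc : c.AllLt w)
    (hm : c.slow 4 = m) (hn : c.slow 5 = n) (hW : 1000 + 10 * (m + n) < 2 ^ w) :
    ∃ c' f, LCmd.Big w M slowBasesL c c' ∧ Moved w c c' f 24 ∧ f 56 = 68 ∧ f 57 = 68 + m ∧
      f 52 = 68 + m + n ∧ f 53 = 68 + m + n + (68 + m + n) ∧
      ∀ a, (a < 52 ∨ 58 ≤ a) → f a = c.slow a := by
  obtain ⟨c₁, b₁, m₁⟩ := moved_op (M := M) (c := c) .div (d := .dir .slow 56)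
    (a₁ := .const 68) (a₂ := .const 1) (Or.inl rfl) hc (const_val (by omega)) (const_val (by omega))
    (Nat.div_one _) trivial
  have e₁ : c₁.slow 56 = 68 := by rw [m₁.slow, Function.update_self]
  obtain ⟨c₂, b₂, m₂⟩ := moved_op (M := M) (c := c₁) .add (d := .dir .slow 57)
    (a₁ := .dir .slow 56) (a₂ := .dir .slow 4) (v := m) (Or.inl rfl) m₁.lt e₁
    (by simp only [Operand.val, Config.load]; rw [m₁.slow, Function.update_of_ne (by omega), hm])
    rfl (by simp only [Op.ok]; omega)
  have e₂ : c₂.slow 57 = 68 + m := by rw [m₂.slow, Function.update_self]; rfl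
  obtain ⟨c₃, b₃, m₃⟩ := moved_op (M := M) (c := c₂) .add (d := .dir .slow 52)
    (a₁ := .dir .slow 57) (a₂ := .dir .slow 5) (v := n) (Or.inl rfl) m₂.lt e₂
    (by simp only [Operand.val, Config.load]
        rw [m₂.slow, Function.update_of_ne (by omega), m₁.slow, Function.update_of_ne (by omega),
          hn])
    rfl (by simp only [Op.ok]; omega)
  have e₃ : c₃.slow 52 = 68 + m + n := by rw [m₃.slow, Function.update_self]; rfl
  obtain ⟨c₄, b₄, m₄⟩ := moved_op (M := M) (c := c₃) .add (d := .dir .slow 53)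
    (a₁ := .dir .slow 52) (a₂ := .dir .slow 52) (Or.inl rfl) m₃.lt e₃ e₃
    rfl (by simp only [Op.ok]; omega)
  refine ⟨c₄, _, .seq b₁ (.seq b₂ (.seq b₃ b₄)), ⟨m₄.lt, m₄.slow, ?_, ?_, ?_⟩,
    ?_, ?_, ?_, Function.update_self .., fun a ha => ?_⟩
  · have := m₁.fa; have := m₂.fa; have := m₃.fa; have := m₄.fa; omega
  · have := m₁.sr; have := m₂.sr; have := m₃.sr; have := m₄.sr; omega
  · have := m₁.sw; have := m₂.sw; have := m₃.sw; have := m₄.sw; omega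
  · rw [Function.update_of_ne (by omega), m₃.slow, Function.update_of_ne (by omega), m₂.slow,
      Function.update_of_ne (by omega), e₁]
  · rw [Function.update_of_ne (by omega), m₃.slow, Function.update_of_ne (by omega), e₂]
  · rw [Function.update_of_ne (by omega), e₃]
  · rw [Function.update_of_ne (by omega), m₃.slow, Function.update_of_ne (by omega), m₂.slow,
      Function.update_of_ne (by omega), m₁.slow, Function.update_of_ne (by omega)]

theorem isDist_dp (sc : ℕ) (x y : List ℕ) {X Y : ℕ → ℕ} (hX : ∀ j < x.length, X j = x.getD j 0)
    (hY : ∀ j < y.length, Y j = y.getD j 0) :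
    IsDist x.length y.length (letterW sc X Y) x.length y.length (dp sc x y) := by
  intro r c hr hc
  rw [if_pos hr, if_pos hc, letterW, hX r hr, hY c hc, dp]

/-- The initial frontier is the first column read upwards and then the first row, so position `t`
holds the distance of `t` from `m`. After the tile, the lower right corner is at position `n`. -/
theorem singleC_spec {sc : ℕ} (hsc : sc ≤ 2) (l : Bool) {x y : List ℕ}
    (hsz : ℓ.sz = slowSize x.length y.length) (h1 : s.v .th = x.length) (h2 : s.v .tw = y.length)
    (h3 : s.v .hm = x.length) (h4 : s.v .wn = y.length)
    (hX : ∀ j < x.length, s.ar .X j = x.getD j 0) (hY : ∀ j < y.length, s.ar .Y j = y.getD j 0)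
    (hW : 1000 + 10 * (x.length + y.length) < ℓ.W) :
    (singleC sc l).wp ℓ (fun s' =>
      s'.v .val = outVal l x.length y.length (dp sc x y x.length y.length) ∧ s'.wr ≤ s.wr ∧
      s'.rd ≤ s.rd ∧ s'.n ≤ s.n + (742 * (x.length * y.length) + 300 * (x.length + y.length) + 600))
      s := by
  set m := x.length with hm
  set n := y.length with hn
  have zU : ℓ.sz .U = m + n + 1 := by rw [hsz]; rfl
  have zE : ℓ.sz .E = m + n + 1 := by rw [hsz]; rfl
  have zX : ℓ.sz .X = m := by rw [hsz]; rfl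
  have zY : ℓ.sz .Y = n := by rw [hsz]; rfl
  refine Cmd.wp_mono (c := Cmd.loop _ _ _) ?_ (fill_spec (N := m + 1)
    (fun j t => if t < j then m - t else s.ar .U t) ⟨trivial, trivial, ?_⟩ ?_ (by omega) (by simp)
    (fun j hj s' h ht e => ?_))
  rotate_left
  · show s.v .th + 1 < ℓ.W; omega
  · show s.v .th + 1 = m + 1; omega
  · have e1 : s'.v .th = m := (h.v .th (by decide)).trans h1
    refine ⟨trivial, ⟨trivial, trivial, ?_⟩, ?_, ?_⟩
    · show s'.v .t ≤ s'.v .th; omega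
    · show s'.v .t < _; omega
    · funext t
      simp only [val_V, val_sub, ht, e1, Function.update_apply]
      split_ifs <;> first | rfl | omega
  rintro s₁ ⟨k₁, r₁, n₁, e₁⟩
  have th₁ : s₁.v .th = m := (k₁.v .th (by decide)).trans h1
  have tw₁ : s₁.v .tw = n := (k₁.v .tw (by decide)).trans h2
  refine Cmd.wp_mono (c := Cmd.loop _ _ _) ?_ (fill_spec (N := n)
    (fun j t => if m < t ∧ t ≤ m + j then t - m else s₁.ar .U t) trivial tw₁ (by omega)
    (by funext t; rw [if_neg (by omega)])
    (fun j hj s' h ht e => ?_))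
  rotate_left
  · have e1 : s'.v .th = m := (h.v .th (by decide)).trans th₁
    refine ⟨⟨⟨trivial, trivial, ?_⟩, trivial, ?_⟩, ⟨trivial, trivial, ?_⟩, ?_, ?_⟩
    · show s'.v .th + 1 < ℓ.W; omega
    · show s'.v .th + 1 + s'.v .t < ℓ.W; omega
    · show s'.v .t + 1 < ℓ.W; omega
    · show s'.v .th + 1 + s'.v .t < _; omega
    · funext t
      simp only [val_V, val_add, val_C, ht, e1, Function.update_apply]
      split_ifs <;> first | rfl | omega
  rintro s₂ ⟨k₂, r₂, n₂, e₂⟩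
  have th₂ : s₂.v .th = m := (k₂.v .th (by decide)).trans th₁
  have tw₂ : s₂.v .tw = n := (k₂.v .tw (by decide)).trans tw₁
  have X₂ : s₂.ar .X = s.ar .X := (k₂.ar .X (by decide)).trans (k₁.ar .X (by decide))
  have Y₂ : s₂.ar .Y = s.ar .Y := (k₂.ar .Y (by decide)).trans (k₁.ar .Y (by decide))
  have U₂ : ∀ t ≤ m + n, s₂.ar .U t = if t ≤ m then m - t else t - m := fun t ht => by
    rw [e₂, e₁]; dsimp only; split_ifs <;> first | rfl | omega
  refine Cmd.wp_mono (c := tileC sc) ?_ (tileC_spec hsc th₂ tw₂ (B := m + n) (by omega) (by omega)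
    (by omega) (by omega) (fun t ht => by rw [U₂ t ht]; split_ifs <;> omega) (by omega) (by omega))
  rintro s₃ ⟨k₃, r₃, n₃, e₃⟩
  have th₃ : s₃.v .th = m := (k₃.v .th (by decide)).trans th₂
  have tw₃ : s₃.v .tw = n := (k₃.v .tw (by decide)).trans tw₂
  have hd : s₃.ar .U n = dp sc x y m n := by
    have e := congrArg Prod.fst e₃
    rw [tileFn_fst, (k₂.v .hm (by decide)).trans ((k₁.v .hm (by decide)).trans h3),
      (k₂.v .wn (by decide)).trans ((k₁.v .wn (by decide)).trans h4), X₂, Y₂] at e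
    dsimp only at e
    rw [e]
    refine (tileV_eq (isDist_dp sc x y hX hY) (fun i hi => ?_) (fun j hj => ?_)).1 n le_rfl
    · rw [U₂ _ (by omega), if_pos (by omega), dp_zero_right]; omega
    · rw [U₂ _ (by omega), dp_zero_left]; split_ifs <;> omega
  have hdle : dp sc x y m n ≤ m + n := dp_le_add _ _
  have w₃ : s₃.wr = s.wr := k₃.wr.trans (k₂.wr.trans k₁.wr)
  simp only [cost_V, cost_C, cost_add, cost_sub] at n₁ n₂
  have e4 : m * (742 * n + 72) = 742 * (m * n) + 72 * m := by ring
  rw [e4] at n₃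
  cases l <;> simp only [outVal, Cmd.wp, ok_add, ok_sub, ok_div, ok_V, ok_C, ok_A,
    val_add, val_sub, val_div, val_V, val_C, val_A, St.setv_v, reduceCtorEq, if_true, if_false,
    th₃, tw₃, hd, true_and, and_true, Bool.false_eq_true]
  · refine ⟨by omega, ?_⟩
    simp; omega
  · refine ⟨by omega, ⟨by omega, by omega⟩, ?_⟩
    simp; omega

theorem slowMainC_spec {sc : ℕ} (hsc : sc ≤ 2) (l : Bool) {x y : List ℕ}
    (hsz : ℓ.sz = slowSize x.length y.length) (hm : s.v .m = x.length) (hn : s.v .n = y.length)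
    (hX : ∀ j < x.length, s.ar .X j = x.getD j 0) (hY : ∀ j < y.length, s.ar .Y j = y.getD j 0)
    (hW : 1000 + 10 * (x.length + y.length) < ℓ.W) :
    (slowMainC sc l).wp ℓ (fun s' =>
      s'.v .val = outVal l x.length y.length (dp sc x y x.length y.length) ∧ s'.wr ≤ s.wr ∧
      s'.rd ≤ s.rd ∧ s'.n ≤ s.n + (742 * (x.length * y.length) + 300 * (x.length + y.length) + 700))
      s := by
  refine ⟨trivial, trivial, trivial, trivial, ?_⟩
  refine Cmd.wp_mono (c := singleC sc l) ?_ (singleC_spec hsc l hsz (by simp [hm]) (by simp [hn])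
    (by simp [hm]) (by simp [hn]) hX hY hW)
  rintro s' ⟨h1, h2, h3, h4⟩
  simp only [St.setv_n, cost_V] at h4
  exact ⟨h1, h2, h3, by linarith⟩

end AsymRAM

namespace AsymRAM

open AsymRAM.Expr

/-- The program for a very small fast memory. -/
def slowL (sc : ℕ) (l : Bool) : LCmd :=
  .seq shiftL (.seq slowBasesL (.seq ((slowMainC sc l).code .slow 4)
    (.op .div (.dir .slow 0) (.dir .slow (4 + Var.val.idx)) (.const 1))))

theorem small_slowMainC (sc : ℕ) (hsc : sc ≤ 2) (l : Bool) : (slowMainC sc l).small := by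
  interval_cases sc <;> cases l <;> decide

theorem slowL_spec {sc : ℕ} (hsc : sc ≤ 2) (l : Bool) {w M : ℕ} {c : Config} {x y : List ℕ}
    (hc : c.AllLt w) (hf : c.fastAccesses = 0) (hm : c.slow 0 = x.length) (hn : c.slow 1 = y.length)
    (hx : ∀ j < x.length, c.slow (4 + j) = x.getD j 0)
    (hy : ∀ j < y.length, c.slow (4 + x.length + j) = y.getD j 0)
    (hx1 : 1 ≤ x.length) (hy1 : 1 ≤ y.length)
    (hW : 1000 + 10 * (x.length + y.length) < 2 ^ w) :
    ∃ c', LCmd.Big w M (slowL sc l) c c' ∧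
      c'.slow 0 = outVal l x.length y.length (dp sc x y x.length y.length) ∧
      c'.slowWrites ≤ c.slowWrites + 4000 * (x.length * y.length) ∧
      c'.slowReads ≤ c.slowReads + 4000 * (x.length * y.length) ∧
      c'.fastAccesses ≤ c.fastAccesses + 4000 * (x.length * y.length) := by
  obtain ⟨c₁, f, b₁, m₁, f4, f5, f6⟩ := shiftL_spec (M := M) hc hm hn (by omega)
  obtain ⟨c₂, g, b₂, m₂, g56, g57, g52, g53, g0⟩ := slowBasesL_spec (M := M) m₁.lt
    (by rw [m₁.slow, f4]) (by rw [m₁.slow, f5]) hW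
  have G : ∀ i < x.length + y.length, c₂.slow (68 + i) = c.slow (4 + i) := fun i hi => by
    rw [m₂.slow, g0 _ (by omega), m₁.slow, f6 i hi]
  set s : St := ⟨fun x => c₂.slow (4 + x.idx), fun y => c₂.slow (4 + y.idx),
    fun y i => c₂.slow (c₂.slow (4 + y.idx) + i), 0,
    c₂.fastAccesses, c₂.slowReads, c₂.slowWrites⟩ with hs
  set ℓ : Lay := ⟨w, M, .slow, 4, slowSize x.length y.length⟩ with hℓ
  have aX : s.ad .X = 68 := by rw [← g56, ← m₂.slow]; rfl
  have aY : s.ad .Y = 68 + x.length := by rw [← g57, ← m₂.slow]; rfl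
  have aU : s.ad .U = 68 + x.length + y.length := by rw [← g52, ← m₂.slow]; rfl
  have aE : s.ad .E = 68 + x.length + y.length + (68 + x.length + y.length) := by
    rw [← g53, ← m₂.slow]; rfl
  have had : ∀ (y' : Arr) (i : ℕ), i < slowSize x.length y.length y' →
      s.ad y' = slowBase x.length y.length y' := fun y' i hi => by
    cases y' <;> first | assumption | exact absurd hi (Nat.not_lt_zero _)
  have R : Rep ℓ s c₂ := by
    refine ⟨m₂.lt, by simp only [hℓ]; omega, fun h => (nomatch h), fun _ => rfl, fun _ => rfl,
      fun _ _ _ => rfl, fun h => (nomatch h), fun z i hi => ?_, fun z z' i i' hi hi' e => ?_, le_rfl,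
      Nat.le_add_right _ _, Nat.le_add_right _ _⟩
    · have : 68 ≤ s.ad z + i ∧ s.ad z + i < 1000 + 10 * (x.length + y.length) := by
        rw [had z i hi]
        simp only [hℓ] at hi
        cases z <;> simp only [slowBase, slowSize] at hi ⊢ <;> omega
      exact ⟨by simp only [hℓ]; omega, fun h => (nomatch h), by simp only [hℓ]; omega⟩
    · rw [had z i hi, had z' i' hi'] at e
      simp only [hℓ] at hi hi'
      cases z <;> cases z' <;> simp only [slowBase, slowSize] at hi hi' e <;>
        first | exact ⟨rfl, by omega⟩ | omega
  obtain ⟨c₃, s₃, b₃, R₃, v₃, w₃, r₃, n₃⟩ := Cmd.code_spec R (small_slowMainC sc hsc l)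
    (slowMainC_spec hsc l (x := x) (y := y) rfl
      (by rw [← f4, ← m₁.slow, ← g0 4 (by omega), ← m₂.slow]; rfl)
      (by rw [← f5, ← m₁.slow, ← g0 5 (by omega), ← m₂.slow]; rfl)
      (fun j hj => by
        show c₂.slow (s.ad .X + j) = _
        rw [aX, G j (by omega), hx j hj])
      (fun j hj => by
        show c₂.slow (s.ad .Y + j) = _
        rw [aY, Nat.add_assoc, G _ (by omega), ← hy j hj, Nat.add_assoc]) hW)
  obtain ⟨c₄, b₄, m₄⟩ := moved_op (w := w) (M := M) (c := c₃) .div (d := .dir .slow 0)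
    (a₁ := .dir .slow (4 + Var.val.idx)) (a₂ := .const 1) (Or.inl rfl) R₃.lt (R₃.var .val)
    (const_val (by omega)) (Nat.div_one _) trivial
  have t1 : x.length ≤ x.length * y.length := Nat.le_mul_of_pos_right _ hy1
  have t2 : y.length ≤ x.length * y.length := Nat.le_mul_of_pos_left _ hx1
  have q1 := R₃.fa
  have q2 := R₃.sr
  have q3 := R₃.sw
  simp only [hℓ, Lay.loc] at q1 q2 q3
  simp only [hs] at w₃ r₃ n₃
  have p1 := m₁.fa; have p2 := m₂.fa; have p4 := m₄.fa
  have p5 := m₁.sr; have p6 := m₂.sr; have p8 := m₄.sr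
  have p9 := m₁.sw; have p10 := m₂.sw; have p12 := m₄.sw
  refine ⟨c₄, .seq b₁ (.seq b₂ (.seq b₃ b₄)), by rw [m₄.slow, Function.update_self, v₃], ?_, ?_, ?_⟩
  · omega
  · omega
  · omega

end AsymRAM

/-! ### The whole program on its initial configuration. -/

namespace AsymRAM

/-- The whole program. -/
def topL (sc : ℕ) (l b : Bool) : LCmd :=
  .ite (.dir .slow 2) (.const 100) (slowL sc l) (fastL sc l b)

theorem init_allLt (w M ω : ℕ) (x y : List ℕ) : (init w M ω x y).AllLt w := fun a => by
  have : 0 < 2 ^ w := by positivity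
  refine ⟨this, ?_⟩
  show min _ (2 ^ w - 1) < 2 ^ w
  omega

theorem init_slow_x {w M ω : ℕ} {x y : List ℕ} (hx : ∀ a ∈ x, a < 2 ^ w) :
    ∀ j < x.length, (init w M ω x y).slow (4 + j) = x.getD j 0 := fun j hj => by
  have h : x.getD j 0 < 2 ^ w := by
    rw [List.getD_eq_getElem _ _ hj]; exact hx _ (List.getElem_mem hj)
  show min (([x.length, y.length, M, ω] ++ x ++ y).getD (4 + j) 0) (2 ^ w - 1) = _
  rw [List.append_assoc, List.getD_append_right _ _ _ _ (by simp), List.getD_append _ _ _ _ (by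
    simpa using hj)]
  simp only [List.length_cons, List.length_nil, Nat.zero_add, Nat.reduceAdd, Nat.add_sub_cancel_left]
  omega

theorem init_slow_y {w M ω : ℕ} {x y : List ℕ} (hy : ∀ a ∈ y, a < 2 ^ w) :
    ∀ j < y.length, (init w M ω x y).slow (4 + x.length + j) = y.getD j 0 := fun j hj => by
  have h : y.getD j 0 < 2 ^ w := by
    rw [List.getD_eq_getElem _ _ hj]; exact hy _ (List.getElem_mem hj)
  show min (([x.length, y.length, M, ω] ++ x ++ y).getD (4 + x.length + j) 0) (2 ^ w - 1) = _
  rw [List.getD_append_right _ _ _ _ (by simp; omega)]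
  have e : 4 + x.length + j - ([x.length, y.length, M, ω] ++ x).length = j := by simp; omega
  rw [e]
  omega

theorem topL_spec {sc : ℕ} (hsc : sc ≤ 2) (l b : Bool) {w M ω : ℕ} {x y : List ℕ}
    (hM : 1 ≤ M) (hω : 1 ≤ ω) (hx : ∀ a ∈ x, a < 2 ^ w) (hy : ∀ a ∈ y, a < 2 ^ w)
    (hx1 : 1 ≤ x.length) (hy1 : 1 ≤ y.length) {S : ℕ} (hS : S = tileSide b M ω)
    (hW : 1000 + M + 100 * (x.length + y.length + M * M * M) < 2 ^ w) :
    ∃ c', LCmd.Big w M (topL sc l b) (init w M ω x y) c' ∧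
      c'.slow 0 = outVal l x.length y.length (dp sc x y x.length y.length) ∧
      (M < 100 → c'.slowWrites ≤ 5000 * (x.length * y.length) ∧
        c'.slowReads ≤ 5000 * (x.length * y.length) ∧
        c'.fastAccesses ≤ 5000 * (x.length * y.length)) ∧
      (100 ≤ M → ∃ k, IsBlockNum S (sideWeight b S) ω k ∧
        c'.slowWrites ≤ 12 * ((x.length / (k * S) + 1) * (y.length / (k * S) + 1) * (k * S)) ∧
        c'.slowReads ≤
          31 * ((x.length / (k * S) + 1) * (y.length / (k * S) + 1) * (k * k * k * k * S)) ∧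
        c'.fastAccesses ≤ 60000 * ((x.length / (k * S) + 1) * (y.length / (k * S) + 1) *
          (k * k * k * k * (S * S)))) := by
  have hS1 : 1 ≤ S := hS ▸ tileSide_pos _ _ _
  have hSM : S ≤ M := hS ▸ tileSide_le b hM
  have hS3 : S * S * S ≤ M * M * M := Nat.mul_le_mul (Nat.mul_le_mul hSM hSM) hSM
  set c₀ := (Operand.const 100).count ((Operand.dir .slow 2).count (init w M ω x y)) with hc₀
  have s₀ : c₀.slow = (init w M ω x y).slow := rfl
  have lt₀ : c₀.AllLt w := init_allLt w M ω x y
  have e0 : c₀.slow 0 = x.length := by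
    show min x.length (2 ^ w - 1) = _; omega
  have e1 : c₀.slow 1 = y.length := by
    show min y.length (2 ^ w - 1) = _; omega
  have e2 : c₀.slow 2 = M := by
    show min M (2 ^ w - 1) = _; omega
  have e3 : c₀.slow 3 = min ω (2 ^ w - 1) := rfl
  have hval : (Operand.dir .slow 2).val w M (init w M ω x y) = M := e2
  have hcst : (Operand.const 100).val w M (init w M ω x y) = 100 := const_val (by omega)
  have hmn : 1 ≤ x.length * y.length := Nat.mul_pos hx1 hy1
  by_cases h : M < 100
  · obtain ⟨c', h1, h2, h3, h4, h5⟩ := slowL_spec (M := M) hsc l lt₀ rfl e0 e1 (init_slow_x hx)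
      (init_slow_y hy) hx1 hy1 (by omega)
    refine ⟨c', .ite_true (by rw [hval, hcst]; exact h) h1, h2, fun _ => ⟨?_, ?_, ?_⟩,
      fun h' => by omega⟩
    · have : c₀.slowWrites = 0 := rfl
      omega
    · have : c₀.slowReads = 1 := rfl
      omega
    · have : c₀.fastAccesses = 0 := rfl
      omega
  · obtain ⟨c', k, h1, h2, h3, h4, h5, h6⟩ := fastL_spec (M := M) hsc l b lt₀ (not_lt.1 h) e0 e1 e2
      (by omega) (init_slow_x hx) (init_slow_y hy) (S := S) (by
        rw [hS, e3]; cases b <;> simp only [tileSide, if_true, Bool.false_eq_true, if_false]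
        congr 2; omega) (by omega)
    refine ⟨c', .ite_false (by rw [hval, hcst]; exact h) h1, h3, fun h' => by omega, fun _ =>
      ⟨k, ⟨h2.pos, h2.sq, ?_, ?_⟩, ?_, ?_, ?_⟩⟩
    · have := h2.cube; omega
    · rcases h2.max with h7 | h7
      · exact Or.inl h7
      · right
        -- The program sees `ω` only up to the largest word. This does not matter: `(k + 1) ^ 3 * q
        -- ≤ 8 * S ^ 3` is below that word, so a constraint that fails for the capped value fails
        -- for `ω` too.
        have hk1 : k + 1 ≤ 2 * k := by have := h2.pos; omega
        have hkS : k ≤ S := (Nat.le_mul_of_pos_right _ h2.pos).trans h2.sq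
        have hq : sideWeight b S ≤ S := by cases b <;> simp [sideWeight, hS1]
        have h8 : (k + 1) * (k + 1) * (k + 1) * sideWeight b S ≤ 2 * k * (2 * k) * (2 * k) * S :=
          Nat.mul_le_mul (Nat.mul_le_mul (Nat.mul_le_mul hk1 hk1) hk1) hq
        have h9 : k * k * k * S ≤ S * S * S := Nat.mul_le_mul_right _ (Nat.mul_le_mul h2.sq hkS)
        have e : 2 * k * (2 * k) * (2 * k) * S = 8 * (k * k * k * S) := by ring
        omega
    · have : c₀.slowWrites = 0 := rfl
      omega
    · have : c₀.slowReads = 1 := rfl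
      have : 1 ≤ (x.length / (k * S) + 1) * (y.length / (k * S) + 1) * (k * k * k * k * S) :=
        Nat.mul_pos (Nat.mul_pos (Nat.succ_pos _) (Nat.succ_pos _)) (Nat.mul_pos (Nat.mul_pos
          (Nat.mul_pos (Nat.mul_pos h2.pos h2.pos) h2.pos) h2.pos) hS1)
      omega
    · have : c₀.fastAccesses = 0 := rfl
      omega

end AsymRAM

/-! ### Comparison of the side of a block with the claimed bound. -/

/-- `R` is the smaller one of `T ^ (1 / 3) * M` and `M ^ (3 / 2)`. -/
structure IsScale (T M R : ℝ) : Prop where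
  pos : 0 < R
  cube : R ^ 3 ≤ T * M ^ 3
  sq : R ^ 2 ≤ M ^ 3
  max : ∀ K, 0 ≤ K → K ^ 3 ≤ T * M ^ 3 → K ^ 2 ≤ M ^ 3 → K ≤ R

theorem isScale {T M : ℝ} (hT : 0 < T) (hM : 0 < M) :
    IsScale T M (min (T ^ ((1 : ℝ) / 3)) (Real.sqrt M) * M) := by
  set t := T ^ ((1 : ℝ) / 3) with ht
  set q := Real.sqrt M with hq
  have ht0 : 0 < t := Real.rpow_pos_of_pos hT _
  have hq0 : 0 < q := Real.sqrt_pos.2 hM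
  have ht3 : t ^ 3 = T := by
    rw [ht, ← Real.rpow_natCast, ← Real.rpow_mul hT.le]; norm_num
  have hq2 : q ^ 2 = M := Real.sq_sqrt hM.le
  have hmin : 0 < min t q := lt_min ht0 hq0
  refine ⟨mul_pos hmin hM, ?_, ?_, fun K hK h1 h2 => ?_⟩
  · rw [mul_pow, ← ht3]
    gcongr
    exact min_le_left _ _
  · have : M ^ 3 = q ^ 2 * M ^ 2 := by rw [hq2]; ring
    rw [mul_pow, this]
    gcongr
    exact min_le_right _ _
  · rw [min_mul_of_nonneg _ _ hM.le]
    refine le_min ?_ ?_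
    · rw [← ht3, ← mul_pow] at h1
      exact (pow_le_pow_iff_left₀ hK (by positivity) (by norm_num)).1 h1
    · have : M ^ 3 = (q * M) ^ 2 := by rw [mul_pow, hq2]; ring
      rw [this] at h2
      exact (pow_le_pow_iff_left₀ hK (by positivity) (by norm_num)).1 h2

/-- `M ^ (2 / 3)` satisfies both constraints in the maximality of `R`. Thus `M` is bounded by a
power of `R`, hence of the lengths, and words of logarithmic size can hold the addresses in fast
memory. -/
theorem IsScale.sq_le_cube {T M R : ℝ} (h : IsScale T M R) (hM : 1 ≤ M) (hT : 1 ≤ T * M) :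
    M ^ 2 ≤ R ^ 3 := by
  set K := M ^ ((2 : ℝ) / 3) with hK
  have hM0 : 0 ≤ M := by linarith
  have hK0 : 0 ≤ K := Real.rpow_nonneg hM0 _
  have hK3 : K ^ 3 = M ^ 2 := by
    rw [hK, ← Real.rpow_natCast, ← Real.rpow_mul hM0, ← Real.rpow_natCast]; norm_num
  have hKM : K ≤ M := by
    rw [← pow_le_pow_iff_left₀ hK0 hM0 (n := 3) (by norm_num), hK3]
    nlinarith [pow_nonneg hM0 2]
  rw [← hK3]
  refine pow_le_pow_left₀ hK0 (h.max K hK0 ?_ ?_) 3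
  · rw [hK3]; nlinarith [pow_nonneg hM0 2]
  · nlinarith [pow_le_pow_left₀ hK0 hKM 2, pow_nonneg hM0 2]

/-- Words that are long enough in comparison with the strings hold all numbers that occur. -/
theorem exists_wordSize {c : ℝ} (hc : 0 < c) : ∃ d : ℕ, ∀ (T R : ℝ) (M m n w : ℕ), 1 ≤ M →
    IsScale T M R → 1 ≤ T * M → c * R ≤ m → c * R ≤ n → (m + n) ^ d ≤ 2 ^ w →
    1 ≤ m ∧ 1 ≤ n ∧ 1000 + M + 100 * (m + n + M * M * M) < 2 ^ w := by
  -- With `N = m + n` one has `M ^ 4 ≤ (N / c) ^ 6`, so this constant times `N ^ 6` bounds all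
  -- numbers needed. As `N ≥ 2`, the factor `N ^ d` absorbs the constant.
  obtain ⟨d, hd⟩ := pow_unbounded_of_one_lt (1100 + 101 * (1 / c) ^ 6) (one_lt_two (α := ℝ))
  refine ⟨d + 6, fun T R M m n w hM hs hT hm hn hw => ?_⟩
  have hR := mul_pos hc hs.pos
  have hm1 : 1 ≤ m := by
    have : (0 : ℝ) < m := hR.trans_le hm
    exact_mod_cast this
  have hn1 : 1 ≤ n := by
    have : (0 : ℝ) < n := hR.trans_le hn
    exact_mod_cast this
  refine ⟨hm1, hn1, ?_⟩
  have hM1 : (1 : ℝ) ≤ M := by exact_mod_cast hM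
  set N : ℝ := m + n with hN
  have hm1' : (1 : ℝ) ≤ m := by exact_mod_cast hm1
  have hn1' : (1 : ℝ) ≤ n := by exact_mod_cast hn1
  have hN2 : 2 ≤ N := by linarith
  have hRm : R ≤ 1 / c * N := by
    rw [one_div, ← div_eq_inv_mul, le_div_iff₀ hc]; linarith
  have h2 : (M : ℝ) ^ 2 ≤ (1 / c * N) ^ 3 :=
    (hs.sq_le_cube hM1 hT).trans (pow_le_pow_left₀ hs.pos.le hRm 3)
  have h4 : (M : ℝ) ^ 4 ≤ (1 / c) ^ 6 * N ^ 6 := by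
    calc (M : ℝ) ^ 4 = ((M : ℝ) ^ 2) ^ 2 := by ring
      _ ≤ ((1 / c * N) ^ 3) ^ 2 := pow_le_pow_left₀ (by positivity) h2 2
      _ = (1 / c) ^ 6 * N ^ 6 := by ring
  have h3 : (M : ℝ) * M * M ≤ M ^ 4 := by
    nlinarith [pow_nonneg (zero_le_one.trans hM1) 3]
  have h1 : (M : ℝ) ≤ M ^ 4 := le_self_pow₀ hM1 (by norm_num)
  have hN6 : N ≤ N ^ 6 := le_self_pow₀ (by linarith) (by norm_num)
  have key : (1000 : ℝ) + M + 100 * (m + n + M * M * M) < 2 ^ w := by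
    calc (1000 : ℝ) + M + 100 * (m + n + M * M * M)
        ≤ 1000 * N ^ 6 + M ^ 4 + 100 * (N ^ 6 + M ^ 4) := by nlinarith
      _ ≤ (1100 + 101 * (1 / c) ^ 6) * N ^ 6 := by nlinarith
      _ < 2 ^ d * N ^ 6 := by gcongr
      _ ≤ N ^ d * N ^ 6 := by gcongr
      _ = N ^ (d + 6) := (pow_add _ _ _).symm
      _ ≤ 2 ^ w := by rw [hN]; exact_mod_cast hw
  exact_mod_cast key

/-- Here the lower bound on the lengths enters: `K ≤ R ≤ a / c` for either length `a`, so padding to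
whole blocks costs at most a factor `1 + 1 / c` in each direction. -/
theorem block_count {c R : ℝ} (hc : 0 < c) {m n K : ℕ} (hK : 1 ≤ K) (hKR : (K : ℝ) ≤ R)
    (hm : c * R ≤ m) (hn : c * R ≤ n) :
    (((m / K + 1) * (n / K + 1) * (K * K) : ℕ) : ℝ) ≤ (1 + 1 / c) ^ 2 * (m * n) := by
  have hK0 : (0 : ℝ) < K := by exact_mod_cast hK
  have key : ∀ a : ℕ, c * R ≤ a → (((a / K + 1) * K : ℕ) : ℝ) ≤ (1 + 1 / c) * a := fun a ha => by
    have h1 : ((a / K * K : ℕ) : ℝ) ≤ a := by exact_mod_cast Nat.div_mul_le_self a K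
    have h2 : (K : ℝ) ≤ 1 / c * a := by
      rw [one_div, ← div_eq_inv_mul, le_div_iff₀ hc]
      nlinarith
    push_cast at h1 ⊢
    linarith
  have := mul_le_mul (key m hm) (key n hn) (by positivity) (by positivity)
  calc (((m / K + 1) * (n / K + 1) * (K * K) : ℕ) : ℝ)
      = (((m / K + 1) * K : ℕ) : ℝ) * (((n / K + 1) * K : ℕ) : ℝ) := by push_cast; ring
    _ ≤ _ := this
    _ = _ := by ring

namespace AsymRAM

/-- The constraints on `k`, multiplied by powers of `S ≤ M`, are the two constraints in the
maximality of `R`. -/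
theorem IsBlockNum.le_scale {S q o k : ℕ} {T M R : ℝ} (h : IsBlockNum S q o k)
    (hs : IsScale T M R) (hq : 0 < q) (hSM : (S : ℝ) ≤ M)
    (ho : (o : ℝ) * S ^ 3 ≤ T * M ^ 3 * q) : ((k * S : ℕ) : ℝ) ≤ R := by
  have hq0 : (0 : ℝ) < q := by exact_mod_cast hq
  refine hs.max _ (by positivity) ?_ ?_
  · have h1 : ((k * k * k * q : ℕ) : ℝ) ≤ o := by exact_mod_cast h.cube
    push_cast at h1 ⊢
    refine le_of_mul_le_mul_right ?_ hq0
    calc ((k : ℝ) * S) ^ 3 * (q : ℝ) = ((k : ℝ) * k * k * q) * S ^ 3 := by ring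
      _ ≤ (o : ℝ) * S ^ 3 := by gcongr
      _ ≤ _ := ho
  · have h1 : ((k * k : ℕ) : ℝ) ≤ S := by exact_mod_cast h.sq
    push_cast at h1 ⊢
    calc ((k : ℝ) * S) ^ 2 = ((k : ℝ) * k) * S ^ 2 := by ring
      _ ≤ (S : ℝ) * S ^ 2 := by gcongr
      _ = (S : ℝ) ^ 3 := by ring
      _ ≤ M ^ 3 := by gcongr

/-- One of the two constraints on `k` fails for `k + 1 ≤ 2 * k`, so up to a constant it is tight,
and `R` satisfies the same constraint. The constant `8000000` is `200 ^ 3`, from `M ≤ 200 * S`, and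
`6000` suffices in both cases. -/
theorem IsBlockNum.scale_le {S q o k : ℕ} {T M R : ℝ} (h : IsBlockNum S q o k)
    (hs : IsScale T M R) (hq : 0 < q) (hM : 0 ≤ M) (hSM : M ≤ 200 * S)
    (ho : T * M ^ 3 * q ≤ 8000000 * o * S ^ 3) : R ≤ 6000 * (k * S : ℕ) := by
  have hq0 : (0 : ℝ) < q := by exact_mod_cast hq
  have hk : ((k + 1 : ℕ) : ℝ) ≤ 2 * k := by
    have : k + 1 ≤ 2 * k := by have := h.pos; omega
    exact_mod_cast this
  push_cast at hk ⊢
  rcases h.max with h1 | h1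
  · have h1 : ((S : ℕ) : ℝ) ≤ ((k + 1) * (k + 1) : ℕ) := by exact_mod_cast h1.le
    push_cast at h1
    refine (pow_le_pow_iff_left₀ hs.pos.le (by positivity) (n := 2) (by norm_num)).1 ?_
    calc R ^ 2 ≤ M ^ 3 := hs.sq
      _ ≤ (200 * S) ^ 3 := by gcongr
      _ = 8000000 * S ^ 2 * S := by ring
      _ ≤ 8000000 * S ^ 2 * ((2 * k) * (2 * k)) := by
        gcongr
        exact h1.trans (by gcongr)
      _ = 32000000 * (k * S) ^ 2 := by ring
      _ ≤ 36000000 * (k * S) ^ 2 := by gcongr; norm_num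
      _ = (6000 * (k * S)) ^ 2 := by ring
  · have h1 : ((o : ℕ) : ℝ) ≤ ((k + 1) * (k + 1) * (k + 1) * q : ℕ) := by exact_mod_cast h1.le
    push_cast at h1
    refine (pow_le_pow_iff_left₀ hs.pos.le (by positivity) (n := 3) (by norm_num)).1 ?_
    refine le_of_mul_le_mul_right ?_ hq0
    have h2 : (o : ℝ) ≤ (2 * k) * (2 * k) * (2 * k) * q := h1.trans (by gcongr)
    calc R ^ 3 * (q : ℝ) ≤ T * M ^ 3 * (q : ℝ) := by have := hs.cube; gcongr
      _ ≤ 8000000 * (o : ℝ) * (S : ℝ) ^ 3 := ho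
      _ ≤ 8000000 * ((2 * k) * (2 * k) * (2 * k) * q) * (S : ℝ) ^ 3 := by gcongr
      _ = 64000000 * (((k : ℝ) * S) ^ 3 * q) := by ring
      _ ≤ 216000000000 * (((k : ℝ) * S) ^ 3 * q) := by gcongr; norm_num
      _ = (6000 * ((k : ℝ) * S)) ^ 3 * q := by ring

theorem le_tileSide (b : Bool) (M ω : ℕ) :
    (if b then min M ω else M) ≤ 200 * tileSide b M ω := by
  unfold tileSide
  generalize (if b then min M ω else M) = a
  omega

/-- The costs of the blocks, in terms of the number of pairs of letters. -/
theorem block_costs {c R : ℝ} (hc : 0 < c) {m n S q o k : ℕ} (h : IsBlockNum S q o k) (hS : 1 ≤ S)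
    (hKR : ((k * S : ℕ) : ℝ) ≤ R) (hm : c * R ≤ m) (hn : c * R ≤ n) {B X : ℝ}
    (hB : B = ((m / (k * S) + 1) * (n / (k * S) + 1) : ℕ)) (hX : X = (1 + 1 / c) ^ 2 * (m * n)) :
    B * (k * S) * (k * S) ≤ X ∧ B * (k * k * k * k * S) ≤ X ∧
      B * (k * k * k * k * S) * (k * S) ≤ X * (k * k * k) ∧
      B * (k * k * k * k * (S * S)) * (k * S) ≤ X * (k * k * k * S) := by
  have hBK := block_count hc (Nat.mul_pos h.pos hS) hKR hm hn
  have e : (((m / (k * S) + 1) * (n / (k * S) + 1) * (k * S * (k * S)) : ℕ) : ℝ)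
      = B * (k * S) * (k * S) := by rw [hB]; push_cast; ring
  rw [e, ← hX] at hBK
  have hS0 : (0 : ℝ) < S := by exact_mod_cast hS
  have hX0 : 0 ≤ X := by rw [hX]; positivity
  have hk : (k : ℝ) * k ≤ S := by exact_mod_cast h.sq
  refine ⟨hBK, ?_, ?_, ?_⟩
  -- After cancelling `S` this is `k ^ 2 ≤ S`: the reads are `O(1)` for each pair of letters.
  · refine le_of_mul_le_mul_right ?_ hS0
    calc B * (k * k * k * k * S) * S = B * (k * S) * (k * S) * (k * k) := by ring
      _ ≤ X * (k * k) := by gcongr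
      _ ≤ X * S := by gcongr
  · calc B * (k * k * k * k * S) * (k * S) = B * (k * S) * (k * S) * (k * k * k) := by ring
      _ ≤ _ := by gcongr
  · calc B * (k * k * k * k * (S * S)) * (k * S)
        = B * (k * S) * (k * S) * (k * k * k * S) := by ring
      _ ≤ _ := by gcongr

end AsymRAM

/-! ### The final bounds. -/

namespace AsymRAM

theorem ComputesWithin_topL {sc : ℕ} (l b : Bool) {w M ω : ℕ} {x y : List ℕ} {c' : Config}
    (h : LCmd.Big w M (topL sc l b) (init w M ω x y) c') {r : ℕ} (hr : c'.slow 0 = r) (B : ℝ) :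
    (((c'.slowReads : ℝ) + ω * c'.slowWrites + c'.fastAccesses ≤ B) →
      ((topL sc l b).code 0).ComputesWithin w M ω x y r (Config.work ω) B) ∧
    (((c'.slowReads : ℝ) + ω * c'.slowWrites ≤ B) →
      ((topL sc l b).code 0).ComputesWithin w M ω x y r (Config.ioCost ω) B) := by
  subst hr
  refine ⟨fun hB => h.computesWithin _ _ (fun _ _ => rfl) ?_,
    fun hB => h.computesWithin _ _ (fun _ _ => rfl) ?_⟩
  · simp only [Config.work, Config.ioCost]; push_cast; exact hB
  · simp only [Config.ioCost]; push_cast; exact hB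

/-- For a very small fast memory the claimed bounds are at least of order `m n ω`, so a constant
number of writes per cell of the grid is affordable. -/
theorem _root_.IsScale.le_thousand {T R : ℝ} {M : ℕ} (h : IsScale T M R) (hM : M < 100) : R ≤ 1000 := by
  have hM' : (M : ℝ) ≤ 100 := by exact_mod_cast hM.le
  refine (pow_le_pow_iff_left₀ h.pos.le (by norm_num) (n := 2) (by norm_num)).1 ?_
  calc R ^ 2 ≤ (M : ℝ) ^ 3 := h.sq
    _ ≤ 100 ^ 3 := by gcongr
    _ = 1000 ^ 2 := by norm_num

/-- The bound for the work. -/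
theorem topL_work {sc : ℕ} (hsc : sc ≤ 2) (l : Bool) {c : ℝ} (hc : 0 < c) {w M ω : ℕ}
    {x y : List ℕ} (hM : 1 ≤ M) (hω : 1 ≤ ω) (hx : ∀ a ∈ x, a < 2 ^ w) (hy : ∀ a ∈ y, a < 2 ^ w)
    {R : ℝ} (hs : IsScale (ω / M) M R) (hxR : c * R ≤ x.length) (hyR : c * R ≤ y.length)
    (hx1 : 1 ≤ x.length) (hy1 : 1 ≤ y.length)
    (hW : 1000 + M + 100 * (x.length + y.length + M * M * M) < 2 ^ w) :
    ((topL sc l true).code 0).ComputesWithin w M ω x y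
      (outVal l x.length y.length (dp sc x y x.length y.length)) (Config.work ω)
      (1000000000 * (1 + 1 / c) ^ 2 *
        ((x.length : ℝ) * y.length + (x.length : ℝ) * y.length * ω / R)) := by
  obtain ⟨c', h1, h2, h3, h4⟩ := topL_spec hsc l true hM hω hx hy hx1 hy1 rfl hW
  refine (ComputesWithin_topL l true h1 h2 _).1 ?_
  set m := x.length
  set n := y.length
  have hM0 : (1 : ℝ) ≤ M := by exact_mod_cast hM
  have hω0 : (1 : ℝ) ≤ ω := by exact_mod_cast hω
  have hR := hs.pos
  set A := (1 + 1 / c) ^ 2 with hA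
  have hA1 : 1 ≤ A := one_le_pow₀ (by have : 0 < 1 / c := by positivity
                                      linarith)
  have hmn : (0 : ℝ) ≤ (m : ℝ) * n := by positivity
  set S := tileSide true M ω with hS
  rcases lt_or_ge M 100 with hM1 | hM1
  · obtain ⟨q1, q2, q3⟩ := h3 hM1
    have q1 : (c'.slowWrites : ℝ) ≤ 5000 * (m * n) := by exact_mod_cast q1
    have q2 : (c'.slowReads : ℝ) ≤ 5000 * (m * n) := by exact_mod_cast q2
    have q3 : (c'.fastAccesses : ℝ) ≤ 5000 * (m * n) := by exact_mod_cast q3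
    have hR1 := hs.le_thousand hM1
    have e : (m : ℝ) * n * ω ≤ 1000 * (m * n * ω / R) := by
      rw [mul_div_assoc', le_div_iff₀ hR]
      have : (0 : ℝ) ≤ m * n * ω := by positivity
      nlinarith
    have hv : 0 ≤ (m : ℝ) * n * ω / R := by positivity
    calc (c'.slowReads : ℝ) + ω * c'.slowWrites + c'.fastAccesses
        ≤ 5000 * (m * n) + ω * (5000 * (m * n)) + 5000 * (m * n) := by gcongr
      _ ≤ 1000000000 * 1 * (m * n + m * n * ω / R) := by nlinarith
      _ ≤ _ := by gcongr
  · obtain ⟨k, hk, q1, q2, q3⟩ := h4 hM1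
    have hS1 : 1 ≤ S := tileSide_pos _ _ _
    have hSM : (S : ℝ) ≤ M := by exact_mod_cast tileSide_le true hM
    have hS0 : (0 : ℝ) < S := by exact_mod_cast hS1
    have hsw : sideWeight true S = S := rfl
    rw [hsw] at hk
    have eT : (ω : ℝ) / M * M ^ 3 * S = ω * M ^ 2 * S := by field_simp
    have hKR := hk.le_scale hs hS1 hSM (by
      rw [eT]
      calc (ω : ℝ) * S ^ 3 = ω * S ^ 2 * S := by ring
        _ ≤ ω * (M : ℝ) ^ 2 * S := by gcongr)
    obtain ⟨b1, b2, -, b4⟩ := block_costs hc hk hS1 hKR hxR hyR rfl rfl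
    rw [← hA] at b1 b2 b4
    set B : ℝ := (((m / (k * S) + 1) * (n / (k * S) + 1) : ℕ) : ℝ) with hB
    have q1 : (c'.slowWrites : ℝ) ≤ 12 * (B * (k * S)) := by rw [hB]; exact_mod_cast q1
    have q2 : (c'.slowReads : ℝ) ≤ 31 * (B * (k * k * k * k * S)) := by rw [hB]; exact_mod_cast q2
    have q3 : (c'.fastAccesses : ℝ) ≤ 60000 * (B * (k * k * k * k * (S * S))) := by
      rw [hB]; exact_mod_cast q3
    set X := A * (m * n) with hX
    have hX0 : 0 ≤ X := by positivity
    have hK0 : (0 : ℝ) < k * S := by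
      have : (0 : ℝ) < k := by exact_mod_cast hk.pos
      positivity
    have hcube : (k : ℝ) * k * k * S ≤ ω := by exact_mod_cast hk.cube
    -- By `k ^ 3 * S ≤ ω` the recomputation in fast memory costs no more than the writes, up to a
    -- constant.
    have hY : (ω * c'.slowWrites + c'.fastAccesses : ℝ) * (k * S) ≤ 60012 * (X * ω) := by
      calc (ω * c'.slowWrites + c'.fastAccesses : ℝ) * (k * S)
          ≤ (ω * (12 * (B * (k * S))) + 60000 * (B * (k * k * k * k * (S * S)))) * (k * S) := by
            gcongr
        _ = 12 * ω * (B * (k * S) * (k * S))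
            + 60000 * (B * (k * k * k * k * (S * S)) * (k * S)) := by ring
        _ ≤ 12 * ω * X + 60000 * (X * (k * k * k * S)) := by gcongr
        _ ≤ 12 * ω * X + 60000 * (X * ω) := by gcongr
        _ = 60012 * (X * ω) := by ring
    have hv : 0 ≤ X * ω / R := by positivity
    have hYb : (ω * c'.slowWrites + c'.fastAccesses : ℝ) ≤ 400000000 * X + 400000000 * (X * ω / R) := by
      -- If `M ≤ ω`, then `S` is proportional to `M` and `R ≤ 6000 * (k * S)`. Otherwise `S` is
      -- proportional to `ω`, so `ω / (k * S) ≤ 200` and the term `m n` alone bounds everything.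
      rcases le_total M ω with h | h
      · have hMS : (M : ℝ) ≤ 200 * S := by
          have := le_tileSide true M ω
          rw [if_pos rfl, min_eq_left h] at this
          exact_mod_cast this
        have hRK := hk.scale_le hs hS1 (by positivity) hMS (by
          rw [eT]
          calc (ω : ℝ) * M ^ 2 * S ≤ ω * (200 * S) ^ 2 * S := by gcongr
            _ = 40000 * ((ω : ℝ) * (S : ℝ) ^ 3) := by ring
            _ ≤ 8000000 * ((ω : ℝ) * (S : ℝ) ^ 3) := by gcongr; norm_num
            _ = 8000000 * ω * (S : ℝ) ^ 3 := by ring)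
        push_cast at hRK
        have e1 : (ω * c'.slowWrites + c'.fastAccesses : ℝ) ≤ 60012 * (X * ω) / (k * S) := by
          rwa [le_div_iff₀ hK0]
        have e2 : 60012 * (X * ω) / (k * S) ≤ 400000000 * (X * ω / R) := by
          rw [mul_div_assoc', div_le_div_iff₀ hK0 hR]
          have : 0 ≤ X * ω := by positivity
          calc 60012 * (X * ω) * R ≤ 60012 * (X * ω) * (6000 * (k * S)) := by gcongr
            _ ≤ 400000000 * (X * ω) * (k * S) := by nlinarith [mul_nonneg this hK0.le]
        linarith
      · have hωS : (ω : ℝ) ≤ 200 * (k * S) := by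
          have := le_tileSide true M ω
          rw [if_pos rfl, min_eq_right h] at this
          have h' : S ≤ k * S := Nat.le_mul_of_pos_left _ hk.pos
          have : ω ≤ 200 * (k * S) := by omega
          exact_mod_cast this
        have e1 : (ω * c'.slowWrites + c'.fastAccesses : ℝ) ≤ 60012 * 200 * X := by
          refine le_of_mul_le_mul_right (hY.trans ?_) hK0
          calc 60012 * (X * ω) ≤ 60012 * (X * (200 * (k * S))) := by gcongr
            _ = 60012 * 200 * X * (k * S) := by ring
        linarith
    have eX : 1000000000 * A * ((m : ℝ) * n + m * n * ω / R)
        = 1000000000 * X + 1000000000 * (X * ω / R) := by rw [hX]; ring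
    rw [eX]
    linarith

/-- The bound for the input-output cost. -/
theorem topL_ioCost {sc : ℕ} (hsc : sc ≤ 2) (l : Bool) {c : ℝ} (hc : 0 < c) {w M ω : ℕ}
    {x y : List ℕ} (hM : 1 ≤ M) (hω : 1 ≤ ω) (hx : ∀ a ∈ x, a < 2 ^ w) (hy : ∀ a ∈ y, a < 2 ^ w)
    {R : ℝ} (hs : IsScale ω M R) (hxR : c * R ≤ x.length) (hyR : c * R ≤ y.length)
    (hx1 : 1 ≤ x.length) (hy1 : 1 ≤ y.length)
    (hW : 1000 + M + 100 * (x.length + y.length + M * M * M) < 2 ^ w) :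
    ((topL sc l false).code 0).ComputesWithin w M ω x y
      (outVal l x.length y.length (dp sc x y x.length y.length)) (Config.ioCost ω)
      (1000000000 * (1 + 1 / c) ^ 2 * ((x.length : ℝ) * y.length * ω / R)) := by
  obtain ⟨c', h1, h2, h3, h4⟩ := topL_spec hsc l false hM hω hx hy hx1 hy1 rfl hW
  refine (ComputesWithin_topL l false h1 h2 _).2 ?_
  set m := x.length
  set n := y.length
  have hM0 : (1 : ℝ) ≤ M := by exact_mod_cast hM
  have hω0 : (1 : ℝ) ≤ ω := by exact_mod_cast hω
  have hR := hs.pos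
  set A := (1 + 1 / c) ^ 2 with hA
  have hA1 : 1 ≤ A := one_le_pow₀ (by have : 0 < 1 / c := by positivity
                                      linarith)
  have hmn : (0 : ℝ) ≤ (m : ℝ) * n := by positivity
  set S := tileSide false M ω with hS
  rcases lt_or_ge M 100 with hM1 | hM1
  · obtain ⟨q1, q2, -⟩ := h3 hM1
    have q1 : (c'.slowWrites : ℝ) ≤ 5000 * (m * n) := by exact_mod_cast q1
    have q2 : (c'.slowReads : ℝ) ≤ 5000 * (m * n) := by exact_mod_cast q2
    have hR1 := hs.le_thousand hM1
    have e : (m : ℝ) * n * ω ≤ 1000 * (m * n * ω / R) := by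
      rw [mul_div_assoc', le_div_iff₀ hR]
      have : (0 : ℝ) ≤ m * n * ω := by positivity
      nlinarith
    have hv : 0 ≤ (m : ℝ) * n * ω / R := by positivity
    have e' : (m : ℝ) * n ≤ m * n * ω := le_mul_of_one_le_right hmn hω0
    calc (c'.slowReads : ℝ) + ω * c'.slowWrites
        ≤ 5000 * (m * n) + ω * (5000 * (m * n)) := by gcongr
      _ ≤ 1000000000 * 1 * (m * n * ω / R) := by linarith
      _ ≤ _ := by gcongr
  · obtain ⟨k, hk, q1, q2, -⟩ := h4 hM1
    have hS1 : 1 ≤ S := tileSide_pos _ _ _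
    have hSM : (S : ℝ) ≤ M := by exact_mod_cast tileSide_le false hM
    have hS0 : (0 : ℝ) < S := by exact_mod_cast hS1
    have hsw : sideWeight false S = 1 := rfl
    rw [hsw] at hk
    have hKR := hk.le_scale hs one_pos hSM (by
      rw [Nat.cast_one, mul_one]; gcongr)
    have hMS : (M : ℝ) ≤ 200 * S := by exact_mod_cast le_tileSide false M ω
    have hRK := hk.scale_le hs one_pos (by positivity) hMS (by
      rw [Nat.cast_one, mul_one]
      calc (ω : ℝ) * M ^ 3 ≤ ω * (200 * S) ^ 3 := by gcongr
        _ = 8000000 * ω * (S : ℝ) ^ 3 := by ring)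
    push_cast at hRK
    obtain ⟨b1, -, b3, -⟩ := block_costs hc hk hS1 hKR hxR hyR rfl rfl
    rw [← hA] at b1 b3
    set B : ℝ := (((m / (k * S) + 1) * (n / (k * S) + 1) : ℕ) : ℝ) with hB
    have q1 : (c'.slowWrites : ℝ) ≤ 12 * (B * (k * S)) := by rw [hB]; exact_mod_cast q1
    have q2 : (c'.slowReads : ℝ) ≤ 31 * (B * (k * k * k * k * S)) := by rw [hB]; exact_mod_cast q2
    set X := A * (m * n) with hX
    have hX0 : 0 ≤ X := by positivity
    have hK0 : (0 : ℝ) < k * S := by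
      have : (0 : ℝ) < k := by exact_mod_cast hk.pos
      positivity
    have hcube : (k : ℝ) * k * k ≤ ω := by
      have := hk.cube
      rw [mul_one] at this
      exact_mod_cast this
    -- By `k ^ 3 ≤ ω` the reads cost no more than the writes, up to a constant.
    have hY : (c'.slowReads + ω * c'.slowWrites : ℝ) * (k * S) ≤ 43 * (X * ω) := by
      calc (c'.slowReads + ω * c'.slowWrites : ℝ) * (k * S)
          ≤ (31 * (B * (k * k * k * k * S)) + ω * (12 * (B * (k * S)))) * (k * S) := by
            gcongr
        _ = 31 * (B * (k * k * k * k * S) * (k * S)) + 12 * ω * (B * (k * S) * (k * S)) := by ring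
        _ ≤ 31 * (X * (k * k * k)) + 12 * ω * X := by gcongr
        _ ≤ 31 * (X * ω) + 12 * ω * X := by gcongr
        _ = 43 * (X * ω) := by ring
    have eX : 1000000000 * A * ((m : ℝ) * n * ω / R) = 1000000000 * (X * ω) / R := by
      rw [hX]; ring
    rw [eX, le_div_iff₀ hR]
    refine le_of_mul_le_mul_right ?_ hK0
    have h0 : 0 ≤ X * ω := by positivity
    calc (c'.slowReads + ω * c'.slowWrites : ℝ) * R * (k * S)
        = (c'.slowReads + ω * c'.slowWrites : ℝ) * (k * S) * R := by ring
      _ ≤ 43 * (X * ω) * (6000 * (k * S)) := by gcongr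
      _ ≤ 1000000000 * (X * ω) * (k * S) := by nlinarith [mul_nonneg h0 hK0.le]

end AsymRAM

theorem exists_outVal {f : List ℕ → List ℕ → ℕ} (hf : f = editDistance ∨ f = lcsLength) :
    ∃ sc ≤ 2, ∃ l, ∀ x y, f x y = AsymRAM.outVal l x.length y.length
      (dp sc x y x.length y.length) := by
  rcases hf with rfl | rfl
  · exact ⟨1, by norm_num, false, editDistance_eq_dp⟩
  · exact ⟨2, le_rfl, true, lcsLength_eq_dp⟩

theorem mainTheorem4 :
    ∀ f : List ℕ → List ℕ → ℕ, (f = editDistance ∨ f = lcsLength) →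
      (∃ P : AsymRAM.Program, ∀ c : ℝ, 0 < c → ∃ (d : ℕ) (C : ℝ),
        ∀ (M ω w : ℕ) (x y : List ℕ), 1 ≤ M → 1 ≤ ω →
          (x.length + y.length) ^ d ≤ 2 ^ w →
          (∀ a ∈ x, a < 2 ^ w) → (∀ a ∈ y, a < 2 ^ w) →
          c * (kT M ω * M) ≤ x.length → c * (kT M ω * M) ≤ y.length →
          P.ComputesWithin w M ω x y (f x y) (AsymRAM.Config.work ω)
            (C * ((x.length : ℝ) * y.length
              + (x.length : ℝ) * y.length * ω / (kT M ω * M)))) ∧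
      (∃ P : AsymRAM.Program, ∀ c : ℝ, 0 < c → ∃ (d : ℕ) (C : ℝ),
        ∀ (M ω w : ℕ) (x y : List ℕ), 1 ≤ M → 1 ≤ ω →
          (x.length + y.length) ^ d ≤ 2 ^ w →
          (∀ a ∈ x, a < 2 ^ w) → (∀ a ∈ y, a < 2 ^ w) →
          c * (kQ M ω * M) ≤ x.length → c * (kQ M ω * M) ≤ y.length →
          P.ComputesWithin w M ω x y (f x y) (AsymRAM.Config.ioCost ω)
            (C * ((x.length : ℝ) * y.length * ω / (kQ M ω * M)))) := by
  intro f hf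
  obtain ⟨sc, hsc, l, hfv⟩ := exists_outVal hf
  refine ⟨⟨(AsymRAM.topL sc l true).code 0, fun c hc => ?_⟩,
    ⟨(AsymRAM.topL sc l false).code 0, fun c hc => ?_⟩⟩
  · obtain ⟨d, hd⟩ := exists_wordSize hc
    refine ⟨d, 1000000000 * (1 + 1 / c) ^ 2, fun M ω w x y hM hω hw hx hy hxR hyR => ?_⟩
    have hM0 : (1 : ℝ) ≤ M := by exact_mod_cast hM
    have hω0 : (1 : ℝ) ≤ ω := by exact_mod_cast hω
    have hs : IsScale (ω / M) M (kT M ω * M) := isScale (by positivity) (by positivity)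
    obtain ⟨hx1, hy1, hW⟩ := hd _ _ M _ _ w hM hs
      (by rw [div_mul_cancel₀ _ (by positivity)]; exact hω0) hxR hyR hw
    rw [hfv]
    exact AsymRAM.topL_work hsc l hc hM hω hx hy hs hxR hyR hx1 hy1 hW
  · obtain ⟨d, hd⟩ := exists_wordSize hc
    refine ⟨d, 1000000000 * (1 + 1 / c) ^ 2, fun M ω w x y hM hω hw hx hy hxR hyR => ?_⟩
    have hM0 : (1 : ℝ) ≤ M := by exact_mod_cast hM
    have hω0 : (1 : ℝ) ≤ ω := by exact_mod_cast hω
    have hs : IsScale ω M (kQ M ω * M) := isScale (by positivity) (by positivity)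
    obtain ⟨hx1, hy1, hW⟩ := hd _ _ M _ _ w hM hs (one_le_mul_of_one_le_of_one_le hω0 hM0)
      hxR hyR hw
    rw [hfv]
    exact AsymRAM.topL_ioCost hsc l hc hM hω hx hy hs hxR hyR hx1 hy1 hW
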